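/- **Data.** Let $\mathfrak h$ be a finite-dimensional complex vector space with a nondegenerate symmetric bilinear form $(\cdot,\cdot)$, let $\alpha_1,\dots,\alpha_R\in\mathfrak h^*$ be linearly independent, and let $H_i\in\mathfrak h$ be defined by $(H_i,\cdot)=\alpha_i$; the induced form on $\mathfrak h^*$ satisfies $(\alpha_i,\alpha_j)=(H_i,H_j)$. Let $\mathfrak g$ be the Lie algebra with generators $E_i,F_i$ $(1\le i\le R)$ and $\mathfrak h$, and relations $[E_i,F_j]=\delta_{ij}H_j$, $[h,E_i]=\alpha_i(h)E_i$, $[h,F_i]=-\alpha_i(h)F_i$, $[h,h']=0$ for $h,h'\in\mathfrak h$. Let $\mathfrak n$ and $\mathfrak n_+$ be the subalgebras generated by the $F_i$ and by the $E_i$. Let $\sigma$ be an automorphism of $\mathfrak g$ with $\sigma E_i=E_{\sigma(i)}$, $\sigma F_i=F_{\sigma(i)}$, $\sigma H_i=H_{\sigma(i)}$ for a permutation $\sigma$ of $\{1,\dots,R\}$ of order $T$; write $\sigma\alpha_i=\alpha_{\sigma(i)}$. Let $\mathfrak g^\sigma$ be the subalgebra of fixed points of $\sigma$, and $\mathfrak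 n^\sigma=\mathfrak n\cap\mathfrak g^\sigma$, $\mathfrak n_+^\sigma=\mathfrak n_+\cap\mathfrak g^\sigma$, $\mathfrak h^\sigma=\mathfrak h\cap\mathfrak g^\sigma$. Let $\omega$ be a primitive $T$-th root of unity. Choose one representative $\iota(i)$, $1\le i\le r$, in each cycle of the permutation, and let $T_i$ be the length of its cycle. For $\lambda\in\mathbb Z_{\ge0}^r$, let $\mathfrak n_\lambda$ (resp. $\mathfrak n_{+,\lambda}$) be the span of the commutators in the $F_j$ (resp. $E_j$) in which, for each $i$, exactly $\lambda_i$ generators have their index in the cycle of $\iota(i)$; let $\mathfrak n^\sigma_\lambda$, $(\mathfrak n^\sigma_+)_\lambda$ be the fixed points in them. Then $\mathfrak g^\sigma=\bigoplus_{\lambda\ne0}\mathfrak n^\sigma_\lambda\oplus\mathfrak h^\sigma\oplus\bigoplus_{\lambda\neq0}(\mathfrak n_+^\sigma)_\lambda$. **The form $G_0$.** Fix $\lambda\ne0$, put $m=\lambda_1+\dots+\lambda_r$, and colour $\{1,\dots,m\}$ so that the first $\lambda_1$ elements have colour $1$, the next $\lambda_2$ colour $2$, and so on; let $\chi(p)=\iota(\text{colour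 of }p)$. Consider in $\mathbb C^m$ the diagonal hyperplanes $H^k_{pq}:\ t_p=\omega^kt_q$ $(p<q,\ k\in\mathbb Z/T)$, with weights $a(H^k_{pq})=(\alpha_{\chi(p)},\sigma^k\alpha_{\chi(q)})$. For a full flag $L=(\mathbb C^m\supset L^1\supset\dots\supset L^m)$, with $L^j$ of codimension $j$, and an $m$-tuple of diagonal hyperplanes, let $\langle L,H_1\wedge\dots\wedge H_m\rangle$ be $\operatorname{sgn}(s)$ if there is a permutation $s$ with $L^j=H_{s(1)}\cap\dots\cap H_{s(j)}$ for all $j$, and $0$ otherwise. The geometric form is $$G(L,L')=\sum_{\{H_1,\dots,H_m\}}\langle L,H_1\wedge\dots\wedge H_m\rangle\,\langle L',H_1\wedge\dots\wedge H_m\rangle\prod_j a(H_j),$$ extended bilinearly to formal linear combinations of flags. Let $\mathfrak a$ be the free Lie algebra on $f^k_p$ $(k\in\mathbb Z/T,\ 1\le p\le m)$, let $\tau:f_p^k\mapsto f_p^{k+1}$, and let $\bar x=\sum_{j\in\mathbb Z/T}\tau^jx$. For a commutator $c$ in $f^{k_1}_{p_1},\dots,f^{k_l}_{p_l}$ let $L_c=\{\omega^{k_1}t_{p_1}=\dots=\omega^{k_l}t_{p_l}\}$.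 Attach to each exterior product of projected commutators in which every index $1,\dots,m$ occurs once a signed flag, by the rules: $\bar f_1\wedge\dots\wedge\bar f_m\mapsto(\mathbb C^m)$, where $\bar f_p$ is the common projection of the $f_p^k$; exchanging adjacent factors changes the sign; if $\bar g_n\wedge\dots\wedge\bar g_3\wedge\bar g_2\wedge\bar g_1\mapsto\pm(\dots\supset L)$, then $\bar g_n\wedge\dots\wedge\bar g_3\wedge\overline{[g_1,g_2]}\mapsto\pm(\dots\supset L\supset L\cap L_{[g_1,g_2]})$. For a commutator $c$ of weight $(1,\dots,1)$ (every index $1,\dots,m$ occurs once), let $\psi(c)$ be the signed full flag obtained by adding $L^m=\{t_1=\dots=t_m=0\}$ to the flag of $\bar c$. Define the bilinear form $G_0$ on the $\tau$-invariants of weight $(1,\dots,1)$ in $\mathfrak a$ by $G_0(\bar c,\bar d)=G(\psi(c),\psi(d))$. **Symmetrization.** Let $\mathsf s:\mathfrak n\to\mathfrak a$ be the Lie algebra homomorphism $F_j\mapsto\sum f^k_p$, the sum over all $(k,p)$ with $\sigma^k(\chi(p))=j$, followed by the projection onto the component of weight $(1,\dots,1)$. Define $\mathsf s$ on $\mathfrak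 n_+$ in the same way, with values in the free Lie algebra on letters $e^k_p$, and let $\theta$ be the isomorphism of Lie algebras $e^k_p\mapsto f^k_p$. Put $|\Sigma Z_\lambda|=\prod_{i=1}^r(T/T_i)^{\lambda_i}\,\lambda_i!$. **Theorem.** There is a unique bilinear form $\Omega$ on $\mathfrak g^\sigma$ with $\Omega(x,y)=-\Omega(y,x)$ for all $x,y$, with $$\Omega(x,y)=-\frac1{|\Sigma Z_\lambda|}\,G_0\big(\theta(\mathsf s\,y),\mathsf s\,x\big)\qquad\text{for }x\in\mathfrak n^\sigma_\lambda,\ y\in(\mathfrak n^\sigma_+)_\lambda,\ \lambda\neq0,$$ and with $\Omega=0$ on all other pairs of components of $\mathfrak g^\sigma$ (that is, on $\mathfrak n^\sigma_\lambda\times(\mathfrak n^\sigma_+)_\mu$ for $\lambda\ne\mu$, on $\mathfrak n^\sigma\times\mathfrak n^\sigma$, on $\mathfrak n_+^\sigma\times\mathfrak n_+^\sigma$ and on $\mathfrak h^\sigma\times\mathfrak g^\sigma$); in particular $G_0$ is well defined. It satisfies the 2-cocycle identity $$\Omega(x,[y,z])+\Omega(y,[z,x])+\Omega(z,[x,y])=0\qquad\text{for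 all }x,y,z\in\mathfrak g^\sigma,$$ and so defines a central extension: $\mathfrak g^\sigma\oplus\mathbb C\mathsf k$ with $[x,y]'=[x,y]+\Omega(x,y)\,\mathsf k$ and $\mathsf k$ central is a Lie algebra. -/

import Mathlib

universe u

noncomputable section

open scoped TensorProduct

namespace CyclotomicCocycle

/-! ### Arrangements, flags and the geometric form

A central arrangement of hyperplanes in `V` is given by an injective family
`hyp : 𝓗 → Submodule ℂ V` of hyperplanes. A flag `V = L⁰ ⊃ L¹ ⊃ ⋯ ⊃ Lᵏ`, with `Lʲ` of
codimension `j`, is recorded by the tuple `L = (L¹, …, Lᵏ)`, indexed by `Fin k`. -/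

section Arrangement

variable {V 𝓗 : Type*} [AddCommGroup V] [Module ℂ V]

open Classical in
/-- The pairing `⟨L, H₁ ∧ ⋯ ∧ Hₖ⟩`: it is the sign of `s` if `s` is a permutation with
`Lⁱ = H_{s(1)} ∩ ⋯ ∩ H_{s(i)}` for all `i`, and zero if there is no such permutation.
(Such a permutation is unique, because the spaces of a flag are pairwise distinct.) -/
def pairing (hyp : 𝓗 → Submodule ℂ V) {k : ℕ} (L : Fin k → Submodule ℂ V) (H : Fin k → 𝓗) : ℤ :=
  ∑ s : Equiv.Perm (Fin k),
    if ∀ i, L i = ⨅ j : Fin k, ⨅ _ : j ≤ i, hyp (H (s j)) then (Equiv.Perm.sign s : ℤ) else 0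

/-- The geometric form of the weighted arrangement `(hyp, a)`, evaluated on two flags: the sum of
`⟨L, H₁ ∧ ⋯ ∧ Hₖ⟩ ⟨L', H₁ ∧ ⋯ ∧ Hₖ⟩ a(H₁) ⋯ a(Hₖ)` over all unordered `k`-tuples of hyperplanes.
The summand is invariant under reordering and vanishes if two of the hyperplanes coincide, so this
is `1 / k!` times the sum over ordered tuples. -/
def geomForm [Fintype 𝓗] (hyp : 𝓗 → Submodule ℂ V) (a : 𝓗 → ℂ) {k : ℕ}
    (L L' : Fin k → Submodule ℂ V) : ℂ :=
  (k.factorial : ℂ)⁻¹ * ∑ H : Fin k → 𝓗,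
    (pairing hyp L H : ℂ) * (pairing hyp L' H : ℂ) * ∏ j, a (H j)

end Arrangement

/-! ### Free Lie algebras and commutators -/

section Free

variable {X : Type*}

/-- The commutator in the free Lie algebra that is described by a bracketed word. -/
def commutator : FreeMagma X → FreeLieAlgebra ℂ X
  | .of x => FreeLieAlgebra.of ℂ x
  | .mul c d => ⁅commutator c, commutator d⁆

/-- The labels of the generators occurring in a bracketed word, from left to right. -/
def content : FreeMagma X → List X
  | .of x => [x]
  | .mul c d => content c ++ content d

/-- Let the generator `x` have degree `deg x`, a standard basis vector of `ℕ^κ`. This is the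
projection of the free Lie algebra onto its component of multidegree `w`: the coefficient of the
monomial with exponent `w` under the homomorphism `x ↦ X_{deg x} ⊗ x` into polynomials with
coefficients in the free Lie algebra. -/
def weightProj {κ : Type*} (deg : X → κ) (w : κ →₀ ℕ) :
    FreeLieAlgebra ℂ X →ₗ[ℂ] FreeLieAlgebra ℂ X :=
  (TensorProduct.lid ℂ (FreeLieAlgebra ℂ X)).toLinearMap ∘ₗ
    LinearMap.rTensor (FreeLieAlgebra ℂ X) (MvPolynomial.lcoeff ℂ w) ∘ₗ
      (FreeLieAlgebra.lift ℂ
        (fun x => (MvPolynomial.X (deg x) : MvPolynomial κ ℂ) ⊗ₜ[ℂ] FreeLieAlgebra.of ℂ x) :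
        FreeLieAlgebra ℂ X →ₗ⁅ℂ⁆ MvPolynomial κ ℂ ⊗[ℂ] FreeLieAlgebra ℂ X).toLinearMap

end Free

/-! ### The arrangement of diagonal hyperplanes, and flags attached to commutators -/

section Diagonal

variable (T m : ℕ) [NeZero T] (ω : ℂ)

/-- The free Lie algebra `𝔞` with generators `f^k_i`, where `k ∈ ℤ/T` and `1 ≤ i ≤ m`. -/
abbrev FreeA : Type := FreeLieAlgebra ℂ (ZMod T × Fin m)

/-- The labels `(i, j, k)` of the diagonal hyperplanes: `i < j` and `k ∈ ℤ/T`. -/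
abbrev Diag : Type := {p : Fin m × Fin m × ZMod T // p.1 < p.2.1}

variable {T m}

/-- The subspace `ω^k t_i = ω^l t_j` of `ℂ^m`. -/
def eqSpace (k : ZMod T) (i : Fin m) (l : ZMod T) (j : Fin m) : Submodule ℂ (Fin m → ℂ) :=
  LinearMap.ker
    ((ω ^ k.val) • (LinearMap.proj i : (Fin m → ℂ) →ₗ[ℂ] ℂ) -
      (ω ^ l.val) • (LinearMap.proj j : (Fin m → ℂ) →ₗ[ℂ] ℂ))

/-- The diagonal hyperplane `t_i = ω^k t_j` with label `(i, j, k)`. -/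
def diagHyp (p : Diag T m) : Submodule ℂ (Fin m → ℂ) :=
  eqSpace ω 0 p.1.1 p.1.2.2 p.1.2.1

/-- The edge `L_c : ω^{k₁} t_{i₁} = ⋯ = ω^{kₗ} t_{iₗ}` of a commutator `c` in the generators
`f^{k₁}_{i₁}, …, f^{kₗ}_{iₗ}`. -/
def island (c : FreeMagma (ZMod T × Fin m)) : Submodule ℂ (Fin m → ℂ) :=
  ⨅ p ∈ content c, ⨅ q ∈ content c, eqSpace ω p.1 p.2 q.1 q.2

/-- The rules that attach signed flags to exterior products of projected commutators.
`FlagOf ω [g_p, …, g_1] s [L¹, …, L^q]` means that the rules send `ḡ_p ∧ ⋯ ∧ ḡ_1`, in which every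
index `1, …, m` occurs once, to `s` times the flag `ℂ^m ⊃ L¹ ⊃ ⋯ ⊃ L^q`:
* `f̄_1 ∧ ⋯ ∧ f̄_m` is sent to the trivial flag (here `f̄_i` is the projection of each `f^k_i`);
* exchanging two adjacent factors changes the sign;
* if `g_p ∧ ⋯ ∧ g_3 ∧ g_2 ∧ g_1` is sent to `s · (⋯ ⊃ L)`, then `g_p ∧ ⋯ ∧ g_3 ∧ [g_1, g_2]` is
  sent to `s · (⋯ ⊃ L ⊃ L ∩ L_{[g_1, g_2]})`. -/
inductive FlagOf : List (FreeMagma (ZMod T × Fin m)) → ℤ → List (Submodule ℂ (Fin m → ℂ)) → Prop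
  | base (k : Fin m → ZMod T) :
      FlagOf (List.ofFn fun i => FreeMagma.of (k i, i)) 1 []
  | swap {s : ℤ} {Ls : List (Submodule ℂ (Fin m → ℂ))} (u v : List (FreeMagma (ZMod T × Fin m)))
      (g h : FreeMagma (ZMod T × Fin m)) :
      FlagOf (u ++ g :: h :: v) s Ls → FlagOf (u ++ h :: g :: v) (-s) Ls
  | join {s : ℤ} {Ls : List (Submodule ℂ (Fin m → ℂ))} (u : List (FreeMagma (ZMod T × Fin m)))
      (g₁ g₂ : FreeMagma (ZMod T × Fin m)) :
      FlagOf (u ++ [g₂, g₁]) s Ls →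
        FlagOf (u ++ [g₁ * g₂]) s (Ls ++ [Ls.getLastD ⊤ ⊓ island ω (g₁ * g₂)])

/-- The full flag `L¹ ⊃ ⋯ ⊃ L^{m-1} ⊃ L^m` obtained from `[L¹, …, L^{m-1}]` by adding the last edge
`t_1 = ⋯ = t_m = 0`. If `s · (L¹ ⊃ ⋯ ⊃ L^{m-1})` is attached to `c̄`, then `s` times the completed
flag is attached to `c̄ v₀`. -/
def completeFlag (Ls : List (Submodule ℂ (Fin m → ℂ))) : Fin m → Submodule ℂ (Fin m → ℂ) :=
  fun i => (Ls ++ [⊥]).getD i ⊥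

/-- The automorphism `τ^j : f^k_i ↦ f^{k+j}_i` of `𝔞`. -/
def shift (j : ZMod T) : FreeA T m →ₗ⁅ℂ⁆ FreeA T m :=
  FreeLieAlgebra.lift ℂ fun p => FreeLieAlgebra.of ℂ (p.1 + j, p.2)

/-- The projection `x ↦ x̄ = ∑_j τ^j x` of `𝔞` onto its subalgebra of `τ`-invariants. -/
def bar (x : FreeA T m) : FreeA T m := ∑ j : ZMod T, shift j x

/-- `Γ` restricts on the `τ`-invariants of weight `(1, …, 1)` in `𝔞` to the form `G₀`: for all
commutators `c`, `d` of weight `(1, …, 1)`, the number `Γ (c̄, d̄)` is the value of the geometric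
form of the arrangement of diagonal hyperplanes, weighted by `a`, on the signed full flags attached
to `c̄ v₀` and `d̄ v₀`. Since the `c̄` span the `τ`-invariants of that weight, this determines the
restriction of `Γ` to them. -/
def IsGeomZero (a : Diag T m → ℂ) (Γ : FreeA T m →ₗ[ℂ] FreeA T m →ₗ[ℂ] ℂ) : Prop :=
  ∀ (c d : FreeMagma (ZMod T × Fin m)) (s s' : ℤ) (Ls Ls' : List (Submodule ℂ (Fin m → ℂ))),
    FlagOf ω [c] s Ls → FlagOf ω [d] s' Ls' →
      Γ (bar (commutator c)) (bar (commutator d)) =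
        s * s' * geomForm (diagHyp ω) a (completeFlag Ls) (completeFlag Ls')

end Diagonal

/-! ### The Lie algebra `𝔤` -/

section LieAlgebraG

variable {R : ℕ} {𝔥 : Type u} [AddCommGroup 𝔥] [Module ℂ 𝔥] [FiniteDimensional ℂ 𝔥]

/-- The element `H_i` of `𝔥` with `(H_i, ·) = α_i`. -/
def coroot (B : LinearMap.BilinForm ℂ 𝔥) (hB : B.Nondegenerate) (α : Fin R → Module.Dual ℂ 𝔥)
    (i : Fin R) : 𝔥 :=
  (B.toDual hB).symm (α i)

/-- The form induced on `𝔥*` by the form on `𝔥`, evaluated on simple roots: `(α_i, α_j)`. -/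
def rootForm (B : LinearMap.BilinForm ℂ 𝔥) (hB : B.Nondegenerate) (α : Fin R → Module.Dual ℂ 𝔥)
    (i j : Fin R) : ℂ :=
  B (coroot B hB α i) (coroot B hB α j)

variable (R 𝔥) in
/-- The generators of `𝔤`. -/
inductive Gen : Type u
  | E : Fin R → Gen
  | F : Fin R → Gen
  | H : 𝔥 → Gen

/-- The element `E_i` of the free Lie algebra on all generators. -/
def letterE (𝔥 : Type u) (i : Fin R) : FreeLieAlgebra ℂ (Gen R 𝔥) := FreeLieAlgebra.of ℂ (.E i)

/-- The element `F_i` of the free Lie algebra on all generators. -/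
def letterF (𝔥 : Type u) (i : Fin R) : FreeLieAlgebra ℂ (Gen R 𝔥) := FreeLieAlgebra.of ℂ (.F i)

/-- The generator `h` of the free Lie algebra on all generators. -/
def letterH (R : ℕ) (h : 𝔥) : FreeLieAlgebra ℂ (Gen R 𝔥) := FreeLieAlgebra.of ℂ (.H h)

/-- The defining relations of `𝔤`, each in the form `l - r` for a relation `l = r`. The first two
express that `𝔥` is mapped linearly to `𝔤`. -/
inductive IsRelator (B : LinearMap.BilinForm ℂ 𝔥) (hB : B.Nondegenerate)
    (α : Fin R → Module.Dual ℂ 𝔥) : FreeLieAlgebra ℂ (Gen R 𝔥) → Prop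
  | add (h h' : 𝔥) : IsRelator B hB α (letterH R (h + h') - (letterH R h + letterH R h'))
  | smul (z : ℂ) (h : 𝔥) : IsRelator B hB α (letterH R (z • h) - z • letterH R h)
  | EF (i j : Fin R) : IsRelator B hB α
      (⁅letterE 𝔥 i, letterF 𝔥 j⁆ - if i = j then letterH R (coroot B hB α j) else 0)
  | HE (h : 𝔥) (i : Fin R) : IsRelator B hB α
      (⁅letterH R h, letterE 𝔥 i⁆ - α i h • letterE 𝔥 i)
  | HF (h : 𝔥) (i : Fin R) : IsRelator B hB α
      (⁅letterH R h, letterF 𝔥 i⁆ - (-α i h) • letterF 𝔥 i)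
  | HH (h h' : 𝔥) : IsRelator B hB α ⁅letterH R h, letterH R h'⁆

/-- The ideal generated by the defining relations. -/
def relIdeal (B : LinearMap.BilinForm ℂ 𝔥) (hB : B.Nondegenerate)
    (α : Fin R → Module.Dual ℂ 𝔥) : LieIdeal ℂ (FreeLieAlgebra ℂ (Gen R 𝔥)) :=
  LieSubmodule.lieSpan ℂ (FreeLieAlgebra ℂ (Gen R 𝔥)) {x | IsRelator B hB α x}

/-- The Lie algebra `𝔤` with generators `E_i`, `F_i` and `H ∈ 𝔥` and the above relations. -/
abbrev LieG (B : LinearMap.BilinForm ℂ 𝔥) (hB : B.Nondegenerate)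
    (α : Fin R → Module.Dual ℂ 𝔥) : Type u :=
  FreeLieAlgebra ℂ (Gen R 𝔥) ⧸ relIdeal B hB α

variable (B : LinearMap.BilinForm ℂ 𝔥) (hB : B.Nondegenerate) (α : Fin R → Module.Dual ℂ 𝔥)

/-- The image of a generator in `𝔤`. -/
def gen (x : Gen R 𝔥) : LieG B hB α :=
  LieSubmodule.Quotient.mk (FreeLieAlgebra.of ℂ x)

/-- The homomorphism from the free Lie algebra on `F_1, …, F_R` to `𝔤`, with image `𝔫`. -/
def toN : FreeLieAlgebra ℂ (Fin R) →ₗ⁅ℂ⁆ LieG B hB α :=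
  FreeLieAlgebra.lift ℂ fun i => gen B hB α (.F i)

/-- The homomorphism from the free Lie algebra on `E_1, …, E_R` to `𝔤`, with image `𝔫₊`. -/
def toNPlus : FreeLieAlgebra ℂ (Fin R) →ₗ⁅ℂ⁆ LieG B hB α :=
  FreeLieAlgebra.lift ℂ fun i => gen B hB α (.E i)

variable {B hB α}

/-- The subalgebra `𝔤^σ` of the fixed points of `σ`. -/
def fixedPoints (σ : LieG B hB α ≃ₗ⁅ℂ⁆ LieG B hB α) : LieSubalgebra ℂ (LieG B hB α) where
  carrier := {x | σ x = x}
  add_mem' {x y} hx hy := by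
    have hx' : σ x = x := hx
    have hy' : σ y = y := hy
    change σ (x + y) = x + y
    rw [map_add, hx', hy']
  zero_mem' := map_zero σ
  smul_mem' z x hx := by
    have hx' : σ x = x := hx
    change σ (z • x) = z • x
    rw [map_smul, hx']
  lie_mem' {x y} hx hy := by
    have hx' : σ x = x := hx
    have hy' : σ y = y := hy
    change σ ⁅x, y⁆ = ⁅x, y⁆
    rw [LieEquiv.map_lie, hx', hy']

end LieAlgebraG

/-! ### Symmetrization and the form `Ω` -/

section Symmetrization

variable {R r : ℕ} (T : ℕ) [NeZero T] (perm : Equiv.Perm (Fin R)) (rep : Fin r → Fin R)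

open Classical in
/-- The subspace of weight `lam` of the free Lie algebra on `R` generators: it is spanned by the
commutators in which, for each `i`, exactly `lam i` generators have their index in the cycle of
`rep i`. -/
def weightSpace (lam : Fin r → ℕ) : Submodule ℂ (FreeLieAlgebra ℂ (Fin R)) :=
  Submodule.span ℂ {x | ∃ c : FreeMagma (Fin R), x = commutator c ∧
    ∀ i, (content c).countP (fun j => decide (perm.SameCycle (rep i) j)) = lam i}

/-- The index in `1, …, r` of an element of `1, …, m`, where `m = lam 1 + ⋯ + lam r` and the first
`lam 1` elements have index `1`, the next `lam 2` elements have index `2`, and so on. -/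
def colour {lam : Fin r → ℕ} (p : Fin (∑ i, lam i)) : Fin r := (finSigmaFinEquiv.symm p).1

/-- The homomorphism from the free Lie algebra on `F_1, …, F_R` to `𝔞` with
`F_j ↦ ∑ f^k_p`, the sum over all `k ∈ ℤ/T` and `p ∈ {1, …, m}` with `σ^k (rep (colour p)) = j`.
(If `T_i` is the length of the cycle of `rep i`, this sends `F_{σ^k (rep i)}` to the sum of the
`f^{k + T_i l}_p` over `0 ≤ l < T / T_i` and all `p` of colour `i`.) -/
def symHom (lam : Fin r → ℕ) : FreeLieAlgebra ℂ (Fin R) →ₗ⁅ℂ⁆ FreeA T (∑ i, lam i) :=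
  FreeLieAlgebra.lift ℂ fun j => ∑ k : ZMod T, ∑ p : Fin (∑ i, lam i),
    if (perm ^ k.val) (rep (colour p)) = j then FreeLieAlgebra.of ℂ (k, p) else 0

/-- The symmetrization map `𝗌`: the homomorphism `symHom`, followed by the projection onto the
component of weight `(1, …, 1)`. -/
def sym (lam : Fin r → ℕ) : FreeLieAlgebra ℂ (Fin R) →ₗ[ℂ] FreeA T (∑ i, lam i) :=
  weightProj Prod.snd (Finsupp.equivFunOnFinite.symm fun _ => 1) ∘ₗ
    (symHom T perm rep lam).toLinearMap

/-- The order `∏ (T / T_i)^{lam i} (lam i)!` of the product over `i` of the wreath products of the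
symmetric group on `lam i` letters with `ℤ / (T / T_i)`. -/
def symOrder (lam : Fin r → ℕ) : ℕ :=
  ∏ i, (T / Function.minimalPeriod perm (rep i)) ^ lam i * (lam i).factorial

variable {𝔥 : Type u} [AddCommGroup 𝔥] [Module ℂ 𝔥] [FiniteDimensional ℂ 𝔥]
  {B : LinearMap.BilinForm ℂ 𝔥} {hB : B.Nondegenerate} {α : Fin R → Module.Dual ℂ 𝔥}

variable (B hB α) in
/-- The weighting of the diagonal arrangement by Cartan data: the hyperplane `t_p = ω^k t_q` has
the weight `(α_i, σ^k α_j)` with `i = rep (colour p)` and `j = rep (colour q)`, where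
`σ^k α_j = α_{σ^k(j)}`. -/
def cartanWeight (lam : Fin r → ℕ) (p : Diag T (∑ i, lam i)) : ℂ :=
  rootForm B hB α (rep (colour p.1.1)) ((perm ^ p.1.2.2.val) (rep (colour p.1.2.1)))

/-- The defining properties of the form `Ω` on `𝔤^σ`.

It is skew-symmetric. For `x ∈ (𝔫^σ)_λ` and `y ∈ (𝔫₊^σ)_λ`, with `λ ≠ 0`, it is given by
`Ω(x, y) = - |ΣZ_λ|⁻¹ G₀(θ(𝗌 y), 𝗌 x)`, where `θ` is the isomorphism of Lie algebras that exchanges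
the letters `e` and `f`. (An element of `𝔫₊` is written here as `toNPlus y`, with `y` in the free Lie
algebra on the same `R` letters as for `𝔫`, so that `sym … y` is `θ(𝗌 (toNPlus y))`.)
It is zero on all other pairs of components of the weight decomposition of `𝔤^σ`. -/
structure IsOmega (ω : ℂ) (σ : LieG B hB α ≃ₗ⁅ℂ⁆ LieG B hB α)
    (Ω : fixedPoints σ →ₗ[ℂ] fixedPoints σ →ₗ[ℂ] ℂ) : Prop where
  skew : ∀ u v, Ω u v = -Ω v u
  geometric : ∀ lam : Fin r → ℕ, lam ≠ 0 →
    ∃ Γ : FreeA T (∑ i, lam i) →ₗ[ℂ] FreeA T (∑ i, lam i) →ₗ[ℂ] ℂ,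
      IsGeomZero ω (cartanWeight T perm rep B hB α lam) Γ ∧
      ∀ x ∈ weightSpace perm rep lam, ∀ y ∈ weightSpace perm rep lam,
        ∀ (hx : toN B hB α x ∈ fixedPoints σ) (hy : toNPlus B hB α y ∈ fixedPoints σ),
          Ω ⟨toN B hB α x, hx⟩ ⟨toNPlus B hB α y, hy⟩ =
            -((symOrder T perm rep lam : ℂ)⁻¹ *
              Γ (sym T perm rep lam y) (sym T perm rep lam x))
  weight_ne : ∀ lam mu : Fin r → ℕ, lam ≠ mu →
    ∀ x ∈ weightSpace perm rep lam, ∀ y ∈ weightSpace perm rep mu,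
      ∀ (hx : toN B hB α x ∈ fixedPoints σ) (hy : toNPlus B hB α y ∈ fixedPoints σ),
        Ω ⟨toN B hB α x, hx⟩ ⟨toNPlus B hB α y, hy⟩ = 0
  zero_N : ∀ x y (hx : toN B hB α x ∈ fixedPoints σ) (hy : toN B hB α y ∈ fixedPoints σ),
    Ω ⟨toN B hB α x, hx⟩ ⟨toN B hB α y, hy⟩ = 0
  zero_NPlus : ∀ x y (hx : toNPlus B hB α x ∈ fixedPoints σ)
    (hy : toNPlus B hB α y ∈ fixedPoints σ),
    Ω ⟨toNPlus B hB α x, hx⟩ ⟨toNPlus B hB α y, hy⟩ = 0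
  zero_H : ∀ (h : 𝔥) (hh : gen B hB α (.H h) ∈ fixedPoints σ) (v : fixedPoints σ),
    Ω ⟨gen B hB α (.H h), hh⟩ v = 0

end Symmetrization

end CyclotomicCocycle

end

noncomputable section

namespace CyclotomicCocycle

attribute [local instance] LieRing.ofAssociativeRing

/-! ### Free Lie algebras -/

section FreeLie

variable {X : Type*}

/-! Only the pairing of 𝔫^σ with 𝔫₊^σ carries information, so the theorem concerns one bilinear form
on σ-invariant elements of a free Lie algebra. The cocycle identity has one essential case, two
arguments in 𝔫^σ and one in 𝔫₊^σ. Its mirror image follows by the Chevalley involution as soon as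
the form is symmetric, and the case of one argument in each of 𝔥^σ, 𝔫^σ, 𝔫₊^σ is a matter of
weights. Two constructions of the form are compared: an algebraic one, for which the cocycle
identity is visible, and the geometric one, for which symmetry is visible.

Algebraic construction. The positions of a word `w` are the coordinates of a log-canonical Poisson
algebra, with `{z_i, z_j} = ½ a(w_i, w_j) z_i z_j` for `i < j`, and a letter is sent to the sum of
the coordinates of its positions. For a permutation `t` of the letters, take two copies of this
algebra, coupled to first order by ε times `a(w_i, t⁻¹ w_j)`. Send `x` to `x` in the first copy plus
`t x` in the second, contract the ε-part by the Poisson bracket, and add a quadratic correction. On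
`t`-invariant elements this is a derivation, essentially by the Jacobi identity (`crossDer_lie`).
The coefficient of the product of all coordinates is a function of `w`, and on functions of words 𝔫
acts. On Lie elements that action is minus the transpose of the action of 𝔫 on the `𝔤`-module of
words (`evalWords_wordAct`), so the derivation rule becomes the cocycle identity (`crossForm_lie`).
`totalForm` is the sum over `t = σ^l`, `l ≠ 0`.

Geometric construction. A commutator of weight `(1, …, 1)` on `n + 1` indices has a potential `k`,
the exponent carried by each index, and `n` brackets. Its full flag is cut out by those tuples whose
first `n` hyperplanes contain the line defined by `k` and connect the two sides of the successive
brackets, and whose last hyperplane does not contain that line (`FlagOf.exists_full_spec`). The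
first `n` form a spanning tree, and the sign of the flag is read off from a determinant of its edge
vectors. Two flags with potentials `k`, `k'` are cut out by the same hyperplanes in two ways: with
the same last hyperplane, and then `k - k'` is constant; or with different ones, and then exchanging
an edge of the tree shows that `k - k'` takes two values.

Comparison. The alternating sum of a product of antisymmetric kernels over the words of a commutator
is a permanent (`wordSum_prod_kerWord`). It evaluates the algebraic form in the same cases, and
gives `geomForm_eq_crossTotal`. Polarization transports the identity from multilinear words to words
in the original letters; `|ΣZ_λ|` is the number of lifts of a word of weight `λ` (`card_lifts`,
`shiftForm_sym`).

Uniqueness holds because `𝔤^σ` inherits the triangular decomposition, its homogeneous fixed points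
span, and averages of commutators, to each of which a flag is attached, span the invariants on which
`G₀` is evaluated. -/

theorem span_range_commutator :
    Submodule.span ℂ (Set.range (commutator : FreeMagma X → FreeLieAlgebra ℂ X)) = ⊤ := by
  let S : Submodule ℂ (FreeLieAlgebra ℂ X) := Submodule.span ℂ (Set.range commutator)
  have hS : ∀ x ∈ S, ∀ y ∈ S, ⁅x, y⁆ ∈ S := by
    intro x hx y hy
    refine Submodule.span_induction₂ (p := fun x y _ _ => ⁅x, y⁆ ∈ S) ?_ ?_ ?_ ?_ ?_ ?_ ?_ hx hy
    · rintro _ _ ⟨c, rfl⟩ ⟨d, rfl⟩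
      exact Submodule.subset_span ⟨c * d, rfl⟩
    · intro y _; simp
    · intro x _; simp
    · intro x y z _ _ _ h₁ h₂; rw [add_lie]; exact S.add_mem h₁ h₂
    · intro x y z _ _ _ h₁ h₂; rw [lie_add]; exact S.add_mem h₁ h₂
    · intro r x y _ _ h; rw [smul_lie]; exact S.smul_mem r h
    · intro r x y _ _ h; rw [lie_smul]; exact S.smul_mem r h
  let K : LieSubalgebra ℂ (FreeLieAlgebra ℂ X) := { S with lie_mem' := fun {x y} hx hy => hS x hx y hy }
  let φ : FreeLieAlgebra ℂ X →ₗ⁅ℂ⁆ K :=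
    FreeLieAlgebra.lift ℂ fun x => ⟨FreeLieAlgebra.of ℂ x, Submodule.subset_span ⟨.of x, rfl⟩⟩
  have h : K.incl.comp φ = LieHom.id := by
    refine FreeLieAlgebra.hom_ext fun x => ?_
    simp [φ]
  rw [eq_top_iff]
  intro x _
  have := congrArg (fun f : FreeLieAlgebra ℂ X →ₗ⁅ℂ⁆ FreeLieAlgebra ℂ X => f x) h
  have h2 : (φ x : FreeLieAlgebra ℂ X) = x := this
  rw [← h2]
  exact (φ x).2

theorem commutator_mul (c d : FreeMagma X) :
    commutator (c * d) = ⁅commutator c, commutator d⁆ := rfl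

theorem content_mul (c d : FreeMagma X) : content (c * d) = content c ++ content d := rfl

theorem content_ne_nil (c : FreeMagma X) : content c ≠ [] := by
  induction c with
  | ih1 x => simp [content]
  | ih2 c d hc hd => simp [content_mul, hc]

theorem freeLie_linear_ext {V : Type*} [AddCommGroup V] [Module ℂ V]
    {f g : FreeLieAlgebra ℂ X →ₗ[ℂ] V} (h : ∀ c, f (commutator c) = g (commutator c)) : f = g :=
  LinearMap.ext_on_range span_range_commutator h

/-- Induction over the free Lie algebra by linearity, generators and brackets. -/
theorem freeLie_induction {p : FreeLieAlgebra ℂ X → Prop}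
    (zero : p 0) (of : ∀ x, p (FreeLieAlgebra.of ℂ x)) (add : ∀ x y, p x → p y → p (x + y))
    (smul : ∀ (z : ℂ) x, p x → p (z • x)) (lie : ∀ x y, p x → p y → p ⁅x, y⁆)
    (x : FreeLieAlgebra ℂ X) : p x := by
  have hx : x ∈ Submodule.span ℂ (Set.range (commutator : FreeMagma X → FreeLieAlgebra ℂ X)) := by
    rw [span_range_commutator]; trivial
  have hc : ∀ c : FreeMagma X, p (commutator c) := by
    intro c
    induction c with
    | ih1 x => exact of x
    | ih2 c d hc hd => exact lie _ _ hc hd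
  refine Submodule.span_induction (p := fun x _ => p x) ?_ ?_ ?_ ?_ hx
  · rintro _ ⟨c, rfl⟩; exact hc c
  · exact zero
  · intro x y _ _ hx hy; exact add x y hx hy
  · intro z x _ hx; exact smul z x hx

variable (X) in
/-- The vector space with basis the words in `X`. -/
abbrev Words : Type _ := List X →₀ ℂ

/-- Left multiplication by a letter. -/
def consMap (x : X) : Module.End ℂ (Words X) := Finsupp.lmapDomain ℂ ℂ (List.cons x)

@[simp] theorem consMap_single (x : X) (w : List X) (r : ℂ) :
    consMap x (Finsupp.single w r) = Finsupp.single (x :: w) r := by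
  simp [consMap, Finsupp.lmapDomain_apply, Finsupp.mapDomain_single]

variable (X) in
/-- The action of the free Lie algebra on words by left multiplication. -/
def leftMul : FreeLieAlgebra ℂ X →ₗ⁅ℂ⁆ Module.End ℂ (Words X) :=
  FreeLieAlgebra.lift ℂ consMap

@[simp] theorem leftMul_of (x : X) : leftMul X (FreeLieAlgebra.of ℂ x) = consMap x := by
  simp [leftMul]

/-- The canonical map of the free Lie algebra into the free associative algebra. -/
def wordExp : FreeLieAlgebra ℂ X →ₗ[ℂ] Words X :=
  LinearMap.applyₗ (Finsupp.single [] 1) ∘ₗ (leftMul X).toLinearMap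

theorem wordExp_apply (x : FreeLieAlgebra ℂ X) :
    wordExp x = leftMul X x (Finsupp.single [] 1) := rfl

@[simp] theorem wordExp_of (x : X) :
    wordExp (FreeLieAlgebra.of ℂ x) = Finsupp.single [x] 1 := by
  simp [wordExp_apply]

theorem wordExp_lie (x y : FreeLieAlgebra ℂ X) :
    wordExp ⁅x, y⁆ = leftMul X x (wordExp y) - leftMul X y (wordExp x) := by
  simp [wordExp_apply, LieRing.of_associative_ring_bracket]

/-- The alternating sum of the values of `f` on the words in the expansion of a commutator. -/
def wordSum : (List X → ℂ) → FreeMagma X → ℂ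
  | f, .of x => f [x]
  | f, .mul c d => wordSum (fun u => wordSum (fun v => f (u ++ v) - f (v ++ u)) d) c

theorem wordSum_of (f : List X → ℂ) (x : X) : wordSum f (FreeMagma.of x) = f [x] := rfl

theorem wordSum_mul (f : List X → ℂ) (c d : FreeMagma X) :
    wordSum f (c * d) = wordSum (fun u => wordSum (fun v => f (u ++ v) - f (v ++ u)) d) c := rfl

/-- Only rearrangements of the content occur in the expansion of a commutator. This is what allows
multilinearity of the words to be used when a word sum is evaluated. -/
theorem wordSum_congr {f g : List X → ℂ} {c : FreeMagma X}
    (h : ∀ w, w.Perm (content c) → f w = g w) : wordSum f c = wordSum g c := by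
  induction c generalizing f g with
  | ih1 x => exact h _ (List.Perm.refl _)
  | ih2 c d hc hd =>
    rw [wordSum_mul, wordSum_mul]
    refine hc fun u hu => hd fun v hv => ?_
    rw [h, h]
    · exact (List.perm_append_comm).trans (hu.append hv)
    · exact hu.append hv

theorem wordSum_linear (r s : ℂ) (f g : List X → ℂ) (c : FreeMagma X) :
    wordSum (fun w => r * f w + s * g w) c = r * wordSum f c + s * wordSum g c := by
  induction c generalizing f g with
  | ih1 x => rfl
  | ih2 c d hc hd =>
    rw [wordSum_mul, wordSum_mul, wordSum_mul, ← hc]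
    refine wordSum_congr fun u _ => ?_
    rw [← hd]
    refine wordSum_congr fun v _ => ?_
    ring

theorem wordSum_mul_left (r : ℂ) (f : List X → ℂ) (c : FreeMagma X) :
    wordSum (fun w => r * f w) c = r * wordSum f c := by
  simpa using wordSum_linear r 0 f f c

theorem wordSum_zero (c : FreeMagma X) : wordSum (fun _ : List X => 0) c = 0 := by
  simpa using wordSum_mul_left 0 (fun _ => 0) c

theorem wordSum_sub (f g : List X → ℂ) (c : FreeMagma X) :
    wordSum (fun w => f w - g w) c = wordSum f c - wordSum g c := by
  simpa [sub_eq_add_neg] using wordSum_linear 1 (-1) f g c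

theorem wordSum_finset_sum {κ : Type*} (s : Finset κ) (f : κ → List X → ℂ) (c : FreeMagma X) :
    wordSum (fun w => ∑ i ∈ s, f i w) c = ∑ i ∈ s, wordSum (f i) c := by
  classical
  induction s using Finset.induction_on with
  | empty => simpa using wordSum_zero c
  | insert i s hi ih =>
    simp only [Finset.sum_insert hi]
    rw [← ih]
    simpa using wordSum_linear 1 1 (f i) (fun w => ∑ i ∈ s, f i w) c

/-- The linear extension of a function on words. -/
def evalWords (f : List X → ℂ) : Words X →ₗ[ℂ] ℂ := Finsupp.linearCombination ℂ f

@[simp] theorem evalWords_single (f : List X → ℂ) (w : List X) (r : ℂ) :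
    evalWords f (Finsupp.single w r) = r * f w := by
  simp [evalWords]

/-- In the free associative algebra a bracket is a difference of two products, and left
multiplication by words is concatenation. -/
theorem evalWords_leftMul (f : List X → ℂ) (c : FreeMagma X) (t : Words X) :
    evalWords f (leftMul X (commutator c) t) =
      wordSum (fun u => evalWords (fun v => f (u ++ v)) t) c := by
  induction c generalizing f t with
  | ih1 x =>
    rw [wordSum_of, commutator, leftMul_of]
    induction t using Finsupp.induction_linear with
    | zero => simp
    | add a b ha hb => simp only [map_add, ha, hb]
    | single w r => simp
  | ih2 c d hc hd =>
    rw [commutator_mul, LieHom.map_lie, LieRing.of_associative_ring_bracket, LinearMap.sub_apply,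
      map_sub, Module.End.mul_apply, Module.End.mul_apply, hc, hd, wordSum_mul]
    have h1 : ∀ u, evalWords (fun v => f (u ++ v)) (leftMul X (commutator d) t) =
        wordSum (fun v => evalWords (fun w => f (u ++ v ++ w)) t) d := by
      intro u; rw [hd]; simp [List.append_assoc]
    have h2 : ∀ u, evalWords (fun v => f (u ++ v)) (leftMul X (commutator c) t) =
        wordSum (fun v => evalWords (fun w => f (u ++ v ++ w)) t) c := by
      intro u; rw [hc]; simp [List.append_assoc]
    simp only [h1, h2]
    -- Nested expansions over two commutators may be interchanged; the product in the opposite order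
    -- comes with `d` outermost.
    have h3 : ∀ (g : List X → List X → ℂ) (c d : FreeMagma X),
        wordSum (fun u => wordSum (fun v => g u v) d) c =
        wordSum (fun v => wordSum (fun u => g u v) c) d := by
      intro g c d
      induction c generalizing g with
      | ih1 x => rfl
      | ih2 c c' hc hc' =>
        simp only [wordSum_mul]
        rw [← hc]
        refine wordSum_congr fun u _ => ?_
        rw [← hc']
        refine wordSum_congr fun v _ => ?_
        rw [wordSum_sub]
    rw [h3 (fun u v => evalWords (fun w => f (u ++ v ++ w)) t) d c, ← wordSum_sub]
    refine wordSum_congr fun u _ => ?_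
    rw [← wordSum_sub]

theorem evalWords_wordExp (f : List X → ℂ) (c : FreeMagma X) :
    evalWords f (wordExp (commutator c)) = wordSum f c := by
  rw [wordExp_apply, evalWords_leftMul]
  simp

theorem apply_eq_evalWords (t : Words X) (w : List X) :
    t w = evalWords (fun v => Finsupp.single v 1 w) t := by
  induction t using Finsupp.induction_linear with
  | zero => simp
  | add a b ha hb => simp [ha, hb]
  | single v r => classical simp [Finsupp.single_apply]

/-- The coefficient of `w` is the word sum of the indicator function of `w`, which vanishes on all
rearrangements of the content. -/
theorem wordExp_commutator_apply_eq_zero {c : FreeMagma X} {w : List X}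
    (h : ¬ w.Perm (content c)) : wordExp (commutator c) w = 0 := by
  rw [apply_eq_evalWords, evalWords_wordExp, ← wordSum_zero c]
  refine wordSum_congr fun v hv => ?_
  refine Finsupp.single_eq_of_ne ?_
  rintro rfl
  exact h hv

/-! ### The free Lie algebra embeds into the free associative algebra -/

/-- The action of a generator on `L × ℂ`, in which the second factor is a derivation. -/
def degreeLetter (x : X) : Module.End ℂ (FreeLieAlgebra ℂ X × ℂ) :=
  LinearMap.inl ℂ _ _ ∘ₗ
    ((LieAlgebra.ad ℂ (FreeLieAlgebra ℂ X) (FreeLieAlgebra.of ℂ x)).comp (LinearMap.fst ℂ _ _) +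
      (LinearMap.toSpanSingleton ℂ _ (FreeLieAlgebra.of ℂ x)).comp (LinearMap.snd ℂ _ _))

variable (X) in
/-- The action of the free Lie algebra on `L × ℂ`, in which the second factor is a derivation. -/
def degreeRep : FreeLieAlgebra ℂ X →ₗ⁅ℂ⁆ Module.End ℂ (FreeLieAlgebra ℂ X × ℂ) :=
  FreeLieAlgebra.lift ℂ degreeLetter

theorem degreeRep_apply_zero (x y : FreeLieAlgebra ℂ X) : degreeRep X x (y, 0) = (⁅x, y⁆, 0) := by
  induction x using freeLie_induction generalizing y with
  | zero => simp; rfl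
  | of x => simp [degreeRep, degreeLetter]
  | add a b ha hb => simp [ha, hb]
  | smul z a ha => simp [ha]
  | lie a b ha hb =>
    simp [LieRing.of_associative_ring_bracket, ha, hb]

/-- The second factor acts as the Euler derivation: the bracket of `c` and `d` sends `(0, 1)` to
`|d| [c, d] - |c| [d, c]`, so the lengths add. -/
theorem degreeRep_commutator (c : FreeMagma X) :
    degreeRep X (commutator c) (0, 1) = (((content c).length : ℂ) • commutator c, 0) := by
  induction c with
  | ih1 x => simp [degreeRep, degreeLetter, commutator, content]
  | ih2 c d hc hd =>
    rw [commutator_mul, LieHom.map_lie, LieRing.of_associative_ring_bracket]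
    simp only [LinearMap.sub_apply, Module.End.mul_apply, hc, hd, degreeRep_apply_zero, lie_smul,
      content_mul, List.length_append, Nat.cast_add, add_smul, Prod.mk_sub_mk, sub_self]
    rw [← lie_skew (commutator c) (commutator d)]
    congr 1
    module

variable (X) in
/-- The derivation of the free Lie algebra that multiplies commutators by their length. -/
def degreeDer : Module.End ℂ (FreeLieAlgebra ℂ X) :=
  LinearMap.fst ℂ _ _ ∘ₗ LinearMap.applyₗ ((0, 1) : FreeLieAlgebra ℂ X × ℂ) ∘ₗ
    (degreeRep X).toLinearMap

theorem degreeDer_commutator (c : FreeMagma X) :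
    degreeDer X (commutator c) = ((content c).length : ℂ) • commutator c := by
  change (degreeRep X (commutator c) (0, 1)).1 = _
  rw [degreeRep_commutator]

/-- The algebra is spanned by eigenvectors whose eigenvalues, the lengths of commutators, are
nonzero, and eigenspaces for distinct eigenvalues are independent. -/
theorem degreeDer_injective : Function.Injective (degreeDer X) := by
  rw [← LinearMap.ker_eq_bot, ← Module.End.eigenspace_zero]
  have hind := Module.End.eigenspaces_iSupIndep (degreeDer X)
  have htop : (⨆ (μ : ℂ) (_ : μ ≠ 0), Module.End.eigenspace (degreeDer X) μ) = ⊤ := by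
    rw [eq_top_iff, ← span_range_commutator, Submodule.span_le]
    rintro _ ⟨c, rfl⟩
    have h0 : ((content c).length : ℂ) ≠ 0 := by
      simpa using content_ne_nil c
    refine Submodule.mem_iSup_of_mem _ (Submodule.mem_iSup_of_mem h0 ?_)
    rw [Module.End.mem_eigenspace_iff]
    exact degreeDer_commutator c
  have := hind 0
  rw [htop] at this
  exact disjoint_top.mp this

/-- The action of words on `L × ℂ`, applied to `(0, 1)`. -/
def wordAction : Words X →ₗ[ℂ] FreeLieAlgebra ℂ X × ℂ :=
  Finsupp.linearCombination ℂ fun w => w.foldr (fun x v => degreeLetter x v) (0, 1)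

theorem wordAction_leftMul (x : FreeLieAlgebra ℂ X) (t : Words X) :
    wordAction (leftMul X x t) = degreeRep X x (wordAction t) := by
  induction x using freeLie_induction generalizing t with
  | zero => simp
  | of x =>
    induction t using Finsupp.induction_linear with
    | zero => simp
    | add a b ha hb => simp only [map_add, ha, hb]
    | single w r => simp [wordAction, degreeRep]
  | add a b ha hb => simp [ha, hb]
  | smul z a ha => simp [ha]
  | lie a b ha hb => simp [LieRing.of_associative_ring_bracket, ha, hb]

/-- A Dynkin–Specht–Wever argument. The action on `L × ℂ` extends from the Lie algebra to words, so
`degreeDer x` depends only on the expansion of `x` into words; and `degreeDer` is injective. -/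
theorem wordExp_injective : Function.Injective (wordExp (X := X)) := by
  rw [injective_iff_map_eq_zero]
  intro x hx
  have h : degreeDer X x = 0 := by
    have h1 := wordAction_leftMul x (Finsupp.single [] 1)
    rw [← wordExp_apply, hx, map_zero] at h1
    have h2 : wordAction (X := X) (Finsupp.single [] 1) = (0, 1) := by simp [wordAction]
    rw [h2] at h1
    exact congrArg Prod.fst h1.symm
  exact degreeDer_injective (h.trans (map_zero _).symm)

variable (X) in
/-- A left inverse of the embedding into the free associative algebra. -/
def wordExpInv : Words X →ₗ[ℂ] FreeLieAlgebra ℂ X :=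
  (LinearMap.exists_leftInverse_of_injective (wordExp (X := X))
    (LinearMap.ker_eq_bot.mpr wordExp_injective)).choose

@[simp] theorem wordExpInv_wordExp (x : FreeLieAlgebra ℂ X) : wordExpInv X (wordExp x) = x :=
  LinearMap.congr_fun (LinearMap.exists_leftInverse_of_injective (wordExp (X := X))
    (LinearMap.ker_eq_bot.mpr wordExp_injective)).choose_spec x

end FreeLie

/-! ### The structure of `𝔤` -/

section StructureG

variable {R : ℕ} {𝔥 : Type u} [AddCommGroup 𝔥] [Module ℂ 𝔥] [FiniteDimensional ℂ 𝔥]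
variable {B : LinearMap.BilinForm ℂ 𝔥} {hB : B.Nondegenerate} {α : Fin R → Module.Dual ℂ 𝔥}

theorem lieG_mk_lie (x y : FreeLieAlgebra ℂ (Gen R 𝔥)) :
    (LieSubmodule.Quotient.mk ⁅x, y⁆ : LieG B hB α) =
      ⁅(LieSubmodule.Quotient.mk x : LieG B hB α), (LieSubmodule.Quotient.mk y : LieG B hB α)⁆ :=
  LieSubmodule.Quotient.mk_bracket _ x y

theorem lieG_mk_eq_zero {x : FreeLieAlgebra ℂ (Gen R 𝔥)} (hx : IsRelator B hB α x) :
    (LieSubmodule.Quotient.mk x : LieG B hB α) = 0 :=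
  (LieSubmodule.Quotient.mk_eq_zero' (N := relIdeal B hB α)).mpr (LieSubmodule.subset_lieSpan hx)

theorem gen_H_add (h h' : 𝔥) :
    gen B hB α (.H (h + h')) = gen B hB α (.H h) + gen B hB α (.H h') :=
  sub_eq_zero.mp (lieG_mk_eq_zero (IsRelator.add (hB := hB) (α := α) h h'))

theorem gen_H_smul (z : ℂ) (h : 𝔥) : gen B hB α (.H (z • h)) = z • gen B hB α (.H h) :=
  sub_eq_zero.mp (lieG_mk_eq_zero (IsRelator.smul (hB := hB) (α := α) z h))

variable (B hB α) in
/-- The map from `𝔥` to `𝔤`. -/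
def toH : 𝔥 →ₗ[ℂ] LieG B hB α where
  toFun h := gen B hB α (.H h)
  map_add' := gen_H_add
  map_smul' := gen_H_smul

theorem toH_apply (h : 𝔥) : toH B hB α h = gen B hB α (.H h) := rfl

theorem lie_gen_E_F (i j : Fin R) :
    ⁅gen B hB α (.E i), gen B hB α (.F j)⁆ = if i = j then toH B hB α (coroot B hB α j) else 0 := by
  have h := lieG_mk_eq_zero (IsRelator.EF (B := B) (hB := hB) (α := α) i j)
  split_ifs at h ⊢ with hij
  · exact sub_eq_zero.mp h
  · rw [sub_zero] at h; exact h

theorem lie_toH_E (h : 𝔥) (i : Fin R) :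
    ⁅toH B hB α h, gen B hB α (.E i)⁆ = α i h • gen B hB α (.E i) :=
  sub_eq_zero.mp (lieG_mk_eq_zero (IsRelator.HE (B := B) (hB := hB) (α := α) h i))

theorem lie_toH_F (h : 𝔥) (i : Fin R) :
    ⁅toH B hB α h, gen B hB α (.F i)⁆ = (-α i h) • gen B hB α (.F i) :=
  sub_eq_zero.mp (lieG_mk_eq_zero (IsRelator.HF (B := B) (hB := hB) (α := α) h i))

theorem lie_toH_toH (h h' : 𝔥) : ⁅toH B hB α h, toH B hB α h'⁆ = 0 :=
  lieG_mk_eq_zero (IsRelator.HH (B := B) (hB := hB) (α := α) h h')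

section Lift

variable {L : Type*} [LieRing L] [LieAlgebra ℂ L] (e f : Fin R → L) (k : 𝔥 →ₗ[ℂ] L)

/-- The images of the generators of `𝔤` under a homomorphism. -/
def genMap : Gen R 𝔥 → L
  | .E i => e i
  | .F i => f i
  | .H h => k h

/-- The universal property of `𝔤`. -/
def liftG (hef : ∀ i j, ⁅e i, f j⁆ = if i = j then k (coroot B hB α j) else 0)
    (hke : ∀ h i, ⁅k h, e i⁆ = α i h • e i) (hkf : ∀ h i, ⁅k h, f i⁆ = (-α i h) • f i)
    (hkk : ∀ h h', ⁅k h, k h'⁆ = 0) : LieG B hB α →ₗ⁅ℂ⁆ L :=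
  have hker : relIdeal B hB α ≤ (FreeLieAlgebra.lift ℂ (genMap e f k)).ker := by
    refine LieSubmodule.lieSpan_le.mpr ?_
    rintro x hx
    rw [SetLike.mem_coe, LieHom.mem_ker]
    cases hx with
    | add h h' => simp [letterH, genMap]
    | smul z h => simp [letterH, genMap]
    | EF i j =>
      have := hef i j
      split_ifs at this ⊢ with hij <;> simp [letterH, letterE, letterF, genMap, this]
    | HE h i => simp [letterH, letterE, genMap, hke]
    | HF h i => simp [letterH, letterF, genMap, hkf]
    | HH h h' => simp [letterH, genMap, hkk]
  { (relIdeal B hB α).toSubmodule.liftQ (FreeLieAlgebra.lift ℂ (genMap e f k)).toLinearMap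
      (fun x hx => by
        have := hker hx
        rwa [LieHom.mem_ker] at this) with
    map_lie' := by
      intro x y
      obtain ⟨x, rfl⟩ := LieSubmodule.Quotient.surjective_mk' _ x
      obtain ⟨y, rfl⟩ := LieSubmodule.Quotient.surjective_mk' _ y
      exact LieHom.map_lie (FreeLieAlgebra.lift ℂ (genMap e f k)) x y }

variable {e f k}
variable (hef : ∀ i j, ⁅e i, f j⁆ = if i = j then k (coroot B hB α j) else 0)
    (hke : ∀ h i, ⁅k h, e i⁆ = α i h • e i) (hkf : ∀ h i, ⁅k h, f i⁆ = (-α i h) • f i)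
    (hkk : ∀ h h', ⁅k h, k h'⁆ = 0)

theorem liftG_gen (x : Gen R 𝔥) :
    liftG e f k hef hke hkf hkk (gen B hB α x) = genMap e f k x :=
  FreeLieAlgebra.lift_of_apply (genMap e f k) x

theorem lieG_hom_ext {φ ψ : LieG B hB α →ₗ⁅ℂ⁆ L}
    (hE : ∀ i, φ (gen B hB α (.E i)) = ψ (gen B hB α (.E i)))
    (hF : ∀ i, φ (gen B hB α (.F i)) = ψ (gen B hB α (.F i)))
    (hH : ∀ h, φ (toH B hB α h) = ψ (toH B hB α h)) : φ = ψ := by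
  let q : FreeLieAlgebra ℂ (Gen R 𝔥) →ₗ⁅ℂ⁆ LieG B hB α :=
    { (LieSubmodule.Quotient.mk' (relIdeal B hB α)).toLinearMap with
      map_lie' := fun {x y} => lieG_mk_lie x y }
  have h : φ.comp q = ψ.comp q := FreeLieAlgebra.hom_ext fun x => by
    cases x with
    | E i => exact hE i
    | F i => exact hF i
    | H h => exact hH h
  ext x
  obtain ⟨x, rfl⟩ := LieSubmodule.Quotient.surjective_mk' _ x
  exact LieHom.congr_fun h x

end Lift

/-! #### The triangular decomposition -/

@[simp] theorem toN_of (i : Fin R) : toN B hB α (FreeLieAlgebra.of ℂ i) = gen B hB α (.F i) := by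
  simp [toN]

@[simp] theorem toNPlus_of (i : Fin R) :
    toNPlus B hB α (FreeLieAlgebra.of ℂ i) = gen B hB α (.E i) := by
  simp [toNPlus]

/-- The sum of the content of a commutator, with respect to a function on the letters. -/
def contentSum {X N : Type*} [AddCommMonoid N] (d : X → N) (c : FreeMagma X) : N :=
  ((content c).map d).sum

theorem contentSum_of {X N : Type*} [AddCommMonoid N] (d : X → N) (x : X) :
    contentSum d (.of x) = d x := by simp [contentSum, content]

theorem contentSum_mul {X N : Type*} [AddCommMonoid N] (d : X → N) (c c' : FreeMagma X) :
    contentSum d (c * c') = contentSum d c + contentSum d c' := by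
  simp [contentSum, content_mul]

theorem lie_toH_toN (h : 𝔥) (c : FreeMagma (Fin R)) :
    ⁅toH B hB α h, toN B hB α (commutator c)⁆ =
      (-contentSum (fun i => α i h) c) • toN B hB α (commutator c) := by
  induction c with
  | ih1 x => simp [commutator, contentSum_of, lie_toH_F]
  | ih2 c d hc hd =>
    rw [commutator_mul, LieHom.map_lie, leibniz_lie, hc, hd, contentSum_mul, lie_smul, smul_lie]
    module

theorem lie_toH_toNPlus (h : 𝔥) (c : FreeMagma (Fin R)) :
    ⁅toH B hB α h, toNPlus B hB α (commutator c)⁆ =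
      contentSum (fun i => α i h) c • toNPlus B hB α (commutator c) := by
  induction c with
  | ih1 x => simp [commutator, contentSum_of, lie_toH_E]
  | ih2 c d hc hd =>
    rw [commutator_mul, LieHom.map_lie, leibniz_lie, hc, hd, contentSum_mul, lie_smul, smul_lie]
    module

theorem exists_lie_toH_toN (h : 𝔥) (x : FreeLieAlgebra ℂ (Fin R)) :
    ∃ y, ⁅toH B hB α h, toN B hB α x⁆ = toN B hB α y := by
  induction x using freeLie_induction with
  | zero => exact ⟨0, by simp⟩
  | of i => exact ⟨(-α i h) • FreeLieAlgebra.of ℂ i, by simp [lie_toH_F]⟩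
  | add a b ha hb =>
    obtain ⟨a', ha⟩ := ha; obtain ⟨b', hb⟩ := hb
    exact ⟨a' + b', by simp [ha, hb]⟩
  | smul z a ha => obtain ⟨a', ha⟩ := ha; exact ⟨z • a', by simp [ha]⟩
  | lie a b ha hb =>
    obtain ⟨a', ha⟩ := ha; obtain ⟨b', hb⟩ := hb
    exact ⟨⁅a', b⁆ + ⁅a, b'⁆, by simp only [LieHom.map_lie, leibniz_lie (toH B hB α h), ha, hb, map_add]⟩

/-- A Cartan component arises only on generators. In a longer bracket the Leibniz rule brackets it
with another element of 𝔫, and 𝔥 preserves 𝔫. -/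
theorem exists_lie_E_toN (i : Fin R) (x : FreeLieAlgebra ℂ (Fin R)) :
    ∃ y h, ⁅gen B hB α (.E i), toN B hB α x⁆ = toN B hB α y + toH B hB α h := by
  induction x using freeLie_induction with
  | zero => exact ⟨0, 0, by simp⟩
  | of j =>
    refine ⟨0, if i = j then coroot B hB α j else 0, ?_⟩
    rw [toN_of, lie_gen_E_F]
    split_ifs <;> simp
  | add a b ha hb =>
    obtain ⟨a', h, ha⟩ := ha; obtain ⟨b', h', hb⟩ := hb
    exact ⟨a' + b', h + h', by simp only [map_add, lie_add, ha, hb]; abel⟩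
  | smul z a ha => obtain ⟨a', h, ha⟩ := ha; exact ⟨z • a', z • h, by simp [ha]⟩
  | lie a b ha hb =>
    obtain ⟨a', h, ha⟩ := ha; obtain ⟨b', h', hb⟩ := hb
    obtain ⟨c, hc⟩ := exists_lie_toH_toN (hB := hB) (α := α) h b
    obtain ⟨d, hd⟩ := exists_lie_toH_toN (hB := hB) (α := α) h' a
    refine ⟨⁅a', b⁆ + c + ⁅a, b'⁆ - d, 0, ?_⟩
    rw [LieHom.map_lie, leibniz_lie, ha, hb, add_lie, lie_add, hc,
      ← lie_skew (toN B hB α a) (toH B hB α h'), hd]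
    simp only [map_add, map_sub, LieHom.map_lie, map_zero]
    abel

/-! #### The Chevalley involution -/

variable (B hB α) in
/-- The involution of `𝔤` that exchanges `E_i` with `F_i`, and is `-1` on `𝔥`. -/
def chevalley : LieG B hB α →ₗ⁅ℂ⁆ LieG B hB α :=
  liftG (fun i => gen B hB α (.F i)) (fun i => gen B hB α (.E i)) (-toH B hB α)
    (by
      intro i j
      rw [← lie_skew, lie_gen_E_F]
      by_cases h : i = j
      · subst h; simp
      · simp [h, Ne.symm h])
    (by intro h i; simp [lie_toH_F])
    (by intro h i; simp [lie_toH_E])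
    (by intro h h'; simp [lie_toH_toH])

@[simp] theorem chevalley_E (i : Fin R) :
    chevalley B hB α (gen B hB α (.E i)) = gen B hB α (.F i) := liftG_gen _ _ _ _ _

@[simp] theorem chevalley_F (i : Fin R) :
    chevalley B hB α (gen B hB α (.F i)) = gen B hB α (.E i) := liftG_gen _ _ _ _ _

@[simp] theorem chevalley_H (h : 𝔥) :
    chevalley B hB α (toH B hB α h) = -toH B hB α h := liftG_gen _ _ _ _ _

@[simp] theorem chevalley_chevalley (u : LieG B hB α) :
    chevalley B hB α (chevalley B hB α u) = u := by
  have : (chevalley B hB α).comp (chevalley B hB α) = LieHom.id :=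
    lieG_hom_ext (by simp) (by simp) (by simp)
  exact LieHom.congr_fun this u

@[simp] theorem chevalley_toN (x : FreeLieAlgebra ℂ (Fin R)) :
    chevalley B hB α (toN B hB α x) = toNPlus B hB α x := by
  have : (chevalley B hB α).comp (toN B hB α) = toNPlus B hB α :=
    FreeLieAlgebra.hom_ext (by simp)
  exact LieHom.congr_fun this x

@[simp] theorem chevalley_toNPlus (x : FreeLieAlgebra ℂ (Fin R)) :
    chevalley B hB α (toNPlus B hB α x) = toN B hB α x := by
  rw [← chevalley_toN, chevalley_chevalley]

theorem exists_lie_F_toNPlus (i : Fin R) (x : FreeLieAlgebra ℂ (Fin R)) :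
    ∃ y h, ⁅gen B hB α (.F i), toNPlus B hB α x⁆ = toNPlus B hB α y + toH B hB α h := by
  obtain ⟨y, h, hy⟩ := exists_lie_E_toN (B := B) (hB := hB) (α := α) i x
  refine ⟨y, -h, ?_⟩
  have := congrArg (chevalley B hB α) hy
  simpa using this

theorem exists_lie_toH_toNPlus (h : 𝔥) (x : FreeLieAlgebra ℂ (Fin R)) :
    ∃ y, ⁅toH B hB α h, toNPlus B hB α x⁆ = toNPlus B hB α y := by
  obtain ⟨y, hy⟩ := exists_lie_toH_toN (B := B) (hB := hB) (α := α) h x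
  refine ⟨-y, ?_⟩
  have := congrArg (chevalley B hB α) hy
  rw [LieHom.map_lie, chevalley_toN, chevalley_toN, chevalley_H, neg_lie] at this
  rw [map_neg, ← this, neg_neg]

/-- The triangular decomposition of `𝔤`. -/
theorem exists_triangular (u : LieG B hB α) :
    ∃ x h y, u = toN B hB α x + toH B hB α h + toNPlus B hB α y := by
  let S : Submodule ℂ (LieG B hB α) :=
    LinearMap.range (toN B hB α).toLinearMap ⊔ LinearMap.range (toH B hB α) ⊔
      LinearMap.range (toNPlus B hB α).toLinearMap
  have hS : ∀ v, v ∈ S ↔ ∃ x h y, v = toN B hB α x + toH B hB α h + toNPlus B hB α y := by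
    intro v
    simp only [S, Submodule.mem_sup, LinearMap.mem_range]
    constructor
    · rintro ⟨_, ⟨_, ⟨x, rfl⟩, _, ⟨h, rfl⟩, rfl⟩, _, ⟨y, rfl⟩, rfl⟩
      exact ⟨x, h, y, rfl⟩
    · rintro ⟨x, h, y, rfl⟩
      exact ⟨_, ⟨_, ⟨x, rfl⟩, _, ⟨h, rfl⟩, rfl⟩, _, ⟨y, rfl⟩, rfl⟩
  have hE : ∀ i, ∀ v ∈ S, ⁅gen B hB α (.E i), v⁆ ∈ S := by
    intro i v hv
    obtain ⟨x, h, y, rfl⟩ := (hS v).mp hv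
    obtain ⟨x', h', hx⟩ := exists_lie_E_toN (B := B) (hB := hB) (α := α) i x
    refine (hS _).mpr ⟨x', h', -α i h • FreeLieAlgebra.of ℂ i + ⁅FreeLieAlgebra.of ℂ i, y⁆, ?_⟩
    rw [lie_add, lie_add, hx, ← lie_skew _ (toH B hB α h), lie_toH_E]
    simp only [map_add, map_smul, LieHom.map_lie, toNPlus_of]
    module
  have hF : ∀ i, ∀ v ∈ S, ⁅gen B hB α (.F i), v⁆ ∈ S := by
    intro i v hv
    obtain ⟨x, h, y, rfl⟩ := (hS v).mp hv
    obtain ⟨y', h', hy⟩ := exists_lie_F_toNPlus (B := B) (hB := hB) (α := α) i y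
    refine (hS _).mpr ⟨α i h • FreeLieAlgebra.of ℂ i + ⁅FreeLieAlgebra.of ℂ i, x⁆, h', y', ?_⟩
    rw [lie_add, lie_add, hy, ← lie_skew _ (toH B hB α h), lie_toH_F]
    simp only [map_add, map_smul, LieHom.map_lie, toN_of]
    module
  have hH : ∀ k, ∀ v ∈ S, ⁅toH B hB α k, v⁆ ∈ S := by
    intro k v hv
    obtain ⟨x, h, y, rfl⟩ := (hS v).mp hv
    obtain ⟨x', hx⟩ := exists_lie_toH_toN (B := B) (hB := hB) (α := α) k x
    obtain ⟨y', hy⟩ := exists_lie_toH_toNPlus (B := B) (hB := hB) (α := α) k y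
    refine (hS _).mpr ⟨x', 0, y', ?_⟩
    rw [lie_add, lie_add, hx, hy, lie_toH_toH, map_zero]
  -- Stability of `S` under the action of `z` and membership of `z` are proved together: for a
  -- bracket, membership uses stability under the first factor.
  have key : ∀ z : FreeLieAlgebra ℂ (Gen R 𝔥),
      (∀ v ∈ S, ⁅(LieSubmodule.Quotient.mk z : LieG B hB α), v⁆ ∈ S) ∧
        (LieSubmodule.Quotient.mk z : LieG B hB α) ∈ S := by
    intro z
    induction z using freeLie_induction with
    | zero =>
      have h0 : (LieSubmodule.Quotient.mk 0 : LieG B hB α) = 0 :=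
        (LieSubmodule.Quotient.mk' (relIdeal B hB α)).map_zero
      rw [h0]
      exact ⟨fun v _ => by rw [zero_lie]; exact S.zero_mem, S.zero_mem⟩
    | of g =>
      cases g with
      | E i => exact ⟨hE i, (hS _).mpr ⟨0, 0, FreeLieAlgebra.of ℂ i, by simp; rfl⟩⟩
      | F i => exact ⟨hF i, (hS _).mpr ⟨FreeLieAlgebra.of ℂ i, 0, 0, by simp; rfl⟩⟩
      | H h => exact ⟨hH h, (hS _).mpr ⟨0, h, 0, by simp; rfl⟩⟩
    | add a b ha hb =>
      have h0 : (LieSubmodule.Quotient.mk (a + b) : LieG B hB α) =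
        LieSubmodule.Quotient.mk a + LieSubmodule.Quotient.mk b := rfl
      rw [h0]
      exact ⟨fun v hv => by rw [add_lie]; exact S.add_mem (ha.1 v hv) (hb.1 v hv),
        S.add_mem ha.2 hb.2⟩
    | smul z a ha =>
      have h0 : (LieSubmodule.Quotient.mk (z • a) : LieG B hB α) =
        z • LieSubmodule.Quotient.mk a := rfl
      rw [h0]
      exact ⟨fun v hv => by rw [smul_lie]; exact S.smul_mem z (ha.1 v hv), S.smul_mem z ha.2⟩
    | lie a b ha hb =>
      rw [lieG_mk_lie]
      refine ⟨fun v hv => ?_, ha.1 _ hb.2⟩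
      rw [lie_lie]
      exact S.sub_mem (ha.1 _ (hb.1 v hv)) (hb.1 _ (ha.1 v hv))
  obtain ⟨z, rfl⟩ := LieSubmodule.Quotient.surjective_mk' _ u
  exact (hS _).mp (key z).2

end StructureG

/-! ### Highest weight modules on words -/

section Contract

variable {X : Type*}

open Classical in
/-- The lowering operator of the letter `i` on a word: it deletes an occurrence of `i`, with
coefficient determined by the letters to its right. -/
def contractWord (a : X → X → ℂ) (c : X → ℂ) (i : X) : List X → Words X
  | [] => 0
  | j :: w => consMap j (contractWord a c i w) -
      if i = j then Finsupp.single w (c i + (w.map (a i)).sum) else 0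

/-- The linear extension of `contractWord`. -/
def contract (a : X → X → ℂ) (c : X → ℂ) (i : X) : Module.End ℂ (Words X) :=
  Finsupp.linearCombination ℂ (contractWord a c i)

/-- The diagonal operator that multiplies each word `w` by `f w`. -/
def diagWords (f : List X → ℂ) : Module.End ℂ (Words X) :=
  Finsupp.linearCombination ℂ fun w => Finsupp.single w (f w)

@[simp] theorem diagWords_single (f : List X → ℂ) (w : List X) (r : ℂ) :
    diagWords f (Finsupp.single w r) = Finsupp.single w (r * f w) := by
  simp [diagWords]

@[simp] theorem contract_single (a : X → X → ℂ) (c : X → ℂ) (i : X) (w : List X) (r : ℂ) :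
    contract a c i (Finsupp.single w r) = r • contractWord a c i w := by
  simp [contract]

theorem words_end_ext {f g : Module.End ℂ (Words X)}
    (h : ∀ w, f (Finsupp.single w 1) = g (Finsupp.single w 1)) : f = g :=
  Finsupp.lhom_ext' fun w => LinearMap.ext_ring (h w)

/-- The recursion that defines `contractWord` is this commutation relation, read as a rule for
moving the lowering operator past the first letter. -/
theorem lie_consMap_contract [DecidableEq X] (a : X → X → ℂ) (c : X → ℂ) (i j : X) :
    consMap i * contract a c j - contract a c j * consMap i =
      if i = j then diagWords (fun w => c j + (w.map (a j)).sum) else 0 := by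
  refine words_end_ext fun w => ?_
  simp only [LinearMap.sub_apply, Module.End.mul_apply, contract_single, consMap_single, one_smul,
    contractWord, sub_sub_cancel]
  by_cases h : i = j
  · subst h; simp
  · simp [h, Ne.symm h]

theorem lie_diagWords_consMap (c : ℂ) (f : X → ℂ) (i : X) :
    diagWords (fun w => c + (w.map f).sum) * consMap i -
      consMap i * diagWords (fun w => c + (w.map f).sum) = f i • consMap i := by
  refine words_end_ext fun w => ?_
  simp only [LinearMap.sub_apply, Module.End.mul_apply, consMap_single, diagWords_single,
    LinearMap.smul_apply, List.map_cons, List.sum_cons, ← Finsupp.single_sub, Finsupp.smul_single]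
  congr 1
  simp

theorem diagWords_consMap (c : ℂ) (f : X → ℂ) (i : X) (t : Words X) :
    diagWords (fun w => c + (w.map f).sum) (consMap i t) =
      consMap i (diagWords (fun w => c + (w.map f).sum) t) + f i • consMap i t := by
  have h := LinearMap.congr_fun (lie_diagWords_consMap c f i) t
  simp only [LinearMap.sub_apply, Module.End.mul_apply, LinearMap.smul_apply] at h
  rw [← h]; abel

/-- Each term of the lowering operator removes one letter `i`, and so lowers the eigenvalue by `f
i`. -/
theorem lie_diagWords_contract (a : X → X → ℂ) (c : X → ℂ) (d : ℂ) (f : X → ℂ) (i : X) :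
    diagWords (fun w => d + (w.map f).sum) * contract a c i -
      contract a c i * diagWords (fun w => d + (w.map f).sum) = (-f i) • contract a c i := by
  refine words_end_ext fun w => ?_
  simp only [LinearMap.sub_apply, Module.End.mul_apply, contract_single, diagWords_single,
    LinearMap.smul_apply, one_smul, one_mul]
  induction w with
  | nil => simp [contractWord]
  | cons j w ih =>
    simp only [contractWord, map_sub, diagWords_consMap, List.map_cons, List.sum_cons]
    have ih' := congrArg (consMap j) ih
    simp only [map_sub, map_smul] at ih'
    rw [sub_eq_iff_eq_add] at ih'
    rw [ih']
    split_ifs with h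
    · subst h
      rw [diagWords_single, smul_sub, smul_sub, Finsupp.smul_single, Finsupp.smul_single]
      have h1 : Finsupp.single w ((c i + (w.map (a i)).sum) * (d + (w.map f).sum)) =
        Finsupp.single w ((d + (f i + (w.map f).sum)) • (c i + (w.map (a i)).sum)) +
        Finsupp.single w ((-f i) • (c i + (w.map (a i)).sum)) := by
        rw [← Finsupp.single_add]; congr 1; simp only [smul_eq_mul]; ring
      rw [h1]
      module
    · rw [map_zero]; module

end Contract

/-! ### The module of words over 𝔤, and the projections of 𝔤 to 𝔫 and 𝔫₊ -/

section Verma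

variable {R : ℕ} {𝔥 : Type u} [AddCommGroup 𝔥] [Module ℂ 𝔥] [FiniteDimensional ℂ 𝔥]
variable {B : LinearMap.BilinForm ℂ 𝔥} {hB : B.Nondegenerate} {α : Fin R → Module.Dual ℂ 𝔥}

theorem apply_coroot (i : Fin R) (h : 𝔥) : B (coroot B hB α i) h = α i h :=
  LinearMap.BilinForm.apply_toDual_symm_apply (hB := hB) (α i) h

theorem rootForm_eq (i j : Fin R) : rootForm B hB α i j = α i (coroot B hB α j) :=
  apply_coroot i _

theorem rootForm_symm (hsymm : B.IsSymm) (i j : Fin R) :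
    rootForm B hB α i j = rootForm B hB α j i := hsymm.eq _ _

variable (hB α) in
/-- The action of `𝔥` on the module with extremal weight `Λ`. -/
def vermaH (Λ : Module.Dual ℂ 𝔥) : 𝔥 →ₗ[ℂ] Module.End ℂ (Words (Fin R)) where
  toFun h := diagWords fun w => Λ h + (w.map fun i => α i h).sum
  map_add' h h' := words_end_ext fun w => by
    have : ∀ w : List (Fin R), (w.map fun i => α i h + α i h').sum =
      (w.map fun i => α i h).sum + (w.map fun i => α i h').sum := fun w => List.sum_map_add
    simp only [map_add, LinearMap.add_apply, diagWords_single, ← Finsupp.single_add, this]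
    congr 1; ring
  map_smul' z h := words_end_ext fun w => by
    have : ∀ w : List (Fin R), (w.map fun i => z * α i h).sum =
      z * (w.map fun i => α i h).sum := fun w => List.sum_map_mul_left _ _ _
    simp only [map_smul, LinearMap.smul_apply, diagWords_single, smul_eq_mul, this,
      RingHom.id_apply, Finsupp.smul_single]
    congr 1; ring

variable (hB α) in
/-- The module over `𝔤` with basis the words in the `E_i`, generated by a vector of weight `Λ` that
is annihilated by the `F_i`. -/
def verma (hsymm : B.IsSymm) (Λ : Module.Dual ℂ 𝔥) :
    LieG B hB α →ₗ⁅ℂ⁆ Module.End ℂ (Words (Fin R)) :=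
  liftG consMap (contract (rootForm B hB α) fun i => Λ (coroot B hB α i)) (vermaH α Λ)
    (by
      intro i j
      rw [LieRing.of_associative_ring_bracket, lie_consMap_contract]
      split_ifs with h
      -- The lowering operator is written with `(α_j, α_x)` and the action of 𝔥 with `α_x(H_j)`; the
      -- symmetry of the form identifies them.
      · have hj : rootForm B hB α j = fun x => α x (coroot B hB α j) :=
          funext fun x => (rootForm_symm hsymm j x).trans (rootForm_eq x j)
        rw [hj]; rfl
      · rfl)
    (fun h i => (LieRing.of_associative_ring_bracket _ _).trans (lie_diagWords_consMap _ _ _))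
    (fun h i => (LieRing.of_associative_ring_bracket _ _).trans (lie_diagWords_contract _ _ _ _ _))
    (by
      intro h h'
      refine words_end_ext fun w => ?_
      simp only [vermaH, LinearMap.coe_mk, AddHom.coe_mk, LieRing.of_associative_ring_bracket,
        LinearMap.sub_apply, Module.End.mul_apply, diagWords_single, one_mul,
        LinearMap.zero_apply, mul_comm, sub_self])

variable (hsymm : B.IsSymm) (Λ : Module.Dual ℂ 𝔥)

@[simp] theorem verma_E (i : Fin R) : verma hB α hsymm Λ (gen B hB α (.E i)) = consMap i :=
  liftG_gen _ _ _ _ _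

@[simp] theorem verma_F (i : Fin R) : verma hB α hsymm Λ (gen B hB α (.F i)) =
    contract (rootForm B hB α) (fun i => Λ (coroot B hB α i)) i :=
  liftG_gen _ _ _ _ _

@[simp] theorem verma_H (h : 𝔥) : verma hB α hsymm Λ (toH B hB α h) =
    diagWords fun w => Λ h + (w.map fun i => α i h).sum :=
  liftG_gen _ _ _ _ _

@[simp] theorem verma_toNPlus (x : FreeLieAlgebra ℂ (Fin R)) :
    verma hB α hsymm Λ (toNPlus B hB α x) = leftMul (Fin R) x := by
  have : (verma hB α hsymm Λ).comp (toNPlus B hB α) = leftMul (Fin R) :=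
    FreeLieAlgebra.hom_ext (by simp)
  exact LieHom.congr_fun this x

theorem verma_toN_nil (x : FreeLieAlgebra ℂ (Fin R)) :
    verma hB α hsymm Λ (toN B hB α x) (Finsupp.single [] 1) = 0 := by
  induction x using freeLie_induction with
  | zero => simp
  | of i => simp [contractWord]
  | add a b ha hb => simp [ha, hb]
  | smul z a ha => simp [ha]
  | lie a b ha hb => simp [LieRing.of_associative_ring_bracket, ha, hb]

variable (hB α) in
/-- The projection of `𝔤` onto `𝔫₊`, with values in the free associative algebra. -/
def projPlus : LieG B hB α →ₗ[ℂ] Words (Fin R) :=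
  LinearMap.applyₗ (Finsupp.single [] 1) ∘ₗ (verma hB α hsymm 0).toLinearMap

theorem projPlus_apply (u : LieG B hB α) :
    projPlus hB α hsymm u = verma hB α hsymm 0 u (Finsupp.single [] 1) := rfl

@[simp] theorem projPlus_toN (x : FreeLieAlgebra ℂ (Fin R)) :
    projPlus hB α hsymm (toN B hB α x) = 0 := verma_toN_nil hsymm 0 x

@[simp] theorem projPlus_toNPlus (x : FreeLieAlgebra ℂ (Fin R)) :
    projPlus hB α hsymm (toNPlus B hB α x) = wordExp x := by
  rw [projPlus_apply, verma_toNPlus, wordExp_apply]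

@[simp] theorem projPlus_toH (h : 𝔥) : projPlus hB α hsymm (toH B hB α h) = 0 := by
  rw [projPlus_apply, verma_H]; simp

theorem projPlus_lie (u v : LieG B hB α) : projPlus hB α hsymm ⁅u, v⁆ =
    verma hB α hsymm 0 u (projPlus hB α hsymm v) - verma hB α hsymm 0 v (projPlus hB α hsymm u) := by
  simp [projPlus_apply, LieRing.of_associative_ring_bracket]

variable (hB α) in
/-- The component of an element of `𝔤` in `𝔫₊`, as an element of the free Lie algebra. -/
def compPlus : LieG B hB α →ₗ[ℂ] FreeLieAlgebra ℂ (Fin R) :=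
  wordExpInv (Fin R) ∘ₗ projPlus hB α hsymm

variable (hB α) in
/-- The component of an element of `𝔤` in `𝔫`, as an element of the free Lie algebra. -/
def compMinus : LieG B hB α →ₗ[ℂ] FreeLieAlgebra ℂ (Fin R) :=
  compPlus hB α hsymm ∘ₗ (chevalley B hB α).toLinearMap

theorem compMinus_apply (u : LieG B hB α) :
    compMinus hB α hsymm u = compPlus hB α hsymm (chevalley B hB α u) := rfl

@[simp] theorem compPlus_toN (x : FreeLieAlgebra ℂ (Fin R)) :
    compPlus hB α hsymm (toN B hB α x) = 0 := by simp [compPlus]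

@[simp] theorem compPlus_toNPlus (x : FreeLieAlgebra ℂ (Fin R)) :
    compPlus hB α hsymm (toNPlus B hB α x) = x := by simp [compPlus]

@[simp] theorem compPlus_toH (h : 𝔥) : compPlus hB α hsymm (toH B hB α h) = 0 := by
  simp [compPlus]

@[simp] theorem compMinus_toN (x : FreeLieAlgebra ℂ (Fin R)) :
    compMinus hB α hsymm (toN B hB α x) = x := by simp [compMinus_apply]

@[simp] theorem compMinus_toNPlus (x : FreeLieAlgebra ℂ (Fin R)) :
    compMinus hB α hsymm (toNPlus B hB α x) = 0 := by simp [compMinus_apply]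

@[simp] theorem compMinus_toH (h : 𝔥) : compMinus hB α hsymm (toH B hB α h) = 0 := by
  simp [compMinus_apply]

-- `wordExpInv` is only a left inverse. The identity holds because, by the triangular decomposition,
-- `projPlus` takes values in Lie elements.
@[simp] theorem wordExp_compPlus (u : LieG B hB α) :
    wordExp (compPlus hB α hsymm u) = projPlus hB α hsymm u := by
  obtain ⟨x, h, y, rfl⟩ := exists_triangular u
  simp

/-! #### Elements that normalize the generators -/

/-- Appending a letter to a word. -/
def snocMap {X : Type*} (x : X) : Module.End ℂ (Words X) :=
  Finsupp.lmapDomain ℂ ℂ fun w => w ++ [x]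

theorem snocMap_single {X : Type*} (x : X) (w : List X) (r : ℂ) :
    snocMap x (Finsupp.single w r) = Finsupp.single (w ++ [x]) r := by
  simp [snocMap, Finsupp.lmapDomain_apply, Finsupp.mapDomain_single]

/-- Left and right multiplication in the free associative algebra commute. -/
theorem leftMul_snocMap {X : Type*} (x : FreeLieAlgebra ℂ X) (j : X) (t : Words X) :
    leftMul X x (snocMap j t) = snocMap j (leftMul X x t) := by
  induction x using freeLie_induction generalizing t with
  | zero => simp
  | of x =>
    induction t using Finsupp.induction_linear with
    | zero => simp
    | add a b ha hb => simp only [map_add, ha, hb]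
    | single w r => simp [snocMap_single]
  | add a b ha hb => simp [ha, hb]
  | smul z a ha => simp [ha]
  | lie a b ha hb => simp [LieRing.of_associative_ring_bracket, ha, hb]

theorem wordExp_nil {X : Type*} (x : FreeLieAlgebra ℂ X) : wordExp x [] = 0 := by
  have : (Finsupp.lapply [] : Words X →ₗ[ℂ] ℂ) ∘ₗ wordExp = 0 := by
    refine freeLie_linear_ext fun c => ?_
    refine wordExp_commutator_apply_eq_zero fun h => content_ne_nil c ?_
    exact h.symm.eq_nil
  exact LinearMap.congr_fun this x

theorem snocMap_apply_append {X : Type*} (j : X) (t : Words X) (w : List X) :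
    snocMap j t (w ++ [j]) = t w :=
  Finsupp.mapDomain_apply (fun _ _ h => List.append_left_injective _ h) t w

theorem consMap_apply_ne {X : Type*} {i j : X} (hij : i ≠ j) (t : Words X) (w : List X) :
    consMap j t (i :: w) = 0 := by
  refine Finsupp.mapDomain_of_notMem_range _ _ ?_
  rintro ⟨v, hv⟩
  exact hij (List.cons.inj hv).1.symm

/-- The center of a free Lie algebra on more than one generator is trivial. -/
theorem eq_zero_of_central {X : Type*} {x : FreeLieAlgebra ℂ X} (hX : ∀ i : X, ∃ j : X, i ≠ j)
    (h : ∀ j, ⁅x, (FreeLieAlgebra.of ℂ j : FreeLieAlgebra ℂ X)⁆ = 0) : x = 0 := by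
  refine wordExp_injective ?_
  rw [map_zero]
  ext w
  cases w with
  | nil => exact wordExp_nil x
  | cons i w =>
    obtain ⟨j, hij⟩ := hX i
    have h1 := congrArg wordExp (h j)
    rw [wordExp_lie, map_zero, sub_eq_zero, wordExp_of, leftMul_of] at h1
    -- If `x` commutes with `j`, then `x j = j x` as combinations of words. The coefficient of `i w
    -- j` is that of `i w` in `x` on the left, and zero on the right because `i ≠ j`.
    have h2 := leftMul_snocMap x j (Finsupp.single [] 1)
    rw [snocMap_single, List.nil_append, h1, ← wordExp_apply] at h2
    have h3 := congrArg (fun t : Words X => t ((i :: w) ++ [j])) h2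
    simp only [snocMap_apply_append] at h3
    rw [Finsupp.zero_apply, ← h3, List.cons_append, consMap_apply_ne hij]

theorem exists_smul_of {X : Type*} {i : X} (hX : ∀ j : X, i = j) (x : FreeLieAlgebra ℂ X) :
    ∃ z : ℂ, x = z • FreeLieAlgebra.of ℂ i := by
  induction x using freeLie_induction with
  | zero => exact ⟨0, by simp⟩
  | of j => exact ⟨1, by rw [hX j, one_smul]⟩
  | add a b ha hb =>
    obtain ⟨s, rfl⟩ := ha; obtain ⟨t, rfl⟩ := hb; exact ⟨s + t, by rw [add_smul]⟩
  | smul z a ha => obtain ⟨s, rfl⟩ := ha; exact ⟨z * s, by rw [mul_smul]⟩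
  | lie a b ha hb =>
    obtain ⟨s, rfl⟩ := ha; obtain ⟨t, rfl⟩ := hb; exact ⟨0, by simp⟩

variable {hsymm} in
-- Let `x` be the component in 𝔫. The components in 𝔥 and 𝔫₊ do not spoil the hypothesis on the
-- `F_j`, so each bracket of `x` with a generator is a multiple of that generator. The multiple is
-- zero, and a central element of a free Lie algebra on at least two letters vanishes. With one
-- letter, `x` is a multiple of `F_i`; bracketing with `E_i` then produces the same multiple of
-- `H_i` up to sign, and `H_i` must be shown to be nonzero in 𝔤.
theorem compMinus_eq_zero_of_normalizes (hα : LinearIndependent ℂ α) {v : LieG B hB α}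
    (hE : ∀ j, ∃ s : ℂ, ⁅v, gen B hB α (.E j)⁆ = s • gen B hB α (.E j))
    (hF : ∀ j, ∃ s : ℂ, ⁅v, gen B hB α (.F j)⁆ = s • gen B hB α (.F j)) :
    compMinus hB α hsymm v = 0 := by
  obtain ⟨x, h, y, rfl⟩ := exists_triangular v
  simp only [map_add, compMinus_toN, compMinus_toH, compMinus_toNPlus, add_zero]
  have hlie : ∀ j, ∃ s : ℂ, ⁅x, (FreeLieAlgebra.of ℂ j : FreeLieAlgebra ℂ (Fin R))⁆ =
      s • FreeLieAlgebra.of ℂ j := by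
    intro j
    obtain ⟨s, hs⟩ := hF j
    obtain ⟨y', h', hy⟩ := exists_lie_F_toNPlus (B := B) (hB := hB) (α := α) j y
    have := congrArg (compMinus hB α hsymm) hs
    rw [add_lie, add_lie, lie_toH_F, ← lie_skew (toNPlus B hB α y) (gen B hB α (.F j)), hy,
      ← toN_of, ← LieHom.map_lie] at this
    simp only [map_add, map_neg, map_smul, compMinus_toN, compMinus_toNPlus, compMinus_toH,
      neg_zero, add_zero] at this
    refine ⟨s + α j h, ?_⟩
    rw [add_smul, ← this]; module
  by_cases hR : ∀ i : Fin R, ∃ j : Fin R, i ≠ j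
  · refine eq_zero_of_central hR fun j => ?_
    obtain ⟨s, hs⟩ := hlie j
    have h1 := congrArg (fun z => wordExp z [j]) hs
    simp only [wordExp_lie, map_smul, wordExp_of, leftMul_of, Finsupp.sub_apply,
      Finsupp.smul_apply, Finsupp.single_eq_same, smul_eq_mul, mul_one] at h1
    have h2 := leftMul_snocMap x j (Finsupp.single [] 1)
    rw [snocMap_single, List.nil_append, ← wordExp_apply] at h2
    -- The coefficient of the word `j` in both `x j` and `j x` is the constant term of `x`, which is
    -- zero for a Lie element. Hence the multiple in `hs` is zero.
    have h3 : leftMul (Fin R) x (Finsupp.single [j] 1) [j] = 0 := by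
      rw [h2]
      exact (snocMap_apply_append j (wordExp x) []).trans (wordExp_nil x)
    have h4 : consMap j (wordExp x) [j] = 0 := by
      have : consMap j (wordExp x) (j :: []) = wordExp x [] :=
        Finsupp.mapDomain_apply (fun _ _ h => (List.cons.inj h).2) _ _
      rw [this, wordExp_nil]
    rw [h3, h4, sub_zero] at h1
    rw [hs, ← h1, zero_smul]
  · push Not at hR
    obtain ⟨i, hi⟩ := hR
    obtain ⟨z, rfl⟩ := exists_smul_of hi x
    have hne : coroot B hB α i ≠ 0 := by
      intro h0
      apply hα.ne_zero i
      ext k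
      rw [← apply_coroot (hB := hB) (α := α), h0]; simp
    -- In the module with such an extremal weight, `H_i` acts on the empty word by a nonzero scalar,
    -- whereas `E_i` has no component along the empty word.
    obtain ⟨Λ, hΛ⟩ : ∃ Λ : Module.Dual ℂ 𝔥, Λ (coroot B hB α i) ≠ 0 := by
      by_contra hcon
      push Not at hcon
      exact hne ((Module.forall_dual_apply_eq_zero_iff ℂ _).mp hcon)
    obtain ⟨w, rfl⟩ := exists_smul_of hi y
    obtain ⟨s, hs⟩ := hE i
    rw [add_lie, add_lie, lie_toH_E, map_smul, map_smul, toN_of, toNPlus_of, smul_lie, smul_lie,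
      lie_self, smul_zero, add_zero, ← lie_skew, lie_gen_E_F, if_pos rfl] at hs
    have := congrArg (fun u => verma hB α hsymm Λ u (Finsupp.single [] 1) []) hs
    simp [hΛ] at this
    simp [this]

end Verma

/-! ### Relabelling of generators and fixed points -/

section Relabel

variable {X Y Z : Type*}

/-- The homomorphism of free Lie algebras that is induced by a map of the generators. -/
def relabel (f : X → Y) : FreeLieAlgebra ℂ X →ₗ⁅ℂ⁆ FreeLieAlgebra ℂ Y :=
  FreeLieAlgebra.lift ℂ fun x => FreeLieAlgebra.of ℂ (f x)

@[simp] theorem relabel_of (f : X → Y) (x : X) :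
    relabel f (FreeLieAlgebra.of ℂ x) = FreeLieAlgebra.of ℂ (f x) := by simp [relabel]

theorem relabel_commutator (f : X → Y) (c : FreeMagma X) :
    relabel f (commutator c) = commutator (FreeMagma.map f c) := by
  induction c with
  | ih1 x => exact relabel_of f x
  | ih2 c d hc hd => rw [commutator_mul, LieHom.map_lie, hc, hd, map_mul, commutator_mul]

theorem content_map (f : X → Y) (c : FreeMagma X) :
    content (FreeMagma.map f c) = (content c).map f := by
  induction c with
  | ih1 x => rfl
  | ih2 c d hc hd => rw [map_mul, content_mul, content_mul, hc, hd, List.map_append]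

theorem relabel_relabel (f : Y → Z) (g : X → Y) (x : FreeLieAlgebra ℂ X) :
    relabel f (relabel g x) = relabel (f ∘ g) x := by
  have : (relabel f).comp (relabel g) = relabel (f ∘ g) := FreeLieAlgebra.hom_ext (by simp)
  exact LieHom.congr_fun this x

theorem relabel_id (x : FreeLieAlgebra ℂ X) : relabel id x = x := by
  have : relabel id = (LieHom.id : FreeLieAlgebra ℂ X →ₗ⁅ℂ⁆ FreeLieAlgebra ℂ X) :=
    FreeLieAlgebra.hom_ext (by simp)
  exact LieHom.congr_fun this x

theorem relabel_pow_eq {e : Equiv.Perm X} {x : FreeLieAlgebra ℂ X} (h : relabel e x = x) (n : ℕ) :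
    relabel ⇑(e ^ n) x = x := by
  induction n with
  | zero => exact relabel_id x
  | succ n ih =>
    have : (⇑(e ^ (n + 1)) : X → X) = ⇑(e ^ n) ∘ e := by
      rw [pow_succ]; rfl
    rw [this, ← relabel_relabel, h, ih]

end Relabel

/-! ### Diagram automorphisms and their fixed points -/

section Fixed

variable {R : ℕ} {𝔥 : Type u} [AddCommGroup 𝔥] [Module ℂ 𝔥] [FiniteDimensional ℂ 𝔥]
variable {B : LinearMap.BilinForm ℂ 𝔥} {hB : B.Nondegenerate} {α : Fin R → Module.Dual ℂ 𝔥}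
variable {σ : LieG B hB α ≃ₗ⁅ℂ⁆ LieG B hB α} {perm : Equiv.Perm (Fin R)}

theorem map_toN (hF : ∀ i, σ (gen B hB α (.F i)) = gen B hB α (.F (perm i)))
    (x : FreeLieAlgebra ℂ (Fin R)) : σ (toN B hB α x) = toN B hB α (relabel perm x) := by
  have : σ.toLieHom.comp (toN B hB α) = (toN B hB α).comp (relabel perm) :=
    FreeLieAlgebra.hom_ext (by simp [hF])
  exact LieHom.congr_fun this x

theorem map_toNPlus (hE : ∀ i, σ (gen B hB α (.E i)) = gen B hB α (.E (perm i)))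
    (x : FreeLieAlgebra ℂ (Fin R)) : σ (toNPlus B hB α x) = toNPlus B hB α (relabel perm x) := by
  have : σ.toLieHom.comp (toNPlus B hB α) = (toNPlus B hB α).comp (relabel perm) :=
    FreeLieAlgebra.hom_ext (by simp [hE])
  exact LieHom.congr_fun this x

variable (hsymm : B.IsSymm) (hα : LinearIndependent ℂ α)

include hα in
/-- A diagram automorphism preserves the Cartan subalgebra. -/
theorem exists_map_toH (hE : ∀ i, σ (gen B hB α (.E i)) = gen B hB α (.E (perm i)))
    (hF : ∀ i, σ (gen B hB α (.F i)) = gen B hB α (.F (perm i))) (hsymm : B.IsSymm) (h : 𝔥) :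
    ∃ h', σ (toH B hB α h) = toH B hB α h' := by
  have hE' : ∀ j, ∃ s : ℂ, ⁅σ (toH B hB α h), gen B hB α (.E j)⁆ = s • gen B hB α (.E j) := by
    intro j
    refine ⟨α (perm.symm j) h, ?_⟩
    have := hE (perm.symm j)
    rw [Equiv.apply_symm_apply] at this
    rw [← this, ← LieEquiv.map_lie, lie_toH_E, map_smul]
  have hF' : ∀ j, ∃ s : ℂ, ⁅σ (toH B hB α h), gen B hB α (.F j)⁆ = s • gen B hB α (.F j) := by
    intro j
    refine ⟨-α (perm.symm j) h, ?_⟩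
    have := hF (perm.symm j)
    rw [Equiv.apply_symm_apply] at this
    rw [← this, ← LieEquiv.map_lie, lie_toH_F, map_smul]
  have h1 := compMinus_eq_zero_of_normalizes (hsymm := hsymm) hα hE' hF'
  -- The hypotheses are symmetric under the exchange of the `E_j` with the `F_j`, so the component
  -- in 𝔫₊ vanishes as well.
  have h2 : compMinus hB α hsymm (chevalley B hB α (σ (toH B hB α h))) = 0 := by
    refine compMinus_eq_zero_of_normalizes hα (fun j => ?_) (fun j => ?_)
    · obtain ⟨s, hs⟩ := hF' j
      exact ⟨s, by simpa using congrArg (chevalley B hB α) hs⟩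
    · obtain ⟨s, hs⟩ := hE' j
      exact ⟨s, by simpa using congrArg (chevalley B hB α) hs⟩
  obtain ⟨x, h', y, hu⟩ := exists_triangular (σ (toH B hB α h))
  rw [hu] at h1 h2
  simp at h1 h2
  exact ⟨h', by rw [hu, h1, h2]; simp⟩

include hsymm hα in
/-- The triangular decomposition of the fixed points of a diagram automorphism. -/
theorem exists_triangular_fixed
    (hE : ∀ i, σ (gen B hB α (.E i)) = gen B hB α (.E (perm i)))
    (hF : ∀ i, σ (gen B hB α (.F i)) = gen B hB α (.F (perm i)))
    {u : LieG B hB α} (hu : u ∈ fixedPoints σ) :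
    ∃ x h y, u = toN B hB α x + toH B hB α h + toNPlus B hB α y ∧ relabel perm x = x ∧
      σ (toH B hB α h) = toH B hB α h ∧ relabel perm y = y := by
  obtain ⟨x, h, y, rfl⟩ := exists_triangular u
  obtain ⟨h', hh⟩ := exists_map_toH (perm := perm) hα hE hF hsymm h
  have hu' : σ (toN B hB α x + toH B hB α h + toNPlus B hB α y) =
    toN B hB α x + toH B hB α h + toNPlus B hB α y := hu
  rw [map_add, map_add, map_toN hF, map_toNPlus hE, hh] at hu'
  have h1 := congrArg (compMinus hB α hsymm) hu'
  have h2 := congrArg (compPlus hB α hsymm) hu'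
  simp at h1 h2
  rw [h1, h2] at hu'
  exact ⟨x, h, y, rfl, h1, by rw [hh]; exact add_left_cancel (add_right_cancel hu'), h2⟩

theorem toN_mem (hF : ∀ i, σ (gen B hB α (.F i)) = gen B hB α (.F (perm i)))
    {x : FreeLieAlgebra ℂ (Fin R)} (hx : relabel perm x = x) : toN B hB α x ∈ fixedPoints σ :=
  (map_toN hF x).trans (by rw [hx])

theorem toNPlus_mem (hE : ∀ i, σ (gen B hB α (.E i)) = gen B hB α (.E (perm i)))
    {x : FreeLieAlgebra ℂ (Fin R)} (hx : relabel perm x = x) :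
    toNPlus B hB α x ∈ fixedPoints σ :=
  (map_toNPlus hE x).trans (by rw [hx])

theorem gen_E_ne_zero (hsymm : B.IsSymm) (i : Fin R) : gen B hB α (.E i) ≠ 0 := by
  intro h
  have := congrArg (projPlus hB α hsymm) h
  rw [← toNPlus_of, projPlus_toNPlus, wordExp_of, map_zero] at this
  simp at this

/-- The form on the simple roots is invariant under a diagram automorphism. -/
theorem rootForm_perm (hsymm : B.IsSymm)
    (hE : ∀ i, σ (gen B hB α (.E i)) = gen B hB α (.E (perm i)))
    (hH : ∀ i, σ (gen B hB α (.H (coroot B hB α i))) = gen B hB α (.H (coroot B hB α (perm i))))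
    (i j : Fin R) : rootForm B hB α (perm i) (perm j) = rootForm B hB α i j := by
  have h := lie_toH_E (B := B) (hB := hB) (α := α) (coroot B hB α j) i
  have h1 := congrArg σ h
  rw [LieEquiv.map_lie, map_smul, hE, toH_apply, hH, ← toH_apply, lie_toH_E] at h1
  rw [rootForm_eq, rootForm_eq]
  exact smul_left_injective ℂ (gen_E_ne_zero hsymm _) h1

/-- Apply `σ` to the relation `[h, E_i] = α_i(h) E_i` and compare eigenvalues. This makes `α_i(h)` a
function of the cycle of `i`, hence a grading that the form respects. -/
theorem root_perm_of_fixed (hsymm : B.IsSymm)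
    (hE : ∀ i, σ (gen B hB α (.E i)) = gen B hB α (.E (perm i))) {h : 𝔥}
    (hh : σ (toH B hB α h) = toH B hB α h) (i : Fin R) : α (perm i) h = α i h := by
  have h1 := congrArg σ (lie_toH_E (B := B) (hB := hB) (α := α) h i)
  rw [LieEquiv.map_lie, map_smul, hE, hh, lie_toH_E] at h1
  exact smul_left_injective ℂ (gen_E_ne_zero hsymm _) h1

end Fixed

/-! ### Log-canonical Poisson algebras -/

section LogPoisson

variable {M M' A : Type*} [AddCommMonoid M] [AddCommMonoid M'] [CommRing A]

/-- The antisymmetrization of a biadditive map. -/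
def poisCoeff (c : M →+ M →+ A) (α β : M) : A := c α β - c β α

theorem poisCoeff_add_left (c : M →+ M →+ A) (α β γ : M) :
    poisCoeff c (α + β) γ = poisCoeff c α γ + poisCoeff c β γ := by
  simp [poisCoeff]; ring

theorem poisCoeff_add_right (c : M →+ M →+ A) (α β γ : M) :
    poisCoeff c α (β + γ) = poisCoeff c α β + poisCoeff c α γ := by
  simp [poisCoeff]; ring

theorem poisCoeff_skew (c : M →+ M →+ A) (α β : M) : poisCoeff c α β = -poisCoeff c β α := by
  simp [poisCoeff]

/-- The Lie algebra with basis `z^α`, for `α ∈ M`, and bracket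
`{z^α, z^β} = (c α β - c β α) z^(α + β)`. -/
def LogPoisson (_ : M →+ M →+ A) : Type _ := M →₀ A

namespace LogPoisson

variable {c : M →+ M →+ A}

instance : AddCommGroup (LogPoisson c) := inferInstanceAs (AddCommGroup (M →₀ A))
instance : Module A (LogPoisson c) := inferInstanceAs (Module A (M →₀ A))
instance [Algebra ℂ A] : Module ℂ (LogPoisson c) := inferInstanceAs (Module ℂ (M →₀ A))

/-- The multiple `r z^α` of a basis element. -/
def mono (c : M →+ M →+ A) (α : M) (r : A) : LogPoisson c := Finsupp.single α r

/-- The coefficient of `z^α`. -/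
def coeff (α : M) : LogPoisson c →+ A := Finsupp.applyAddHom α

theorem coeff_mono [DecidableEq M] (α β : M) (r : A) :
    coeff α (mono c β r) = if β = α then r else 0 := Finsupp.single_apply

theorem coeff_smul [Algebra ℂ A] (α : M) (z : ℂ) (f : LogPoisson c) :
    coeff α (z • f) = z • coeff α f := rfl

theorem mono_add (α : M) (r s : A) : mono c α (r + s) = mono c α r + mono c α s :=
  Finsupp.single_add _ _ _

theorem mono_zero (α : M) : mono c α 0 = 0 := Finsupp.single_zero _

theorem mono_neg (α : M) (r : A) : mono c α (-r) = -mono c α r := Finsupp.single_neg _ _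

theorem induction {p : LogPoisson c → Prop} (zero : p 0)
    (add : ∀ f g, p f → p g → p (f + g)) (mono : ∀ α r, p (mono c α r)) (f : LogPoisson c) : p f :=
  Finsupp.induction_linear f zero add mono

/-- The bracket with a basis element. -/
def bracketMono (c : M →+ M →+ A) (α : M) : LogPoisson c →ₗ[A] LogPoisson c :=
  (Finsupp.linearCombination A fun β => mono c (α + β) (poisCoeff c α β) :
    (M →₀ A) →ₗ[A] LogPoisson c)

/-- The bracket as a bilinear map. -/
def bracket (c : M →+ M →+ A) : LogPoisson c →ₗ[A] LogPoisson c →ₗ[A] LogPoisson c :=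
  (Finsupp.linearCombination A (bracketMono c) :
    (M →₀ A) →ₗ[A] LogPoisson c →ₗ[A] LogPoisson c)

theorem bracketMono_mono (α β : M) (s : A) :
    bracketMono c α (mono c β s) = s • mono c (α + β) (poisCoeff c α β) :=
  Finsupp.linearCombination_single _ _ _

theorem smul_mono (α : M) (z : A) (r : A) : z • mono c α r = mono c α (z * r) :=
  Finsupp.smul_single _ _ _

theorem bracket_mono (α β : M) (r s : A) :
    bracket c (mono c α r) (mono c β s) = mono c (α + β) (r * s * poisCoeff c α β) := by
  have h1 : bracket c (mono c α r) = r • bracketMono c α := Finsupp.linearCombination_single _ _ _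
  rw [h1, LinearMap.smul_apply, bracketMono_mono, smul_mono, smul_mono, mul_assoc]

theorem bracket_skew (f g : LogPoisson c) : bracket c f g = -bracket c g f := by
  induction f using LogPoisson.induction with
  | zero => simp
  | add f f' hf hf' => rw [map_add, map_add, LinearMap.add_apply, hf, hf', neg_add]
  | mono α r =>
    induction g using LogPoisson.induction with
    | zero => simp
    | add g g' hg hg' => rw [map_add, map_add, LinearMap.add_apply, hg, hg', neg_add]
    | mono β s =>
      rw [bracket_mono, bracket_mono, ← mono_neg, poisCoeff_skew c α β, add_comm β α]
      congr 1; ring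

/-- On monomials all terms are multiples of `z^(α + β + γ)`. With `p` the antisymmetrized
coefficient, biadditivity turns both sides into `p(β,γ) (p(α,β) + p(α,γ))`; on the right the terms
`p(α,β) p(α,γ)` and `p(α,γ) p(β,α)` cancel. -/
theorem bracket_jacobi (f g h : LogPoisson c) :
    bracket c f (bracket c g h) = bracket c (bracket c f g) h + bracket c g (bracket c f h) := by
  induction f using LogPoisson.induction with
  | zero => simp
  | add f f' hf hf' => simp only [map_add, LinearMap.add_apply, hf, hf']; abel
  | mono α r =>
    induction g using LogPoisson.induction with
    | zero => simp
    | add g g' hg hg' => simp only [map_add, LinearMap.add_apply, hg, hg']; abel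
    | mono β s =>
      induction h using LogPoisson.induction with
      | zero => simp
      | add h h' hh hh' => simp only [map_add, hh, hh']; abel
      | mono γ t =>
        simp only [bracket_mono, poisCoeff_add_left, poisCoeff_add_right]
        rw [← add_assoc, show β + (α + γ) = α + β + γ by abel, ← mono_add]
        congr 1
        rw [poisCoeff_skew c β α]
        ring

variable [Algebra ℂ A]

instance : IsScalarTower ℂ A (LogPoisson c) := inferInstanceAs (IsScalarTower ℂ A (M →₀ A))

instance : LieRing (LogPoisson c) where
  bracket f g := bracket c f g
  add_lie f g h := by change bracket c _ _ = _; rw [map_add]; rfl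
  lie_add f g h := by change bracket c _ _ = _; rw [map_add]
  lie_self f := by
    change bracket c f f = 0
    have h := bracket_skew f f
    have h2 : (2 : ℂ) • bracket c f f = 0 := by
      rw [two_smul]; nth_rewrite 1 [h]; exact neg_add_cancel _
    exact (smul_eq_zero.mp h2).resolve_left two_ne_zero
  leibniz_lie f g h := bracket_jacobi f g h

theorem lie_mono (α β : M) (r s : A) :
    ⁅mono c α r, mono c β s⁆ = mono c (α + β) (r * s * poisCoeff c α β) := bracket_mono α β r s

instance : LieAlgebra ℂ (LogPoisson c) where
  lie_smul z f g := by
    change bracket c f (z • g) = z • bracket c f g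
    rw [← algebraMap_smul A z g, ← algebraMap_smul A z (bracket c f g), map_smul]

/-- By cancellation, `ν` is the only exponent that is carried to `μ + ν`. -/
theorem coeff_lie_mono [IsCancelAdd M] (μ ν : M) (r : A) (f : LogPoisson c) :
    coeff (μ + ν) ⁅mono c μ r, f⁆ = r * poisCoeff c μ ν * coeff ν f := by
  classical
  induction f using LogPoisson.induction with
  | zero => simp
  | add f g hf hg => rw [lie_add, map_add, hf, hg, map_add, mul_add]
  | mono α s =>
    rw [lie_mono, coeff_mono, coeff_mono]
    by_cases h : α = ν
    · subst h; rw [if_pos rfl, if_pos rfl]; ring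
    · rw [if_neg h, if_neg (by simpa using h), mul_zero]

end LogPoisson
end LogPoisson

/-! ### Monomial maps and gradings of log-canonical Poisson algebras -/

section PoissonMaps

open LogPoisson

variable {M M' M'' A A' : Type*} [AddCommMonoid M] [AddCommMonoid M'] [AddCommMonoid M'']
  [CommRing A] [CommRing A'] [Algebra ℂ A] [Algebra ℂ A']

theorem LogPoisson.smul_lie' {c : M →+ M →+ A} (r : A) (f g : LogPoisson c) :
    ⁅r • f, g⁆ = r • ⁅f, g⁆ := by
  change bracket c _ _ = _; rw [map_smul]; rfl

theorem LogPoisson.lie_smul' {c : M →+ M →+ A} (r : A) (f g : LogPoisson c) :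
    ⁅f, r • g⁆ = r • ⁅f, g⁆ := by
  change bracket c _ _ = _; rw [map_smul]; rfl

/-- The linear map with `r z^α ↦ (ρ α r) z^(φ α)`. -/
def mapMono (c : M →+ M →+ A) (c' : M' →+ M' →+ A') (φ : M → M') (ρ : M → A →ₗ[ℂ] A') :
    LogPoisson c →ₗ[ℂ] LogPoisson c' :=
  (Finsupp.lsum ℂ fun α => Finsupp.lsingle (φ α) ∘ₗ ρ α : (M →₀ A) →ₗ[ℂ] (M' →₀ A'))

@[simp] theorem mapMono_mono (c : M →+ M →+ A) (c' : M' →+ M' →+ A') (φ : M → M')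
    (ρ : M → A →ₗ[ℂ] A') (α : M) (r : A) :
    mapMono c c' φ ρ (mono c α r) = mono c' (φ α) (ρ α r) := by
  change (Finsupp.lsum ℂ fun α => Finsupp.lsingle (φ α) ∘ₗ ρ α : (M →₀ A) →ₗ[ℂ] (M' →₀ A'))
    (Finsupp.single α r) = _
  rw [Finsupp.lsum_single]; rfl

/-- Bilinear identities can be checked on monomials. -/
theorem LogPoisson.induction₂ {c : M →+ M →+ A} {c' : M' →+ M' →+ A'}
    {p : LogPoisson c → LogPoisson c' → Prop}
    (zl : ∀ g, p 0 g) (zr : ∀ f, p f 0) (addl : ∀ f f' g, p f g → p f' g → p (f + f') g)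
    (addr : ∀ f g g', p f g → p f g' → p f (g + g'))
    (hm : ∀ α r β s, p (mono c α r) (mono c' β s)) (f : LogPoisson c) (g : LogPoisson c') :
    p f g := by
  induction f using LogPoisson.induction with
  | zero => exact zl g
  | add x y hx hy => exact addl _ _ _ hx hy
  | mono α r =>
    induction g using LogPoisson.induction with
    | zero => exact zr _
    | add x y hx hy => exact addr _ _ _ hx hy
    | mono β s => exact hm _ _ _ _

/-- The elements that are homogeneous of degree `n` for the grading `D`. -/
def homog (c : M →+ M →+ A) (D : M →+ M') (n : M') : Submodule ℂ (LogPoisson c) :=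
  Submodule.span ℂ {x | ∃ α r, D α = n ∧ x = mono c α r}

theorem mono_mem_homog {c : M →+ M →+ A} {D : M →+ M'} {n : M'} {α : M} (h : D α = n) (r : A) :
    mono c α r ∈ homog c D n := Submodule.subset_span ⟨α, r, h, rfl⟩

theorem coeff_eq_zero_of_mem_homog {c : M →+ M →+ A} {D : M →+ M'} {n : M'} {f : LogPoisson c}
    (hf : f ∈ homog c D n) {α : M} (hα : D α ≠ n) : coeff α f = 0 := by
  classical
  induction hf using Submodule.span_induction with
  | mem x hx =>
    obtain ⟨β, r, hβ, rfl⟩ := hx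
    rw [coeff_mono, if_neg]
    rintro rfl
    exact hα hβ
  | zero => simp
  | add x y _ _ hx hy => rw [map_add, hx, hy, add_zero]
  | smul z x _ hx => rw [coeff_smul, hx, smul_zero]

theorem lie_mem_homog {c : M →+ M →+ A} {D : M →+ M'} {m n : M'} {f g : LogPoisson c}
    (hf : f ∈ homog c D m) (hg : g ∈ homog c D n) : ⁅f, g⁆ ∈ homog c D (m + n) := by
  refine Submodule.span_induction₂ (p := fun x y _ _ => ⁅x, y⁆ ∈ homog c D (m + n))
    ?_ ?_ ?_ ?_ ?_ ?_ ?_ hf hg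
  · rintro _ _ ⟨α, r, hα, rfl⟩ ⟨β, s, hβ, rfl⟩
    rw [lie_mono]
    exact mono_mem_homog (by rw [map_add, hα, hβ]) _
  · intro y _; simp
  · intro x _; simp
  · intro x y z _ _ _ h₁ h₂; rw [add_lie]; exact add_mem h₁ h₂
  · intro x y z _ _ _ h₁ h₂; rw [lie_add]; exact add_mem h₁ h₂
  · intro r x y _ _ h; rw [smul_lie]; exact Submodule.smul_mem _ r h
  · intro r x y _ _ h; rw [lie_smul]; exact Submodule.smul_mem _ r h

theorem mapMono_mem_homog {c : M →+ M →+ A} {c' : M' →+ M' →+ A'} {φ : M → M'}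
    {ρ : M → A →ₗ[ℂ] A'} {D : M →+ M''} {D' : M' →+ M''} (h : ∀ α, D' (φ α) = D α) {n : M''}
    {f : LogPoisson c} (hf : f ∈ homog c D n) : mapMono c c' φ ρ f ∈ homog c' D' n := by
  induction hf using Submodule.span_induction with
  | mem x hx =>
    obtain ⟨β, r, hβ, rfl⟩ := hx
    rw [mapMono_mono]
    exact mono_mem_homog (by rw [h, hβ]) _
  | zero => simp
  | add x y _ _ hx hy => rw [map_add]; exact add_mem hx hy
  | smul z x _ hx => rw [map_smul]; exact Submodule.smul_mem _ _ hx

theorem lift_commutator_mem_homog {X : Type*} {c : M →+ M →+ A} {D : M →+ M'}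
    {g : X → LogPoisson c} {d : X → M'} (h : ∀ x, g x ∈ homog c D (d x)) (e : FreeMagma X) :
    FreeLieAlgebra.lift ℂ g (commutator e) ∈ homog c D (contentSum d e) := by
  induction e with
  | ih1 x => rw [commutator, FreeLieAlgebra.lift_of_apply, contentSum_of]; exact h x
  | ih2 a b ha hb =>
    rw [commutator_mul, LieHom.map_lie, contentSum_mul]
    exact lie_mem_homog ha hb

end PoissonMaps

/-! ### A derivation from two infinitesimally coupled copies of a Poisson algebra -/

section CrossDerivation

open LogPoisson

variable {M : Type*} [AddCommMonoid M]

/-- The deformation over the dual numbers of the sum of two copies of a log-canonical bracket, in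
which the mixed brackets are given by `A`. -/
def doubled (c A : M →+ M →+ ℂ) : M × M →+ M × M →+ DualNumber ℂ where
  toFun p :=
    { toFun := fun q => TrivSqZeroExt.inl (c p.1 q.1 + c p.2 q.2) + TrivSqZeroExt.inr (A p.1 q.2)
      map_zero' := by simp
      map_add' := by
        intro q q'
        ext <;> simp
        ring }
  map_zero' := by ext q <;> simp
  map_add' p p' := by
    ext q <;> simp
    ring

variable (c A : M →+ M →+ ℂ) (q : M → ℂ)

theorem doubled_apply (p p' : M × M) : doubled c A p p' =
    TrivSqZeroExt.inl (c p.1 p'.1 + c p.2 p'.2) + TrivSqZeroExt.inr (A p.1 p'.2) := rfl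

/-- The inclusion of the first copy. -/
def inclLeft : LogPoisson c →ₗ[ℂ] LogPoisson (doubled c A) :=
  mapMono _ _ (fun α => (α, 0)) fun _ => (TrivSqZeroExt.inlAlgHom ℂ ℂ ℂ).toLinearMap

/-- The inclusion of the second copy. -/
def inclRight : LogPoisson c →ₗ[ℂ] LogPoisson (doubled c A) :=
  mapMono _ _ (fun α => (0, α)) fun _ => (TrivSqZeroExt.inlAlgHom ℂ ℂ ℂ).toLinearMap

/-- The contraction of the infinitesimal part along the Poisson bracket. -/
def contractEps : LogPoisson (doubled c A) →ₗ[ℂ] LogPoisson c :=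
  mapMono _ _ (fun p => p.1 + p.2) fun p =>
    (poisCoeff c p.1 p.2) • TrivSqZeroExt.sndHom ℂ ℂ

/-- The diagonal operator with eigenvalues `q`. -/
def diagOp : LogPoisson c →ₗ[ℂ] LogPoisson c :=
  mapMono _ _ id fun α => q α • LinearMap.id

theorem inclLeft_mono (α : M) (r : ℂ) :
    inclLeft c A (mono c α r) = mono _ (α, 0) (TrivSqZeroExt.inl r) := mapMono_mono _ _ _ _ _ _

theorem inclRight_mono (α : M) (r : ℂ) :
    inclRight c A (mono c α r) = mono _ (0, α) (TrivSqZeroExt.inl r) := mapMono_mono _ _ _ _ _ _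

theorem contractEps_mono (p : M × M) (r : DualNumber ℂ) :
    contractEps c A (mono _ p r) = mono c (p.1 + p.2) (poisCoeff c p.1 p.2 * r.snd) :=
  mapMono_mono _ _ _ _ _ _

theorem diagOp_mono (α : M) (r : ℂ) : diagOp c q (mono c α r) = mono c α (q α * r) :=
  mapMono_mono _ _ _ _ _ _

theorem lie_inclLeft (f g : LogPoisson c) :
    ⁅inclLeft c A f, inclLeft c A g⁆ = inclLeft c A ⁅f, g⁆ := by
  induction f, g using LogPoisson.induction₂ with
  | zl g => simp
  | zr f => simp
  | addl f f' g h h' => simp [h, h']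
  | addr f g g' h h' => simp [h, h']
  | hm α r β s =>
    simp only [inclLeft_mono, lie_mono]
    congr 1
    · simp
    · ext <;> simp [poisCoeff, doubled_apply]

theorem lie_inclRight (f g : LogPoisson c) :
    ⁅inclRight c A f, inclRight c A g⁆ = inclRight c A ⁅f, g⁆ := by
  induction f, g using LogPoisson.induction₂ with
  | zl g => simp
  | zr f => simp
  | addl f f' g h h' => simp [h, h']
  | addr f g g' h h' => simp [h, h']
  | hm α r β s =>
    simp only [inclRight_mono, lie_mono]
    congr 1
    · simp
    · ext <;> simp [poisCoeff, doubled_apply]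

theorem exists_lie_inclLeft_inclRight (f g : LogPoisson c) :
    ∃ b, ⁅inclLeft c A f, inclRight c A g⁆ = (DualNumber.eps : DualNumber ℂ) • b := by
  induction f, g using LogPoisson.induction₂ with
  | zl g => exact ⟨0, by simp⟩
  | zr f => exact ⟨0, by simp⟩
  | addl f f' g h h' =>
    obtain ⟨b, hb⟩ := h; obtain ⟨b', hb'⟩ := h'
    exact ⟨b + b', by rw [map_add, add_lie, hb, hb', smul_add]⟩
  | addr f g g' h h' =>
    obtain ⟨b, hb⟩ := h; obtain ⟨b', hb'⟩ := h'
    exact ⟨b + b', by rw [map_add, lie_add, hb, hb', smul_add]⟩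
  | hm α r β s =>
    refine ⟨mono _ (α, β) (TrivSqZeroExt.inl (r * s * A α β)), ?_⟩
    rw [inclLeft_mono, inclRight_mono, lie_mono, smul_mono]
    congr 1
    · simp
    · ext <;> simp [poisCoeff, doubled_apply]; ring

theorem contractEps_inclLeft (f : LogPoisson c) : contractEps c A (inclLeft c A f) = 0 := by
  induction f using LogPoisson.induction with
  | zero => simp
  | add f g hf hg => simp [hf, hg]
  | mono α r => rw [inclLeft_mono, contractEps_mono]; simp [mono_zero]

theorem contractEps_inclRight (f : LogPoisson c) : contractEps c A (inclRight c A f) = 0 := by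
  induction f using LogPoisson.induction with
  | zero => simp
  | add f g hf hg => simp [hf, hg]
  | mono α r => rw [inclRight_mono, contractEps_mono]; simp [mono_zero]

/-- On the ε-part only the uncoupled brackets act, and contraction is the map `z^α ⊗ z^β ↦ {z^α,
z^β}`. That it intertwines the diagonal action with the adjoint action is the Jacobi identity. -/
theorem contractEps_lie_eps (f : LogPoisson c) (b : LogPoisson (doubled c A)) :
    contractEps c A ⁅inclLeft c A f + inclRight c A f, (DualNumber.eps : DualNumber ℂ) • b⁆ =
      ⁅f, contractEps c A ((DualNumber.eps : DualNumber ℂ) • b)⁆ := by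
  induction f, b using LogPoisson.induction₂ with
  | zl g => simp
  | zr f => simp
  | addl f f' g h h' =>
    rw [add_lie f f', ← h, ← h', ← map_add, ← add_lie, map_add, map_add]
    congr 2; abel
  | addr f g g' h h' => simp only [smul_add, lie_add, map_add, h, h']
  | hm α r p s =>
    rw [inclLeft_mono, inclRight_mono, smul_mono, add_lie, lie_mono, lie_mono, map_add]
    simp only [contractEps_mono, lie_mono, Prod.fst_add, Prod.snd_add, zero_add]
    rw [show p.1 + (α + p.2) = α + (p.1 + p.2) from add_left_comm _ _ _, add_assoc α, ← mono_add]
    congr 1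
    simp only [poisCoeff, doubled_apply, map_add, AddMonoidHom.add_apply, map_zero,
      AddMonoidHom.zero_apply, TrivSqZeroExt.snd_mul, TrivSqZeroExt.fst_mul, TrivSqZeroExt.snd_add,
      TrivSqZeroExt.fst_add, TrivSqZeroExt.snd_sub, TrivSqZeroExt.fst_sub, TrivSqZeroExt.fst_inl,
      TrivSqZeroExt.snd_inl, TrivSqZeroExt.fst_inr, TrivSqZeroExt.snd_inr, DualNumber.fst_eps,
      DualNumber.snd_eps, smul_eq_mul, MulOpposite.smul_eq_mul_unop, MulOpposite.unop_op]
    ring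

/-- For `z^α` and `z^β` the two mixed brackets contract to `A α β` and `A β α` times `{z^α, z^β}`.
This is the defect of additivity of `q`, so `diagOp` is the correction that restores the Leibniz
rule. -/
theorem contractEps_lie_mixed (hq : ∀ α β, q (α + β) = q α + q β - A α β - A β α)
    (f g : LogPoisson c) :
    contractEps c A ⁅inclLeft c A f, inclRight c A g⁆ +
      contractEps c A ⁅inclRight c A f, inclLeft c A g⁆ + diagOp c q ⁅f, g⁆ =
      ⁅diagOp c q f, g⁆ + ⁅f, diagOp c q g⁆ := by
  induction f, g using LogPoisson.induction₂ with
  | zl g => simp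
  | zr f => simp
  | addl f f' g h h' =>
    simp only [map_add, add_lie] at h h' ⊢
    refine Eq.trans ?_ ((congrArg₂ (· + ·) h h').trans ?_) <;> beta_reduce <;> abel
  | addr f g g' h h' =>
    simp only [map_add, lie_add] at h h' ⊢
    refine Eq.trans ?_ ((congrArg₂ (· + ·) h h').trans ?_) <;> beta_reduce <;> abel
  | hm α r β s =>
    simp only [inclLeft_mono, inclRight_mono, lie_mono, contractEps_mono, diagOp_mono,
      Prod.fst_add, Prod.snd_add, zero_add, add_zero]
    rw [add_comm β α, ← mono_add, ← mono_add, ← mono_add]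
    congr 1
    simp only [poisCoeff, doubled_apply, map_add, AddMonoidHom.add_apply, map_zero,
      AddMonoidHom.zero_apply, TrivSqZeroExt.snd_mul, TrivSqZeroExt.fst_mul, TrivSqZeroExt.snd_add,
      TrivSqZeroExt.fst_add, TrivSqZeroExt.snd_sub, TrivSqZeroExt.fst_sub, TrivSqZeroExt.fst_inl,
      TrivSqZeroExt.snd_inl, TrivSqZeroExt.fst_inr, TrivSqZeroExt.snd_inr, DualNumber.fst_eps,
      DualNumber.snd_eps, smul_eq_mul, MulOpposite.smul_eq_mul_unop, MulOpposite.unop_op, hq]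
    ring

variable {X : Type*} (g g' : X → LogPoisson c)

/-- The homomorphism to the doubled Poisson algebra. -/
def doubledHom : FreeLieAlgebra ℂ X →ₗ⁅ℂ⁆ LogPoisson (doubled c A) :=
  FreeLieAlgebra.lift ℂ fun x => inclLeft c A (g x) + inclRight c A (g' x)

/-- A derivation along `FreeLieAlgebra.lift ℂ g` on the elements on which `g` and `g'` agree. -/
def crossDer : FreeLieAlgebra ℂ X →ₗ[ℂ] LogPoisson c :=
  contractEps c A ∘ₗ (doubledHom c A g g').toLinearMap +
    diagOp c q ∘ₗ (FreeLieAlgebra.lift ℂ g : FreeLieAlgebra ℂ X →ₗ⁅ℂ⁆ LogPoisson c).toLinearMap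

/-- The two copies commute modulo ε, so modulo ε the homomorphism is the sum of the two separate
ones. -/
theorem exists_doubledHom (x : FreeLieAlgebra ℂ X) :
    ∃ b, doubledHom c A g g' x = inclLeft c A (FreeLieAlgebra.lift ℂ g x) +
      inclRight c A (FreeLieAlgebra.lift ℂ g' x) + (DualNumber.eps : DualNumber ℂ) • b := by
  induction x using freeLie_induction with
  | zero => exact ⟨0, by simp⟩
  | of x => exact ⟨0, by simp [doubledHom]⟩
  | add x y hx hy =>
    obtain ⟨b, hb⟩ := hx; obtain ⟨b', hb'⟩ := hy
    refine ⟨b + b', ?_⟩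
    simp only [map_add, hb, hb', smul_add]; abel
  | smul z x hx =>
    obtain ⟨b, hb⟩ := hx
    refine ⟨z • b, ?_⟩
    simp only [map_smul, hb, smul_add]
    rw [smul_comm]
  | lie x y hx hy =>
    obtain ⟨b, hb⟩ := hx; obtain ⟨b', hb'⟩ := hy
    obtain ⟨d, hd⟩ := exists_lie_inclLeft_inclRight c A (FreeLieAlgebra.lift ℂ g x)
      (FreeLieAlgebra.lift ℂ g' y)
    obtain ⟨d', hd'⟩ := exists_lie_inclLeft_inclRight c A (FreeLieAlgebra.lift ℂ g y)
      (FreeLieAlgebra.lift ℂ g' x)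
    refine ⟨d - d' + ⁅inclLeft c A (FreeLieAlgebra.lift ℂ g x) +
      inclRight c A (FreeLieAlgebra.lift ℂ g' x), b'⁆ +
      ⁅b, inclLeft c A (FreeLieAlgebra.lift ℂ g y) +
      inclRight c A (FreeLieAlgebra.lift ℂ g' y)⁆ + (DualNumber.eps : DualNumber ℂ) • ⁅b, b'⁆, ?_⟩
    rw [LieHom.map_lie, hb, hb', LieHom.map_lie, LieHom.map_lie]
    simp only [add_lie, lie_add, lie_inclLeft, lie_inclRight, smul_add, smul_sub, ← hd, ← hd',
      LogPoisson.smul_lie', LogPoisson.lie_smul']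
    rw [← lie_skew (inclLeft c A (FreeLieAlgebra.lift ℂ g y))]
    abel

/-- If `g` and `g'` give the same value `f` on an element, its image is `f` in both copies plus an
ε-part. In a bracket the ε-parts are acted on by diagonal elements, which contraction turns into the
adjoint action; the mixed brackets of the diagonal elements are compensated by `diagOp`. -/
theorem crossDer_lie (hq : ∀ α β, q (α + β) = q α + q β - A α β - A β α)
    {x y : FreeLieAlgebra ℂ X} (hx : FreeLieAlgebra.lift ℂ g' x = FreeLieAlgebra.lift ℂ g x)
    (hy : FreeLieAlgebra.lift ℂ g' y = FreeLieAlgebra.lift ℂ g y) :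
    crossDer c A q g g' ⁅x, y⁆ = ⁅FreeLieAlgebra.lift ℂ g x, crossDer c A q g g' y⁆ -
      ⁅FreeLieAlgebra.lift ℂ g y, crossDer c A q g g' x⁆ := by
  obtain ⟨b, hb⟩ := exists_doubledHom c A g g' x
  obtain ⟨d, hd⟩ := exists_doubledHom c A g g' y
  simp only [crossDer, LinearMap.add_apply, LinearMap.comp_apply, LieHom.coe_toLinearMap,
    LieHom.map_lie]
  rw [hb, hd, hx, hy]
  set f := FreeLieAlgebra.lift ℂ g x
  set h := FreeLieAlgebra.lift ℂ g y
  -- Expansion of the bracket; the product of the two ε-parts is dropped since `ε² = 0`.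
  have key : ⁅inclLeft c A f + inclRight c A f + (DualNumber.eps : DualNumber ℂ) • b,
      inclLeft c A h + inclRight c A h + (DualNumber.eps : DualNumber ℂ) • d⁆ =
      inclLeft c A ⁅f, h⁆ + inclRight c A ⁅f, h⁆ + ⁅inclLeft c A f, inclRight c A h⁆ +
      ⁅inclRight c A f, inclLeft c A h⁆ +
      ⁅inclLeft c A f + inclRight c A f, (DualNumber.eps : DualNumber ℂ) • d⁆ -
      ⁅inclLeft c A h + inclRight c A h, (DualNumber.eps : DualNumber ℂ) • b⁆ := by
    have h0 : ⁅(DualNumber.eps : DualNumber ℂ) • b, (DualNumber.eps : DualNumber ℂ) • d⁆ = 0 := by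
      rw [LogPoisson.smul_lie', LogPoisson.lie_smul', smul_smul, DualNumber.eps_mul_eps, zero_smul]
    rw [lie_add (_ + _), add_lie _ _ ((DualNumber.eps : DualNumber ℂ) • d), h0,
      add_lie _ _ (_ + _), ← lie_skew ((DualNumber.eps : DualNumber ℂ) • b)]
    rw [add_lie, lie_add, lie_add, lie_inclLeft, lie_inclRight]
    abel
  rw [key]
  simp only [map_add, map_sub, contractEps_inclLeft, contractEps_inclRight, contractEps_lie_eps,
    zero_add, lie_add]
  have hm := contractEps_lie_mixed c A q hq f h
  rw [← lie_skew (diagOp c q f) h] at hm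
  rw [← sub_eq_zero] at hm ⊢
  rw [← hm]
  abel

end CrossDerivation

/-! ### Restriction of a Poisson algebra to a face of its exponents -/

section Restriction

open LogPoisson

variable {M M' A : Type*} [AddCommMonoid M] [AddCommMonoid M'] [CommRing A] [Algebra ℂ A]

open Classical in
/-- The linear map that sends `z^α` to `z^(ψ α)` if `α ∈ F`, and to zero otherwise. -/
def restrictMono (c : M →+ M →+ A) (c' : M' →+ M' →+ A) (F : Set M) (ψ : M →+ M') :
    LogPoisson c →ₗ[ℂ] LogPoisson c' :=
  mapMono c c' ψ fun α => if α ∈ F then LinearMap.id else 0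

theorem restrictMono_of_mem (c : M →+ M →+ A) (c' : M' →+ M' →+ A) {F : Set M} (ψ : M →+ M')
    {α : M} (h : α ∈ F) (r : A) : restrictMono c c' F ψ (mono c α r) = mono c' (ψ α) r := by
  rw [restrictMono, mapMono_mono, if_pos h]; rfl

theorem restrictMono_of_notMem (c : M →+ M →+ A) (c' : M' →+ M' →+ A) {F : Set M} (ψ : M →+ M')
    {α : M} (h : α ∉ F) (r : A) : restrictMono c c' F ψ (mono c α r) = 0 := by
  rw [restrictMono, mapMono_mono, if_neg h, LinearMap.zero_apply, mono_zero]

/-- By `hF` a sum lies in `F` only if both summands do, so the monomials outside `F` span an ideal,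
and killing them is a homomorphism. -/
theorem restrictMono_lie {c : M →+ M →+ A} {c' : M' →+ M' →+ A} {F : Set M} {ψ : M →+ M'}
    (hF : ∀ α β, α + β ∈ F ↔ α ∈ F ∧ β ∈ F)
    (hc : ∀ α ∈ F, ∀ β ∈ F, c' (ψ α) (ψ β) = c α β) (f g : LogPoisson c) :
    restrictMono c c' F ψ ⁅f, g⁆ = ⁅restrictMono c c' F ψ f, restrictMono c c' F ψ g⁆ := by
  induction f, g using LogPoisson.induction₂ with
  | zl g => simp
  | zr f => simp
  | addl f f' g h h' => simp [h, h']
  | addr f g g' h h' => simp [h, h']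
  | hm α r β s =>
    rw [lie_mono]
    by_cases hα : α ∈ F
    · by_cases hβ : β ∈ F
      · rw [restrictMono_of_mem _ _ _ ((hF _ _).mpr ⟨hα, hβ⟩), restrictMono_of_mem _ _ _ hα,
          restrictMono_of_mem _ _ _ hβ, lie_mono, map_add, poisCoeff, poisCoeff, hc α hα β hβ,
          hc β hβ α hα]
      · rw [restrictMono_of_notMem _ _ _ (fun h => hβ ((hF _ _).mp h).2),
          restrictMono_of_notMem _ _ _ hβ, lie_zero]
    · rw [restrictMono_of_notMem _ _ _ (fun h => hα ((hF _ _).mp h).1),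
        restrictMono_of_notMem _ _ _ hα, zero_lie]

theorem coeff_restrictMono {c : M →+ M →+ A} {c' : M' →+ M' →+ A} {F : Set M} {ψ : M →+ M'}
    (hψ : Set.InjOn ψ F) {α : M} (hα : α ∈ F) (f : LogPoisson c) :
    coeff (ψ α) (restrictMono c c' F ψ f) = coeff α f := by
  classical
  induction f using LogPoisson.induction with
  | zero => simp
  | add f g hf hg => simp only [map_add, hf, hg]
  | mono β r =>
    by_cases hβ : β ∈ F
    · rw [restrictMono_of_mem _ _ _ hβ, coeff_mono, coeff_mono]
      exact if_congr (hψ.eq_iff hβ hα) rfl rfl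
    · rw [restrictMono_of_notMem _ _ _ hβ, coeff_mono, if_neg, map_zero]
      rintro rfl
      exact hβ hα

theorem restrictMono_lift {X : Type*} {c : M →+ M →+ A} {c' : M' →+ M' →+ A} {F : Set M}
    {ψ : M →+ M'} (hF : ∀ α β, α + β ∈ F ↔ α ∈ F ∧ β ∈ F)
    (hc : ∀ α ∈ F, ∀ β ∈ F, c' (ψ α) (ψ β) = c α β) {g : X → LogPoisson c}
    {h : X → LogPoisson c'} (hg : ∀ x, restrictMono c c' F ψ (g x) = h x)
    (x : FreeLieAlgebra ℂ X) :
    restrictMono c c' F ψ (FreeLieAlgebra.lift ℂ g x) = FreeLieAlgebra.lift ℂ h x := by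
  induction x using freeLie_induction with
  | zero => simp
  | of x => rw [FreeLieAlgebra.lift_of_apply, FreeLieAlgebra.lift_of_apply, hg]
  | add x y hx hy => simp [hx, hy]
  | smul z x hx => simp [hx]
  | lie x y hx hy => rw [LieHom.map_lie, LieHom.map_lie, restrictMono_lie hF hc, hx, hy]

/-- Every ingredient of `crossDer` is compatible with restriction to a face; in the doubled algebra
the face is `F × F`. The case of interest forgets one position of a word. -/
theorem restrictMono_crossDer {X : Type*} {c A : M →+ M →+ ℂ} {q : M → ℂ}
    {c' A' : M' →+ M' →+ ℂ} {q' : M' → ℂ} {F : Set M} {ψ : M →+ M'} (h0 : (0 : M) ∈ F)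
    (hF : ∀ α β, α + β ∈ F ↔ α ∈ F ∧ β ∈ F)
    (hc : ∀ α ∈ F, ∀ β ∈ F, c' (ψ α) (ψ β) = c α β)
    (hA : ∀ α ∈ F, ∀ β ∈ F, A' (ψ α) (ψ β) = A α β) (hq : ∀ α ∈ F, q' (ψ α) = q α)
    {g g' : X → LogPoisson c} {h h' : X → LogPoisson c'}
    (hg : ∀ x, restrictMono c c' F ψ (g x) = h x)
    (hg' : ∀ x, restrictMono c c' F ψ (g' x) = h' x) (x : FreeLieAlgebra ℂ X) :
    restrictMono c c' F ψ (crossDer c A q g g' x) = crossDer c' A' q' h h' x := by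
  let F2 : Set (M × M) := F ×ˢ F
  let ψ2 : M × M →+ M' × M' := ψ.prodMap ψ
  have hF2 : ∀ α β, α + β ∈ F2 ↔ α ∈ F2 ∧ β ∈ F2 := by
    intro α β
    simp only [F2, Set.mem_prod, Prod.fst_add, Prod.snd_add, hF]
    tauto
  have hc2 : ∀ α ∈ F2, ∀ β ∈ F2, doubled c' A' (ψ2 α) (ψ2 β) = doubled c A α β := by
    rintro ⟨α, α'⟩ ⟨hα, hα'⟩ ⟨β, β'⟩ ⟨hβ, hβ'⟩
    simp only [doubled_apply, ψ2, AddMonoidHom.prodMap_def, AddMonoidHom.prod_apply,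
      AddMonoidHom.comp_apply, AddMonoidHom.coe_fst, AddMonoidHom.coe_snd]
    rw [hc α hα β hβ, hc α' hα' β' hβ', hA α hα β' hβ']
  have hl : ∀ f, restrictMono (doubled c A) (doubled c' A') F2 ψ2 (inclLeft c A f) =
      inclLeft c' A' (restrictMono c c' F ψ f) := by
    intro f
    induction f using LogPoisson.induction with
    | zero => simp
    | add f g hf hg => simp [hf, hg]
    | mono α r =>
      rw [inclLeft_mono]
      by_cases hα : α ∈ F
      · rw [restrictMono_of_mem _ _ _ hα, restrictMono_of_mem _ _ _ (show (α, 0) ∈ F2 from ⟨hα, h0⟩),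
          inclLeft_mono]
        simp [ψ2]
      · rw [restrictMono_of_notMem _ _ _ hα, restrictMono_of_notMem _ _ _ (fun h => hα h.1), map_zero]
  have hr : ∀ f, restrictMono (doubled c A) (doubled c' A') F2 ψ2 (inclRight c A f) =
      inclRight c' A' (restrictMono c c' F ψ f) := by
    intro f
    induction f using LogPoisson.induction with
    | zero => simp
    | add f g hf hg => simp [hf, hg]
    | mono α r =>
      rw [inclRight_mono]
      by_cases hα : α ∈ F
      · rw [restrictMono_of_mem _ _ _ hα, restrictMono_of_mem _ _ _ (show (0, α) ∈ F2 from ⟨h0, hα⟩),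
          inclRight_mono]
        simp [ψ2]
      · rw [restrictMono_of_notMem _ _ _ hα, restrictMono_of_notMem _ _ _ (fun h => hα h.2), map_zero]
  have hcontr : ∀ f, restrictMono c c' F ψ (contractEps c A f) =
      contractEps c' A' (restrictMono (doubled c A) (doubled c' A') F2 ψ2 f) := by
    intro f
    induction f using LogPoisson.induction with
    | zero => simp
    | add f g hf hg => simp [hf, hg]
    | mono p r =>
      rw [contractEps_mono]
      by_cases hp : p ∈ F2
      · rw [restrictMono_of_mem _ _ _ hp, restrictMono_of_mem _ _ _ ((hF _ _).mpr hp),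
          contractEps_mono]
        simp only [ψ2, AddMonoidHom.prodMap_def, AddMonoidHom.prod_apply, map_add,
          AddMonoidHom.comp_apply, AddMonoidHom.coe_fst, AddMonoidHom.coe_snd, poisCoeff]
        rw [hc _ hp.1 _ hp.2, hc _ hp.2 _ hp.1]
      · rw [restrictMono_of_notMem _ _ _ hp, map_zero,
          restrictMono_of_notMem _ _ _ (fun h => hp ((hF _ _).mp h))]
  have hdiag : ∀ f, restrictMono c c' F ψ (diagOp c q f) =
      diagOp c' q' (restrictMono c c' F ψ f) := by
    intro f
    induction f using LogPoisson.induction with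
    | zero => simp
    | add f g hf hg => simp [hf, hg]
    | mono α r =>
      rw [diagOp_mono]
      by_cases hα : α ∈ F
      · rw [restrictMono_of_mem _ _ _ hα, restrictMono_of_mem _ _ _ hα, diagOp_mono, hq α hα]
      · rw [restrictMono_of_notMem _ _ _ hα, restrictMono_of_notMem _ _ _ hα, map_zero]
  have h2 : restrictMono (doubled c A) (doubled c' A') F2 ψ2 (doubledHom c A g g' x) =
      doubledHom c' A' h h' x :=
    restrictMono_lift hF2 hc2 (fun x => by rw [map_add, hl, hr, hg, hg']) x
  simp only [crossDer, LinearMap.add_apply, LinearMap.comp_apply, LieHom.coe_toLinearMap, map_add,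
    hcontr, hdiag, h2, restrictMono_lift hF hc hg]

end Restriction

/-! ### The Poisson algebra of a word -/

section WordPoisson

open LogPoisson

/-- The biadditive map on `ℕ →₀ ℕ` with given values on the basis. -/
def pairForm (k : ℕ → ℕ → ℂ) : (ℕ →₀ ℕ) →+ (ℕ →₀ ℕ) →+ ℂ :=
  Finsupp.liftAddHom fun i => multiplesHom _ (Finsupp.liftAddHom fun j => multiplesHom ℂ (k i j))

theorem pairForm_single (k : ℕ → ℕ → ℂ) (i j m n : ℕ) :
    pairForm k (Finsupp.single i m) (Finsupp.single j n) = m * n * k i j := by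
  simp [pairForm, mul_assoc]

theorem pairForm_mapDomain (k : ℕ → ℕ → ℂ) (φ : ℕ → ℕ) (α β : ℕ →₀ ℕ) :
    pairForm k (α.mapDomain φ) (β.mapDomain φ) = pairForm (fun i j => k (φ i) (φ j)) α β := by
  induction α using Finsupp.induction_linear with
  | zero => simp
  | add α α' h h' => simp only [Finsupp.mapDomain_add, map_add, AddMonoidHom.add_apply, h, h']
  | single i m =>
    induction β using Finsupp.induction_linear with
    | zero => simp
    | add α α' h h' => simp only [Finsupp.mapDomain_add, map_add, h, h']
    | single j n => rw [Finsupp.mapDomain_single, Finsupp.mapDomain_single, pairForm_single,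
        pairForm_single]

/-- The additive map on `ℕ →₀ ℕ` that is given by the diagonal of a kernel. -/
def diagForm (k : ℕ → ℕ → ℂ) : (ℕ →₀ ℕ) →+ ℂ :=
  Finsupp.liftAddHom fun i => multiplesHom ℂ (k i i)

theorem diagForm_single (k : ℕ → ℕ → ℂ) (i m : ℕ) :
    diagForm k (Finsupp.single i m) = m * k i i := by
  simp [diagForm]

theorem diagForm_mapDomain (k : ℕ → ℕ → ℂ) (φ : ℕ → ℕ) (α : ℕ →₀ ℕ) :
    diagForm k (α.mapDomain φ) = diagForm (fun i j => k (φ i) (φ j)) α := by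
  induction α using Finsupp.induction_linear with
  | zero => simp
  | add α α' h h' => simp only [Finsupp.mapDomain_add, map_add, h, h']
  | single i m => rw [Finsupp.mapDomain_single, diagForm_single, diagForm_single]

/-- The order embedding of `ℕ` into `ℕ` that omits `k`. -/
def skip (k j : ℕ) : ℕ := if j < k then j else j + 1

theorem skip_lt_skip {k i j : ℕ} : skip k i < skip k j ↔ i < j := by
  unfold skip; split_ifs <;> omega

theorem skip_injective (k : ℕ) : Function.Injective (skip k) := fun i j h => by
  unfold skip at h; split_ifs at h <;> omega

theorem skip_ne (k j : ℕ) : skip k j ≠ k := by unfold skip; split_ifs <;> omega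

theorem exists_skip_eq {k i : ℕ} (h : i ≠ k) : ∃ j, skip k j = i := by
  rcases lt_or_gt_of_ne h with h | h
  · exact ⟨i, by simp [skip, h]⟩
  · refine ⟨i - 1, ?_⟩
    unfold skip; rw [if_neg (by omega)]; omega

theorem getElem?_eraseIdx_eq {X : Type*} (w : List X) (k j : ℕ) :
    (w.eraseIdx k)[j]? = w[skip k j]? := by
  rw [List.getElem?_eraseIdx, skip]; split_ifs <;> rfl

/-- The exponents that do not involve the position `k`. -/
def avoid (k : ℕ) : Set (ℕ →₀ ℕ) := {α | α k = 0}

/-- The removal of the position `k` from an exponent. -/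
def unskip (k : ℕ) : (ℕ →₀ ℕ) →+ (ℕ →₀ ℕ) :=
  Finsupp.comapDomain.addMonoidHom (skip_injective k)

theorem mapDomain_unskip {k : ℕ} {α : ℕ →₀ ℕ} (h : α ∈ avoid k) :
    (unskip k α).mapDomain (skip k) = α := by
  refine Finsupp.mapDomain_comapDomain _ (skip_injective k) _ fun i hi => ?_
  refine exists_skip_eq fun hik => ?_
  subst hik
  simp only [Finset.mem_coe, Finsupp.mem_support_iff] at hi
  exact hi h

theorem unskip_single (k j m : ℕ) :
    unskip k (Finsupp.single (skip k j) m) = Finsupp.single j m :=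
  Finsupp.comapDomain_single _ _ _ _

theorem unskip_injOn (k : ℕ) : Set.InjOn (unskip k) (avoid k) := fun α hα β hβ h => by
  rw [← mapDomain_unskip hα, h, mapDomain_unskip hβ]

theorem add_mem_avoid (k : ℕ) (α β : ℕ →₀ ℕ) :
    α + β ∈ avoid k ↔ α ∈ avoid k ∧ β ∈ avoid k := by
  simp [avoid]

theorem pairForm_unskip {k : ℕ} {κ κ' : ℕ → ℕ → ℂ}
    (h : ∀ i j, κ' i j = κ (skip k i) (skip k j)) {α β : ℕ →₀ ℕ} (hα : α ∈ avoid k)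
    (hβ : β ∈ avoid k) : pairForm κ' (unskip k α) (unskip k β) = pairForm κ α β := by
  conv_rhs => rw [← mapDomain_unskip hα, ← mapDomain_unskip hβ, pairForm_mapDomain]
  rw [show κ' = fun i j => κ (skip k i) (skip k j) from funext₂ h]

theorem diagForm_unskip {k : ℕ} {κ κ' : ℕ → ℕ → ℂ}
    (h : ∀ i j, κ' i j = κ (skip k i) (skip k j)) {α : ℕ →₀ ℕ} (hα : α ∈ avoid k) :
    diagForm κ' (unskip k α) = diagForm κ α := by
  conv_rhs => rw [← mapDomain_unskip hα, diagForm_mapDomain]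
  rw [show κ' = fun i j => κ (skip k i) (skip k j) from funext₂ h]

theorem sum_range_skip {V : Type*} [AddCommMonoid V] {k n : ℕ} (hk : k < n + 1) (f : ℕ → V) :
    ∑ i ∈ Finset.range (n + 1), f i = f k + ∑ j ∈ Finset.range n, f (skip k j) := by
  rw [Finset.sum_range, Fin.sum_univ_succAbove _ ⟨k, hk⟩, Finset.sum_range]
  congr 1
  refine Finset.sum_congr rfl fun j _ => ?_
  congr 1
  simp only [Fin.succAbove, Fin.lt_def, skip]
  split_ifs <;> simp_all

/-- The exponent in which all of `0, …, n - 1` occur once. -/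
def fullExp (n : ℕ) : ℕ →₀ ℕ := ∑ i ∈ Finset.range n, Finsupp.single i 1

variable {X : Type*}

/-- The extension by zero of a kernel to optional letters. -/
def optKernel (a : X → X → ℂ) : Option X → Option X → ℂ
  | some x, some y => a x y
  | _, _ => 0

/-- Half of the kernel on the pairs of positions `i < j` of a word. -/
def orderKernel (a : X → X → ℂ) (w : List X) (i j : ℕ) : ℂ :=
  if i < j then 2⁻¹ * optKernel a w[i]? w[j]? else 0

/-- The kernel that pairs a letter of a word with the translate of another one. -/
def crossKernel (a : X → X → ℂ) (t : Equiv.Perm X) (w : List X) (i j : ℕ) : ℂ :=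
  optKernel a w[i]? (w[j]?.map t.symm)

/-- The quadratic function that is attached to a kernel. -/
def quadForm (k : ℕ → ℕ → ℂ) (α : ℕ →₀ ℕ) : ℂ := diagForm k α - pairForm k α α

/-- Any additive function could be added to `quadForm` here. The choice of `diagForm` is dictated by
geometry: it removes the pairs consisting of an index and itself, to which no diagonal hyperplane
corresponds (`sum_unbalanced`). -/
theorem quadForm_add (k : ℕ → ℕ → ℂ) (α β : ℕ →₀ ℕ) : quadForm k (α + β) =
    quadForm k α + quadForm k β - pairForm k α β - pairForm k β α := by
  simp [quadForm]; ring

/-- The log-canonical Poisson algebra of a word. -/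
abbrev WordPoisson (a : X → X → ℂ) (w : List X) : Type :=
  LogPoisson (pairForm (orderKernel a w))

open Classical in
/-- The sum of the coordinates of the positions of a letter in a word. -/
def letterSum (a : X → X → ℂ) (w : List X) (x : X) : WordPoisson a w :=
  ∑ i ∈ Finset.range w.length, if w[i]? = some x then mono _ (Finsupp.single i 1) 1 else 0

/-- The map from the free Lie algebra to the Poisson algebra of a word. -/
def wordHom (a : X → X → ℂ) (w : List X) : FreeLieAlgebra ℂ X →ₗ⁅ℂ⁆ WordPoisson a w :=
  FreeLieAlgebra.lift ℂ (letterSum a w)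

/-- The derivation that is attached to a word and to a permutation of the letters. -/
def wordDer (a : X → X → ℂ) (t : Equiv.Perm X) (w : List X) :
    FreeLieAlgebra ℂ X →ₗ[ℂ] WordPoisson a w :=
  crossDer _ (pairForm (crossKernel a t w)) (quadForm (crossKernel a t w)) (letterSum a w)
    fun x => letterSum a w (t x)

/-- The projection that forgets the position `k` of a word. -/
def erasePos (a : X → X → ℂ) (w : List X) (k : ℕ) :
    WordPoisson a w →ₗ[ℂ] WordPoisson a (w.eraseIdx k) :=
  restrictMono _ _ (avoid k) (unskip k)

theorem orderKernel_eraseIdx (a : X → X → ℂ) (w : List X) (k i j : ℕ) :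
    orderKernel a (w.eraseIdx k) i j = orderKernel a w (skip k i) (skip k j) := by
  simp only [orderKernel, getElem?_eraseIdx_eq, skip_lt_skip]

theorem crossKernel_eraseIdx (a : X → X → ℂ) (t : Equiv.Perm X) (w : List X) (k i j : ℕ) :
    crossKernel a t (w.eraseIdx k) i j = crossKernel a t w (skip k i) (skip k j) := by
  simp only [crossKernel, getElem?_eraseIdx_eq]

theorem erasePos_lie (a : X → X → ℂ) (w : List X) (k : ℕ) (f g : WordPoisson a w) :
    erasePos a w k ⁅f, g⁆ = ⁅erasePos a w k f, erasePos a w k g⁆ :=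
  restrictMono_lie (add_mem_avoid k)
    (fun _ hα _ hβ => pairForm_unskip (orderKernel_eraseIdx a w k) hα hβ) f g

theorem erasePos_letterSum (a : X → X → ℂ) {w : List X} {k : ℕ} (hk : k < w.length) (x : X) :
    erasePos a w k (letterSum a w x) = letterSum a (w.eraseIdx k) x := by
  classical
  have hl : w.length = (w.eraseIdx k).length + 1 := by rw [List.length_eraseIdx]; simp [hk]; omega
  unfold letterSum
  rw [hl, sum_range_skip (by omega : k < _ + 1), map_add, map_sum]
  have h1 : erasePos a w k (if w[k]? = some x then mono _ (Finsupp.single k 1) 1 else 0) = 0 := by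
    split_ifs
    · exact restrictMono_of_notMem _ _ _ (by simp [avoid]) _
    · exact map_zero _
  rw [h1, zero_add]
  refine Finset.sum_congr rfl fun j _ => ?_
  rw [getElem?_eraseIdx_eq]
  split_ifs
  · rw [erasePos, restrictMono_of_mem _ _ _ (by simp [avoid, skip_ne]), unskip_single]
  · exact map_zero _

theorem erasePos_wordHom (a : X → X → ℂ) {w : List X} {k : ℕ} (hk : k < w.length)
    (x : FreeLieAlgebra ℂ X) :
    erasePos a w k (wordHom a w x) = wordHom a (w.eraseIdx k) x :=
  restrictMono_lift (add_mem_avoid k)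
    (fun _ hα _ hβ => pairForm_unskip (orderKernel_eraseIdx a w k) hα hβ)
    (erasePos_letterSum a hk) x

theorem erasePos_wordDer (a : X → X → ℂ) (t : Equiv.Perm X) {w : List X} {k : ℕ}
    (hk : k < w.length) (x : FreeLieAlgebra ℂ X) :
    erasePos a w k (wordDer a t w x) = wordDer a t (w.eraseIdx k) x :=
  restrictMono_crossDer (by simp [avoid]) (add_mem_avoid k)
    (fun _ hα _ hβ => pairForm_unskip (orderKernel_eraseIdx a w k) hα hβ)
    (fun _ hα _ hβ => pairForm_unskip (crossKernel_eraseIdx a t w k) hα hβ)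
    (fun _ hα => by
      rw [quadForm, quadForm, pairForm_unskip (crossKernel_eraseIdx a t w k) hα hα,
        diagForm_unskip (crossKernel_eraseIdx a t w k) hα])
    (erasePos_letterSum a hk) (fun x => erasePos_letterSum a hk (t x)) x

theorem lift_letterSum_comp (a : X → X → ℂ) (t : Equiv.Perm X) (w : List X)
    (x : FreeLieAlgebra ℂ X) :
    FreeLieAlgebra.lift ℂ (fun x => letterSum a w (t x)) x = wordHom a w (relabel t x) := by
  have : FreeLieAlgebra.lift ℂ (fun x => letterSum a w (t x)) =
      (wordHom a w).comp (relabel t) := FreeLieAlgebra.hom_ext (by simp [wordHom])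
  exact LieHom.congr_fun this x

/-- The second copy sees the element through `relabel t`, so for `t`-invariant elements the two
copies agree, as `crossDer_lie` requires. -/
theorem wordDer_lie (a : X → X → ℂ) (t : Equiv.Perm X) (w : List X) {x y : FreeLieAlgebra ℂ X}
    (hx : relabel t x = x) (hy : relabel t y = y) :
    wordDer a t w ⁅x, y⁆ = ⁅wordHom a w x, wordDer a t w y⁆ - ⁅wordHom a w y, wordDer a t w x⁆ :=
  crossDer_lie _ _ _ _ _ (quadForm_add _) ((lift_letterSum_comp a t w x).trans (by rw [hx]; rfl))
    ((lift_letterSum_comp a t w y).trans (by rw [hy]; rfl))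

/-- The action of a letter on functions on words. -/
def letterAct (a : X → X → ℂ) (x : X) : Module.End ℂ (List X → ℂ) where
  toFun f w := ∑ k ∈ Finset.range w.length, open Classical in
    if w[k]? = some x then
      poisCoeff (pairForm (orderKernel a w)) (Finsupp.single k 1) (fullExp w.length) *
        f (w.eraseIdx k) else 0
  map_add' f g := by
    ext w
    rw [Pi.add_apply, ← Finset.sum_add_distrib]
    refine Finset.sum_congr rfl fun k _ => ?_
    split_ifs
    · rw [Pi.add_apply]; ring
    · simp
  map_smul' z f := by
    ext w
    rw [Pi.smul_apply, Finset.smul_sum]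
    refine Finset.sum_congr rfl fun k _ => ?_
    split_ifs
    · simp; ring
    · simp

/-- The action of the free Lie algebra on functions on words. -/
def wordAct (a : X → X → ℂ) : FreeLieAlgebra ℂ X →ₗ⁅ℂ⁆ Module.End ℂ (List X → ℂ) :=
  FreeLieAlgebra.lift ℂ (letterAct a)

/-- Families of elements of the Poisson algebras of all words that are compatible with the removal
of letters. -/
def IsNatural (a : X → X → ℂ) (f : ∀ w : List X, WordPoisson a w) : Prop :=
  ∀ w k, k < w.length → erasePos a w k (f w) = f (w.eraseIdx k)

/-- The coefficients of the square-free monomials of full degree. -/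
def topCoeff (a : X → X → ℂ) (f : ∀ w : List X, WordPoisson a w) (w : List X) : ℂ :=
  coeff (fullExp w.length) (f w)

/-- The coefficient of the full monomial in `{z_k, f w}` is a scalar times the coefficient in `f w`
of the product of all other coordinates. By naturality the latter is the top coefficient of `f` at
the word with position `k` erased. This settles generators; brackets follow because both sides are
Lie algebra actions and the action preserves natural families. -/
theorem topCoeff_lie_wordHom (a : X → X → ℂ) (x : FreeLieAlgebra ℂ X)
    {f : ∀ w : List X, WordPoisson a w} (hf : IsNatural a f) :
    topCoeff a (fun w => ⁅wordHom a w x, f w⁆) = wordAct a x (topCoeff a f) := by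
  induction x using freeLie_induction generalizing f with
  | zero => ext w; simp [topCoeff]
  | add x y hx hy =>
    rw [map_add, LinearMap.add_apply, ← hx hf, ← hy hf]
    ext w; simp [topCoeff]
  | smul z x hx =>
    rw [map_smul, LinearMap.smul_apply, ← hx hf]
    ext w; simp [topCoeff, coeff_smul]
  | lie x y hx hy =>
    have hnat : ∀ x, IsNatural a (fun w => ⁅wordHom a w x, f w⁆) := fun x w k hk => by
      rw [erasePos_lie, erasePos_wordHom a hk, hf w k hk]
    rw [LieHom.map_lie, LieRing.of_associative_ring_bracket, LinearMap.sub_apply,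
      Module.End.mul_apply, Module.End.mul_apply, ← hx hf, ← hy hf, ← hx (hnat y), ← hy (hnat x)]
    ext w
    simp only [topCoeff, Pi.sub_apply, LieHom.map_lie, ← map_sub]
    rw [lie_lie]
  | of x =>
    ext w
    simp only [topCoeff, wordHom, wordAct, FreeLieAlgebra.lift_of_apply, letterSum, letterAct,
      LinearMap.coe_mk, AddHom.coe_mk]
    rw [sum_lie, map_sum]
    refine Finset.sum_congr rfl fun k hk => ?_
    rw [Finset.mem_range] at hk
    split_ifs with h
    · obtain ⟨n, hn⟩ : ∃ n, w.length = n + 1 := ⟨w.length - 1, by omega⟩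
      have hl : (w.eraseIdx k).length = n := by rw [List.length_eraseIdx]; simp [hk]; omega
      have hfull : fullExp w.length = Finsupp.single k 1 +
          ∑ j ∈ Finset.range n, Finsupp.single (skip k j) 1 := by
        rw [fullExp, hn, sum_range_skip (by omega : k < n + 1)]
      have hrest : ∑ j ∈ Finset.range n, Finsupp.single (skip k j) 1 ∈ avoid k := by
        simp [avoid, Finsupp.finsetSum_apply, skip_ne]
      rw [hfull, coeff_lie_mono, one_mul, ← hf w k hk, hl, erasePos]
      have hu : fullExp n = unskip k (∑ j ∈ Finset.range n, Finsupp.single (skip k j) 1) := by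
        rw [map_sum, fullExp]; simp only [unskip_single]
      rw [hu, coeff_restrictMono (unskip_injOn k) hrest]
      congr 1
      rw [poisCoeff_add_right, show poisCoeff (pairForm (orderKernel a w)) (Finsupp.single k 1)
        (Finsupp.single k 1) = 0 from sub_self _, zero_add]
    · simp

/-- The value on words of the derivation that is attached to a permutation of the letters. -/
def crossValue (a : X → X → ℂ) (t : Equiv.Perm X) :
    FreeLieAlgebra ℂ X →ₗ[ℂ] (List X → ℂ) where
  toFun x := topCoeff a fun w => wordDer a t w x
  map_add' x y := by ext w; simp [topCoeff]
  map_smul' z x := by ext w; simp [topCoeff, coeff_smul]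

/-- The derivation rule for all words at once, after passage to top coefficients: the Poisson
brackets become the action on functions of words. -/
theorem crossValue_lie (a : X → X → ℂ) (t : Equiv.Perm X) {x y : FreeLieAlgebra ℂ X}
    (hx : relabel t x = x) (hy : relabel t y = y) :
    crossValue a t ⁅x, y⁆ = wordAct a x (crossValue a t y) - wordAct a y (crossValue a t x) := by
  have hn : ∀ x, IsNatural a (fun w => wordDer a t w x) := fun x w k hk =>
    erasePos_wordDer a t hk x
  have h1 := topCoeff_lie_wordHom a x (hn y)
  have h2 := topCoeff_lie_wordHom a y (hn x)
  have e : ∀ x, crossValue a t x = topCoeff a fun w => wordDer a t w x := fun _ => rfl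
  rw [e x, e y, ← h1, ← h2]
  ext w
  rw [e]
  simp only [topCoeff, Pi.sub_apply, ← map_sub, wordDer_lie a t w hx hy]

end WordPoisson

/-! ### The action on functions of words as a transpose of the lowering operators -/

section ActionPairing

variable {X : Type*}

theorem evalWords_consMap (f : List X → ℂ) (j : X) (t : Words X) :
    evalWords f (consMap j t) = evalWords (fun w => f (j :: w)) t := by
  induction t using Finsupp.induction_linear with
  | zero => simp
  | add a b ha hb => simp only [map_add, ha, hb]
  | single w r => simp

theorem evalWords_add (f g : List X → ℂ) : evalWords (f + g) = evalWords f + evalWords g := by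
  refine Finsupp.lhom_ext' fun w => LinearMap.ext_ring ?_; simp

theorem evalWords_sub (f g : List X → ℂ) : evalWords (f - g) = evalWords f - evalWords g := by
  refine Finsupp.lhom_ext' fun w => LinearMap.ext_ring ?_; simp

theorem evalWords_smul (z : ℂ) (f : List X → ℂ) : evalWords (z • f) = z • evalWords f := by
  refine Finsupp.lhom_ext' fun w => LinearMap.ext_ring ?_; simp

open Classical in
/-- The sum of the words that are obtained from a word by removing a letter `i`. -/
def deleteWord (i : X) : List X → Words X
  | [] => 0
  | j :: w => consMap j (deleteWord i w) + if j = i then Finsupp.single w 1 else 0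

/-- The linear extension of `deleteWord`. -/
def deleteLetter (i : X) : Module.End ℂ (Words X) := Finsupp.linearCombination ℂ (deleteWord i)

@[simp] theorem deleteLetter_single (i : X) (w : List X) (r : ℂ) :
    deleteLetter i (Finsupp.single w r) = r • deleteWord i w := by simp [deleteLetter]

open Classical in
theorem deleteLetter_consMap (i j : X) (t : Words X) :
    deleteLetter i (consMap j t) = consMap j (deleteLetter i t) + if j = i then t else 0 := by
  induction t using Finsupp.induction_linear with
  | zero => simp
  | add a b ha hb =>
    simp only [map_add, ha, hb]
    split_ifs
    · abel
    · simp
  | single w r =>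
    rw [consMap_single, deleteLetter_single, deleteLetter_single, deleteWord, smul_add, map_smul]
    congr 1
    split_ifs <;> simp

/-- Deleting a letter is the derivation of the free associative algebra with scalar values on the
letters. It therefore sends Lie elements to scalars, and brackets to zero. -/
theorem exists_deleteLetter_leftMul (i : X) (x : FreeLieAlgebra ℂ X) :
    ∃ z : ℂ, ∀ t, deleteLetter i (leftMul X x t) = leftMul X x (deleteLetter i t) + z • t := by
  classical
  induction x using freeLie_induction with
  | zero => exact ⟨0, by simp⟩
  | of j =>
    refine ⟨if j = i then 1 else 0, fun t => ?_⟩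
    rw [leftMul_of, deleteLetter_consMap]
    split_ifs <;> simp
  | add x y hx hy =>
    obtain ⟨z, hz⟩ := hx; obtain ⟨z', hz'⟩ := hy
    refine ⟨z + z', fun t => ?_⟩
    simp only [map_add, LinearMap.add_apply, hz, hz', add_smul]; abel
  | smul s x hx =>
    obtain ⟨z, hz⟩ := hx
    exact ⟨s * z, fun t => by simp only [map_smul, LinearMap.smul_apply, hz, smul_add, mul_smul]⟩
  | lie x y hx hy =>
    obtain ⟨z, hz⟩ := hx; obtain ⟨z', hz'⟩ := hy
    refine ⟨0, fun t => ?_⟩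
    simp only [LieHom.map_lie, LieRing.of_associative_ring_bracket, LinearMap.sub_apply,
      Module.End.mul_apply, map_sub, hz, hz', map_add, map_smul]
    module

theorem exists_deleteLetter_wordExp (i : X) (x : FreeLieAlgebra ℂ X) :
    ∃ z : ℂ, deleteLetter i (wordExp x) = Finsupp.single [] z := by
  obtain ⟨z, hz⟩ := exists_deleteLetter_leftMul i x
  exact ⟨z, by rw [wordExp_apply, hz]; simp [deleteWord]⟩

open Classical in
theorem evalWords_deleteWord (f : List X → ℂ) (i : X) (w : List X) :
    evalWords f (deleteWord i w) =
      ∑ k ∈ Finset.range w.length, if w[k]? = some i then f (w.eraseIdx k) else 0 := by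
  induction w generalizing f with
  | nil => simp [deleteWord]
  | cons j w ih =>
    rw [deleteWord, map_add, evalWords_consMap, ih, List.length_cons, Finset.sum_range_succ']
    congr 1
    simp only [List.getElem?_cons_zero, Option.some.injEq, List.eraseIdx_cons_zero]
    split_ifs <;> simp

open Classical in
theorem evalWords_contractWord (a : X → X → ℂ) (f : List X → ℂ) (i : X) (w : List X) :
    evalWords f (contractWord a 0 i w) = -∑ k ∈ Finset.range w.length,
      if w[k]? = some i then ((w.drop (k + 1)).map (a i)).sum * f (w.eraseIdx k) else 0 := by
  induction w generalizing f with
  | nil => simp [contractWord]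
  | cons j w ih =>
    rw [contractWord, map_sub, evalWords_consMap, ih, List.length_cons, Finset.sum_range_succ',
      neg_add, ← sub_eq_add_neg]
    congr 1
    simp only [List.getElem?_cons_zero, Option.some.injEq, List.eraseIdx_cons_zero, eq_comm (a := i)]
    split_ifs <;> simp

theorem sum_range_gt {A : Type*} [AddCommMonoid A] (g : Option X → A) (w : List X) (k : ℕ) :
    (∑ l ∈ Finset.range w.length, if k < l then g w[l]? else 0) =
      ((w.drop (k + 1)).map fun x => g (some x)).sum := by
  have h0 : ∀ w : List X, ∑ l ∈ Finset.range w.length, g w[l]? =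
      (w.map fun x => g (some x)).sum := by
    intro w
    induction w with
    | nil => simp
    | cons j w ih =>
      rw [List.length_cons, Finset.sum_range_succ']
      simp [ih, add_comm]
  induction w generalizing k with
  | nil => simp
  | cons j w ih =>
    rw [List.length_cons, Finset.sum_range_succ']
    cases k with
    | zero => simp [h0]
    | succ k => simpa using ih k

theorem sum_range_lt {A : Type*} [AddCommMonoid A] (g : Option X → A) (w : List X) (k : ℕ) :
    (∑ l ∈ Finset.range w.length, if l < k then g w[l]? else 0) =
      ((w.take k).map fun x => g (some x)).sum := by
  induction w generalizing k with
  | nil => simp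
  | cons j w ih =>
    rw [List.length_cons, Finset.sum_range_succ']
    cases k with
    | zero => simp
    | succ k =>
      have := ih k
      simp only [List.length_cons, List.getElem?_cons_succ, List.getElem?_cons_zero, List.take_succ_cons,
        List.map_cons, List.sum_cons, Nat.succ_lt_succ_iff, Nat.zero_lt_succ, if_true]
      rw [this, add_comm]

/-- The kernel counts a pair of positions with weight one half, with a plus sign for the positions
after `k` and a minus sign for those before it. -/
theorem poisCoeff_single_fullExp {a : X → X → ℂ} (ha : ∀ x y, a x y = a y x) {w : List X} {k : ℕ}
    {i : X} (hk : w[k]? = some i) :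
    poisCoeff (pairForm (orderKernel a w)) (Finsupp.single k 1) (fullExp w.length) =
      2⁻¹ * ((w.drop (k + 1)).map (a i)).sum - 2⁻¹ * ((w.take k).map (a i)).sum := by
  have h1 : pairForm (orderKernel a w) (Finsupp.single k 1) (fullExp w.length) =
      ∑ l ∈ Finset.range w.length, orderKernel a w k l := by
    simp [fullExp, pairForm_single]
  have h2 : pairForm (orderKernel a w) (fullExp w.length) (Finsupp.single k 1) =
      ∑ l ∈ Finset.range w.length, orderKernel a w l k := by
    simp [fullExp, pairForm_single, AddMonoidHom.finsetSum_apply]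
  have h3 := sum_range_gt (fun o => 2⁻¹ * optKernel a (some i) o) w k
  have h4 := sum_range_lt (fun o => 2⁻¹ * optKernel a o (some i)) w k
  rw [poisCoeff, h1, h2]
  simp only [orderKernel, hk]
  rw [h3, h4]
  simp only [optKernel, List.sum_map_mul_left, fun x => ha x i]

/-- Half of (right minus left) equals right minus half of (right plus left). The right part is the
lowering operator up to sign; the remaining sum depends only on the word after deletion, and so
factors through `deleteLetter`. -/
theorem evalWords_letterAct {a : X → X → ℂ} (ha : ∀ x y, a x y = a y x) (f : List X → ℂ) (i : X)
    (t : Words X) : evalWords (letterAct a i f) t = -evalWords f (contract a 0 i t) -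
      2⁻¹ * evalWords (fun v => (v.map (a i)).sum * f v) (deleteLetter i t) := by
  classical
  induction t using Finsupp.induction_linear with
  | zero => simp
  | add a b ha hb => simp only [map_add, ha, hb]; ring
  | single w r =>
    rw [evalWords_single, contract_single, deleteLetter_single, map_smul, map_smul,
      evalWords_contractWord, evalWords_deleteWord, smul_eq_mul, smul_eq_mul]
    have : letterAct a i f w = ∑ k ∈ Finset.range w.length,
        if w[k]? = some i then poisCoeff (pairForm (orderKernel a w)) (Finsupp.single k 1)
          (fullExp w.length) * f (w.eraseIdx k) else 0 := rfl
    rw [this]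
    have h2 : ∀ k, (if w[k]? = some i then poisCoeff (pairForm (orderKernel a w))
        (Finsupp.single k 1) (fullExp w.length) * f (w.eraseIdx k) else 0) =
        (if w[k]? = some i then ((w.drop (k + 1)).map (a i)).sum * f (w.eraseIdx k) else 0) -
        2⁻¹ * (if w[k]? = some i then ((w.eraseIdx k).map (a i)).sum * f (w.eraseIdx k) else 0) := by
      intro k
      split_ifs with h
      · rw [poisCoeff_single_fullExp ha h, List.eraseIdx_eq_take_drop_succ, List.map_append,
          List.sum_append]
        ring
      · simp
    rw [Finset.sum_congr rfl fun k _ => h2 k, Finset.sum_sub_distrib, ← Finset.mul_sum]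
    ring

/-- On a Lie element deletion leaves a multiple of the empty word, where the correction is an empty
sum. Thus the skew action needed for Poisson brackets and the one-sided lowering operator agree. -/
theorem evalWords_letterAct_wordExp {a : X → X → ℂ} (ha : ∀ x y, a x y = a y x) (f : List X → ℂ)
    (i : X) (y : FreeLieAlgebra ℂ X) :
    evalWords (letterAct a i f) (wordExp y) = -evalWords f (contract a 0 i (wordExp y)) := by
  obtain ⟨z, hz⟩ := exists_deleteLetter_wordExp i y
  rw [evalWords_letterAct ha, hz]
  simp

end ActionPairing

/-! ### The cocycle identity for one permutation -/

section CrossForm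

variable {R : ℕ} {𝔥 : Type u} [AddCommGroup 𝔥] [Module ℂ 𝔥] [FiniteDimensional ℂ 𝔥]
variable {B : LinearMap.BilinForm ℂ 𝔥} {hB : B.Nondegenerate} {α : Fin R → Module.Dual ℂ 𝔥}
variable (hsymm : B.IsSymm)

/-- For a generator this is `evalWords_letterAct_wordExp`, since `F_i` acts on the module of
extremal weight zero by `contract _ 0 i`. Both sides are then compatible with brackets in `x`. -/
theorem evalWords_wordAct (f : List (Fin R) → ℂ) (x y : FreeLieAlgebra ℂ (Fin R)) :
    evalWords (wordAct (rootForm B hB α) x f) (wordExp y) =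
      -evalWords f (projPlus hB α hsymm ⁅toN B hB α x, toNPlus B hB α y⁆) := by
  have hv : ∀ x y, projPlus hB α hsymm ⁅toN B hB α x, toNPlus B hB α y⁆ =
      verma hB α hsymm 0 (toN B hB α x) (wordExp y) := fun x y => by
    rw [projPlus_lie, projPlus_toN, map_zero, sub_zero, projPlus_toNPlus]
  induction x using freeLie_induction generalizing f y with
  | zero =>
    have := evalWords_smul 0 (0 : List (Fin R) → ℂ)
    rw [zero_smul, zero_smul] at this
    simp [this]
  | of i =>
    rw [wordAct, FreeLieAlgebra.lift_of_apply, hv, toN_of, verma_F,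
      evalWords_letterAct_wordExp (rootForm_symm hsymm)]
    rfl
  | add x x' h h' =>
    simp only [map_add, LinearMap.add_apply, add_lie]
    rw [evalWords_add, LinearMap.add_apply, h, h']; ring
  | smul z x h =>
    simp only [map_smul, LinearMap.smul_apply, smul_lie]
    rw [evalWords_smul, LinearMap.smul_apply, h]; simp
  | lie x x' h h' =>
    simp only [LieHom.map_lie, LieRing.of_associative_ring_bracket, LinearMap.sub_apply,
      Module.End.mul_apply]
    -- The duality is available on Lie elements only. To apply it a second time, the projection of
    -- the first bracket is rewritten as the expansion of the Lie element `compPlus`.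
    rw [evalWords_sub, LinearMap.sub_apply, h, h', ← wordExp_compPlus, ← wordExp_compPlus, h, h', hv, hv,
      wordExp_compPlus, wordExp_compPlus, hv, hv, ← LieHom.map_lie, hv, LieHom.map_lie,
      LieHom.map_lie, LieRing.of_associative_ring_bracket, LinearMap.sub_apply,
      Module.End.mul_apply, Module.End.mul_apply, map_sub]
    ring

/-- The values of the derivation that is attached to a permutation, as a bilinear form. -/
def crossForm {X : Type*} (a : X → X → ℂ) (t : Equiv.Perm X) :
    FreeLieAlgebra ℂ X →ₗ[ℂ] Words X →ₗ[ℂ] ℂ where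
  toFun x := evalWords (crossValue a t x)
  map_add' x y := by rw [map_add, evalWords_add]
  map_smul' z x := by rw [map_smul, evalWords_smul]; rfl

/-- The rule for `crossValue` on a bracket, transposed to the module of words: this is the cocycle
identity for two elements of 𝔫 and one of 𝔫₊. -/
theorem crossForm_lie (t : Equiv.Perm (Fin R)) {x x' : FreeLieAlgebra ℂ (Fin R)}
    (hx : relabel t x = x) (hx' : relabel t x' = x') (y : FreeLieAlgebra ℂ (Fin R)) :
    crossForm (rootForm B hB α) t ⁅x, x'⁆ (wordExp y) =
      crossForm (rootForm B hB α) t x (projPlus hB α hsymm ⁅toN B hB α x', toNPlus B hB α y⁆) -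
      crossForm (rootForm B hB α) t x' (projPlus hB α hsymm ⁅toN B hB α x, toNPlus B hB α y⁆) := by
  change evalWords (crossValue _ t ⁅x, x'⁆) (wordExp y) = evalWords (crossValue _ t x) _ -
    evalWords (crossValue _ t x') _
  rw [crossValue_lie _ t hx hx', evalWords_sub, LinearMap.sub_apply, evalWords_wordAct hsymm,
    evalWords_wordAct hsymm]
  ring

end CrossForm

/-! ### Vanishing of the form on different weights -/

section Grading

open LogPoisson

variable {X N : Type*} [AddCommMonoid N]

theorem doubledHom_commutator_mem_homog {M : Type*} [AddCommMonoid M] {c A : M →+ M →+ ℂ}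
    {g g' : X → LogPoisson c} {D : M →+ N} {d : X → N} (hg : ∀ x, g x ∈ homog c D (d x))
    (hg' : ∀ x, g' x ∈ homog c D (d x)) (e : FreeMagma X) :
    doubledHom c A g g' (commutator e) ∈
      homog (doubled c A) (D.comp (AddMonoidHom.fst M M) + D.comp (AddMonoidHom.snd M M))
        (contentSum d e) := by
  refine lift_commutator_mem_homog (fun x => add_mem ?_ ?_) e
  · exact mapMono_mem_homog (fun α => by simp) (hg x)
  · exact mapMono_mem_homog (fun α => by simp) (hg' x)

theorem crossDer_commutator_mem_homog {M : Type*} [AddCommMonoid M] {c A : M →+ M →+ ℂ}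
    {q : M → ℂ} {g g' : X → LogPoisson c} {D : M →+ N} {d : X → N}
    (hg : ∀ x, g x ∈ homog c D (d x)) (hg' : ∀ x, g' x ∈ homog c D (d x)) (e : FreeMagma X) :
    crossDer c A q g g' (commutator e) ∈ homog c D (contentSum d e) := by
  refine add_mem ?_ ?_
  · exact mapMono_mem_homog (fun p => by simp) (doubledHom_commutator_mem_homog hg hg' e)
  · exact mapMono_mem_homog (fun α => rfl) (lift_commutator_mem_homog hg e)

/-- The degree of an exponent, for a degree function on the letters. -/
def wordDegree (d : X → N) (w : List X) : (ℕ →₀ ℕ) →+ N :=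
  Finsupp.liftAddHom fun i => multiplesHom N (w[i]?.elim 0 d)

theorem wordDegree_single (d : X → N) (w : List X) (i : ℕ) :
    wordDegree d w (Finsupp.single i 1) = w[i]?.elim 0 d := by
  simp [wordDegree]

theorem wordDegree_fullExp (d : X → N) (w : List X) :
    wordDegree d w (fullExp w.length) = (w.map d).sum := by
  rw [fullExp, map_sum]
  simp only [wordDegree_single]
  have := sum_range_lt (fun o => Option.elim o 0 d) w w.length
  simp only [List.take_length, Option.elim_some] at this
  rw [← this]
  exact Finset.sum_congr rfl fun i hi => (if_pos (Finset.mem_range.mp hi)).symm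

theorem letterSum_mem_homog (a : X → X → ℂ) (d : X → N) (w : List X) (x : X) :
    letterSum a w x ∈ homog _ (wordDegree d w) (d x) := by
  classical
  refine sum_mem fun i _ => ?_
  split_ifs with h
  · exact mono_mem_homog (by rw [wordDegree_single, h]; rfl) _
  · exact zero_mem _

/-- For a degree that `t` preserves, both copies of a letter have the same degree, and brackets,
contraction and `diagOp` are homogeneous. The full monomial has the degree of the word. -/
theorem crossValue_commutator_eq_zero (a : X → X → ℂ) {t : Equiv.Perm X} {d : X → N}
    (hd : ∀ x, d (t x) = d x) {c : FreeMagma X} {w : List X}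
    (h : (w.map d).sum ≠ contentSum d c) : crossValue a t (commutator c) w = 0 := by
  refine coeff_eq_zero_of_mem_homog (crossDer_commutator_mem_homog
    (letterSum_mem_homog a d w) (fun x => ?_) c) (by rwa [wordDegree_fullExp])
  rw [← hd]
  exact letterSum_mem_homog a d w _

theorem crossForm_commutator_eq_zero (a : X → X → ℂ) {t : Equiv.Perm X} {d : X → N}
    (hd : ∀ x, d (t x) = d x) {c c' : FreeMagma X} (h : contentSum d c' ≠ contentSum d c) :
    crossForm a t (commutator c) (wordExp (commutator c')) = 0 := by
  change evalWords _ _ = 0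
  rw [evalWords_wordExp, ← wordSum_zero c']
  refine wordSum_congr fun w hw => crossValue_commutator_eq_zero a hd ?_
  rwa [(hw.map d).sum_eq]

end Grading

/-! ### Alternating sums of products of kernels over the words of a commutator -/

section KernelSums

variable {X ι : Type*}

/-- Half of the sum of the values of a kernel on the pairs of letters of a word. -/
def kerWord (K : X → X → ℂ) : List X → ℂ
  | [] => 0
  | x :: w => 2⁻¹ * (w.map (K x)).sum + kerWord K w

/-- The sum of the values of a kernel on the pairs of letters of two words. -/
def kerPair (K : X → X → ℂ) (p : List X × List X) : ℂ :=
  (p.1.map fun x => (p.2.map (K x)).sum).sum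

theorem kerWord_append (K : X → X → ℂ) (u v : List X) :
    kerWord K (u ++ v) = kerWord K u + kerWord K v + 2⁻¹ * kerPair K (u, v) := by
  induction u with
  | nil => simp [kerWord, kerPair]
  | cons x u ih =>
    simp only [List.cons_append, kerWord, ih, kerPair, List.map_append, List.sum_append,
      List.map_cons, List.sum_cons]
    ring

theorem kerPair_perm (K : X → X → ℂ) {u v u' v' : List X} (hu : u.Perm u') (hv : v.Perm v') :
    kerPair K (u, v) = kerPair K (u', v') := by
  unfold kerPair
  rw [(hu.map _).sum_eq]
  congr 2
  funext x
  exact (hv.map _).sum_eq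

theorem kerPair_swap {K : X → X → ℂ} (hK : ∀ x y, K x y = -K y x) (u v : List X) :
    kerPair K (v, u) = -kerPair K (u, v) := by
  unfold kerPair
  induction u with
  | nil => simp
  | cons x u ih =>
    simp only [List.map_cons, List.sum_cons, List.sum_map_add] at ih ⊢
    rw [ih, neg_add]
    congr 1
    rw [← neg_one_mul, ← List.sum_map_mul_left]
    congr 2
    funext y
    rw [hK, neg_one_mul]

/-- The pairs of contents of the brackets of a bracketed word. -/
def nodes : FreeMagma X → List (List X × List X)
  | .of _ => []
  | .mul c d => (content c, content d) :: (nodes c ++ nodes d)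

theorem nodes_mul (c d : FreeMagma X) :
    nodes (c * d) = (content c, content d) :: (nodes c ++ nodes d) := rfl

theorem length_nodes (c : FreeMagma X) : (nodes c).length + 1 = (content c).length := by
  induction c with
  | ih1 x => rfl
  | ih2 c d hc hd =>
    rw [nodes_mul, content_mul, List.length_append, ← hc, ← hd]
    simp; omega

variable [DecidableEq ι]

/-- The permanent of a matrix whose rows are indexed by `S` and whose columns are the values of `K`
on the entries of a list. -/
def permSum {N : Type*} (K : ι → N → ℂ) : Finset ι → List N → ℂ
  | S, [] => if S = ∅ then 1 else 0
  | S, J :: l => ∑ i ∈ S, K i J * permSum K (S.erase i) l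

theorem permSum_eq_zero {N : Type*} (K : ι → N → ℂ) {S : Finset ι} {l : List N}
    (h : S.card ≠ l.length) : permSum K S l = 0 := by
  induction l generalizing S with
  | nil => exact if_neg (by rintro rfl; simp at h)
  | cons J l ih =>
    refine Finset.sum_eq_zero fun i hi => ?_
    rw [ih, mul_zero]
    rw [Finset.card_erase_of_mem hi]
    simp only [List.length_cons] at h
    have := Finset.card_pos.mpr ⟨i, hi⟩
    omega

/-- Laplace expansion of a permanent along a block of columns. -/
theorem permSum_append {N : Type*} (K : ι → N → ℂ) (S : Finset ι) (l l' : List N) :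
    permSum K S (l ++ l') = ∑ U ∈ S.powerset, permSum K U l * permSum K (S \ U) l' := by
  induction l generalizing S with
  | nil =>
    rw [Finset.sum_eq_single ∅]
    · simp [permSum]
    · intro U _ hU; simp [permSum, hU]
    · simp
  | cons J l ih =>
    simp only [List.cons_append, permSum, ih, Finset.sum_mul, Finset.mul_sum]
    rw [Finset.sum_sigma', Finset.sum_sigma']
    refine Finset.sum_bij' (fun p _ => ⟨insert p.1 p.2, p.1⟩) (fun p _ => ⟨p.2, p.1.erase p.2⟩)
      ?_ ?_ ?_ ?_ ?_
    · rintro ⟨i, U⟩ h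
      simp only [Finset.mem_sigma, Finset.mem_powerset] at h ⊢
      exact ⟨Finset.insert_subset h.1 (h.2.trans (Finset.erase_subset _ _)),
        Finset.mem_insert_self _ _⟩
    · rintro ⟨U, i⟩ h
      simp only [Finset.mem_sigma, Finset.mem_powerset] at h ⊢
      exact ⟨h.1 h.2, Finset.erase_subset_erase _ h.1⟩
    · rintro ⟨i, U⟩ h
      simp only [Finset.mem_sigma, Finset.mem_powerset] at h ⊢
      have : i ∉ U := fun hi => by simpa using h.2 hi
      simp [this]
    · rintro ⟨U, i⟩ h
      simp only [Finset.mem_sigma, Finset.mem_powerset] at h ⊢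
      simp [h.2]
    · rintro ⟨i, U⟩ h
      simp only [Finset.mem_sigma, Finset.mem_powerset] at h ⊢
      have : i ∉ U := fun hi => by simpa using h.2 hi
      rw [Finset.erase_insert this, mul_assoc]
      congr 3
      ext j
      simp only [Finset.mem_sdiff, Finset.mem_erase, Finset.mem_insert]
      tauto

theorem permSum_perm {N : Type*} (K : ι → N → ℂ) {l l' : List N} (h : l.Perm l') (S : Finset ι) :
    permSum K S l = permSum K S l' := by
  induction h generalizing S with
  | nil => rfl
  | cons J _ ih => simp only [permSum, ih]
  | trans _ _ h h' => rw [h, h']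
  | swap J J' l =>
    simp only [permSum, Finset.mul_sum]
    rw [Finset.sum_comm' (t' := S) (s' := fun i => S.erase i)]
    · refine Finset.sum_congr rfl fun i _ => Finset.sum_congr rfl fun j _ => ?_
      rw [Finset.erase_right_comm]; ring
    · intro i j
      simp only [Finset.mem_erase]
      tauto

theorem permSum_ofFn {N : Type*} [Fintype ι] (K : ι → N → ℂ) {n : ℕ} (J : Fin n → N)
    (S : Finset ι) (hS : S.card = n) : permSum K S (List.ofFn J) =
      ∑ f : Fin n → ι, open Classical in
        if Function.Injective f ∧ ∀ k, f k ∈ S then ∏ k, K (f k) (J k) else 0 := by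
  induction n generalizing S with
  | zero =>
    rw [Finset.card_eq_zero] at hS
    subst hS
    simp [permSum, Function.injective_of_subsingleton]
  | succ n ih =>
    rw [List.ofFn_succ, permSum, ← (Fin.consEquiv fun _ : Fin (n + 1) => ι).sum_comp,
      Fintype.sum_prod_type, ← Finset.sum_subset (Finset.subset_univ S)]
    · refine Finset.sum_congr rfl fun i hi => ?_
      rw [ih _ _ (by rw [Finset.card_erase_of_mem hi, hS]; rfl), Finset.mul_sum]
      refine Finset.sum_congr rfl fun f _ => ?_
      rw [mul_ite, mul_zero]
      refine if_congr ?_ ?_ rfl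
      · simp only [Fin.consEquiv, Equiv.coe_fn_mk, Fin.cons_injective_iff, Fin.forall_fin_succ,
          Fin.cons_zero, Fin.cons_succ, Set.mem_range, Finset.mem_erase, not_exists]
        constructor
        · rintro ⟨h1, h2⟩; exact ⟨⟨fun k => (h2 k).1, h1⟩, hi, fun k => (h2 k).2⟩
        · rintro ⟨⟨h1, h2⟩, _, h3⟩; exact ⟨h2, fun k => ⟨h1 k, h3 k⟩⟩
      · simp [Fin.consEquiv, Fin.prod_univ_succ]
    · intro i _ hi
      refine Finset.sum_eq_zero fun f _ => if_neg ?_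
      rintro ⟨_, h⟩
      exact hi (by simpa [Fin.consEquiv] using h 0)

/-- The permanent as a sum over permutations. -/
theorem permSum_univ {N : Type*} {n : ℕ} (K : Fin n → N → ℂ) (J : Fin n → N) :
    permSum K Finset.univ (List.ofFn J) = ∑ s : Equiv.Perm (Fin n), ∏ k, K (s k) (J k) := by
  classical
  rw [permSum_ofFn K J _ (by simp), ← Finset.sum_filter]
  symm
  refine Finset.sum_bij (fun s _ => ⇑s) ?_ ?_ ?_ ?_
  · intro s _; simp [s.injective]
  · intro s _ s' _ h; exact DFunLike.coe_injective h
  · intro f hf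
    simp only [Finset.mem_filter, Finset.mem_univ, true_and, implies_true, and_true] at hf
    exact ⟨Equiv.ofBijective f (Finite.injective_iff_bijective.mp hf), Finset.mem_univ _, rfl⟩
  · intro s _; rfl

/-- The alternating sum of a product of antisymmetric kernels over the words of a commutator is a
permanent if there are as many kernels as brackets, and it is zero if there are fewer. -/
theorem wordSum_prod_kerWord {K : ι → X → X → ℂ} (hK : ∀ i x y, K i x y = -K i y x)
    (c : FreeMagma X) : ∀ S : Finset ι, S.card ≤ (nodes c).length →
      wordSum (fun w => ∏ i ∈ S, kerWord (K i) w) c =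
        permSum (fun i => kerPair (K i)) S (nodes c) := by
  induction c with
  | ih1 x =>
    intro S hS
    have : S = ∅ := by simpa [nodes] using hS
    subst this
    simp [wordSum_of, nodes, permSum]
  | ih2 c d hc hd =>
    intro S hS
    have hc0 : ∀ S : Finset ι, S.card < (nodes c).length →
        wordSum (fun w => ∏ i ∈ S, kerWord (K i) w) c = 0 := fun S h => by
      rw [hc S h.le, permSum_eq_zero _ h.ne]
    have hd0 : ∀ S : Finset ι, S.card < (nodes d).length →
        wordSum (fun w => ∏ i ∈ S, kerWord (K i) w) d = 0 := fun S h => by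
      rw [hd S h.le, permSum_eq_zero _ h.ne]
    set κ : ι → ℂ := fun i => kerPair (K i) (content c, content d) with hκ
    -- Each kernel on `u v` is its value on `u`, plus that on `v`, plus `½ κ i`; on `v u` the last
    -- term changes sign. Expanding the two products, `U` is the set of kernels that contribute the
    -- cross term and `V` the set evaluated on `u`; even `U` cancel.
    have hexp : wordSum (fun w => ∏ i ∈ S, kerWord (K i) w) (c * d) =
        ∑ U ∈ S.powerset, ((1 - (-1) ^ U.card) * ∏ i ∈ U, 2⁻¹ * κ i) *
          ∑ V ∈ (S \ U).powerset, wordSum (fun w => ∏ i ∈ V, kerWord (K i) w) c *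
            wordSum (fun w => ∏ i ∈ (S \ U) \ V, kerWord (K i) w) d := by
      rw [wordSum_mul]
      have h1 : ∀ u, u.Perm (content c) → ∀ v, v.Perm (content d) →
          ∏ i ∈ S, kerWord (K i) (u ++ v) - ∏ i ∈ S, kerWord (K i) (v ++ u) =
          ∑ U ∈ S.powerset, ((1 - (-1) ^ U.card) * ∏ i ∈ U, 2⁻¹ * κ i) *
            ∑ V ∈ (S \ U).powerset, (∏ i ∈ V, kerWord (K i) u) *
              ∏ i ∈ (S \ U) \ V, kerWord (K i) v := by
        intro u hu v hv
        have e1 : ∏ i ∈ S, kerWord (K i) (u ++ v) =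
            ∏ i ∈ S, (2⁻¹ * κ i + (kerWord (K i) u + kerWord (K i) v)) :=
          Finset.prod_congr rfl fun i _ => by
            rw [kerWord_append, kerPair_perm (K i) hu hv]; ring
        have e2 : ∏ i ∈ S, kerWord (K i) (v ++ u) =
            ∏ i ∈ S, (-(2⁻¹ * κ i) + (kerWord (K i) u + kerWord (K i) v)) :=
          Finset.prod_congr rfl fun i _ => by
            rw [kerWord_append, kerPair_perm (K i) hv hu, kerPair_swap (hK i)]; ring
        rw [e1, e2, Finset.prod_add, Finset.prod_add, ← Finset.sum_sub_distrib]
        refine Finset.sum_congr rfl fun U _ => ?_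
        rw [Finset.prod_neg, ← Finset.prod_add]
        ring
      rw [wordSum_congr fun u hu => wordSum_congr fun v hv => h1 u hu v hv]
      simp only [wordSum_finset_sum, wordSum_mul_left]
      refine Finset.sum_congr rfl fun U _ => ?_
      congr 1
      refine Finset.sum_congr rfl fun V _ => ?_
      rw [mul_comm, ← wordSum_mul_left]
      exact wordSum_congr fun u _ => mul_comm _ _
    rw [hexp, nodes_mul, permSum]
    rw [nodes_mul, List.length_cons, List.length_append] at hS
    -- Only singletons `U` survive. For empty `U` the scalar is zero; for larger `U` fewer kernels
    -- remain than there are brackets in `c` and `d` together, so one of the two factors has too few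
    -- and vanishes.
    rw [← Finset.sum_subset (s₁ := S.powersetCard 1)]
    · rw [Finset.powersetCard_one, Finset.sum_map]
      refine Finset.sum_congr rfl fun i hi => ?_
      simp only [Function.Embedding.coeFn_mk, Finset.card_singleton, Finset.prod_singleton,
        Finset.sdiff_singleton_eq_erase, permSum_append]
      rw [show (1 - (-1 : ℂ) ^ 1) * (2⁻¹ * κ i) = κ i by ring]
      congr 1
      refine Finset.sum_congr rfl fun V hV => ?_
      have h1 := Finset.card_sdiff_add_card_eq_card (Finset.mem_powerset.mp hV)
      rw [Finset.card_erase_of_mem hi] at h1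
      rcases le_or_gt V.card (nodes c).length with h | h
      · rcases le_or_gt (S.erase i \ V).card (nodes d).length with h' | h'
        · rw [hc V h, hd _ h']
        · rw [hc0 V (by omega), permSum_eq_zero _ (show V.card ≠ _ by omega), zero_mul, zero_mul]
      · rw [hd0 _ (by omega), permSum_eq_zero _ (show (S.erase i \ V).card ≠ _ by omega), mul_zero,
          mul_zero]
    · intro U hU
      rw [Finset.mem_powersetCard] at hU
      exact Finset.mem_powerset.mpr hU.1
    · intro U hU hU'
      rw [Finset.mem_powersetCard, not_and] at hU'
      have h0 := Finset.card_sdiff_add_card_eq_card (Finset.mem_powerset.mp hU)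
      have hU1 := hU' (Finset.mem_powerset.mp hU)
      rcases Nat.eq_zero_or_pos U.card with hz | hp
      · rw [hz]; simp
      · rw [Finset.sum_eq_zero, mul_zero]
        intro V hV
        have h1 := Finset.card_sdiff_add_card_eq_card (Finset.mem_powerset.mp hV)
        rcases lt_or_ge V.card (nodes c).length with h | h
        · rw [hc0 V h, zero_mul]
        · rw [hd0 _ (by omega), mul_zero]

end KernelSums

/-! ### Homomorphisms that send letters to monomials -/

section MonomialValues

open LogPoisson

variable {X M A : Type*} [AddCommMonoid M] [CommRing A] [Algebra ℂ A]

theorem nodes_sublist {c : FreeMagma X} {J : List X × List X} (hJ : J ∈ nodes c) :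
    (J.1 ++ J.2).Sublist (content c) := by
  induction c with
  | ih1 x => simp [nodes] at hJ
  | ih2 c d hc hd =>
    rw [nodes_mul, List.mem_cons, List.mem_append] at hJ
    rw [content_mul]
    rcases hJ with rfl | hJ | hJ
    · exact List.Sublist.refl _
    · exact (hc hJ).trans (List.sublist_append_left _ _)
    · exact (hd hJ).trans (List.sublist_append_right _ _)

theorem lift_commutator_eq_zero {L : Type*} [LieRing L] [LieAlgebra ℂ L] {g : X → L}
    {c : FreeMagma X} {x : X} (hx : x ∈ content c) (h : g x = 0) :
    FreeLieAlgebra.lift ℂ g (commutator c) = 0 := by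
  induction c with
  | ih1 y =>
    rw [content, List.mem_singleton] at hx
    rw [commutator, FreeLieAlgebra.lift_of_apply, ← hx, h]
  | ih2 c d hc hd =>
    rw [content_mul, List.mem_append] at hx
    rw [commutator_mul, LieHom.map_lie]
    rcases hx with hx | hx
    · rw [hc hx, zero_lie]
    · rw [hd hx, lie_zero]

/-- Brackets of monomials are monomials, so each bracket of the word contributes one scalar factor,
determined by the total exponents of its two sides. -/
theorem lift_commutator_eq_mono {c : M →+ M →+ A} {g : X → LogPoisson c} {μ : X → M}
    {e : FreeMagma X} (h : ∀ x ∈ content e, g x = mono c (μ x) 1) :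
    FreeLieAlgebra.lift ℂ g (commutator e) = mono c (contentSum μ e)
      ((nodes e).map fun J => poisCoeff c (J.1.map μ).sum (J.2.map μ).sum).prod := by
  induction e with
  | ih1 x =>
    rw [commutator, FreeLieAlgebra.lift_of_apply, h x (by simp [content]), contentSum_of]
    simp [nodes]
  | ih2 e e' he he' =>
    rw [commutator_mul, LieHom.map_lie, he fun x hx => h x (by simp [content_mul, hx]),
      he' fun x hx => h x (by simp [content_mul, hx]), lie_mono, contentSum_mul, nodes_mul,
      List.map_cons, List.prod_cons, List.map_append, List.prod_append]
    congr 1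
    rw [mul_comm]; rfl

theorem poisCoeff_sum_sum {κ κ' : Type*} (c : M →+ M →+ A) (s : Finset κ) (s' : Finset κ')
    (f : κ → M) (f' : κ' → M) : poisCoeff c (∑ i ∈ s, f i) (∑ j ∈ s', f' j) =
      ∑ i ∈ s, ∑ j ∈ s', poisCoeff c (f i) (f' j) := by
  simp only [poisCoeff, map_sum, AddMonoidHom.finsetSum_apply, Finset.sum_sub_distrib]
  congr 1
  rw [Finset.sum_comm]

/-- The Leibniz rule for the ε-coefficient. -/
theorem snd_finset_prod {ι : Type*} [DecidableEq ι] (s : Finset ι) (f : ι → DualNumber ℂ) :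
    (∏ i ∈ s, f i).snd = ∑ i ∈ s, (f i).snd * ∏ j ∈ s.erase i, (f j).fst := by
  have hfst : ∀ s : Finset ι, (∏ i ∈ s, f i).fst = ∏ i ∈ s, (f i).fst := fun s =>
    map_prod (TrivSqZeroExt.fstHom ℂ ℂ ℂ) f s
  induction s using Finset.induction_on with
  | empty => simp
  | insert i s hi ih =>
    rw [Finset.prod_insert hi, TrivSqZeroExt.snd_mul, Finset.sum_insert hi, Finset.erase_insert hi,
      ih, hfst]
    simp only [smul_eq_mul, MulOpposite.smul_eq_mul_unop, MulOpposite.unop_op]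
    rw [add_comm]
    congr 1
    rw [Finset.mul_sum]
    refine Finset.sum_congr rfl fun j hj => ?_
    have hij : i ≠ j := by rintro rfl; exact hi hj
    rw [Finset.erase_insert_of_ne hij, Finset.prod_insert (by simp [hi])]
    ring

end MonomialValues

/-! ### Words in which every index occurs once -/

section Multilinear

open LogPoisson

variable {T m : ℕ} [NeZero T]

/-- The words in which every index occurs once, with exponents prescribed by `k`. -/
def HasPotential (k : Fin m → ZMod T) (w : List (ZMod T × Fin m)) : Prop :=
  w.Perm (List.ofFn fun p => (k p, p))

theorem HasPotential.perm {k : Fin m → ZMod T} {w w' : List (ZMod T × Fin m)}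
    (h : HasPotential k w) (hw : w'.Perm w) : HasPotential k w' := hw.trans h

theorem HasPotential.nodup {k : Fin m → ZMod T} {w : List (ZMod T × Fin m)}
    (h : HasPotential k w) : w.Nodup := by
  rw [h.nodup_iff, List.nodup_ofFn]
  intro p q hpq
  exact congrArg Prod.snd hpq

theorem HasPotential.mem_iff {k : Fin m → ZMod T} {w : List (ZMod T × Fin m)}
    (h : HasPotential k w) (x : ZMod T × Fin m) : x ∈ w ↔ x.1 = k x.2 := by
  rw [List.Perm.mem_iff h, List.mem_ofFn]
  constructor
  · rintro ⟨p, rfl⟩; rfl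
  · rintro hx; exact ⟨x.2, by rw [← hx]⟩

theorem HasPotential.sum_map {V : Type*} [AddCommMonoid V] {k : Fin m → ZMod T}
    {w : List (ZMod T × Fin m)} (h : HasPotential k w) (F : ZMod T × Fin m → V) :
    (w.map F).sum = ∑ p, F (k p, p) := by
  rw [(h.map F).sum_eq, List.map_ofFn, List.sum_ofFn]; rfl

/-- The set of indices of a word. -/
def indices (A : List (ZMod T × Fin m)) : Finset (Fin m) := (A.map Prod.snd).toFinset

theorem HasPotential.sum_map_sublist {V : Type*} [AddCommMonoid V] {k : Fin m → ZMod T}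
    {w A : List (ZMod T × Fin m)} (h : HasPotential k w) (hA : A.Sublist w)
    (F : ZMod T × Fin m → V) : (A.map F).sum = ∑ p ∈ indices A, F (k p, p) := by
  have h1 : ∀ x ∈ A, x.1 = k x.2 := fun x hx => (h.mem_iff x).mp (hA.subset hx)
  have h2 : A.map F = (A.map Prod.snd).map fun p => F (k p, p) := by
    rw [List.map_map]
    refine List.map_congr_left fun x hx => ?_
    rw [Function.comp_apply, ← h1 x hx]
  have h3 : (A.map Prod.snd).Nodup := by
    refine List.Nodup.map_on (fun x hx y hy hxy => ?_) (h.nodup.sublist hA)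
    exact Prod.ext (by rw [h1 x hx, h1 y hy, hxy]) hxy
  rw [h2, indices, List.sum_toFinset _ h3]

/-- The position of the first occurrence of a letter in a word. -/
def letterPos {X : Type*} [DecidableEq X] (w : List X) (x : X) : ℕ := w.idxOf x

/-- The coefficient of the bracket of the coordinates of two letters of a word. -/
def signKernel {X : Type*} [DecidableEq X] (a : X → X → ℂ) (w : List X) (x y : X) : ℂ :=
  orderKernel a w (letterPos w x) (letterPos w y) -
    orderKernel a w (letterPos w y) (letterPos w x)

theorem poisCoeff_single_single (k : ℕ → ℕ → ℂ) (i j : ℕ) :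
    poisCoeff (pairForm k) (Finsupp.single i 1) (Finsupp.single j 1) = k i j - k j i := by
  simp [poisCoeff, pairForm_single]

theorem signKernel_swap {X : Type*} [DecidableEq X] (a : X → X → ℂ) (w : List X) (x y : X) :
    signKernel a w y x = -signKernel a w x y := by simp [signKernel]

theorem getElem?_letterPos {X : Type*} [DecidableEq X] {w : List X} {x : X} (h : x ∈ w) :
    w[letterPos w x]? = some x := by
  rw [letterPos, List.getElem?_eq_getElem (List.idxOf_lt_length_of_mem h), List.getElem_idxOf]

/-- `signKernel` is half of `a`, with the sign of the order of the two positions. Its product with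
an antisymmetric `κ` is symmetric, so the double sum counts each pair twice. -/
theorem kerWord_eq_sum {X : Type*} [DecidableEq X] (a : X → X → ℂ) {κ : X → X → ℂ}
    (hκ : ∀ x y, κ x y = -κ y x) {w : List X} (hw : w.Nodup) :
    kerWord (fun x y => a x y * κ x y) w =
      2⁻¹ * (w.map fun x => (w.map fun y => signKernel a w x y * κ x y).sum).sum := by
  induction w with
  | nil => simp [kerWord]
  | cons z w ih =>
    rw [List.nodup_cons] at hw
    have hz : ∀ x ∈ w, z ≠ x := fun x hx h => hw.1 (h ▸ hx)
    have hp0 : letterPos (z :: w) z = 0 := List.idxOf_cons_self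
    have hp : ∀ x ∈ w, letterPos (z :: w) x = letterPos w x + 1 := fun x hx =>
      List.idxOf_cons_ne _ (hz x hx)
    have hs : ∀ x ∈ w, ∀ y ∈ w, signKernel a (z :: w) x y = signKernel a w x y := by
      intro x hx y hy
      simp [signKernel, orderKernel, hp x hx, hp y hy]
    have hzx : ∀ x ∈ w, signKernel a (z :: w) z x = 2⁻¹ * a z x := by
      intro x hx
      simp [signKernel, orderKernel, hp0, hp x hx, getElem?_letterPos hx, optKernel]
    have hzz : signKernel a (z :: w) z z = 0 := sub_self _
    have e1 : (w.map fun x => ((z :: w).map fun y => signKernel a (z :: w) x y * κ x y).sum).sum =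
        (w.map fun x => 2⁻¹ * (a z x * κ z x)).sum +
        (w.map fun x => (w.map fun y => signKernel a w x y * κ x y).sum).sum := by
      rw [← List.sum_map_add]
      congr 1
      refine List.map_congr_left fun x hx => ?_
      rw [List.map_cons, List.sum_cons, signKernel_swap, hzx x hx, hκ x z]
      congr 1
      · ring
      · congr 1
        exact List.map_congr_left fun y hy => by rw [hs x hx y hy]
    have e2 : ((z :: w).map fun y => signKernel a (z :: w) z y * κ z y).sum =
        (w.map fun x => 2⁻¹ * (a z x * κ z x)).sum := by
      rw [List.map_cons, List.sum_cons, hzz, zero_mul, zero_add]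
      congr 1
      exact List.map_congr_left fun y hy => by rw [hzx y hy]; ring
    rw [kerWord, ih hw.2, List.map_cons, List.sum_cons, e1, e2, List.sum_map_mul_left]
    ring

/-- The antisymmetric function on pairs of indices that records whether they connect `A` to `B`. -/
def connect {I : Type*} [DecidableEq I] (A B : Finset I) (p q : I) : ℂ :=
  (if p ∈ A ∧ q ∈ B then 1 else 0) - if p ∈ B ∧ q ∈ A then 1 else 0

theorem connect_swap {I : Type*} [DecidableEq I] (A B : Finset I) (p q : I) :
    connect A B p q = -connect A B q p := by
  simp only [connect, neg_sub]
  congr 1 <;> exact if_congr and_comm rfl rfl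

/-- The pairs from `A` to `B` and those from `B` to `A` contribute equally, because both factors
change sign. -/
theorem sum_mul_connect {I : Type*} [Fintype I] [DecidableEq I] (A B : Finset I) {F : I → I → ℂ}
    (hF : ∀ p q, F p q = -F q p) :
    2⁻¹ * ∑ p, ∑ q, F p q * connect A B p q = ∑ p ∈ A, ∑ q ∈ B, F p q := by
  have h1 : ∀ A B : Finset I, ∑ p, ∑ q, F p q * (if p ∈ A ∧ q ∈ B then 1 else 0) =
      ∑ p ∈ A, ∑ q ∈ B, F p q := by
    intro A B
    have : ∀ p, ∑ q, F p q * (if p ∈ A ∧ q ∈ B then 1 else 0) =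
        if p ∈ A then ∑ q ∈ B, F p q else 0 := fun p => by
      by_cases hp : p ∈ A <;> simp [hp]
    simp only [this]
    simp
  have h2 : ∑ p ∈ B, ∑ q ∈ A, F p q = -∑ p ∈ A, ∑ q ∈ B, F p q := by
    rw [Finset.sum_comm]
    simp only [← Finset.sum_neg_distrib]
    exact Finset.sum_congr rfl fun p _ => Finset.sum_congr rfl fun q _ => hF q p
  simp only [connect, mul_sub, Finset.sum_sub_distrib]
  rw [h1, h1, h2]
  ring

end Multilinear

/-! ### Values of the derivations on multilinear words -/

section WordValues

open LogPoisson

theorem letterSum_of_mem {X : Type*} [DecidableEq X] (a : X → X → ℂ) {w : List X} (hw : w.Nodup)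
    {x : X} (hx : x ∈ w) : letterSum a w x = mono _ (Finsupp.single (letterPos w x) 1) 1 := by
  classical
  rw [letterSum, Finset.sum_eq_single (letterPos w x)]
  · rw [if_pos (getElem?_letterPos hx)]
  · intro i hi hne
    refine if_neg fun h => hne ?_
    obtain ⟨hi', rfl⟩ := List.getElem?_eq_some_iff.mp h
    exact (hw.idxOf_getElem i hi').symm
  · intro h
    exact absurd (Finset.mem_range.mpr (List.idxOf_lt_length_of_mem hx)) h

theorem letterSum_of_notMem {X : Type*} (a : X → X → ℂ) {w : List X} {x : X} (hx : x ∉ w) :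
    letterSum a w x = 0 := by
  classical
  refine Finset.sum_eq_zero fun i _ => if_neg fun h => hx ?_
  exact List.mem_of_getElem? h

theorem sum_range_getElem? {X A : Type*} [AddCommMonoid A] (g : Option X → A) (w : List X) :
    ∑ l ∈ Finset.range w.length, g w[l]? = (w.map fun x => g (some x)).sum := by
  have := sum_range_lt g w w.length
  rw [List.take_length] at this
  rw [← this]
  exact Finset.sum_congr rfl fun i hi => (if_pos (Finset.mem_range.mp hi)).symm

theorem fullExp_eq_sum_letterPos {X : Type*} [DecidableEq X] {w : List X} (hw : w.Nodup) :
    fullExp w.length = (w.map fun x => Finsupp.single (letterPos w x) 1).sum := by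
  have := sum_range_getElem?
    (fun o => Option.elim o (0 : ℕ →₀ ℕ) fun x => Finsupp.single (letterPos w x) 1) w
  simp only [Option.elim_some] at this
  rw [← this, fullExp]
  refine Finset.sum_congr rfl fun i hi => ?_
  rw [Finset.mem_range] at hi
  rw [List.getElem?_eq_getElem hi, Option.elim_some, letterPos, hw.idxOf_getElem]

theorem quadForm_fullExp {X : Type*} (a : X → X → ℂ) (t : Equiv.Perm X) (w : List X) :
    quadForm (crossKernel a t w) (fullExp w.length) = (w.map fun x => a x (t.symm x)).sum -
      (w.map fun x => (w.map fun y => a x (t.symm y)).sum).sum := by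
  have h1 : diagForm (crossKernel a t w) (fullExp w.length) =
      ∑ i ∈ Finset.range w.length, optKernel a w[i]? (w[i]?.map t.symm) := by
    simp [fullExp, diagForm_single, crossKernel]
  have h2 : pairForm (crossKernel a t w) (fullExp w.length) (fullExp w.length) =
      ∑ i ∈ Finset.range w.length, ∑ j ∈ Finset.range w.length,
        optKernel a w[i]? (w[j]?.map t.symm) := by
    simp [fullExp, pairForm_single, crossKernel, AddMonoidHom.finsetSum_apply]
    exact Finset.sum_comm
  rw [quadForm, h1, h2, sum_range_getElem? (fun o => optKernel a o (o.map t.symm))]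
  simp only [fun i => sum_range_getElem? (fun o => optKernel a w[i]? (o.map t.symm)) w]
  rw [sum_range_getElem? (fun o => (w.map fun y => optKernel a o ((some y).map t.symm)).sum)]
  rfl

variable {T m : ℕ} [NeZero T]

/-- The permutation `τ^l` of the letters. -/
def shiftPerm (m : ℕ) (l : ZMod T) : Equiv.Perm (ZMod T × Fin m) :=
  (Equiv.addRight l).prodCongr (Equiv.refl _)

@[simp] theorem shiftPerm_apply (l : ZMod T) (x : ZMod T × Fin m) :
    shiftPerm m l x = (x.1 + l, x.2) := rfl

@[simp] theorem shiftPerm_symm_apply (l : ZMod T) (x : ZMod T × Fin m) :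
    (shiftPerm m l).symm x = (x.1 - l, x.2) := by
  rw [Equiv.symm_apply_eq]; simp

variable {a : ZMod T × Fin m → ZMod T × Fin m → ℂ}

/-- The exponent of the coordinate of an index in a word. -/
def posExp (k : Fin m → ZMod T) (w : List (ZMod T × Fin m)) (p : Fin m) : ℕ →₀ ℕ :=
  Finsupp.single (letterPos w (k p, p)) 1

theorem poisCoeff_posExp (a : ZMod T × Fin m → ZMod T × Fin m → ℂ) (k : Fin m → ZMod T)
    (w : List (ZMod T × Fin m)) (p q : Fin m) :
    poisCoeff (pairForm (orderKernel a w)) (posExp k w p) (posExp k w q) =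
      signKernel a w (k p, p) (k q, q) := poisCoeff_single_single _ _ _

/-- The kernel on letters that is obtained from `a` and a function on pairs of indices. -/
def indexKernel (a : ZMod T × Fin m → ZMod T × Fin m → ℂ) (κ : Fin m → Fin m → ℂ)
    (x y : ZMod T × Fin m) : ℂ := a x y * κ x.2 y.2

theorem kerWord_indexKernel (a : ZMod T × Fin m → ZMod T × Fin m → ℂ) {k : Fin m → ZMod T}
    {w : List (ZMod T × Fin m)} (hw : HasPotential k w) {κ : Fin m → Fin m → ℂ}
    (hκ : ∀ p q, κ p q = -κ q p) : kerWord (indexKernel a κ) w =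
      2⁻¹ * ∑ p, ∑ q, signKernel a w (k p, p) (k q, q) * κ p q := by
  have := kerWord_eq_sum a (κ := fun x y => κ x.2 y.2) (fun x y => hκ _ _) hw.nodup
  simp only [hw.sum_map] at this
  exact this

/-- The kernel that is attached to a bracket, restricted to the pairs that satisfy a condition. -/
def nodeKernel (a : ZMod T × Fin m → ZMod T × Fin m → ℂ) (ρ : Fin m → Fin m → ℂ)
    (J : List (ZMod T × Fin m) × List (ZMod T × Fin m)) : ZMod T × Fin m → ZMod T × Fin m → ℂ :=
  indexKernel a fun p q => ρ p q * connect (indices J.1) (indices J.2) p q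

theorem kerWord_nodeKernel (a : ZMod T × Fin m → ZMod T × Fin m → ℂ) {k : Fin m → ZMod T}
    {w : List (ZMod T × Fin m)} (hw : HasPotential k w) {ρ : Fin m → Fin m → ℂ}
    (hρ : ∀ p q, ρ p q = ρ q p) (J : List (ZMod T × Fin m) × List (ZMod T × Fin m)) :
    kerWord (nodeKernel a ρ J) w = ∑ p ∈ indices J.1, ∑ q ∈ indices J.2,
      signKernel a w (k p, p) (k q, q) * ρ p q := by
  rw [nodeKernel, kerWord_indexKernel a hw (fun p q => by rw [hρ, connect_swap, mul_neg]),
    ← sum_mul_connect (indices J.1) (indices J.2)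
      (F := fun p q => signKernel a w (k p, p) (k q, q) * ρ p q)
      (fun p q => by rw [signKernel_swap, hρ, neg_mul])]
  congr 1
  refine Finset.sum_congr rfl fun p _ => Finset.sum_congr rfl fun q _ => ?_
  ring

/-- The sum of the values of `a` over the pairs of indices of a bracket, with weights. -/
def nodeSum (a : ZMod T × Fin m → ZMod T × Fin m → ℂ) (k : Fin m → ZMod T)
    (ρ : Fin m → Fin m → ℂ) (J : List (ZMod T × Fin m) × List (ZMod T × Fin m)) : ℂ :=
  ∑ p ∈ indices J.1, ∑ q ∈ indices J.2, a (k p, p) (k q, q) * ρ p q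

theorem kerPair_indexKernel (a : ZMod T × Fin m → ZMod T × Fin m → ℂ) {k : Fin m → ZMod T}
    {c : FreeMagma (ZMod T × Fin m)} (hc : HasPotential k (content c)) (κ : Fin m → Fin m → ℂ)
    {J : List (ZMod T × Fin m) × List (ZMod T × Fin m)} (hJ : J ∈ nodes c) :
    kerPair (indexKernel a κ) J = nodeSum a k κ J := by
  have h := nodes_sublist hJ
  have h1 := (List.sublist_append_left J.1 J.2).trans h
  have h2 := (List.sublist_append_right J.1 J.2).trans h
  simp only [kerPair, hc.sum_map_sublist h1, hc.sum_map_sublist h2]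
  rfl

/-- The exponent of a letter in the doubled Poisson algebra, according to its side. -/
def sideExp (k : Fin m → ZMod T) (w : List (ZMod T × Fin m)) (U : Finset (Fin m))
    (x : ZMod T × Fin m) : (ℕ →₀ ℕ) × (ℕ →₀ ℕ) :=
  if x.2 ∈ U then (posExp k w x.2, 0) else (0, posExp k w x.2)

section Fixed

variable {k k' : Fin m → ZMod T} {l : ZMod T} {U : Finset (Fin m)}
  {w : List (ZMod T × Fin m)} {d : FreeMagma (ZMod T × Fin m)}

/-- The indicator function of the pairs that are on the same side. -/
def sameSide (U : Finset (Fin m)) (p q : Fin m) : ℂ := if p ∈ U ↔ q ∈ U then 1 else 0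

theorem poisCoeff_sideExp_fst (ha : ∀ x y, a x y = a y x) (p q : Fin m) (z z' : ZMod T) :
    (poisCoeff (doubled (pairForm (orderKernel a w)) (pairForm (crossKernel a (shiftPerm m l) w)))
      (sideExp k w U (z, p)) (sideExp k w U (z', q))).fst =
      signKernel a w (k p, p) (k q, q) * sameSide U p q := by
  rw [← poisCoeff_posExp]
  by_cases hp : p ∈ U <;> by_cases hq : q ∈ U <;>
    simp [poisCoeff, sideExp, hp, hq, doubled_apply, sameSide]

/-- Only pairs on different sides are coupled. The translate built into `crossKernel` undoes the
shift by `l` on the second side, so the coupling is the value of `a` on the original letters of the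
commutator. -/
theorem poisCoeff_sideExp_snd (ha : ∀ x y, a x y = a y x) (hw : HasPotential k w)
    (hU : ∀ p ∈ U, k p = k' p) (hU' : ∀ p ∉ U, k p = k' p + l) (p q : Fin m) (z z' : ZMod T) :
    (poisCoeff (doubled (pairForm (orderKernel a w)) (pairForm (crossKernel a (shiftPerm m l) w)))
      (sideExp k w U (z, p)) (sideExp k w U (z', q))).snd =
      a (k' p, p) (k' q, q) * connect U Uᶜ p q := by
  have hmem : ∀ p, (k p, p) ∈ w := fun p => (hw.mem_iff _).mpr rfl
  have h : ∀ p ∈ U, ∀ q ∉ U, pairForm (crossKernel a (shiftPerm m l) w) (posExp k w p)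
      (posExp k w q) = a (k' p, p) (k' q, q) := by
    intro p hp q hq
    rw [posExp, posExp, pairForm_single, crossKernel, getElem?_letterPos (hmem p),
      getElem?_letterPos (hmem q)]
    simp [optKernel, hU p hp, hU' q hq]
  by_cases hp : p ∈ U <;> by_cases hq : q ∈ U
  · simp [poisCoeff, sideExp, hp, hq, doubled_apply, connect]
  · simp [poisCoeff, sideExp, hp, hq, doubled_apply, connect, h p hp q hq]
  · simp [poisCoeff, sideExp, hp, hq, doubled_apply, connect, h q hq p hp, ha (k' q, q)]
  · simp [poisCoeff, sideExp, hp, hq, doubled_apply, connect]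

/-- As `l ≠ 0`, each letter of `d` meets the word `w` in exactly one copy: in the first one if its
index lies in `U`, and in the second one otherwise. So every letter goes to a monomial. -/
theorem doubledHom_commutator (hl : l ≠ 0) (hw : HasPotential k w)
    (hd : HasPotential k' (content d))
    (hU : ∀ p ∈ U, k p = k' p) (hU' : ∀ p ∉ U, k p = k' p + l) :
    doubledHom (pairForm (orderKernel a w)) (pairForm (crossKernel a (shiftPerm m l) w))
      (letterSum a w) (fun x => letterSum a w (shiftPerm m l x)) (commutator d) =
      mono _ (∑ p ∈ U, posExp k w p, ∑ p ∈ Uᶜ, posExp k w p)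
        ((nodes d).map fun J => poisCoeff (doubled (pairForm (orderKernel a w))
          (pairForm (crossKernel a (shiftPerm m l) w))) (J.1.map (sideExp k w U)).sum
            (J.2.map (sideExp k w U)).sum).prod := by
  have h1 : ∀ x ∈ content d, inclLeft (pairForm (orderKernel a w))
      (pairForm (crossKernel a (shiftPerm m l) w)) (letterSum a w x) +
      inclRight (pairForm (orderKernel a w))
      (pairForm (crossKernel a (shiftPerm m l) w)) (letterSum a w (shiftPerm m l x)) =
      mono _ (sideExp k w U x) 1 := by
    rintro ⟨z, p⟩ hx
    have hz : z = k' p := (hd.mem_iff _).mp hx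
    subst hz
    by_cases hp : p ∈ U
    · rw [letterSum_of_mem a hw.nodup ((hw.mem_iff _).mpr (hU p hp).symm),
        letterSum_of_notMem a (fun h => ?_), map_zero, add_zero, inclLeft_mono, sideExp, if_pos hp,
        posExp, hU p hp]
      · rfl
      · have := (hw.mem_iff _).mp h
        simp [hU p hp] at this
        exact hl this
    · have hp' := hU' p hp
      rw [letterSum_of_notMem a (fun h => ?_), map_zero, zero_add,
        letterSum_of_mem a hw.nodup ((hw.mem_iff _).mpr hp'.symm), inclRight_mono, sideExp,
        if_neg hp, posExp, hp']
      · rfl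
      · have := (hw.mem_iff _).mp h
        simp [hp'] at this
        exact hl this
  rw [doubledHom, lift_commutator_eq_mono h1]
  congr 1
  rw [contentSum, hd.sum_map, Prod.ext_iff]
  simp only [Prod.fst_sum, Prod.snd_sum]
  constructor
  · have : ∀ p, (sideExp k w U (k' p, p)).1 = if p ∈ U then posExp k w p else 0 := fun p => by
      unfold sideExp; split_ifs <;> rfl
    simp only [this, Finset.sum_ite_mem, Finset.univ_inter]
  · have : ∀ p, (sideExp k w U (k' p, p)).2 = if p ∈ Uᶜ then posExp k w p else 0 := fun p => by
      unfold sideExp; simp only [Finset.mem_compl]; split_ifs <;> rfl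
    simp only [this, Finset.sum_ite_mem, Finset.univ_inter]

/-- By the Leibniz rule for ε, one bracket `J i` connects the two sides and all others only see
pairs on the same side. Contraction contributes the bracket of the two complete sides, which is the
kernel `connect U Uᶜ` on `w`. -/
theorem coeff_contractEps_doubledHom (ha : ∀ x y, a x y = a y x) (hl : l ≠ 0)
    (hw : HasPotential k w) (hd : HasPotential k' (content d))
    (hU : ∀ p ∈ U, k p = k' p) (hU' : ∀ p ∉ U, k p = k' p + l) {n : ℕ}
    {J : Fin n → List (ZMod T × Fin m) × List (ZMod T × Fin m)} (hJ : (nodes d).Perm (List.ofFn J)) :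
    coeff (fullExp w.length) (contractEps _ _ (doubledHom (pairForm (orderKernel a w))
      (pairForm (crossKernel a (shiftPerm m l) w)) (letterSum a w)
      (fun x => letterSum a w (shiftPerm m l x)) (commutator d))) =
    ∑ i, nodeSum a k' (connect U Uᶜ) (J i) * (kerWord (indexKernel a (connect U Uᶜ)) w *
      ∏ j ∈ Finset.univ.erase i, kerWord (nodeKernel a (sameSide U) (J j)) w) := by
  classical
  have hJmem : ∀ i, J i ∈ nodes d := fun i => hJ.mem_iff.mpr (by simp)
  rw [doubledHom_commutator hl hw hd hU hU', contractEps_mono, coeff_mono, if_pos]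
  · rw [(hJ.map _).prod_eq, List.map_ofFn, List.prod_ofFn, snd_finset_prod, Finset.mul_sum]
    refine Finset.sum_congr rfl fun i _ => ?_
    have h1 : poisCoeff (pairForm (orderKernel a w)) (∑ p ∈ U, posExp k w p)
        (∑ p ∈ Uᶜ, posExp k w p) = kerWord (indexKernel a (connect U Uᶜ)) w := by
      rw [poisCoeff_sum_sum, kerWord_indexKernel a hw (connect_swap _ _),
        sum_mul_connect _ _ (F := fun p q => signKernel a w (k p, p) (k q, q))
          (fun p q => signKernel_swap _ _ _ _)]
      simp only [poisCoeff_posExp]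
    have h2 : ∀ J ∈ nodes d, poisCoeff (doubled (pairForm (orderKernel a w))
          (pairForm (crossKernel a (shiftPerm m l) w))) (J.1.map (sideExp k w U)).sum
            (J.2.map (sideExp k w U)).sum = ∑ p ∈ indices J.1, ∑ q ∈ indices J.2,
          poisCoeff (doubled (pairForm (orderKernel a w))
          (pairForm (crossKernel a (shiftPerm m l) w))) (sideExp k w U (k' p, p))
            (sideExp k w U (k' q, q)) := by
      intro J hJ
      have h := nodes_sublist hJ
      have h1 := (List.sublist_append_left J.1 J.2).trans h
      have h2 := (List.sublist_append_right J.1 J.2).trans h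
      rw [hd.sum_map_sublist h1, hd.sum_map_sublist h2, poisCoeff_sum_sum]
    rw [h1]
    simp only [Function.comp_apply, h2 _ (hJmem _)]
    rw [mul_left_comm]
    congr 1
    · simp only [TrivSqZeroExt.snd_sum, poisCoeff_sideExp_snd ha hw hU hU']; rfl
    · congr 1
      refine Finset.prod_congr rfl fun j _ => ?_
      simp only [TrivSqZeroExt.fst_sum, poisCoeff_sideExp_fst ha]
      rw [kerWord_nodeKernel a hw (fun p q => by simp only [sameSide, iff_comm])]
  · rw [fullExp_eq_sum_letterPos hw.nodup, hw.sum_map]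
    exact Finset.sum_add_sum_compl U (posExp k w)

/-- The commutator goes to the full monomial, so `diagOp` multiplies it by `quadForm` of the full
exponent; the brackets contribute one kernel each. -/
theorem coeff_diagOp_lift (hw : HasPotential k w) (hd : HasPotential k (content d)) {n : ℕ}
    {J : Fin n → List (ZMod T × Fin m) × List (ZMod T × Fin m)} (hJ : (nodes d).Perm (List.ofFn J)) :
    coeff (fullExp w.length) (diagOp _ (quadForm (crossKernel a (shiftPerm m l) w))
      (FreeLieAlgebra.lift ℂ (letterSum a w) (commutator d))) =
    (∑ p, a (k p, p) (k p - l, p) - ∑ p, ∑ q, a (k p, p) (k q - l, q)) *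
      ∏ j, kerWord (nodeKernel a (fun _ _ => 1) (J j)) w := by
  classical
  have hJmem : ∀ i, J i ∈ nodes d := fun i => hJ.mem_iff.mpr (by simp)
  have h1 : ∀ x ∈ content d, letterSum a w x = mono _ (posExp k w x.2) 1 := by
    rintro ⟨z, p⟩ hx
    have hz : z = k p := (hd.mem_iff _).mp hx
    subst hz
    exact letterSum_of_mem a hw.nodup ((hw.mem_iff (k p, p)).mpr rfl)
  rw [lift_commutator_eq_mono h1, diagOp_mono, contentSum, hd.sum_map, fullExp_eq_sum_letterPos hw.nodup,
    hw.sum_map, coeff_mono]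
  change (if ∑ p, posExp k w p = ∑ p, posExp k w p then
    quadForm _ (∑ p, posExp k w p) * _ else 0) = _
  rw [if_pos rfl]
  have h2 : quadForm (crossKernel a (shiftPerm m l) w)
      (∑ p, posExp k w p) =
      ∑ p, a (k p, p) (k p - l, p) - ∑ p, ∑ q, a (k p, p) (k q - l, q) := by
    have := quadForm_fullExp a (shiftPerm m l) w
    rw [fullExp_eq_sum_letterPos hw.nodup] at this
    simp only [hw.sum_map, shiftPerm_symm_apply] at this
    exact this
  rw [h2, (hJ.map _).prod_eq, List.map_ofFn, List.prod_ofFn]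
  congr 1
  refine Finset.prod_congr rfl fun j _ => ?_
  have h := nodes_sublist (hJmem j)
  have h1 := (List.sublist_append_left _ _).trans h
  have h2 := (List.sublist_append_right _ _).trans h
  rw [Function.comp_apply, hd.sum_map_sublist h1, hd.sum_map_sublist h2, poisCoeff_sum_sum,
    kerWord_nodeKernel a hw (fun _ _ => rfl)]
  simp only [poisCoeff_posExp, mul_one]

end Fixed

end WordValues

/-! ### Alternating sums of the derivations, and their totals over the powers of `τ` -/

section CrossSums

open LogPoisson

variable {T m n : ℕ} [NeZero T] {a : ZMod T × Fin m → ZMod T × Fin m → ℂ}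

theorem sameSide_swap (U : Finset (Fin m)) (p q : Fin m) : sameSide U p q = sameSide U q p := by
  simp only [sameSide, iff_comm]

theorem indexKernel_swap (ha : ∀ x y, a x y = a y x) {κ : Fin m → Fin m → ℂ}
    (hκ : ∀ p q, κ p q = -κ q p) (x y : ZMod T × Fin m) :
    indexKernel a κ x y = -indexKernel a κ y x := by
  rw [indexKernel, indexKernel, ha, hκ, mul_neg]

/-- The alternating sum of a product of index kernels over the words of a commutator. -/
theorem wordSum_prod_indexKernel (ha : ∀ x y, a x y = a y x) {k : Fin m → ZMod T}
    {c : FreeMagma (ZMod T × Fin m)} (hc : HasPotential k (content c))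
    {J : Fin n → List (ZMod T × Fin m) × List (ZMod T × Fin m)} (hJ : (nodes c).Perm (List.ofFn J))
    {κ : Fin n → Fin m → Fin m → ℂ} (hκ : ∀ i p q, κ i p q = -κ i q p) :
    wordSum (fun w => ∏ i, kerWord (indexKernel a (κ i)) w) c =
      ∑ s : Equiv.Perm (Fin n), ∏ i, nodeSum a k (κ (s i)) (J i) := by
  have hJmem : ∀ i, J i ∈ nodes c := fun i => hJ.mem_iff.mpr (by simp)
  rw [wordSum_prod_kerWord (fun i => indexKernel_swap ha (hκ i)) c _
    (by rw [hJ.length_eq]; simp), permSum_perm _ hJ, permSum_univ]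
  refine Finset.sum_congr rfl fun s _ => Finset.prod_congr rfl fun i _ => ?_
  exact kerPair_indexKernel a hc _ (hJmem i)

/-- The function on pairs of indices that is attached to the two sides of a bracket. -/
def nodeConnect (J : List (ZMod T × Fin m) × List (ZMod T × Fin m)) : Fin m → Fin m → ℂ :=
  connect (indices J.1) (indices J.2)

/-- The functions on pairs of indices that are attached to brackets, of which the one with index `i`
is replaced by the one that connects the two sides. -/
def mixedConnect (U : Finset (Fin m))
    (J : Fin n → List (ZMod T × Fin m) × List (ZMod T × Fin m)) (i j : Fin n) :
    Fin m → Fin m → ℂ :=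
  if j = i then connect U Uᶜ else fun p q => sameSide U p q * nodeConnect (J j) p q

theorem nodeSum_zero (k : Fin m → ZMod T) (J : List (ZMod T × Fin m) × List (ZMod T × Fin m))
    {κ : Fin m → Fin m → ℂ} (h : ∀ p q, κ p q = 0) : nodeSum a k κ J = 0 := by
  simp [nodeSum, h]

theorem nodeSum_neg (k : Fin m → ZMod T) (J : List (ZMod T × Fin m) × List (ZMod T × Fin m))
    {κ κ' : Fin m → Fin m → ℂ} (h : ∀ p q, κ p q = -κ' p q) :
    nodeSum a k κ J = -nodeSum a k κ' J := by
  simp [nodeSum, h]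

variable {k k' : Fin m → ZMod T} {l : ZMod T} {c d : FreeMagma (ZMod T × Fin m)}
  {J J' : Fin n → List (ZMod T × Fin m) × List (ZMod T × Fin m)}

theorem crossValue_commutator (t : Equiv.Perm (ZMod T × Fin m)) (d : FreeMagma (ZMod T × Fin m))
    (w : List (ZMod T × Fin m)) : crossValue a t (commutator d) w =
      coeff (fullExp w.length) (contractEps _ _ (doubledHom (pairForm (orderKernel a w))
        (pairForm (crossKernel a t w)) (letterSum a w) (fun x => letterSum a w (t x))
        (commutator d))) +
      coeff (fullExp w.length) (diagOp _ (quadForm (crossKernel a t w))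
        (FreeLieAlgebra.lift ℂ (letterSum a w) (commutator d))) := rfl

/-- The value of the derivation on a commutator with the same potential. -/
theorem wordSum_crossValue_of_eq (ha : ∀ x y, a x y = a y x) (hl : l ≠ 0)
    (hc : HasPotential k (content c)) (hd : HasPotential k (content d))
    (hJ : (nodes d).Perm (List.ofFn J)) (hJ' : (nodes c).Perm (List.ofFn J')) :
    wordSum (crossValue a (shiftPerm m l) (commutator d)) c =
      (∑ p, a (k p, p) (k p - l, p) - ∑ p, ∑ q, a (k p, p) (k q - l, q)) *
        ∑ s : Equiv.Perm (Fin n), ∏ i, nodeSum a k (nodeConnect (J (s i))) (J' i) := by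
  rw [← wordSum_prod_indexKernel (κ := fun i => nodeConnect (J i)) ha hc hJ'
    (fun i => connect_swap _ _), ← wordSum_mul_left]
  refine wordSum_congr fun w hw => ?_
  have hw' := hc.perm hw
  -- All letters of `d` already occur in `w` without translation, so every index is on the first
  -- side. No bracket connects two sides, and only the term of `diagOp` is left.
  rw [crossValue_commutator, coeff_contractEps_doubledHom ha hl hw' hd (U := Finset.univ)
    (fun _ _ => rfl) (fun p hp => absurd (Finset.mem_univ p) hp) hJ, coeff_diagOp_lift hw' hd hJ,
    Finset.sum_eq_zero, zero_add]
  · simp only [nodeKernel, one_mul]; rfl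
  · intro i _
    rw [nodeSum_zero _ _ (fun p q => by simp [connect]), zero_mul]

/-- The value of the derivation on a commutator whose potential differs by two values. -/
theorem wordSum_crossValue_of_sides (ha : ∀ x y, a x y = a y x) (hl : l ≠ 0)
    (hc : HasPotential k (content c)) (hd : HasPotential k' (content d)) {U : Finset (Fin m)}
    (hU : ∀ p ∈ U, k p = k' p) (hU' : ∀ p ∉ U, k p = k' p + l) {p₀ : Fin m} (hp₀ : p₀ ∉ U)
    (hJ : (nodes d).Perm (List.ofFn J)) (hJ' : (nodes c).Perm (List.ofFn J')) :
    wordSum (crossValue a (shiftPerm m l) (commutator d)) c =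
      ∑ i, nodeSum a k' (connect U Uᶜ) (J i) *
        ∑ s : Equiv.Perm (Fin n), ∏ j, nodeSum a k (mixedConnect U J i (s j)) (J' j) := by
  have hκ : ∀ i j p q, mixedConnect U J i j p q = -mixedConnect U J i j q p := by
    intro i j p q
    unfold mixedConnect
    split_ifs
    · exact connect_swap _ _ _ _
    · simp only [nodeConnect]
      rw [sameSide_swap, connect_swap, mul_neg]
  simp only [fun i => (wordSum_prod_indexKernel ha hc hJ' (hκ i)).symm]
  simp only [← wordSum_mul_left, ← wordSum_finset_sum]
  refine wordSum_congr fun w hw => ?_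
  have hw' := hc.perm hw
  -- The letter of index `p₀` occurs in `w` only after translation by `l`, so the untranslated
  -- homomorphism kills `d` and the term of `diagOp` is absent.
  have h0 : FreeLieAlgebra.lift ℂ (letterSum a w) (commutator d) = 0 := by
    refine lift_commutator_eq_zero ((hd.mem_iff (k' p₀, p₀)).mpr rfl) (letterSum_of_notMem a ?_)
    intro h
    have := (hw'.mem_iff _).mp h
    simp [hU' p₀ hp₀] at this
    exact hl this
  rw [crossValue_commutator, coeff_contractEps_doubledHom ha hl hw' hd hU hU' hJ, h0, map_zero,
    map_zero, add_zero]
  refine Finset.sum_congr rfl fun i _ => ?_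
  rw [← Finset.mul_prod_erase _ _ (Finset.mem_univ i)]
  congr 2
  · simp [mixedConnect]
  · refine Finset.prod_congr rfl fun j hj => ?_
    rw [mixedConnect, if_neg (Finset.ne_of_mem_erase hj)]
    rfl

/-- The value of the derivation on a commutator whose potential differs by other values. -/
theorem wordSum_crossValue_of_ne (hc : HasPotential k (content c))
    (hd : HasPotential k' (content d)) {p : Fin m} (hp : k p ≠ k' p) (hp' : k p ≠ k' p + l) :
    wordSum (crossValue a (shiftPerm m l) (commutator d)) c = 0 := by
  rw [← wordSum_zero c]
  refine wordSum_congr fun w hw => ?_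
  have hw' := hc.perm hw
  have hmem : (k' p, p) ∈ content d := (hd.mem_iff _).mpr rfl
  have h1 : letterSum a w (k' p, p) = 0 := letterSum_of_notMem a fun h =>
    hp ((hw'.mem_iff _).mp h).symm
  have h2 : letterSum a w (shiftPerm m l (k' p, p)) = 0 := letterSum_of_notMem a fun h =>
    hp' ((hw'.mem_iff _).mp h).symm
  rw [crossValue_commutator, lift_commutator_eq_zero hmem h1, doubledHom,
    lift_commutator_eq_zero hmem (by rw [h1, h2, map_zero, map_zero, add_zero])]
  simp

/-- The sum of the values of the derivations of all nontrivial powers of `τ`, over the translates of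
a commutator. -/
def crossTotal (a : ZMod T × Fin m → ZMod T × Fin m → ℂ) (d c : FreeMagma (ZMod T × Fin m)) : ℂ :=
  ∑ j : ZMod T, ∑ l ∈ Finset.univ.erase (0 : ZMod T),
    wordSum (crossValue a (shiftPerm m l) (commutator (FreeMagma.map (shiftPerm m j) d))) c

theorem nodes_map {X Y : Type*} (f : X → Y) (c : FreeMagma X) : nodes (FreeMagma.map f c) =
    (nodes c).map fun J => (J.1.map f, J.2.map f) := by
  induction c with
  | ih1 x => rfl
  | ih2 c d hc hd =>
    rw [map_mul, nodes_mul, nodes_mul, hc, hd, content_map, content_map, List.map_cons,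
      List.map_append]

theorem indices_map (j : ZMod T) (A : List (ZMod T × Fin m)) :
    indices (A.map (shiftPerm m j)) = indices A := by
  rw [indices, List.map_map]; rfl

theorem HasPotential.map_shift {w : List (ZMod T × Fin m)} (h : HasPotential k w) (j : ZMod T) :
    HasPotential (fun p => k p + j) (w.map (shiftPerm m j)) := by
  have := List.Perm.map (shiftPerm m j) h
  rw [List.map_ofFn] at this
  exact this

/-- The translate of a pair of words. -/
def shiftNode (j : ZMod T) (J : List (ZMod T × Fin m) × List (ZMod T × Fin m)) :
    List (ZMod T × Fin m) × List (ZMod T × Fin m) :=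
  (J.1.map (shiftPerm m j), J.2.map (shiftPerm m j))

theorem nodeConnect_shiftNode (j : ZMod T) (J : List (ZMod T × Fin m) × List (ZMod T × Fin m)) :
    nodeConnect (shiftNode j J) = nodeConnect J := by
  simp only [nodeConnect, shiftNode, indices_map]

theorem nodeSum_shiftNode (hτ : ∀ j x y, a (shiftPerm m j x) (shiftPerm m j y) = a x y)
    (j : ZMod T) (κ : Fin m → Fin m → ℂ)
    (J : List (ZMod T × Fin m) × List (ZMod T × Fin m)) :
    nodeSum a (fun p => k p + j) κ (shiftNode j J) = nodeSum a k κ J := by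
  simp only [nodeSum, shiftNode, indices_map]
  refine Finset.sum_congr rfl fun p _ => Finset.sum_congr rfl fun q _ => ?_
  rw [← hτ j (k p, p) (k q, q)]; rfl

theorem mixedConnect_shiftNode (U : Finset (Fin m)) (j : ZMod T) (i i' : Fin n) :
    mixedConnect U (fun i => shiftNode j (J i)) i i' = mixedConnect U J i i' := by
  simp only [mixedConnect, nodeConnect_shiftNode]

theorem perm_nodes_map (hJ : (nodes d).Perm (List.ofFn J)) (j : ZMod T) :
    (nodes (FreeMagma.map (shiftPerm m j) d)).Perm (List.ofFn fun i => shiftNode j (J i)) := by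
  rw [nodes_map]
  have := hJ.map (shiftNode j)
  rw [List.map_ofFn] at this
  exact this

/-- Only the translate `j = u` contributes. If `j + l = u`, all indices are on the second side, and
the empty first side cannot be connected to it; for other `j` some letter meets the word in neither
copy. -/
theorem crossTotal_of_const (ha : ∀ x y, a x y = a y x)
    (hc : HasPotential k (content c)) (hd : HasPotential k' (content d))
    (hJ : (nodes d).Perm (List.ofFn J)) (hJ' : (nodes c).Perm (List.ofFn J')) (p₀ : Fin m)
    {u : ZMod T} (hu : ∀ p, k p = k' p + u) :
    crossTotal a d c = (∑ l ∈ Finset.univ.erase (0 : ZMod T),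
      (∑ p, a (k p, p) (k p - l, p) - ∑ p, ∑ q, a (k p, p) (k q - l, q))) *
        ∑ s : Equiv.Perm (Fin n), ∏ i, nodeSum a k (nodeConnect (J (s i))) (J' i) := by
  have hk : k = fun p => k' p + u := funext hu
  have hd' : ∀ j, HasPotential (fun p => k' p + j)
      (content (FreeMagma.map (shiftPerm m j) d)) := fun j => by
    rw [content_map]; exact hd.map_shift j
  rw [crossTotal, Finset.sum_eq_single u, Finset.sum_mul]
  · refine Finset.sum_congr rfl fun l hl => ?_
    rw [wordSum_crossValue_of_eq ha (Finset.ne_of_mem_erase hl) hc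
      (by have := hd' u; rwa [← hk] at this) (perm_nodes_map hJ u) hJ']
    simp only [nodeConnect_shiftNode]
  · intro j _ hj
    refine Finset.sum_eq_zero fun l hl => ?_
    by_cases hjl : j + l = u
    · rw [wordSum_crossValue_of_sides ha (Finset.ne_of_mem_erase hl) hc (hd' j) (U := ∅)
        (by simp) (fun p _ => by rw [hu, ← hjl]; ring) (Finset.notMem_empty p₀)
        (perm_nodes_map hJ j) hJ']
      refine Finset.sum_eq_zero fun i _ => ?_
      rw [nodeSum_zero _ _ (fun p q => by simp [connect]), zero_mul]
    · refine wordSum_crossValue_of_ne hc (hd' j) (p := p₀) ?_ ?_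
      · rw [hu]; simpa using Ne.symm hj
      · rw [hu, add_assoc]; simpa using Ne.symm hjl
  · simp

/-- Exchanging the two sides reverses the connecting kernel and leaves the kernels of the same-side
pairs alone. -/
theorem mixedConnect_compl (U : Finset (Fin m)) (i j : Fin n) (p q : Fin m) :
    mixedConnect Uᶜ J i j p q = (if j = i then -1 else 1) * mixedConnect U J i j p q := by
  unfold mixedConnect
  split_ifs
  · rw [compl_compl]; simp [connect]
  · have : sameSide Uᶜ p q = sameSide U p q := by simp [sameSide, not_iff_not]
    change sameSide Uᶜ p q * _ = 1 * (sameSide U p q * _)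
    rw [this, one_mul]

/-- A pair `(j, l)` produces the shifts `j` and `j + l`, which must be `u` and `v`. The two possible
pairs, `(u, v - u)` and `(v, u - v)`, contribute equally, hence the factor two. -/
theorem crossTotal_of_sides (ha : ∀ x y, a x y = a y x)
    (hτ : ∀ j x y, a (shiftPerm m j x) (shiftPerm m j y) = a x y)
    (hc : HasPotential k (content c)) (hd : HasPotential k' (content d))
    (hJ : (nodes d).Perm (List.ofFn J)) (hJ' : (nodes c).Perm (List.ofFn J'))
    {U : Finset (Fin m)} {u v : ZMod T} (huv : u ≠ v) (hU : ∀ p ∈ U, k p = k' p + u)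
    (hU' : ∀ p ∉ U, k p = k' p + v) {p₀ p₁ : Fin m} (hp₀ : p₀ ∈ U) (hp₁ : p₁ ∉ U) :
    crossTotal a d c = 2 * ∑ i, nodeSum a k' (connect U Uᶜ) (J i) *
        ∑ s : Equiv.Perm (Fin n), ∏ j, nodeSum a k (mixedConnect U J i (s j)) (J' j) := by
  have hd' : ∀ j, HasPotential (fun p => k' p + j)
      (content (FreeMagma.map (shiftPerm m j) d)) := fun j => by
    rw [content_map]; exact hd.map_shift j
  have hne : ∀ j l, l ≠ 0 → (j ≠ u ∨ l ≠ v - u) → (j ≠ v ∨ l ≠ u - v) →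
      wordSum (crossValue a (shiftPerm m l) (commutator (FreeMagma.map (shiftPerm m j) d))) c
        = 0 := by
    intro j l hl h1 h2
    by_cases hA : (u ≠ j ∧ u ≠ j + l)
    · refine wordSum_crossValue_of_ne hc (hd' j) (p := p₀) ?_ ?_
      · rw [hU _ hp₀]; simpa using hA.1
      · rw [hU _ hp₀, add_assoc]; simpa using hA.2
    · by_cases hB : (v ≠ j ∧ v ≠ j + l)
      · refine wordSum_crossValue_of_ne hc (hd' j) (p := p₁) ?_ ?_
        · rw [hU' _ hp₁]; simpa using hB.1
        · rw [hU' _ hp₁, add_assoc]; simpa using hB.2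
      · exfalso
        rw [not_and_or, not_not, not_not] at hA hB
        rcases hA with rfl | rfl
        · rcases hB with h | rfl
          · exact huv h.symm
          · rcases h1 with h | h <;> simp at h
        · rcases hB with rfl | h
          · rcases h2 with h | h <;> simp at h
          · exact huv h.symm
  have hval : ∀ (W : Finset (Fin m)) (x y : ZMod T), x ≠ y → (∀ p ∈ W, k p = k' p + x) →
      (∀ p ∉ W, k p = k' p + y) → (∃ p, p ∉ W) →
      wordSum (crossValue a (shiftPerm m (y - x))
        (commutator (FreeMagma.map (shiftPerm m x) d))) c =
      ∑ i, nodeSum a k' (connect W Wᶜ) (J i) *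
        ∑ s : Equiv.Perm (Fin n), ∏ j, nodeSum a k (mixedConnect W J i (s j)) (J' j) := by
    rintro W x y hxy hW hW' ⟨p, hp⟩
    rw [wordSum_crossValue_of_sides ha (sub_ne_zero.mpr hxy.symm) hc (hd' x) hW
      (fun p hp => by rw [hW' p hp]; ring) hp (perm_nodes_map hJ x) hJ']
    simp only [nodeSum_shiftNode hτ, mixedConnect_shiftNode]
  -- Passing to the complement changes two signs, one in the factor of the connecting bracket and
  -- one in the kernel that replaces it.
  have hsym : ∑ i, nodeSum a k' (connect Uᶜ Uᶜᶜ) (J i) *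
        ∑ s : Equiv.Perm (Fin n), ∏ j, nodeSum a k (mixedConnect Uᶜ J i (s j)) (J' j) =
      ∑ i, nodeSum a k' (connect U Uᶜ) (J i) *
        ∑ s : Equiv.Perm (Fin n), ∏ j, nodeSum a k (mixedConnect U J i (s j)) (J' j) := by
    refine Finset.sum_congr rfl fun i _ => ?_
    have h1 : nodeSum a k' (connect Uᶜ Uᶜᶜ) (J i) = -nodeSum a k' (connect U Uᶜ) (J i) :=
      nodeSum_neg _ _ fun p q => by rw [compl_compl]; simp [connect]
    have h2 : ∀ j j', nodeSum a k (mixedConnect Uᶜ J i j) (J' j') =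
        (if j = i then -1 else 1) * nodeSum a k (mixedConnect U J i j) (J' j') := by
      intro j j'
      simp only [nodeSum, Finset.mul_sum, mixedConnect_compl]
      refine Finset.sum_congr rfl fun p _ => Finset.sum_congr rfl fun q _ => ?_
      ring
    rw [h1, neg_mul, ← mul_neg]
    congr 1
    rw [← Finset.sum_neg_distrib]
    refine Finset.sum_congr rfl fun s _ => ?_
    simp only [h2, Finset.prod_mul_distrib]
    have h3 : ∏ j, (if s j = i then (-1 : ℂ) else 1) = -1 := by
      rw [Finset.prod_eq_single (s.symm i)]
      · simp
      · intro j _ hj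
        rw [if_neg]
        rintro rfl
        simp at hj
      · simp
    rw [h3]; ring
  have h1 := hval U u v huv hU hU' ⟨p₁, hp₁⟩
  have h2 := hval Uᶜ v u huv.symm (fun p hp => hU' p (Finset.mem_compl.mp hp))
    (fun p hp => hU p (by simpa using hp)) ⟨p₀, by simpa using hp₀⟩
  rw [hsym] at h2
  rw [crossTotal, ← Finset.sum_subset (Finset.subset_univ {u, v}), Finset.sum_pair huv,
    Finset.sum_eq_single (v - u), Finset.sum_eq_single (u - v), h1, h2, two_mul]
  · intro l hl hl'
    exact hne v l (Finset.ne_of_mem_erase hl) (Or.inl huv.symm) (Or.inr hl')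
  · intro h; exact absurd (by simp [sub_eq_zero, huv]) h
  · intro l hl hl'
    exact hne u l (Finset.ne_of_mem_erase hl) (Or.inr hl') (Or.inl huv)
  · intro h; exact absurd (by simp [sub_eq_zero, huv.symm]) h
  · intro j _ hj
    simp only [Finset.mem_insert, Finset.mem_singleton, not_or] at hj
    exact Finset.sum_eq_zero fun l hl =>
      hne j l (Finset.ne_of_mem_erase hl) (Or.inl hj.1) (Or.inl hj.2)

/-- For given `j` and `l`, each letter can be shifted only by `j` or by `j + l`, so three different
shifts cannot all occur. -/
theorem crossTotal_of_three (hc : HasPotential k (content c)) (hd : HasPotential k' (content d))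
    {p₀ p₁ p₂ : Fin m} (h01 : k p₀ - k' p₀ ≠ k p₁ - k' p₁) (h02 : k p₀ - k' p₀ ≠ k p₂ - k' p₂)
    (h12 : k p₁ - k' p₁ ≠ k p₂ - k' p₂) : crossTotal a d c = 0 := by
  have hd' : ∀ j, HasPotential (fun p => k' p + j)
      (content (FreeMagma.map (shiftPerm m j) d)) := fun j => by
    rw [content_map]; exact hd.map_shift j
  refine Finset.sum_eq_zero fun j _ => Finset.sum_eq_zero fun l hl => ?_
  have key : ∃ p, k p - k' p ≠ j ∧ k p - k' p ≠ j + l := by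
    by_contra! h
    by_cases h0 : k p₀ - k' p₀ = j
    · have h1 := h p₁ (fun h => h01 (h0.trans h.symm))
      have h2 := h p₂ (fun h => h02 (h0.trans h.symm))
      exact h12 (h1.trans h2.symm)
    · have h0' := h p₀ h0
      by_cases h1 : k p₁ - k' p₁ = j
      · exact h02 (h0'.trans (h p₂ (fun h => h12 (h1.trans h.symm))).symm)
      · exact h01 (h0'.trans (h p₁ h1).symm)
  obtain ⟨p, hp, hp'⟩ := key
  refine wordSum_crossValue_of_ne hc (hd' j) (p := p) (fun h => hp ?_) (fun h => hp' ?_)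
  · rw [h]; ring
  · rw [h]; ring

end CrossSums

/-! ### The flag of a commutator -/

section Orientation

variable {T m : ℕ} [NeZero T]

/-- The vector of an oriented edge. -/
def edgeVec (e : Fin m × Fin m) : Fin m → ℂ := Pi.single e.1 1 - Pi.single e.2 1

/-- The indicator function of the indices of a bracketed word. -/
def indicatorVec (g : FreeMagma (ZMod T × Fin m)) : Fin m → ℂ :=
  ∑ p ∈ indices (content g), Pi.single p 1

/-- The product of a list of vectors in the exterior algebra. -/
def wedge (l : List (Fin m → ℂ)) : ExteriorAlgebra ℂ (Fin m → ℂ) :=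
  (l.map (ExteriorAlgebra.ι ℂ)).prod

theorem wedge_append (l l' : List (Fin m → ℂ)) : wedge (l ++ l') = wedge l * wedge l' := by
  simp [wedge]

theorem wedge_cons (x : Fin m → ℂ) (l : List (Fin m → ℂ)) :
    wedge (x :: l) = ExteriorAlgebra.ι ℂ x * wedge l := by simp [wedge]

theorem ι_mul_wedge_eq_zero {x : Fin m → ℂ} {l : List (Fin m → ℂ)}
    (h : x ∈ Submodule.span ℂ {y | y ∈ l}) : ExteriorAlgebra.ι ℂ x * wedge l = 0 := by
  induction h using Submodule.span_induction with
  | zero => simp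
  | add x y _ _ hx hy => rw [map_add, add_mul, hx, hy, add_zero]
  | smul z x _ hx => rw [map_smul, smul_mul_assoc, hx, smul_zero]
  | mem y hy =>
    obtain ⟨u, v, rfl⟩ := List.append_of_mem hy
    rw [wedge_append, wedge_cons]
    clear hy
    induction u with
    | nil => simp [wedge, ← mul_assoc]
    | cons z u ih =>
      have hzy := ExteriorAlgebra.ι_add_mul_swap (R := ℂ) y z
      rw [wedge_cons, mul_assoc, ← mul_assoc (ExteriorAlgebra.ι ℂ y),
        eq_neg_of_add_eq_zero_left hzy, neg_mul, mul_assoc, ih, mul_zero, neg_zero]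

/-- The potential of a list of bracketed words in which every index occurs once. -/
def ListPotential (k : Fin m → ZMod T) (gs : List (FreeMagma (ZMod T × Fin m))) : Prop :=
  HasPotential k (gs.flatMap content)

theorem ListPotential.disjoint {k : Fin m → ZMod T} {u v : List (FreeMagma (ZMod T × Fin m))}
    (h : ListPotential k (u ++ v)) {g g' : FreeMagma (ZMod T × Fin m)} (hg : g ∈ u)
    (hg' : g' ∈ v) : Disjoint (indices (content g)) (indices (content g')) := by
  rw [Finset.disjoint_left]
  intro p hp hp'
  simp only [indices, List.mem_toFinset, List.mem_map] at hp hp'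
  obtain ⟨x, hx, rfl⟩ := hp
  obtain ⟨y, hy, hxy⟩ := hp'
  have h' : HasPotential k (u.flatMap content ++ v.flatMap content) := by
    rw [← List.flatMap_append]; exact h
  have hx' : x ∈ u.flatMap content := List.mem_flatMap.mpr ⟨g, hg, hx⟩
  have hy' : y ∈ v.flatMap content := List.mem_flatMap.mpr ⟨g', hg', hy⟩
  have e1 := (h'.mem_iff x).mp (List.mem_append_left _ hx')
  have e2 := (h'.mem_iff y).mp (List.mem_append_right _ hy')
  have : x = y := Prod.ext (by rw [e1, e2, hxy]) hxy.symm
  subst this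
  exact List.disjoint_of_nodup_append h'.nodup hx' hy'

theorem indices_mul (g h : FreeMagma (ZMod T × Fin m)) :
    indices (content (g * h)) = indices (content g) ∪ indices (content h) := by
  ext p; simp [indices, content_mul]

theorem indices_nonempty (g : FreeMagma (ZMod T × Fin m)) : (indices (content g)).Nonempty := by
  obtain ⟨x, hx⟩ := List.exists_mem_of_ne_nil _ (content_ne_nil g)
  exact ⟨x.2, by simpa [indices] using ⟨x.1, hx⟩⟩

theorem indicatorVec_mul {g h : FreeMagma (ZMod T × Fin m)}
    (hd : Disjoint (indices (content g)) (indices (content h))) :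
    indicatorVec (g * h) = indicatorVec g + indicatorVec h := by
  rw [indicatorVec, indices_mul, Finset.sum_union hd]; rfl

/-- An oriented edge goes from the first to the second word of a pair. -/
def Crosses (e : Fin m × Fin m) (J : List (ZMod T × Fin m) × List (ZMod T × Fin m)) : Prop :=
  e.1 ∈ indices J.1 ∧ e.2 ∈ indices J.2

/-- The total number of oriented forests of a given shape. -/
def sizeProd (gs : List (FreeMagma (ZMod T × Fin m))) : ℂ :=
  (gs.map fun g => ((indices (content g)).card : ℂ)).prod

/-- The orientation of a forest with trees `gs` and edges `E`, relative to the standard one. -/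
def OrientedBy (gs : List (FreeMagma (ZMod T × Fin m))) (s : ℤ) (E : List (Fin m × Fin m)) : Prop :=
  wedge (gs.map indicatorVec) * wedge (E.reverse.map edgeVec) =
      ((s : ℂ) * sizeProd gs) • wedge (List.ofFn fun i : Fin m => Pi.single i 1) ∧
    ∀ g ∈ gs, ∀ p ∈ indices (content g), ∀ q ∈ indices (content g),
      edgeVec (p, q) ∈ Submodule.span ℂ {y | y ∈ E.reverse.map edgeVec}

theorem orientedBy_base (k : Fin m → ZMod T) :
    OrientedBy (List.ofFn fun i => FreeMagma.of (k i, i)) 1 [] := by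
  have hi : ∀ i, indices (content (FreeMagma.of (k i, i))) = {i} := fun i => by
    simp [indices, content]
  constructor
  · have h1 : sizeProd (List.ofFn fun i => FreeMagma.of (k i, i)) = 1 := by
      rw [sizeProd, List.map_ofFn, List.prod_ofFn]
      exact Finset.prod_eq_one fun i _ => by simp [hi]
    have h2 : (List.ofFn fun i => FreeMagma.of (k i, i)).map indicatorVec =
        List.ofFn fun i : Fin m => Pi.single i 1 := by
      rw [List.map_ofFn]
      congr 1
      funext i
      simp [indicatorVec, hi]
    rw [h1, h2]
    simp [wedge]
  · intro g hg p hp q hq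
    obtain ⟨i, rfl⟩ := (List.mem_ofFn ..).mp hg
    rw [hi, Finset.mem_singleton] at hp hq
    subst hp; subst hq
    simp [edgeVec]

theorem orientedBy_swap {u v : List (FreeMagma (ZMod T × Fin m))}
    {g h : FreeMagma (ZMod T × Fin m)} {s : ℤ} {E : List (Fin m × Fin m)}
    (ho : OrientedBy (u ++ g :: h :: v) s E) : OrientedBy (u ++ h :: g :: v) (-s) E := by
  refine ⟨?_, fun g' hg' => ho.2 g' ?_⟩
  · have h1 := ho.1
    have hs : sizeProd (u ++ h :: g :: v) = sizeProd (u ++ g :: h :: v) := by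
      simp only [sizeProd, List.map_append, List.map_cons, List.prod_append, List.prod_cons]
      ring
    rw [hs]
    push_cast
    rw [neg_mul, neg_smul, ← h1]
    simp only [List.map_append, List.map_cons, wedge_append, wedge_cons]
    have := ExteriorAlgebra.ι_add_mul_swap (R := ℂ) (indicatorVec h) (indicatorVec g)
    rw [← mul_assoc (ExteriorAlgebra.ι ℂ (indicatorVec h)), eq_neg_of_add_eq_zero_left this]
    simp only [mul_assoc, neg_mul, mul_neg]
  · simp only [List.mem_append, List.mem_cons] at hg' ⊢
    tauto

/-- Modulo the edges already present, a basis vector of an index in a tree equals the indicator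
vector of the tree divided by its size. With sizes `n₁`, `n₂` and indicator vectors `x`, `y`, the
new edge becomes `x/n₁ - y/n₂`, and `(x + y) ∧ (x/n₁ - y/n₂) = (1/n₁ + 1/n₂) y ∧ x`. The scalar is
the change of `sizeProd`, from `n₁ n₂` to `n₁ + n₂`, so the sign is unchanged. -/
theorem orientedBy_join {k : Fin m → ZMod T} {u : List (FreeMagma (ZMod T × Fin m))}
    {g₁ g₂ : FreeMagma (ZMod T × Fin m)} {s : ℤ} {E : List (Fin m × Fin m)}
    (hk : ListPotential k (u ++ [g₂, g₁])) (ho : OrientedBy (u ++ [g₂, g₁]) s E)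
    {e : Fin m × Fin m} (he : Crosses e (content g₁, content g₂)) :
    OrientedBy (u ++ [g₁ * g₂]) s (E ++ [e]) := by
  have hdisj : Disjoint (indices (content g₁)) (indices (content g₂)) := by
    have : ListPotential k ((u ++ [g₂]) ++ [g₁]) := by simpa using hk
    exact (this.disjoint (g := g₂) (g' := g₁) (by simp) (by simp)).symm
  have hspan : ∀ {x}, x ∈ Submodule.span ℂ {y | y ∈ E.reverse.map edgeVec} →
      x ∈ Submodule.span ℂ {y | y ∈ (E ++ [e]).reverse.map edgeVec} := fun hx =>
    Submodule.span_mono (fun y hy => by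
      rw [List.reverse_append]
      exact List.mem_cons_of_mem _ hy) hx
  have he' : edgeVec e ∈ Submodule.span ℂ {y | y ∈ (E ++ [e]).reverse.map edgeVec} :=
    Submodule.subset_span (by simp)
  have h1 := ho.2 g₁ (by simp)
  have h2 := ho.2 g₂ (by simp)
  refine ⟨?_, ?_⟩
  · set Q := wedge (E.reverse.map edgeVec) with hQ
    set n₁ : ℂ := ((indices (content g₁)).card : ℂ) with hn₁
    set n₂ : ℂ := ((indices (content g₂)).card : ℂ) with hn₂
    have hn₁' : n₁ ≠ 0 := by simpa [hn₁] using (indices_nonempty g₁).ne_empty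
    have hn₂' : n₂ ≠ 0 := by simpa [hn₂] using (indices_nonempty g₂).ne_empty
    set x := ExteriorAlgebra.ι ℂ (indicatorVec g₁) with hx
    set y := ExteriorAlgebra.ι ℂ (indicatorVec g₂) with hy
    -- Sum the relations between the vector of `p` and those of all indices of its tree; differences
    -- inside a tree are spanned by edges and vanish after multiplication by `Q`.
    have key : ∀ g ∈ u ++ [g₂, g₁], ∀ p ∈ indices (content g),
        ((indices (content g)).card : ℂ) • (ExteriorAlgebra.ι ℂ (Pi.single p (1 : ℂ)) * Q) =
          ExteriorAlgebra.ι ℂ (indicatorVec g) * Q := by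
      intro g hg p hp
      have : ((indices (content g)).card : ℂ) • Pi.single p (1 : ℂ) - indicatorVec g =
          ∑ q ∈ indices (content g), edgeVec (p, q) := by
        simp only [edgeVec, Finset.sum_sub_distrib, Finset.sum_const, indicatorVec]
        rw [Nat.cast_smul_eq_nsmul]
      have h0 := ι_mul_wedge_eq_zero (l := E.reverse.map edgeVec) (this ▸
        Submodule.sum_mem _ fun q hq => ho.2 g hg p hp q hq)
      rwa [map_sub, map_smul, sub_mul, smul_mul_assoc, sub_eq_zero] at h0
    have e1 := key g₁ (by simp) e.1 he.1
    have e2 := key g₂ (by simp) e.2 he.2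
    have ho1 := ho.1
    simp only [List.map_append, List.map_cons, List.map_nil, wedge_append, wedge_cons] at ho1 ⊢
    have hw0 : wedge ([] : List (Fin m → ℂ)) = 1 := rfl
    have hE : (E ++ [e]).reverse = e :: E.reverse := by simp
    rw [hw0, mul_one] at ho1 ⊢
    rw [hE, List.map_cons, wedge_cons, indicatorVec_mul hdisj, ← hQ]
    rw [← hQ, ← hx, ← hy] at ho1
    rw [← hx] at e1; rw [← hy] at e2
    have e1' : ExteriorAlgebra.ι ℂ (Pi.single e.1 (1 : ℂ)) * Q = n₁⁻¹ • (x * Q) := by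
      rw [← e1, smul_smul, inv_mul_cancel₀ hn₁', one_smul]
    have e2' : ExteriorAlgebra.ι ℂ (Pi.single e.2 (1 : ℂ)) * Q = n₂⁻¹ • (y * Q) := by
      rw [← e2, smul_smul, inv_mul_cancel₀ hn₂', one_smul]
    have hxx : x * x = 0 := ExteriorAlgebra.ι_sq_zero _
    have hyy : y * y = 0 := ExteriorAlgebra.ι_sq_zero _
    have hxy : x * y = -(y * x) := eq_neg_of_add_eq_zero_left (ExteriorAlgebra.ι_add_mul_swap _ _)
    have hev : ExteriorAlgebra.ι ℂ (edgeVec e) * Q = n₁⁻¹ • (x * Q) - n₂⁻¹ • (y * Q) := by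
      rw [edgeVec, map_sub, sub_mul, e1', e2']
    have hmain : ExteriorAlgebra.ι ℂ (indicatorVec g₁ + indicatorVec g₂) *
        (ExteriorAlgebra.ι ℂ (edgeVec e) * Q) = (n₁⁻¹ + n₂⁻¹) • (y * x * Q) := by
      rw [hev, map_add, ← hx, ← hy, mul_sub, mul_smul_comm, mul_smul_comm, add_mul, add_mul,
        ← mul_assoc, ← mul_assoc, ← mul_assoc, ← mul_assoc, hxx, hyy, hxy, zero_mul, neg_mul]
      module
    have hsz : sizeProd (u ++ [g₁ * g₂]) = (n₁⁻¹ + n₂⁻¹) * sizeProd (u ++ [g₂, g₁]) := by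
      simp only [sizeProd, List.map_append, List.prod_append, List.map_cons, List.map_nil,
        List.prod_cons, List.prod_nil, indices_mul, Finset.card_union_of_disjoint hdisj, ← hn₁,
        ← hn₂, Nat.cast_add]
      field_simp
      ring
    rw [mul_assoc, hmain, mul_smul_comm, ← mul_assoc, ho1, smul_smul, hsz]
    congr 1; ring
  · intro g hg p hp q hq
    simp only [List.mem_append, List.mem_singleton] at hg
    rcases hg with hg | rfl
    · exact hspan (ho.2 g (by simp [hg]) p hp q hq)
    · have hadd : ∀ p q r : Fin m, edgeVec (p, r) = edgeVec (p, q) + edgeVec (q, r) := by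
        intro p q r; simp [edgeVec]
      have hneg : ∀ p q : Fin m, edgeVec (p, q) = -edgeVec (q, p) := by
        intro p q; simp [edgeVec]
      have hto : ∀ p ∈ indices (content (g₁ * g₂)),
          edgeVec (p, e.1) ∈ Submodule.span ℂ {y | y ∈ (E ++ [e]).reverse.map edgeVec} := by
        intro p hp
        rw [indices_mul, Finset.mem_union] at hp
        rcases hp with hp | hp
        · exact hspan (h1 p hp _ he.1)
        · rw [hadd p e.2 e.1]
          refine add_mem (hspan (h2 p hp _ he.2)) ?_
          rw [hneg]
          exact neg_mem he'
      rw [hadd p e.1 q, hneg e.1 q]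
      exact add_mem (hto p hp) (neg_mem (hto q hq))

end Orientation

/-! ### The hyperplanes that cut out the flag of a commutator -/

section Lattice

variable {T m : ℕ} [NeZero T] {ω : ℂ}

/-- The character of `ℤ/T` that is defined by a `T`-th root of unity. -/
theorem pow_val_add (hω : IsPrimitiveRoot ω T) (a b : ZMod T) :
    ω ^ (a + b).val = ω ^ a.val * ω ^ b.val := by
  rw [ZMod.val_add, ← pow_add, ← pow_eq_pow_mod _ hω.pow_eq_one]

theorem pow_val_ne_zero (hω : IsPrimitiveRoot ω T) (a : ZMod T) : ω ^ a.val ≠ 0 :=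
  pow_ne_zero _ (hω.ne_zero (NeZero.ne T))

theorem pow_val_inj (hω : IsPrimitiveRoot ω T) {a b : ZMod T} (h : ω ^ a.val = ω ^ b.val) :
    a = b :=
  ZMod.val_injective T (hω.pow_inj (ZMod.val_lt a) (ZMod.val_lt b) h)

theorem mem_eqSpace {k l : ZMod T} {i j : Fin m} {t : Fin m → ℂ} :
    t ∈ eqSpace ω k i l j ↔ ω ^ k.val * t i = ω ^ l.val * t j := by
  simp [eqSpace, sub_eq_zero]

/-- Rescaled coordinates, in which balanced hyperplanes become `s_p = s_q`. -/
def rescale (ω : ℂ) (k : Fin m → ZMod T) (t : Fin m → ℂ) (p : Fin m) : ℂ := ω ^ (k p).val * t p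

theorem exists_rescale_eq (hω : IsPrimitiveRoot ω T) (k : Fin m → ZMod T) (s : Fin m → ℂ) :
    ∃ t, rescale ω k t = s :=
  ⟨fun p => (ω ^ (k p).val)⁻¹ * s p, funext fun p =>
    mul_inv_cancel_left₀ (pow_val_ne_zero hω _) _⟩

theorem mem_diagHyp_iff (hω : IsPrimitiveRoot ω T) (k : Fin m → ZMod T) (h : Diag T m)
    (t : Fin m → ℂ) : t ∈ diagHyp ω h ↔ rescale ω k t h.1.1 =
      ω ^ (h.1.2.2 + k h.1.1 - k h.1.2.1).val * rescale ω k t h.1.2.1 := by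
  rw [diagHyp, mem_eqSpace, rescale, rescale, ← mul_assoc, ← pow_val_add hω, sub_add_cancel,
    add_comm, pow_val_add hω, mul_assoc, mul_right_inj' (pow_val_ne_zero hω _)]
  simp

/-- A diagonal hyperplane that contains the line with the given potential. -/
def Balanced (k : Fin m → ZMod T) (h : Diag T m) : Prop := h.1.2.2 = k h.1.2.1 - k h.1.1

instance (k : Fin m → ZMod T) (h : Diag T m) : Decidable (Balanced k h) :=
  inferInstanceAs (Decidable (_ = _))

theorem balanced_iff {k : Fin m → ZMod T} {h : Diag T m} :
    Balanced k h ↔ h.1.2.2 + k h.1.1 - k h.1.2.1 = 0 := by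
  rw [Balanced, sub_eq_zero, eq_sub_iff_add_eq]

theorem Balanced.mem_iff (hω : IsPrimitiveRoot ω T) {k : Fin m → ZMod T} {h : Diag T m}
    (hb : Balanced k h) {t : Fin m → ℂ} :
    t ∈ diagHyp ω h ↔ rescale ω k t h.1.1 = rescale ω k t h.1.2.1 := by
  rw [mem_diagHyp_iff hω k, balanced_iff.mp hb]; simp

/-- A balanced hyperplane whose indices are separated by a pair of words. -/
def Adapted (k : Fin m → ZMod T) (h : Diag T m)
    (J : List (ZMod T × Fin m) × List (ZMod T × Fin m)) : Prop :=
  Balanced k h ∧ (Crosses (h.1.1, h.1.2.1) J ∨ Crosses (h.1.2.1, h.1.1) J)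

theorem mem_island (k : Fin m → ZMod T) {g : FreeMagma (ZMod T × Fin m)}
    (hg : ∀ x ∈ content g, x.1 = k x.2) {t : Fin m → ℂ} :
    t ∈ island ω g ↔ ∀ p ∈ indices (content g), ∀ q ∈ indices (content g),
      rescale ω k t p = rescale ω k t q := by
  simp only [island, Submodule.mem_iInf, mem_eqSpace, indices, List.mem_toFinset, List.mem_map,
    forall_exists_index, and_imp, forall_apply_eq_imp_iff₂]
  refine forall₂_congr fun x hx => forall₂_congr fun y hy => ?_
  rw [hg x hx, hg y hy]; rfl

theorem ListPotential.fst_eq {k : Fin m → ZMod T} {gs : List (FreeMagma (ZMod T × Fin m))}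
    (h : ListPotential k gs) {g : FreeMagma (ZMod T × Fin m)} (hg : g ∈ gs) :
    ∀ x ∈ content g, x.1 = k x.2 := fun x hx =>
  (HasPotential.mem_iff h x).mp (List.mem_flatMap.mpr ⟨g, hg, hx⟩)

/-- The intersection of the edges of a list of bracketed words. -/
def islands (ω : ℂ) (gs : List (FreeMagma (ZMod T × Fin m))) : Submodule ℂ (Fin m → ℂ) :=
  ⨅ g ∈ gs, island ω g

theorem islands_append (gs gs' : List (FreeMagma (ZMod T × Fin m))) :
    islands ω (gs ++ gs') = islands ω gs ⊓ islands ω gs' := by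
  simp only [islands, List.mem_append, iInf_or, iInf_inf_eq]

theorem islands_singleton (g : FreeMagma (ZMod T × Fin m)) : islands ω [g] = island ω g := by
  simp [islands]

theorem island_mul_le (g h : FreeMagma (ZMod T × Fin m)) :
    island ω (g * h) ≤ island ω g ⊓ island ω h := by
  simp only [island, content_mul]
  refine le_inf ?_ ?_ <;>
  · refine le_iInf₂ fun p hp => le_iInf₂ fun q hq => ?_
    refine (iInf₂_le p ?_).trans (iInf₂_le q ?_) <;> simp [hp, hq]

theorem islands_join (u : List (FreeMagma (ZMod T × Fin m))) (g₁ g₂ : FreeMagma (ZMod T × Fin m)) :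
    islands ω (u ++ [g₂, g₁]) ⊓ island ω (g₁ * g₂) = islands ω (u ++ [g₁ * g₂]) := by
  have h := island_mul_le (ω := ω) g₁ g₂
  have : islands ω [g₂, g₁] = island ω g₂ ⊓ island ω g₁ := by
    rw [← List.singleton_append, islands_append, islands_singleton, islands_singleton]
  rw [islands_append, islands_append, islands_singleton, this, inf_assoc]
  congr 1
  rw [inf_eq_right, inf_comm]
  exact h

theorem mem_islands {k : Fin m → ZMod T} {gs : List (FreeMagma (ZMod T × Fin m))}
    (hk : ListPotential k gs) {t : Fin m → ℂ} :
    t ∈ islands ω gs ↔ ∀ g ∈ gs, ∀ p ∈ indices (content g), ∀ q ∈ indices (content g),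
      rescale ω k t p = rescale ω k t q := by
  simp only [islands, Submodule.mem_iInf]
  exact forall₂_congr fun g hg => mem_island k (hk.fst_eq hg)

/-- In the coordinates rescaled by the potential, the edges of the trees are given by equalities of
coordinates. Testing with two vectors shows that the hyperplane must be balanced and must separate
the indices of the two trees; conversely, one equality across two trees forces all others. -/
theorem islands_inf_eq_iff (hω : IsPrimitiveRoot ω T) {k : Fin m → ZMod T}
    {u : List (FreeMagma (ZMod T × Fin m))} {g₁ g₂ : FreeMagma (ZMod T × Fin m)}
    (hk : ListPotential k (u ++ [g₂, g₁])) (h : Diag T m) :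
    islands ω (u ++ [g₂, g₁]) ⊓ island ω (g₁ * g₂) =
      islands ω (u ++ [g₂, g₁]) ⊓ diagHyp ω h ↔ Adapted k h (content g₁, content g₂) := by
  have hk' : ListPotential k ((u ++ [g₂]) ++ [g₁]) := by simpa using hk
  have hd : Disjoint (indices (content g₂)) (indices (content g₁)) :=
    hk'.disjoint (by simp) (by simp)
  have hdu : ∀ g ∈ u, Disjoint (indices (content g)) (indices (content g₁)) := fun g hg =>
    hk'.disjoint (by simp [hg]) (by simp)
  have hdu' : ∀ g ∈ u, Disjoint (indices (content g)) (indices (content g₂)) := fun g hg =>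
    hk.disjoint hg (by simp)
  have hx : ∀ x ∈ content (g₁ * g₂), x.1 = k x.2 := by
    intro x hx
    rw [content_mul, List.mem_append] at hx
    rcases hx with hx | hx
    · exact hk.fst_eq (by simp) x hx
    · exact hk.fst_eq (by simp) x hx
  have hstep : ∀ s : Fin m → ℂ, (∀ g ∈ u ++ [g₂, g₁], ∀ p ∈ indices (content g),
      ∀ q ∈ indices (content g), s p = s q) → ∃ t, rescale ω k t = s ∧
        t ∈ islands ω (u ++ [g₂, g₁]) := by
    intro s hs
    obtain ⟨t, rfl⟩ := exists_rescale_eq hω k s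
    exact ⟨t, rfl, (mem_islands hk).mpr hs⟩
  constructor
  · intro heq
    have hiff : ∀ t ∈ islands ω (u ++ [g₂, g₁]), t ∈ island ω (g₁ * g₂) ↔ t ∈ diagHyp ω h := by
      intro t ht
      have := SetLike.ext_iff.mp heq t
      rw [Submodule.mem_inf, Submodule.mem_inf] at this
      exact ⟨fun h => (this.mp ⟨ht, h⟩).2, fun h => (this.mpr ⟨ht, h⟩).2⟩
    -- The indicator vector of both trees lies on the joined edge, so it lies on `h`. If both
    -- indices of `h` belong to the trees, this forces `h` to be balanced; it excludes that exactly
    -- one does.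
    obtain ⟨t₁, ht₁, hm₁⟩ := hstep
      (fun p => if p ∈ indices (content g₁) ∪ indices (content g₂) then 1 else 0) (by
        intro g hg p hp q hq
        simp only [List.mem_append, List.mem_cons, List.not_mem_nil, or_false] at hg
        rcases hg with hg | rfl | rfl
        · have e1 := Finset.disjoint_left.mp (hdu g hg)
          have e2 := Finset.disjoint_left.mp (hdu' g hg)
          simp [e1 hp, e2 hp, e1 hq, e2 hq]
        · simp [hp, hq]
        · simp [hp, hq])
    -- The indicator vector of the first tree alone is not on the joined edge, so it is not on `h`;
    -- hence `h` has exactly one index in that tree.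
    obtain ⟨t₂, ht₂, hm₂⟩ := hstep (fun p => if p ∈ indices (content g₁) then 1 else 0) (by
        intro g hg p hp q hq
        simp only [List.mem_append, List.mem_cons, List.not_mem_nil, or_false] at hg
        rcases hg with hg | rfl | rfl
        · have e1 := Finset.disjoint_left.mp (hdu g hg)
          simp [e1 hp, e1 hq]
        · have e1 := Finset.disjoint_left.mp hd
          simp [e1 hp, e1 hq]
        · simp [hp, hq])
    have h₁ := (hiff t₁ hm₁).mp ((mem_island k hx).mpr (by
      intro p hp q hq
      rw [indices_mul] at hp hq
      rw [ht₁]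
      simp only [if_pos hp, if_pos hq]))
    have h₂ : t₂ ∉ diagHyp ω h := by
      rw [← hiff t₂ hm₂, mem_island k hx]
      intro hc
      obtain ⟨p, hp⟩ := indices_nonempty g₁
      obtain ⟨q, hq⟩ := indices_nonempty g₂
      have := hc p (by simp [indices_mul, hp]) q (by simp [indices_mul, hq])
      have hq' := Finset.disjoint_left.mp hd hq
      rw [ht₂] at this
      simp [hp, hq'] at this
    rw [mem_diagHyp_iff hω k, ht₁] at h₁
    beta_reduce at h₁
    by_cases hp : h.1.1 ∈ indices (content g₁) ∪ indices (content g₂)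
    · by_cases hq : h.1.2.1 ∈ indices (content g₁) ∪ indices (content g₂)
      · rw [if_pos hp, if_pos hq, mul_one] at h₁
        have hb : Balanced k h := balanced_iff.mpr (pow_val_inj hω (by rw [← h₁]; simp))
        refine ⟨hb, ?_⟩
        rw [hb.mem_iff hω, ht₂] at h₂
        rw [Finset.mem_union] at hp hq
        simp only [Crosses]
        by_cases hp1 : h.1.1 ∈ indices (content g₁)
        · by_cases hq1 : h.1.2.1 ∈ indices (content g₁)
          · simp [hp1, hq1] at h₂
          · exact Or.inl ⟨hp1, hq.resolve_left hq1⟩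
        · by_cases hq1 : h.1.2.1 ∈ indices (content g₁)
          · exact Or.inr ⟨hq1, hp.resolve_left hp1⟩
          · simp [hp1, hq1] at h₂
      · rw [if_pos hp, if_neg hq, mul_zero] at h₁
        exact absurd h₁ one_ne_zero
    · by_cases hq : h.1.2.1 ∈ indices (content g₁) ∪ indices (content g₂)
      · rw [if_neg hp, if_pos hq, mul_one] at h₁
        exact absurd h₁.symm (pow_val_ne_zero hω _)
      · exfalso
        apply h₂
        rw [mem_diagHyp_iff hω k, ht₂]
        simp only [Finset.mem_union, not_or] at hp hq
        simp [hp.1, hq.1]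
  · rintro ⟨hb, hcr⟩
    ext t
    rw [Submodule.mem_inf, Submodule.mem_inf]
    refine and_congr_right fun ht => ?_
    rw [hb.mem_iff hω, mem_island k hx]
    have e1 := (mem_islands hk).mp ht g₁ (by simp)
    have e2 := (mem_islands hk).mp ht g₂ (by simp)
    rw [indices_mul]
    constructor
    · intro hc
      rcases hcr with hcr | hcr
      · exact hc _ (Finset.mem_union_left _ hcr.1) _ (Finset.mem_union_right _ hcr.2)
      · exact hc _ (Finset.mem_union_right _ hcr.2) _ (Finset.mem_union_left _ hcr.1)
    · intro hpq
      have : ∀ p ∈ indices (content g₁) ∪ indices (content g₂),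
          rescale ω k t p = rescale ω k t h.1.1 := by
        intro p hp
        rw [Finset.mem_union] at hp
        rcases hcr with hcr | hcr
        · rcases hp with hp | hp
          · exact e1 _ hp _ hcr.1
          · exact (e2 _ hp _ hcr.2).trans hpq.symm
        · rcases hp with hp | hp
          · exact (e1 _ hp _ hcr.1).trans hpq.symm
          · exact e2 _ hp _ hcr.2
      intro p hp q hq
      rw [this p hp, this q hq]

/-- The intersections of the initial segments of a list of hyperplanes. -/
def partialInf (ω : ℂ) (Hs : List (Diag T m)) : List (Submodule ℂ (Fin m → ℂ)) :=
  (List.range Hs.length).map fun i => ⨅ h ∈ Hs.take (i + 1), diagHyp ω h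

theorem partialInf_concat (Hs : List (Diag T m)) (h : Diag T m) :
    partialInf ω (Hs ++ [h]) = partialInf ω Hs ++ [(⨅ h ∈ Hs, diagHyp ω h) ⊓ diagHyp ω h] := by
  rw [partialInf, List.length_append, List.length_singleton, List.range_succ, List.map_append]
  congr 1
  · refine List.map_congr_left fun i hi => ?_
    rw [List.mem_range] at hi
    rw [List.take_append_of_le_length (by omega)]
  · rw [List.map_singleton, List.take_of_length_le (by simp)]
    congr 1
    simp only [List.mem_append, List.mem_singleton, iInf_or, iInf_inf_eq, iInf_iInf_eq_left]

theorem getLastD_partialInf (Hs : List (Diag T m)) :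
    (partialInf ω Hs).getLastD ⊤ = ⨅ h ∈ Hs, diagHyp ω h := by
  induction Hs using List.reverseRecOn with
  | nil => simp [partialInf]
  | append_singleton Hs h _ =>
    rw [partialInf_concat, List.getLastD_concat]
    simp only [List.mem_append, List.mem_singleton, iInf_or, iInf_inf_eq, iInf_iInf_eq_left]

theorem forall₂_concat {α β : Type*} {R : α → β → Prop} {l : List α} {l' : List β} {a : α}
    {b : β} : List.Forall₂ R (l ++ [a]) (l' ++ [b]) ↔ List.Forall₂ R l l' ∧ R a b := by
  rw [← List.forall₂_reverse_iff, List.reverse_append, List.reverse_append]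
  simp [and_comm]

/-- The invariants of the rules that attach signed flags to exterior products. -/
theorem FlagOf.exists_spec (hω : IsPrimitiveRoot ω T) {gs : List (FreeMagma (ZMod T × Fin m))}
    {s : ℤ} {Ls : List (Submodule ℂ (Fin m → ℂ))} (h : FlagOf ω gs s Ls) :
    ∃ (k : Fin m → ZMod T) (J : List (List (ZMod T × Fin m) × List (ZMod T × Fin m))),
      ListPotential k gs ∧ J.length = Ls.length ∧ J.Perm (gs.flatMap nodes) ∧ s * s = 1 ∧
      Ls.getLastD ⊤ = islands ω gs ∧
      (∀ Hs : List (Diag T m), Ls = partialInf ω Hs ↔ List.Forall₂ (Adapted k) Hs J) ∧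
      ∀ E, List.Forall₂ Crosses E J → OrientedBy gs s E := by
  induction h with
  | base k =>
    refine ⟨k, [], ?_, rfl, ?_, rfl, ?_, ?_, ?_⟩
    · rw [ListPotential, List.flatMap_def, List.map_ofFn]
      have : (List.ofFn (content ∘ fun i => FreeMagma.of (k i, i))).flatten =
          List.ofFn fun i => (k i, i) := by
        have : content ∘ (fun i => FreeMagma.of (k i, i)) = fun i => [(k i, i)] := rfl
        rw [this, List.ofFn_eq_map, ← List.flatMap_def, List.ofFn_eq_map,
          ← List.flatMap_pure_eq_map]
        rfl
      rw [this]
      exact List.Perm.refl _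
    · have : (List.ofFn fun i => FreeMagma.of (k i, i)).flatMap nodes = [] := by
        rw [List.flatMap_eq_nil_iff]
        intro g hg
        obtain ⟨i, rfl⟩ := (List.mem_ofFn ..).mp hg
        rfl
      rw [this]
    · symm
      simp only [List.getLastD_nil, islands, iInf_eq_top]
      intro g hg
      obtain ⟨i, rfl⟩ := (List.mem_ofFn ..).mp hg
      simp [island, content, eqSpace]
    · intro Hs
      rw [List.forall₂_nil_right_iff]
      constructor
      · intro h
        have := congrArg List.length h
        simp only [partialInf, List.length_nil, List.length_map, List.length_range] at this
        exact List.length_eq_zero_iff.mp this.symm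
      · rintro rfl; rfl
    · intro E hE
      rw [List.forall₂_nil_right_iff] at hE
      subst hE
      exact orientedBy_base k
  | @swap s Ls u v g h _ ih =>
    obtain ⟨k, J, h1, h2, h3, h4, h5, h6, h7⟩ := ih
    have hp : (u ++ h :: g :: v).Perm (u ++ g :: h :: v) := List.Perm.append_left u (.swap ..)
    refine ⟨k, J, ?_, h2, h3.trans (hp.flatMap_right nodes).symm, by simpa using h4, ?_, h6,
      fun E hE => orientedBy_swap (h7 E hE)⟩
    · exact HasPotential.perm h1 (hp.flatMap_right content)
    · rw [h5]
      simp only [islands, hp.mem_iff]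
  | @join s Ls u g₁ g₂ _ ih =>
    obtain ⟨k, J, h1, h2, h3, h4, h5, h6, h7⟩ := ih
    refine ⟨k, J ++ [(content g₁, content g₂)], ?_, by simp [h2], ?_, h4, ?_, ?_, ?_⟩
    · refine HasPotential.perm h1 ?_
      simp only [List.flatMap_append, List.flatMap_cons, List.flatMap_nil, List.append_nil,
        content_mul]
      exact List.Perm.append_left _ List.perm_append_comm
    · simp only [List.flatMap_append, List.flatMap_cons, List.flatMap_nil, List.append_nil,
        nodes_mul] at h3 ⊢
      refine (h3.append_right _).trans ?_
      rw [List.append_assoc]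
      refine List.Perm.append_left _ ?_
      exact List.perm_append_comm.trans
        (List.Perm.cons (content g₁, content g₂) (l₁ := nodes g₂ ++ nodes g₁) List.perm_append_comm)
    · rw [List.getLastD_concat, h5, islands_join]
    · intro Hs
      rcases List.eq_nil_or_concat Hs with rfl | ⟨Hs, h, rfl⟩
      · constructor
        · intro h
          simp [partialInf] at h
        · intro h
          simp at h
      · rw [List.concat_eq_append, partialInf_concat, forall₂_concat, ← h6,
          ← List.concat_eq_append, ← List.concat_eq_append, List.concat_inj]
        -- Once the shorter flags agree, their last members agree, and the new hyperplane is
        -- governed by `islands_inf_eq_iff`.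
        refine and_congr_right fun hL => ?_
        rw [← getLastD_partialInf, ← hL, h5, islands_inf_eq_iff hω h1]
    · intro E hE
      rcases List.eq_nil_or_concat E with rfl | ⟨E, e, rfl⟩
      · simp at hE
      · rw [List.concat_eq_append, forall₂_concat] at hE
        rw [List.concat_eq_append]
        exact orientedBy_join h1 (h7 E hE.1) hE.2

end Lattice

/-! ### Orientations of spanning trees, and complete flags -/

section FullFlag

variable {T m n : ℕ} [NeZero T] {ω : ℂ}

/-- The determinant of a family of `n` vectors of `ℂ^{n+1}`, together with `(1, …, 1)`. -/
def orient (n : ℕ) : (Fin (n + 1) → ℂ) [⋀^Fin n]→ₗ[ℂ] ℂ :=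
  ((Matrix.detRowAlternating (n := Fin (n + 1)) (R := ℂ)).curryLeft 1).domDomCongr Fin.revPerm

theorem orient_apply (v : Fin n → Fin (n + 1) → ℂ) :
    orient n v = Matrix.det (Matrix.of (Fin.cons 1 (v ∘ Fin.rev))) := rfl

/-- The vector `z` is in the kernel of the matrix whose determinant is taken: it is annihilated by
the row of ones and by all rows `v i`. -/
theorem orient_eq_zero {v : Fin n → Fin (n + 1) → ℂ} {z : Fin (n + 1) → ℂ} (hz : z ≠ 0)
    (h1 : ∑ p, z p = 0) (hv : ∀ i, ∑ p, v i p * z p = 0) : orient n v = 0 := by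
  rw [orient_apply, ← Matrix.exists_mulVec_eq_zero_iff]
  refine ⟨z, hz, funext fun i => ?_⟩
  refine Fin.cases ?_ (fun i => ?_) i
  · simpa [Matrix.mulVec, dotProduct] using h1
  · simpa [Matrix.mulVec, dotProduct] using hv _

theorem sum_edgeVec_mul (e : Fin m × Fin m) (z : Fin m → ℂ) :
    ∑ p, edgeVec e p * z p = z e.1 - z e.2 := by
  simp [edgeVec, sub_mul, Finset.sum_sub_distrib, Pi.single_apply]

/-- The vector that is constant on a set of indices and on its complement, and has sum zero. -/
def cutVec (U : Finset (Fin m)) (p : Fin m) : ℂ := (if p ∈ U then (m : ℂ) else 0) - U.card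

theorem sum_cutVec (U : Finset (Fin m)) : ∑ p, cutVec U p = 0 := by
  simp [cutVec, Finset.sum_sub_distrib, mul_comm]

theorem cutVec_sub (U : Finset (Fin m)) (e : Fin m × Fin m) :
    cutVec U e.1 - cutVec U e.2 = m * connect U Uᶜ e.1 e.2 := by
  simp only [cutVec, connect, Finset.mem_compl]
  by_cases h1 : e.1 ∈ U <;> by_cases h2 : e.2 ∈ U <;> (simp only [h1, h2]; simp; try ring)

theorem cutVec_ne_zero {U : Finset (Fin (n + 1))} {p q : Fin (n + 1)} (hp : p ∈ U) (hq : q ∉ U) :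
    cutVec U ≠ 0 := by
  intro h
  have := cutVec_sub U (p, q)
  rw [h] at this
  simp [connect, hp, hq] at this
  norm_cast at this

/-- A family of edges is dependent if none of them leaves a proper set of indices. -/
theorem orient_edgeVec_eq_zero {e : Fin n → Fin (n + 1) × Fin (n + 1)} {U : Finset (Fin (n + 1))}
    {p q : Fin (n + 1)} (hp : p ∈ U) (hq : q ∉ U) (he : ∀ i, connect U Uᶜ (e i).1 (e i).2 = 0) :
    orient n (edgeVec ∘ e) = 0 := by
  refine orient_eq_zero (cutVec_ne_zero hp hq) (sum_cutVec U) fun i => ?_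
  rw [Function.comp_apply, sum_edgeVec_mul, cutVec_sub, he, mul_zero]

/-- The effect of the replacement of the only edge that leaves a set of indices. -/
theorem orient_edgeVec_update {e : Fin n → Fin (n + 1) × Fin (n + 1)} {U : Finset (Fin (n + 1))}
    {p q : Fin (n + 1)} (hp : p ∈ U) (hq : q ∉ U) (j : Fin n)
    (he : ∀ i, i ≠ j → connect U Uᶜ (e i).1 (e i).2 = 0) (x : Fin (n + 1) × Fin (n + 1)) :
    connect U Uᶜ (e j).1 (e j).2 * orient n (edgeVec ∘ Function.update e j x) =
      connect U Uᶜ x.1 x.2 * orient n (edgeVec ∘ e) := by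
  have h1 : ∀ y, edgeVec ∘ Function.update e j y = Function.update (edgeVec ∘ e) j (edgeVec y) :=
    fun y => Function.comp_update ..
  have h2 : orient n (edgeVec ∘ e) = orient n (Function.update (edgeVec ∘ e) j (edgeVec (e j))) := by
    rw [← h1, Function.update_eq_self]
  rw [h1, h2, ← smul_eq_mul, ← smul_eq_mul, ← AlternatingMap.map_update_smul,
    ← AlternatingMap.map_update_smul, ← sub_eq_zero, ← AlternatingMap.map_update_sub]
  -- The combination of `e j` and `x` that has just been formed does not cross the cut, and neither
  -- do the other edges, so `cutVec U` is in the kernel.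
  refine orient_eq_zero (cutVec_ne_zero hp hq) (sum_cutVec U) fun i => ?_
  by_cases hi : i = j
  · subst hi
    rw [Function.update_self]
    simp only [Pi.sub_apply, Pi.smul_apply, smul_eq_mul, sub_mul, mul_assoc,
      Finset.sum_sub_distrib, ← Finset.mul_sum, sum_edgeVec_mul, cutVec_sub]
    ring
  · rw [Function.update_of_ne hi, Function.comp_apply, sum_edgeVec_mul, cutVec_sub, he i hi,
      mul_zero]

/-- A single tree on all `n + 1` indices has indicator vector `(1, …, 1)` and size `n + 1`. The
relation in the exterior algebra becomes one of determinants. -/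
theorem orient_of_orientedBy {c : FreeMagma (ZMod T × Fin (n + 1))} {k : Fin (n + 1) → ZMod T}
    (hc : HasPotential k (content c)) {s : ℤ} {e : Fin n → Fin (n + 1) × Fin (n + 1)}
    (h : OrientedBy [c] s (List.ofFn e)) : orient n (edgeVec ∘ e) = s * (n + 1) := by
  have hi : indices (content c) = Finset.univ := by
    ext p
    simp only [indices, List.mem_toFinset, List.mem_map, Finset.mem_univ, iff_true]
    exact ⟨(k p, p), (hc.mem_iff _).mpr rfl, rfl⟩
  have hone : indicatorVec c = 1 := by
    rw [indicatorVec, hi]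
    ext p
    simp [Finset.sum_apply, Pi.single_apply]
  have h1 := h.1
  have hm : ∀ (j : ℕ) (v : Fin j → Fin (n + 1) → ℂ),
      wedge (List.ofFn v) = ExteriorAlgebra.ιMulti ℂ j v := by
    intro j v
    rw [wedge, ExteriorAlgebra.ιMulti_apply, List.map_ofFn]; rfl
  have hrev : (List.ofFn e).reverse.map edgeVec = List.ofFn ((edgeVec ∘ e) ∘ Fin.rev) := by
    refine List.ext_getElem (by simp) fun i h1 h2 => ?_
    simp only [List.getElem_map, List.getElem_reverse, List.getElem_ofFn, Function.comp_apply,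
      List.length_ofFn]
    congr 2
    ext
    simp only [Fin.val_rev]
    omega
  have hcons : wedge ([c].map indicatorVec) * wedge ((List.ofFn e).reverse.map edgeVec) =
      ExteriorAlgebra.ιMulti ℂ (n + 1)
        (Fin.cons (α := fun _ => Fin (n + 1) → ℂ) 1 ((edgeVec ∘ e) ∘ Fin.rev)) := by
    rw [← wedge_append, hrev, List.map_singleton, hone, ← hm, List.ofFn_succ]
    rfl
  rw [hcons, hm] at h1
  -- The linear form on the exterior algebra that is the determinant in top degree and zero in all
  -- others.
  have h2 := congrArg (ExteriorAlgebra.liftAlternating (R := ℂ) (N := ℂ)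
    (Function.update 0 (n + 1) (Matrix.detRowAlternating (n := Fin (n + 1)) (R := ℂ)))) h1
  rw [map_smul, ExteriorAlgebra.liftAlternating_apply_ιMulti,
    ExteriorAlgebra.liftAlternating_apply_ιMulti, Function.update_self] at h2
  have h3 : (Matrix.detRowAlternating (n := Fin (n + 1)) (R := ℂ))
      (fun i => Pi.single i (1 : ℂ)) = 1 := by
    have : (fun i => Pi.single i (1 : ℂ)) = (1 : Matrix (Fin (n + 1)) (Fin (n + 1)) ℂ) := by
      ext i j; simp [Matrix.one_apply, Pi.single_apply, eq_comm]
    rw [this]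
    exact Matrix.det_one
  rw [h3] at h2
  have h4 : orient n (edgeVec ∘ e) = (Matrix.detRowAlternating (n := Fin (n + 1)) (R := ℂ))
      (Fin.cons (α := fun _ => Fin (n + 1) → ℂ) 1 ((edgeVec ∘ e) ∘ Fin.rev)) := rfl
  rw [h4, h2, sizeProd]
  simp [hi]

theorem forall₂_ofFn {α β : Type*} {R : α → β → Prop} {f : Fin n → α} {g : Fin n → β} :
    List.Forall₂ R (List.ofFn f) (List.ofFn g) ↔ ∀ i, R (f i) (g i) := by
  rw [List.forall₂_iff_get]
  simp only [List.length_ofFn, List.get_ofFn, true_and]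
  exact ⟨fun h i => h i i.2 i.2, fun h i h1 h2 => h _⟩

theorem completeFlag_eq_iff {H : Fin (n + 1) → Diag T (n + 1)}
    {Ls : List (Submodule ℂ (Fin (n + 1) → ℂ))} (hL : Ls.length = n) :
    (∀ i, completeFlag Ls i = ⨅ j, ⨅ _ : j ≤ i, diagHyp ω (H j)) ↔
      Ls ++ [⊥] = partialInf ω (List.ofFn H) := by
  have hlen : (Ls ++ [⊥]).length = n + 1 := by simp [hL]
  have key : ∀ i : Fin (n + 1), ⨅ h ∈ (List.ofFn H).take (i + 1), diagHyp ω h =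
      ⨅ j, ⨅ _ : j ≤ i, diagHyp ω (H j) := by
    intro i
    refine le_antisymm (le_iInf₂ fun j hj => iInf₂_le (H j) ?_) (le_iInf₂ fun h hh => ?_)
    · rw [List.mem_take_iff_getElem]
      exact ⟨j, by simp; omega, List.getElem_ofFn _⟩
    · rw [List.mem_take_iff_getElem] at hh
      obtain ⟨j, hj, rfl⟩ := hh
      rw [List.getElem_ofFn]
      refine iInf₂_le (⟨j, ?_⟩ : Fin (n + 1)) ?_
      rw [Fin.le_def]
      simp only [List.length_ofFn, lt_inf_iff] at hj
      exact Nat.lt_succ_iff.mp hj.1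
  constructor
  · intro h
    refine List.ext_getElem (by simp [partialInf, hL]) fun i h1 h2 => ?_
    have h' := h ⟨i, hlen ▸ h1⟩
    rw [← key] at h'
    simp only [partialInf, List.getElem_map, List.getElem_range]
    rw [← h', completeFlag, List.getD_eq_getElem _ _ h1]
  · intro h i
    rw [← key, completeFlag, h, List.getD_eq_getElem _ _ (by rw [← h, hlen]; exact i.2)]
    simp only [partialInf, List.getElem_map, List.getElem_range]

/-- The edge of `c` is a line, spanned by `(1, …, 1)` in rescaled coordinates. A hyperplane meets it
in zero exactly if it does not contain it, and it contains it exactly if it is balanced. -/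
theorem bot_eq_island_inf_iff (hω : IsPrimitiveRoot ω T) {k : Fin (n + 1) → ZMod T}
    {c : FreeMagma (ZMod T × Fin (n + 1))} (hc : HasPotential k (content c))
    (h : Diag T (n + 1)) : ⊥ = island ω c ⊓ diagHyp ω h ↔ ¬Balanced k h := by
  have hm : ∀ t, t ∈ island ω c ↔ ∀ p q, rescale ω k t p = rescale ω k t q := by
    intro t
    rw [mem_island k fun x hx => (hc.mem_iff x).mp hx]
    have hi : ∀ p, p ∈ indices (content c) := fun p => by
      simp only [indices, List.mem_toFinset, List.mem_map]
      exact ⟨(k p, p), (hc.mem_iff _).mpr rfl, rfl⟩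
    simp [hi]
  constructor
  · intro h0 hb
    obtain ⟨t, ht⟩ := exists_rescale_eq hω k (fun _ : Fin (n + 1) => 1)
    have : t ∈ island ω c ⊓ diagHyp ω h :=
      ⟨(hm t).mpr fun p q => by rw [ht], (hb.mem_iff hω).mpr (by rw [ht])⟩
    rw [← h0, Submodule.mem_bot] at this
    have h1 := congrFun ht 0
    simp [this, rescale] at h1
  · intro hb
    symm
    rw [Submodule.eq_bot_iff]
    rintro t ⟨h1, h2⟩
    have h1' := (hm t).mp h1
    have h2' := (mem_diagHyp_iff hω k h t).mp h2
    have h3 : rescale ω k t h.1.2.1 = 0 := by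
      by_contra hne
      rw [h1' h.1.1 h.1.2.1] at h2'
      have : ω ^ (h.1.2.2 + k h.1.1 - k h.1.2.1).val = 1 := by
        have := mul_right_cancel₀ hne ((one_mul _).trans h2')
        exact this.symm
      exact hb (balanced_iff.mpr (pow_val_inj hω (by rw [this]; simp)))
    ext p
    have h4 : rescale ω k t p = 0 := (h1' p _).trans h3
    exact (mul_eq_zero.mp h4).resolve_left (pow_val_ne_zero hω _)

/-- The hyperplanes that cut out the signed full flag of a commutator. -/
theorem FlagOf.exists_full_spec (hω : IsPrimitiveRoot ω T) {c : FreeMagma (ZMod T × Fin (n + 1))}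
    {s : ℤ} {Ls : List (Submodule ℂ (Fin (n + 1) → ℂ))} (h : FlagOf ω [c] s Ls) :
    ∃ (k : Fin (n + 1) → ZMod T)
      (J : Fin n → List (ZMod T × Fin (n + 1)) × List (ZMod T × Fin (n + 1))),
      HasPotential k (content c) ∧ (nodes c).Perm (List.ofFn J) ∧ s * s = 1 ∧
      (∀ H : Fin (n + 1) → Diag T (n + 1),
        (∀ i, completeFlag Ls i = ⨅ j, ⨅ _ : j ≤ i, diagHyp ω (H j)) ↔
          (∀ i, Adapted k (H i.castSucc) (J i)) ∧ ¬Balanced k (H (Fin.last n))) ∧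
      ∀ e : Fin n → Fin (n + 1) × Fin (n + 1), (∀ i, Crosses (e i) (J i)) →
        orient n (edgeVec ∘ e) = s * (n + 1) := by
  obtain ⟨k, J, h1, h2, h3, h4, h5, h6, h7⟩ := h.exists_spec hω
  have hc : HasPotential k (content c) := by simpa [ListPotential] using h1
  have hJ' : J.Perm (nodes c) := by simpa using h3
  have hlen : J.length = n := by
    have e1 := length_nodes c
    have e2 := List.Perm.length_eq hc
    rw [List.length_ofFn] at e2
    have e3 := hJ'.length_eq
    omega
  obtain ⟨J, rfl⟩ : ∃ f : Fin n → _, J = List.ofFn f :=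
    ⟨fun i => J.get (i.cast hlen.symm), List.ext_getElem (by simp [hlen]) fun i h1 h2 => by simp⟩
  refine ⟨k, J, hc, hJ'.symm, h4, fun H => ?_, fun e he => ?_⟩
  · rw [completeFlag_eq_iff (h2.symm.trans hlen), List.ofFn_succ', List.concat_eq_append,
      partialInf_concat, ← List.concat_eq_append, ← List.concat_eq_append, List.concat_inj, h6,
      forall₂_ofFn]
    refine and_congr_right fun hA => ?_
    rw [← getLastD_partialInf, ← (h6 _).mpr (forall₂_ofFn.mpr hA), h5, islands_singleton,
      bot_eq_island_inf_iff hω hc]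
  · exact orient_of_orientedBy hc (h7 _ (forall₂_ofFn.mpr he))

/-! ### Existence of flags -/

theorem FlagOf.exists_perm {gs gs' : List (FreeMagma (ZMod T × Fin m))} (hp : gs.Perm gs') :
    ∀ u : List (FreeMagma (ZMod T × Fin m)), (∃ s Ls, FlagOf ω (u ++ gs) s Ls) →
      ∃ s Ls, FlagOf ω (u ++ gs') s Ls := by
  induction hp with
  | nil => exact fun _ h => h
  | cons g _ ih =>
    intro u h
    have := ih (u ++ [g])
    simp only [List.append_assoc, List.singleton_append] at this
    exact this h
  | swap g h l =>
    rintro u ⟨s, Ls, hf⟩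
    exact ⟨-s, Ls, .swap u l _ _ hf⟩
  | trans _ _ h h' => exact fun u hu => h' u (h u hu)

/-- The joining rule acts on the last two factors only; transpositions bring the pieces there. The
prefix `u` makes the induction go through. -/
theorem FlagOf.exists_of_letters (c : FreeMagma (ZMod T × Fin m)) :
    ∀ u : List (FreeMagma (ZMod T × Fin m)),
      (∃ s Ls, FlagOf ω (u ++ (content c).map FreeMagma.of) s Ls) →
      ∃ s Ls, FlagOf ω (u ++ [c]) s Ls := by
  induction c with
  | ih1 x => exact fun _ h => h
  | ih2 g₁ g₂ h₁ h₂ =>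
    intro u h
    rw [content_mul, List.map_append] at h
    have e1 := h₁ (u ++ (content g₂).map FreeMagma.of) (by
      rw [List.append_assoc]
      exact exists_perm List.perm_append_comm u h)
    have e2 := h₂ (u ++ [g₁]) (by
      rw [List.append_assoc] at e1 ⊢
      exact exists_perm List.perm_append_comm u e1)
    rw [List.append_assoc] at e2
    obtain ⟨s, Ls, hf⟩ := exists_perm (List.Perm.swap g₂ g₁ []) u e2
    exact ⟨s, _, .join u g₁ g₂ hf⟩

/-- The rules attach a signed flag to every commutator in which each index occurs once. -/
theorem FlagOf.exists_of_hasPotential {c : FreeMagma (ZMod T × Fin m)} {k : Fin m → ZMod T}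
    (hc : HasPotential k (content c)) : ∃ s Ls, FlagOf ω [c] s Ls := by
  have := FlagOf.exists_of_letters (ω := ω) c []
  simp only [List.nil_append] at this
  refine this ?_
  have h2 := FlagOf.exists_perm (ω := ω) ((List.Perm.map FreeMagma.of hc).symm) []
  simp only [List.nil_append] at h2
  refine h2 ⟨1, [], ?_⟩
  have h3 := FlagOf.base (ω := ω) k
  rwa [List.map_ofFn]

end FullFlag

/-! ### The geometric form in terms of tuples that cut out one flag -/

section GeomForm

/-- The sum over the permutations of `n + 1` objects, according to the last one of them. -/
theorem sum_perm_last {A : Type*} {n : ℕ} (H : Fin (n + 1) → A) (F : (Fin n → A) → A → ℂ) :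
    ∑ σ : Equiv.Perm (Fin (n + 1)),
        ((Equiv.Perm.sign σ : ℤ) : ℂ) * F (fun i => H (σ i.castSucc)) (H (σ (Fin.last n))) =
      ∑ τ : Equiv.Perm (Fin n),
        ((Equiv.Perm.sign τ : ℤ) : ℂ) * F (fun i => H (τ i).castSucc) (H (Fin.last n)) -
      ∑ j, ∑ τ : Equiv.Perm (Fin n), ((Equiv.Perm.sign τ : ℤ) : ℂ) *
        F (fun i => Function.update (fun i : Fin n => H i.castSucc) j (H (Fin.last n)) (τ i))
          (H j.castSucc) := by
  have h1 : ∀ (o : Option (Fin n)) (τ : Equiv.Perm (Fin n)) (x : Fin (n + 1)),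
      ((finSuccEquivLast (n := n)).permCongr.trans Equiv.Perm.decomposeOption).symm (o, τ) x =
      finSuccEquivLast.symm (Equiv.swap none o (Option.map τ (finSuccEquivLast x))) := by
    intro o τ x
    simp [Equiv.permCongr_def]
  have h2 : ∀ (o : Option (Fin n)) (τ : Equiv.Perm (Fin n)),
      Equiv.Perm.sign
        (((finSuccEquivLast (n := n)).permCongr.trans Equiv.Perm.decomposeOption).symm (o, τ)) =
      Equiv.Perm.sign (Equiv.swap none o) * Equiv.Perm.sign τ := by
    intro o τ
    simp [Equiv.Perm.sign_permCongr]
  -- A permutation is one that fixes the last object, followed by a transposition of the last object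
  -- with some object `j`, or by nothing. The transposition accounts for the minus sign and
  -- exchanges the last hyperplane with that of index `j`.
  rw [← ((finSuccEquivLast (n := n)).permCongr.trans Equiv.Perm.decomposeOption).symm.sum_comp,
    Fintype.sum_prod_type, Fintype.sum_option, sub_eq_add_neg, ← Finset.sum_neg_distrib]
  congr 1
  · refine Finset.sum_congr rfl fun τ _ => ?_
    rw [h2, h1]
    simp only [h1]
    simp
  · refine Finset.sum_congr rfl fun j _ => ?_
    rw [← Finset.sum_neg_distrib]
    refine Finset.sum_congr rfl fun τ _ => ?_
    rw [h2, h1, Equiv.Perm.sign_swap (by simp)]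
    simp only [h1]
    have h3 : ∀ i : Fin n, H (finSuccEquivLast.symm (Equiv.swap none (some j)
        (Option.map τ (finSuccEquivLast i.castSucc)))) =
        Function.update (fun i : Fin n => H i.castSucc) j (H (Fin.last n)) (τ i) := by
      intro i
      by_cases hi : τ i = j
      · simp [hi]
      · rw [Function.update_of_ne hi, finSuccEquivLast_castSucc, Option.map_some,
          Equiv.swap_apply_of_ne_of_ne (by simp) (by simpa using hi), finSuccEquivLast_symm_some]
    simp only [h3]
    simp

theorem pairing_comp_perm {V 𝓗 : Type*} [AddCommGroup V] [Module ℂ V] (hyp : 𝓗 → Submodule ℂ V)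
    {k : ℕ} (L : Fin k → Submodule ℂ V) (H : Fin k → 𝓗) (s : Equiv.Perm (Fin k)) :
    pairing hyp L (H ∘ s) = Equiv.Perm.sign s * pairing hyp L H := by
  rw [pairing, pairing, Finset.mul_sum]
  conv_rhs => rw [← Equiv.sum_comp (Equiv.mulLeft s)]
  refine Finset.sum_congr rfl fun t _ => ?_
  simp only [Equiv.coe_mulLeft, Equiv.Perm.coe_mul, Function.comp_apply, Equiv.Perm.sign_mul,
    mul_ite, mul_zero, Units.val_mul]
  refine if_congr Iff.rfl ?_ rfl
  rw [← mul_assoc, ← Units.val_mul, Int.units_mul_self, Units.val_one, one_mul]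

open Classical in
/-- The geometric form as a sum over the tuples of hyperplanes that cut out the second flag. -/
theorem geomForm_eq_sum {V 𝓗 : Type*} [AddCommGroup V] [Module ℂ V] [Fintype 𝓗]
    (hyp : 𝓗 → Submodule ℂ V) (a : 𝓗 → ℂ) {k : ℕ} (L L' : Fin k → Submodule ℂ V) :
    geomForm hyp a L L' = ∑ H : Fin k → 𝓗,
      if ∀ i, L' i = ⨅ j, ⨅ _ : j ≤ i, hyp (H j) then (pairing hyp L H : ℂ) * ∏ j, a (H j)
      else 0 := by
  have hk : (k.factorial : ℂ) ≠ 0 := by exact_mod_cast k.factorial_ne_zero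
  rw [geomForm, inv_mul_eq_iff_eq_mul₀ hk]
  -- Reordering the tuple by `s` multiplies both signs by that of `s`, so all `k!` permutations
  -- contribute the same sum.
  have h1 : ∀ s : Equiv.Perm (Fin k), ∑ H : Fin k → 𝓗, (pairing hyp L H : ℂ) *
      (if ∀ i, L' i = ⨅ j, ⨅ _ : j ≤ i, hyp (H (s j)) then ((Equiv.Perm.sign s : ℤ) : ℂ) else 0) *
        ∏ j, a (H j) = ∑ H : Fin k → 𝓗,
      if ∀ i, L' i = ⨅ j, ⨅ _ : j ≤ i, hyp (H j) then (pairing hyp L H : ℂ) * ∏ j, a (H j)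
      else 0 := by
    intro s
    rw [← (Equiv.arrowCongr s (Equiv.refl 𝓗)).sum_comp]
    refine Finset.sum_congr rfl fun H _ => ?_
    have e1 : ∀ j, (Equiv.arrowCongr s (Equiv.refl 𝓗)) H (s j) = H j := fun j => by simp
    have e2 : (pairing hyp L H : ℂ) = ((Equiv.Perm.sign s : ℤ) : ℂ) *
        (pairing hyp L ((Equiv.arrowCongr s (Equiv.refl 𝓗)) H) : ℂ) := by
      have := pairing_comp_perm hyp L ((Equiv.arrowCongr s (Equiv.refl 𝓗)) H) s
      rw [show (Equiv.arrowCongr s (Equiv.refl 𝓗)) H ∘ s = H from funext e1] at this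
      rw [this]; push_cast; rfl
    have e3 : ∏ j, a ((Equiv.arrowCongr s (Equiv.refl 𝓗)) H j) = ∏ j, a (H j) := by
      rw [← Equiv.prod_comp s]
      exact Finset.prod_congr rfl fun j _ => by rw [e1]
    simp only [e1]
    rw [e3, e2]
    split_ifs
    · ring
    · simp
  have h2 : ∀ H : Fin k → 𝓗, (pairing hyp L H : ℂ) * (pairing hyp L' H : ℂ) * ∏ j, a (H j) =
      ∑ s : Equiv.Perm (Fin k), (pairing hyp L H : ℂ) *
      (if ∀ i, L' i = ⨅ j, ⨅ _ : j ≤ i, hyp (H (s j)) then ((Equiv.Perm.sign s : ℤ) : ℂ) else 0) *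
        ∏ j, a (H j) := by
    intro H
    rw [← Finset.sum_mul, ← Finset.mul_sum]
    congr 2
    rw [pairing]; push_cast; rfl
  simp only [h2]
  rw [Finset.sum_comm]
  simp only [h1, Finset.sum_const, Finset.card_univ, Fintype.card_perm, Fintype.card_fin,
    nsmul_eq_mul]

variable {T m n : ℕ} [NeZero T]

/-- The pair of indices of a diagonal hyperplane. -/
def ends (h : Diag T m) : Fin m × Fin m := (h.1.1, h.1.2.1)

/-- The sign of a hyperplane that is adapted to a pair of words, and zero for other hyperplanes. -/
def adaptCoeff (k : Fin m → ZMod T) (J : List (ZMod T × Fin m) × List (ZMod T × Fin m))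
    (h : Diag T m) : ℂ :=
  if Balanced k h then nodeConnect J (ends h).1 (ends h).2 else 0

theorem nodeConnect_of_crosses {J : List (ZMod T × Fin m) × List (ZMod T × Fin m)}
    (hJ : Disjoint (indices J.1) (indices J.2)) {e : Fin m × Fin m} (he : Crosses e J) :
    nodeConnect J e.1 e.2 = 1 := by
  have := Finset.disjoint_left.mp hJ he.1
  simp [nodeConnect, connect, he.1, he.2, this]

theorem nodeConnect_swap (J : List (ZMod T × Fin m) × List (ZMod T × Fin m)) (p q : Fin m) :
    nodeConnect J p q = -nodeConnect J q p := connect_swap _ _ _ _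

theorem nodeConnect_ne_zero_iff {J : List (ZMod T × Fin m) × List (ZMod T × Fin m)}
    (hJ : Disjoint (indices J.1) (indices J.2)) {e : Fin m × Fin m} :
    nodeConnect J e.1 e.2 ≠ 0 ↔ Crosses e J ∨ Crosses e.swap J := by
  constructor
  · intro h
    by_contra! hc
    apply h
    have h1 : ¬(e.1 ∈ indices J.1 ∧ e.2 ∈ indices J.2) := hc.1
    have h2 : ¬(e.1 ∈ indices J.2 ∧ e.2 ∈ indices J.1) := fun h => hc.2 ⟨h.2, h.1⟩
    simp only [nodeConnect, connect, if_neg h1, if_neg h2, sub_zero]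
  · rintro (h | h)
    · rw [nodeConnect_of_crosses hJ h]; exact one_ne_zero
    · have := nodeConnect_of_crosses hJ h
      rw [nodeConnect_swap]
      rw [Prod.fst_swap, Prod.snd_swap] at this
      rw [this]; simp

theorem adaptCoeff_ne_zero_iff {k : Fin m → ZMod T}
    {J : List (ZMod T × Fin m) × List (ZMod T × Fin m)}
    (hJ : Disjoint (indices J.1) (indices J.2)) {h : Diag T m} :
    adaptCoeff k J h ≠ 0 ↔ Adapted k h J := by
  rw [adaptCoeff, Adapted]
  have := nodeConnect_ne_zero_iff hJ (e := ends h)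
  split_ifs with hb
  · rw [this]; simp only [hb, true_and]; rfl
  · simp [hb]

theorem adaptCoeff_mul_self {k : Fin m → ZMod T}
    {J : List (ZMod T × Fin m) × List (ZMod T × Fin m)}
    (hJ : Disjoint (indices J.1) (indices J.2)) {h : Diag T m} (ha : Adapted k h J) :
    adaptCoeff k J h * adaptCoeff k J h = 1 := by
  rw [adaptCoeff, if_pos ha.1]
  rcases ha.2 with hc | hc
  · have := nodeConnect_of_crosses hJ hc
    rw [show nodeConnect J (ends h).1 (ends h).2 = 1 from this, one_mul]
  · have := nodeConnect_of_crosses hJ hc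
    rw [nodeConnect_swap, show nodeConnect J (ends h).2 (ends h).1 = 1 from this]; norm_num

theorem exists_oriented {k : Fin m → ZMod T}
    {J : List (ZMod T × Fin m) × List (ZMod T × Fin m)}
    (hJ : Disjoint (indices J.1) (indices J.2)) {h : Diag T m} (ha : Adapted k h J) :
    ∃ e, Crosses e J ∧ edgeVec e = adaptCoeff k J h • edgeVec (ends h) := by
  rw [adaptCoeff, if_pos ha.1]
  rcases ha.2 with hc | hc
  · exact ⟨_, hc, by
      rw [show nodeConnect J (ends h).1 (ends h).2 = 1 from nodeConnect_of_crosses hJ hc,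
        one_smul]; rfl⟩
  · refine ⟨_, hc, ?_⟩
    rw [nodeConnect_swap, show nodeConnect J (ends h).2 (ends h).1 = 1 from
      nodeConnect_of_crosses hJ hc]
    simp [edgeVec, ends]

variable {k k' : Fin (n + 1) → ZMod T}
  {J J' : Fin n → List (ZMod T × Fin (n + 1)) × List (ZMod T × Fin (n + 1))} {s s' : ℤ}

/-- The sign of a signed flag in terms of the hyperplanes that cut it out. -/
theorem orient_of_adapted (hJ : ∀ i, Disjoint (indices (J i).1) (indices (J i).2))
    (ho : ∀ e : Fin n → Fin (n + 1) × Fin (n + 1), (∀ i, Crosses (e i) (J i)) →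
      orient n (edgeVec ∘ e) = s * (n + 1))
    {G : Fin n → Diag T (n + 1)} (hG : ∀ i, Adapted k (G i) (J i)) :
    orient n (edgeVec ∘ ends ∘ G) = s * (n + 1) * ∏ i, adaptCoeff k (J i) (G i) := by
  choose e he he' using fun i => exists_oriented (hJ i) (hG i)
  rw [← ho e he, show edgeVec ∘ e = fun i => adaptCoeff k (J i) (G i) •
    (edgeVec ∘ ends ∘ G) i from funext he', AlternatingMap.map_smul_univ, smul_eq_mul, mul_right_comm,
    ← Finset.prod_mul_distrib, Finset.prod_eq_one fun i _ => adaptCoeff_mul_self (hJ i) (hG i),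
    one_mul]

/-- Adapted hyperplanes are the edges of a spanning tree. The nonvanishing is used through cuts: a
spanning tree crosses every cut. -/
theorem orient_ne_zero_of_adapted (hJ : ∀ i, Disjoint (indices (J i).1) (indices (J i).2))
    (hs : s * s = 1)
    (ho : ∀ e : Fin n → Fin (n + 1) × Fin (n + 1), (∀ i, Crosses (e i) (J i)) →
      orient n (edgeVec ∘ e) = s * (n + 1))
    {G : Fin n → Diag T (n + 1)} (hG : ∀ i, Adapted k (G i) (J i)) :
    orient n (edgeVec ∘ ends ∘ G) ≠ 0 := by
  rw [orient_of_adapted hJ ho hG]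
  have h1 : (s : ℂ) ≠ 0 := by
    intro h
    have : s = 0 := by exact_mod_cast h
    simp [this] at hs
  have h2 : ((n : ℂ) + 1) ≠ 0 := by exact_mod_cast n.succ_ne_zero
  exact mul_ne_zero (mul_ne_zero h1 h2)
    (Finset.prod_ne_zero_iff.mpr fun i _ => (adaptCoeff_ne_zero_iff (hJ i)).mpr (hG i))

end GeomForm

/-! ### Sums of weights over the diagonal hyperplanes -/

section DiagSums

variable {T m n : ℕ} [NeZero T] {a : ZMod T × Fin m → ZMod T × Fin m → ℂ}

/-- The weighting of the diagonal hyperplanes that is defined by a function on pairs of letters. -/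
def diagWeight (a : ZMod T × Fin m → ZMod T × Fin m → ℂ) (h : Diag T m) : ℂ :=
  a (0, h.1.1) (h.1.2.2, h.1.2.1)

theorem sum_diag (f : Fin m × Fin m × ZMod T → ℂ) :
    ∑ h : Diag T m, f h.1 = ∑ p, ∑ q, if p < q then ∑ κ, f (p, q, κ) else 0 := by
  rw [← Finset.sum_subtype (Finset.univ.filter fun x : Fin m × Fin m × ZMod T => x.1 < x.2.1)
    (by simp) f, Finset.sum_filter, Fintype.sum_prod_type]
  refine Finset.sum_congr rfl fun p _ => ?_
  rw [Fintype.sum_prod_type]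
  refine Finset.sum_congr rfl fun q _ => ?_
  split_ifs <;> simp

theorem sum_lt_eq {g : Fin m → Fin m → ℂ} (hg : ∀ p q, g p q = g q p) :
    ∑ p, ∑ q, (if p < q then g p q else 0) =
      2⁻¹ * (∑ p, ∑ q, g p q - ∑ p, g p p) := by
  have h1 : ∑ p, ∑ q, (if q < p then g p q else 0) = ∑ p, ∑ q, if p < q then g p q else 0 := by
    rw [Finset.sum_comm]
    simp only [hg]
  have h2 : ∑ p, ∑ q, g p q = ∑ p, ∑ q, (if p < q then g p q else 0) +
      ∑ p, ∑ q, (if q < p then g p q else 0) + ∑ p, g p p := by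
    simp only [← Finset.sum_add_distrib]
    refine Finset.sum_congr rfl fun p _ => ?_
    have : g p p = ∑ q, if q = p then g p q else 0 := by simp
    rw [this, ← Finset.sum_add_distrib]
    refine Finset.sum_congr rfl fun q _ => ?_
    rcases lt_trichotomy p q with h | h | h
    · simp [h, h.not_gt, h.ne']
    · simp [h]
    · simp [h, h.not_gt, h.ne]
  rw [h2, h1]
  ring

/-- For each `p < q` there is exactly one balanced label, `k q - k p`, and by invariance its weight
is that of the letters prescribed by `k`. -/
theorem sum_balanced (ha : ∀ x y, a x y = a y x)
    (hτ : ∀ j x y, a (shiftPerm m j x) (shiftPerm m j y) = a x y) (k : Fin m → ZMod T)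
    {φ : Fin m → Fin m → ℂ} (hφ : ∀ p q, φ p q = φ q p) (h0 : ∀ p, φ p p = 0) :
    ∑ h : Diag T m, (if Balanced k h then diagWeight a h * φ (ends h).1 (ends h).2 else 0) =
      2⁻¹ * ∑ p, ∑ q, a (k p, p) (k q, q) * φ p q := by
  have h1 := sum_diag (T := T) (m := m) (fun x => if x.2.2 = k x.2.1 - k x.1 then
    a (0, x.1) (x.2.2, x.2.1) * φ x.1 x.2.1 else 0)
  refine h1.trans ?_
  have h2 : ∀ p q : Fin m, a (0, p) (k q - k p, q) = a (k p, p) (k q, q) := by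
    intro p q
    have := hτ (k p) (0, p) (k q - k p, q)
    simp only [shiftPerm_apply, zero_add, sub_add_cancel] at this
    exact this.symm
  simp only [Finset.sum_ite_eq', Finset.sum_ite_eq, Finset.mem_univ, if_true, h2]
  rw [sum_lt_eq (fun p q => by rw [ha, hφ])]
  simp [h0]

/-- For `p < q` the unbalanced labels are `k q - k p - l` with `l ≠ 0`. The sum over `l` is
symmetric in `p` and `q` by `l ↦ -l`, so it is half of the sum over all pairs minus the diagonal;
the diagonal is the first sum on the right. -/
theorem sum_unbalanced (ha : ∀ x y, a x y = a y x)
    (hτ : ∀ j x y, a (shiftPerm m j x) (shiftPerm m j y) = a x y) (k : Fin m → ZMod T) :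
    ∑ h : Diag T m, (if Balanced k h then 0 else diagWeight a h) =
      -2⁻¹ * ∑ l ∈ Finset.univ.erase (0 : ZMod T),
        (∑ p, a (k p, p) (k p - l, p) - ∑ p, ∑ q, a (k p, p) (k q - l, q)) := by
  have h1 := sum_diag (T := T) (m := m) (fun x => if x.2.2 = k x.2.1 - k x.1 then 0 else
    a (0, x.1) (x.2.2, x.2.1))
  refine h1.trans ?_
  have h2 : ∀ p q : Fin m, (∑ κ : ZMod T, if κ = k q - k p then 0 else a (0, p) (κ, q)) =
      ∑ l ∈ Finset.univ.erase (0 : ZMod T), a (k p, p) (k q - l, q) := by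
    intro p q
    rw [← Equiv.sum_comp (Equiv.subLeft (k q - k p)), ← Finset.sum_erase Finset.univ (a := 0)]
    · refine Finset.sum_congr rfl fun l hl => ?_
      have hl' := Finset.ne_of_mem_erase hl
      rw [Equiv.subLeft_apply, if_neg (by simpa using hl'), ← hτ (k p)]
      simp only [shiftPerm_apply, zero_add]
      congr 2
      ring
    · simp
  simp only [h2]
  rw [sum_lt_eq]
  · have e1 : ∑ p, ∑ q, ∑ l ∈ Finset.univ.erase (0 : ZMod T), a (k p, p) (k q - l, q) =
        ∑ l ∈ Finset.univ.erase (0 : ZMod T), ∑ p, ∑ q, a (k p, p) (k q - l, q) := by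
      rw [Finset.sum_comm (s := Finset.univ.erase (0 : ZMod T))]
      exact Finset.sum_congr rfl fun p _ => Finset.sum_comm
    rw [e1, Finset.sum_comm (s := Finset.univ) (t := Finset.univ.erase (0 : ZMod T)),
      Finset.sum_sub_distrib]
    ring
  · intro p q
    refine Finset.sum_nbij' (fun l => -l) (fun l => -l) ?_ ?_ ?_ ?_ ?_
    · simp
    · simp
    · simp
    · simp
    · intro l _
      rw [ha, ← hτ l]
      simp [shiftPerm_apply, sub_eq_add_neg]

/-- Both sign functions are antisymmetric, so their product does not depend on the order of the two
indices, and the sum over `p < q` becomes a sum over the pairs of the bracket. -/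
theorem sum_adaptCoeff (ha : ∀ x y, a x y = a y x)
    (hτ : ∀ j x y, a (shiftPerm m j x) (shiftPerm m j y) = a x y) (k : Fin m → ZMod T)
    {κ : Fin m → Fin m → ℂ} (hκ : ∀ p q, κ p q = -κ q p)
    (J : List (ZMod T × Fin m) × List (ZMod T × Fin m)) :
    ∑ h : Diag T m, diagWeight a h * (κ (ends h).1 (ends h).2 * adaptCoeff k J h) =
      nodeSum a k κ J := by
  have h1 : nodeSum a k κ J = 2⁻¹ * ∑ p, ∑ q, a (k p, p) (k q, q) * (κ p q * nodeConnect J p q) := by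
    rw [nodeSum, ← sum_mul_connect _ _ fun p q => ?_]
    · simp only [mul_assoc]; rfl
    · rw [ha, hκ, mul_neg]
  rw [h1, ← sum_balanced ha hτ k]
  · refine Finset.sum_congr rfl fun h _ => ?_
    rw [adaptCoeff]
    split_ifs <;> simp
  · intro p q
    rw [hκ, nodeConnect_swap]; ring
  · intro p
    have := hκ p p
    have : κ p p = 0 := by linear_combination (2⁻¹ : ℂ) * this
    rw [this, zero_mul]

end DiagSums

/-! ### Comparison of the geometric form with the derivations -/

section GeomCross

open Classical

variable {T n : ℕ} [NeZero T] {a : ZMod T × Fin (n + 1) → ZMod T × Fin (n + 1) → ℂ}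
  {k k' : Fin (n + 1) → ZMod T}
  {J J' : Fin n → List (ZMod T × Fin (n + 1)) × List (ZMod T × Fin (n + 1))} {s s' : ℤ}

/-- The indicator function of the tuples of hyperplanes that are adapted to a tuple of brackets. -/
def adaptInd (k : Fin (n + 1) → ZMod T)
    (J : Fin n → List (ZMod T × Fin (n + 1)) × List (ZMod T × Fin (n + 1)))
    (G : Fin n → Diag T (n + 1)) : ℂ :=
  if ∀ i, Adapted k (G i) (J i) then 1 else 0

/-- The indicator function of the unbalanced hyperplanes. -/
def unbalInd (k : Fin (n + 1) → ZMod T) (h : Diag T (n + 1)) : ℂ := if Balanced k h then 0 else 1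

/-- The part of the geometric form in which the last hyperplanes of the two flags agree. -/
def sameLast (a : Diag T (n + 1) → ℂ) (k k' : Fin (n + 1) → ZMod T)
    (J J' : Fin n → List (ZMod T × Fin (n + 1)) × List (ZMod T × Fin (n + 1))) : ℂ :=
  ∑ h, ∑ G : Fin n → Diag T (n + 1), ∑ τ : Equiv.Perm (Fin n),
    (unbalInd k' h * unbalInd k h * a h) * ((∏ i, a (G i)) *
      (((Equiv.Perm.sign τ : ℤ) : ℂ) * (adaptInd k' J G * adaptInd k J' (G ∘ τ))))

/-- The part of the geometric form in which the last hyperplanes of the two flags differ. -/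
def otherLast (a : Diag T (n + 1) → ℂ) (k k' : Fin (n + 1) → ZMod T)
    (J J' : Fin n → List (ZMod T × Fin (n + 1)) × List (ZMod T × Fin (n + 1))) : ℂ :=
  ∑ j, ∑ τ : Equiv.Perm (Fin n), ∑ h, ∑ G : Fin n → Diag T (n + 1),
    (a h * ∏ i, a (G i)) * (((Equiv.Perm.sign τ : ℤ) : ℂ) * (unbalInd k' h * unbalInd k (G j) *
      (adaptInd k' J G * adaptInd k J' (Function.update G j h ∘ τ))))

/-- Write a tuple that cuts out the second flag as `G` followed by the unbalanced hyperplane `h`.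
For the first flag the last hyperplane is either `h` again, or some `G j`, and then `h` takes the
place of `G j`. -/
theorem geomForm_eq_sub {ω : ℂ} (a : Diag T (n + 1) → ℂ)
    {L L' : Fin (n + 1) → Submodule ℂ (Fin (n + 1) → ℂ)}
    (hL : ∀ H : Fin (n + 1) → Diag T (n + 1), (∀ i, L i = ⨅ j, ⨅ _ : j ≤ i, diagHyp ω (H j)) ↔
      (∀ i, Adapted k (H i.castSucc) (J' i)) ∧ ¬Balanced k (H (Fin.last n)))
    (hL' : ∀ H : Fin (n + 1) → Diag T (n + 1), (∀ i, L' i = ⨅ j, ⨅ _ : j ≤ i, diagHyp ω (H j)) ↔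
      (∀ i, Adapted k' (H i.castSucc) (J i)) ∧ ¬Balanced k' (H (Fin.last n))) :
    geomForm (diagHyp ω) a L L' = sameLast a k k' J J' - otherLast a k k' J J' := by
  have hp : ∀ H : Fin (n + 1) → Diag T (n + 1), (pairing (diagHyp ω) L H : ℂ) =
      ∑ τ : Equiv.Perm (Fin n), ((Equiv.Perm.sign τ : ℤ) : ℂ) *
        (adaptInd k J' ((fun i => H i.castSucc) ∘ τ) * unbalInd k (H (Fin.last n))) -
      ∑ j, ∑ τ : Equiv.Perm (Fin n), ((Equiv.Perm.sign τ : ℤ) : ℂ) *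
        (adaptInd k J' (Function.update (fun i : Fin n => H i.castSucc) j (H (Fin.last n)) ∘ τ) *
          unbalInd k (H j.castSucc)) := by
    intro H
    have := sum_perm_last H (fun G h => adaptInd k J' G * unbalInd k h)
    refine Eq.trans ?_ this
    rw [pairing]
    push_cast
    refine Finset.sum_congr rfl fun σ _ => ?_
    rw [if_congr (hL fun j => H (σ j)) rfl rfl, adaptInd, unbalInd]
    by_cases h1 : ∀ i, Adapted k (H (σ (Fin.castSucc i))) (J' i)
    · by_cases h2 : Balanced k (H (σ (Fin.last n)))
      · simp [h1, h2]
      · simp [h1, h2]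
    · simp [h1]
  rw [geomForm_eq_sum, ← (Fin.snocEquiv fun _ : Fin (n + 1) => Diag T (n + 1)).sum_comp,
    Fintype.sum_prod_type, sameLast, otherLast]
  have hterm : ∀ (h : Diag T (n + 1)) (G : Fin n → Diag T (n + 1)),
      (if ∀ i, L' i = ⨅ j, ⨅ _ : j ≤ i, diagHyp ω
          ((Fin.snocEquiv fun _ : Fin (n + 1) => Diag T (n + 1)) (h, G) j) then
        (pairing (diagHyp ω) L ((Fin.snocEquiv fun _ : Fin (n + 1) => Diag T (n + 1)) (h, G)) : ℂ) *
          ∏ j, a ((Fin.snocEquiv fun _ : Fin (n + 1) => Diag T (n + 1)) (h, G) j)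
      else 0) = ∑ τ : Equiv.Perm (Fin n),
    (unbalInd k' h * unbalInd k h * a h) * ((∏ i, a (G i)) *
      (((Equiv.Perm.sign τ : ℤ) : ℂ) * (adaptInd k' J G * adaptInd k J' (G ∘ τ)))) -
      ∑ j, ∑ τ : Equiv.Perm (Fin n),
    (a h * ∏ i, a (G i)) * (((Equiv.Perm.sign τ : ℤ) : ℂ) * (unbalInd k' h * unbalInd k (G j) *
      (adaptInd k' J G * adaptInd k J' (Function.update G j h ∘ τ)))) := by
    intro h G
    set H := (Fin.snocEquiv fun _ : Fin (n + 1) => Diag T (n + 1)) (h, G) with hH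
    have e1 : ∀ i : Fin n, H i.castSucc = G i := fun i => by simp [hH, Fin.snocEquiv]
    have e2 : H (Fin.last n) = h := by simp [hH, Fin.snocEquiv]
    have e3 : (if ∀ i, L' i = ⨅ j, ⨅ _ : j ≤ i, diagHyp ω (H j) then
        (pairing (diagHyp ω) L H : ℂ) * ∏ j, a (H j) else 0) =
        (adaptInd k' J G * unbalInd k' h) * ((∏ i, a (G i)) * a h) *
          (pairing (diagHyp ω) L H : ℂ) := by
      rw [if_congr (hL' H) rfl rfl, adaptInd, unbalInd, Fin.prod_univ_castSucc]
      simp only [e1, e2]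
      by_cases h1 : ∀ i, Adapted k' (G i) (J i)
      · by_cases h2 : Balanced k' h
        · simp [h1, h2]
        · simp [h1, h2]; ring
      · simp [h1]
    rw [e3, hp]
    simp only [e1, e2]
    rw [mul_sub, Finset.mul_sum, Finset.mul_sum]
    congr 1
    · exact Finset.sum_congr rfl fun τ _ => by ring
    · refine Finset.sum_congr rfl fun j _ => ?_
      rw [Finset.mul_sum]
      exact Finset.sum_congr rfl fun τ _ => by ring
  simp only [hterm, Finset.sum_sub_distrib]
  congr 1
  trans ∑ h, ∑ j, ∑ G : Fin n → Diag T (n + 1), ∑ τ : Equiv.Perm (Fin n),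
    (a h * ∏ i, a (G i)) * (((Equiv.Perm.sign τ : ℤ) : ℂ) * (unbalInd k' h * unbalInd k (G j) *
      (adaptInd k' J G * adaptInd k J' (Function.update G j h ∘ τ))))
  · exact Finset.sum_congr rfl fun h _ => Finset.sum_comm
  · rw [Finset.sum_comm]
    refine Finset.sum_congr rfl fun j _ => ?_
    refine Eq.trans (Finset.sum_congr rfl fun h _ => Finset.sum_comm) ?_
    exact Finset.sum_comm

theorem adaptInd_ne_zero {G : Fin n → Diag T (n + 1)} (h : adaptInd k J G ≠ 0) :
    ∀ i, Adapted k (G i) (J i) := by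
  by_contra hc
  exact h (if_neg hc)

theorem unbalInd_ne_zero {h : Diag T (n + 1)} (hh : unbalInd k h ≠ 0) : ¬Balanced k h := by
  intro hc
  exact hh (if_pos hc)

theorem prod_adaptCoeff_eq_zero (hJ : ∀ i, Disjoint (indices (J i).1) (indices (J i).2))
    {G : Fin n → Diag T (n + 1)} (h : ¬∀ i, Adapted k (G i) (J i)) :
    ∏ i, adaptCoeff k (J i) (G i) = 0 := by
  push Not at h
  obtain ⟨i, hi⟩ := h
  refine Finset.prod_eq_zero (Finset.mem_univ i) ?_
  by_contra hne
  exact hi ((adaptCoeff_ne_zero_iff (hJ i)).mp hne)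

theorem prod_adaptCoeff_mul_self (hJ : ∀ i, Disjoint (indices (J i).1) (indices (J i).2))
    {G : Fin n → Diag T (n + 1)} (h : ∀ i, Adapted k (G i) (J i)) :
    (∏ i, adaptCoeff k (J i) (G i)) * ∏ i, adaptCoeff k (J i) (G i) = 1 := by
  rw [← Finset.prod_mul_distrib]
  exact Finset.prod_eq_one fun i _ => adaptCoeff_mul_self (hJ i) (h i)

variable (hJ : ∀ i, Disjoint (indices (J i).1) (indices (J i).2))
  (hJ' : ∀ i, Disjoint (indices (J' i).1) (indices (J' i).2))
  (hs : s * s = 1) (hs' : s' * s' = 1)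
  (ho : ∀ e : Fin n → Fin (n + 1) × Fin (n + 1), (∀ i, Crosses (e i) (J' i)) →
    orient n (edgeVec ∘ e) = s * (n + 1))
  (ho' : ∀ e : Fin n → Fin (n + 1) × Fin (n + 1), (∀ i, Crosses (e i) (J i)) →
    orient n (edgeVec ∘ e) = s' * (n + 1))

theorem connect_ne_zero_iff {U : Finset (Fin (n + 1))} {p q : Fin (n + 1)} :
    connect U Uᶜ p q ≠ 0 ↔ ¬(p ∈ U ↔ q ∈ U) := by
  by_cases hp : p ∈ U <;> by_cases hq : q ∈ U <;> simp [connect, hp, hq]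

theorem connect_mul_self {U : Finset (Fin (n + 1))} {p q : Fin (n + 1)}
    (h : connect U Uᶜ p q ≠ 0) : connect U Uᶜ p q * connect U Uᶜ p q = 1 := by
  rw [connect_ne_zero_iff] at h
  by_cases hp : p ∈ U <;> by_cases hq : q ∈ U <;> simp [connect, hp, hq] at h ⊢

include hJ hJ' hs hs' ho ho'

/-- The signs of both flags are read off from the determinant of one tuple of edges, taken in two
orders that differ by `τ`. When both tuples are adapted all factors are `±1`, so the relation can be
solved for the product of signs. -/
theorem sign_mul_adaptInd (τ : Equiv.Perm (Fin n)) (G : Fin n → Diag T (n + 1)) :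
    (s : ℂ) * s' * (((Equiv.Perm.sign τ : ℤ) : ℂ) * (adaptInd k' J G * adaptInd k J' (G ∘ τ))) =
      (∏ i, adaptCoeff k' (J i) (G i)) * ∏ i, adaptCoeff k (J' i) (G (τ i)) := by
  by_cases h1 : ∀ i, Adapted k' (G i) (J i)
  · by_cases h2 : ∀ i, Adapted k ((G ∘ τ) i) (J' i)
    · have e1 := orient_of_adapted hJ ho' h1
      have e2 := orient_of_adapted hJ' ho h2
      have e3 : orient n (edgeVec ∘ ends ∘ G ∘ τ) =
          ((Equiv.Perm.sign τ : ℤ) : ℂ) * orient n (edgeVec ∘ ends ∘ G) := by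
        have := AlternatingMap.map_perm (orient n) (edgeVec ∘ ends ∘ G) τ
        rw [Units.smul_def, zsmul_eq_mul] at this
        exact this
      rw [e2, e1] at e3
      have hn : ((n : ℂ) + 1) ≠ 0 := by exact_mod_cast n.succ_ne_zero
      have q1 := prod_adaptCoeff_mul_self hJ h1
      have q2 := prod_adaptCoeff_mul_self hJ' h2
      have hsc : (s : ℂ) * s = 1 := by exact_mod_cast hs
      have hsc' : (s' : ℂ) * s' = 1 := by exact_mod_cast hs'
      rw [adaptInd, adaptInd, if_pos h1, if_pos h2]
      have e4 : (s : ℂ) * ∏ i, adaptCoeff k (J' i) ((G ∘ τ) i) =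
          ((Equiv.Perm.sign τ : ℤ) : ℂ) * (s' * ∏ i, adaptCoeff k' (J i) (G i)) := by
        apply mul_right_cancel₀ hn
        linear_combination e3
      change _ = _ * ∏ i, adaptCoeff k (J' i) ((G ∘ τ) i)
      set A := ∏ i, adaptCoeff k' (J i) (G i)
      set B := ∏ i, adaptCoeff k (J' i) ((G ∘ τ) i)
      set t := ((Equiv.Perm.sign τ : ℤ) : ℂ)
      linear_combination (-A * s) * e4 + (A * B) * hsc - (s * t * s') * q1
    · rw [adaptInd, adaptInd, if_neg h2]
      have := prod_adaptCoeff_eq_zero hJ' h2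
      simp only [Function.comp_apply] at this
      rw [this]; ring
  · rw [adaptInd, if_neg h1, prod_adaptCoeff_eq_zero hJ h1]; ring

omit hJ hJ' hs hs' ho ho' in
-- Exchanging `h` with the entry `G j` is an involution of the index set.
theorem sum_update_swap {A : Type*} [Fintype A] (j : Fin n) (f : (Fin n → A) → A → ℂ) :
    ∑ h, ∑ G : Fin n → A, f G h = ∑ g, ∑ G : Fin n → A, f (Function.update G j g) (G j) := by
  classical
  rw [← Fintype.sum_prod_type', ← Fintype.sum_prod_type']
  have hinv : Function.Involutive fun p : A × (Fin n → A) =>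
      (p.2 j, Function.update p.2 j p.1) := by
    rintro ⟨g, G⟩
    simp
  rw [← Equiv.sum_comp hinv.toPerm]
  rfl

/-- The geometric form of flags with equal potentials. -/
theorem sameLast_of_const (hab : ∀ x y, a x y = a y x)
    (hτ : ∀ j x y, a (shiftPerm (n + 1) j x) (shiftPerm (n + 1) j y) = a x y)
    {u : ZMod T} (hu : ∀ p, k p = k' p + u) :
    (s : ℂ) * s' * sameLast (diagWeight a) k k' J J' =
      (∑ h, if Balanced k h then 0 else diagWeight a h) *
        ∑ τ : Equiv.Perm (Fin n), ∏ i, nodeSum a k (nodeConnect (J (τ i))) (J' i) := by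
  have hbal : ∀ h : Diag T (n + 1), Balanced k' h ↔ Balanced k h := by
    intro h
    rw [Balanced, Balanced, hu, hu, add_sub_add_right_eq_sub]
  have h1 : ∀ τ : Equiv.Perm (Fin n), ∏ i, nodeSum a k (nodeConnect (J (τ i))) (J' i) =
      ∑ G : Fin n → Diag T (n + 1), (∏ i, diagWeight a (G i)) *
        ((∏ i, adaptCoeff k' (J i) (G i)) * ∏ i, adaptCoeff k (J' i) (G (τ i))) := by
    intro τ
    have e1 : ∏ i, nodeSum a k (nodeConnect (J (τ i))) (J' i) =
        ∏ i, ∑ h : Diag T (n + 1), diagWeight a h *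
          (nodeConnect (J i) (ends h).1 (ends h).2 * adaptCoeff k (J' (τ.symm i)) h) := by
      rw [← Equiv.prod_comp τ fun i => ∑ h : Diag T (n + 1), diagWeight a h *
          (nodeConnect (J i) (ends h).1 (ends h).2 * adaptCoeff k (J' (τ.symm i)) h)]
      refine Finset.prod_congr rfl fun i _ => ?_
      rw [sum_adaptCoeff hab hτ k (fun p q => nodeConnect_swap _ p q), Equiv.symm_apply_apply]
    rw [e1, Finset.prod_univ_sum, Fintype.piFinset_univ]
    refine Finset.sum_congr rfl fun G _ => ?_
    rw [← Equiv.prod_comp τ.symm fun i => adaptCoeff k (J' i) (G (τ i)), ← Finset.prod_mul_distrib,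
      ← Finset.prod_mul_distrib]
    refine Finset.prod_congr rfl fun i _ => ?_
    rw [Equiv.apply_symm_apply]
    congr 1
    rw [adaptCoeff, adaptCoeff, if_congr (hbal (G i)) rfl rfl]
    split_ifs <;> simp
  simp only [h1]
  rw [sameLast, Finset.mul_sum, Finset.sum_mul]
  refine Finset.sum_congr rfl fun h _ => ?_
  rw [Finset.mul_sum, Finset.sum_comm, Finset.mul_sum]
  simp only [Finset.mul_sum]
  refine Finset.sum_congr rfl fun G _ => Finset.sum_congr rfl fun τ _ => ?_
  rw [← sign_mul_adaptInd hJ hJ' hs hs' ho ho' τ G, unbalInd, unbalInd,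
    if_congr (hbal h) rfl rfl]
  split_ifs <;> ring

omit hJ hJ' hs hs' ho ho' in
theorem Balanced.sub_eq {h : Diag T (n + 1)} (h1 : Balanced k h) (h2 : Balanced k' h) :
    k (ends h).1 - k' (ends h).1 = k (ends h).2 - k' (ends h).2 := by
  have h3 : k h.1.2.1 - k h.1.1 = k' h.1.2.1 - k' h.1.1 := h1.symm.trans h2
  change k h.1.1 - k' h.1.1 = k h.1.2.1 - k' h.1.2.1
  linear_combination -h3

omit hJ hJ' hs hs' ho ho' in
theorem Balanced.of_sub_eq {h : Diag T (n + 1)} (h1 : Balanced k h)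
    (h2 : k (ends h).1 - k' (ends h).1 = k (ends h).2 - k' (ends h).2) : Balanced k' h := by
  have h2' : k h.1.1 - k' h.1.1 = k h.1.2.1 - k' h.1.2.1 := h2
  unfold Balanced at h1 ⊢
  rw [h1]
  linear_combination -h2'

omit hJ' hs ho in
-- The edges of an adapted tuple form a spanning tree, so one of them must leave `U`.
theorem not_adapted_of_cut {U : Finset (Fin (n + 1))} {p q : Fin (n + 1)} (hp : p ∈ U)
    (hq : q ∉ U) {G : Fin n → Diag T (n + 1)}
    (hG : ∀ i, (ends (G i)).1 ∈ U ↔ (ends (G i)).2 ∈ U) : ¬∀ i, Adapted k' (G i) (J i) := by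
  intro hA
  refine orient_ne_zero_of_adapted hJ hs' ho' hA (orient_edgeVec_eq_zero hp hq fun i => ?_)
  by_contra hne
  exact connect_ne_zero_iff.mp hne (hG i)

omit hJ' hs ho in
-- If the same `n` hyperplanes are balanced for both potentials, `k - k'` is constant along the
-- edges of a spanning tree, hence constant.
theorem sameLast_eq_zero (a : Diag T (n + 1) → ℂ) {p q : Fin (n + 1)}
    (hpq : k p - k' p ≠ k q - k' q) : sameLast a k k' J J' = 0 := by
  refine Finset.sum_eq_zero fun h _ => Finset.sum_eq_zero fun G _ =>
    Finset.sum_eq_zero fun τ _ => ?_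
  have : adaptInd k' J G * adaptInd k J' (G ∘ τ) = 0 := by
    by_contra hne
    have h1 := adaptInd_ne_zero (left_ne_zero_of_mul hne)
    have h2 := adaptInd_ne_zero (right_ne_zero_of_mul hne)
    refine not_adapted_of_cut hJ hs' ho'
      (U := Finset.univ.filter fun x => k x - k' x = k p - k' p) (p := p) (q := q) (by simp)
      (by simpa using hpq.symm) (fun i => ?_) h1
    have e1 := (h2 (τ.symm i)).1
    rw [Function.comp_apply, Equiv.apply_symm_apply] at e1
    simp only [Finset.mem_filter, Finset.mem_univ, true_and]
    rw [e1.sub_eq (h1 i).1]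
  rw [this]; ring

omit hJ hJ' hs hs' ho ho' in
-- Equal potentials up to a constant have the same balanced hyperplanes, but `G j` would have to be
-- balanced for `k'` and unbalanced for `k`.
theorem otherLast_of_const (a : Diag T (n + 1) → ℂ) {u : ZMod T} (hu : ∀ p, k p = k' p + u) :
    otherLast a k k' J J' = 0 := by
  refine Finset.sum_eq_zero fun j _ => Finset.sum_eq_zero fun τ _ =>
    Finset.sum_eq_zero fun h _ => Finset.sum_eq_zero fun G _ => ?_
  have : unbalInd k (G j) * adaptInd k' J G = 0 := by
    by_contra hne
    have h1 := unbalInd_ne_zero (left_ne_zero_of_mul hne)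
    have h2 := (adaptInd_ne_zero (right_ne_zero_of_mul hne) j).1
    exact h1 (h2.of_sub_eq (by rw [hu, hu]; ring))
  linear_combination ((a h * ∏ i, a (G i)) * (((Equiv.Perm.sign τ : ℤ) : ℂ) * unbalInd k' h *
    adaptInd k J' (Function.update G j h ∘ τ))) * this

omit hJ hJ' hs hs' ho ho' in
theorem adapted_update {G : Fin n → Diag T (n + 1)} {j : Fin n} {h : Diag T (n + 1)}
    {τ : Equiv.Perm (Fin n)} (hA : ∀ i, Adapted k ((Function.update G j h ∘ τ) i) (J' i)) :
    Balanced k h ∧ ∀ i, i ≠ j → Balanced k (G i) := by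
  have h1 : ∀ i, Balanced k (Function.update G j h i) := fun i => by
    have := (hA (τ.symm i)).1
    rwa [Function.comp_apply, Equiv.apply_symm_apply] at this
  refine ⟨by simpa using h1 j, fun i hi => ?_⟩
  have := h1 i
  rwa [Function.update_of_ne hi] at this

omit hJ' hs ho in
-- All edges of the spanning tree `G` except `G j` are balanced for both potentials. Removing one
-- edge leaves two components, so `k - k'` takes at most two values.
theorem otherLast_of_three (a : Diag T (n + 1) → ℂ) {p₀ p₁ p₂ : Fin (n + 1)}
    (h01 : k p₀ - k' p₀ ≠ k p₁ - k' p₁) (h02 : k p₀ - k' p₀ ≠ k p₂ - k' p₂)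
    (h12 : k p₁ - k' p₁ ≠ k p₂ - k' p₂) : otherLast a k k' J J' = 0 := by
  refine Finset.sum_eq_zero fun j _ => Finset.sum_eq_zero fun τ _ =>
    Finset.sum_eq_zero fun h _ => Finset.sum_eq_zero fun G _ => ?_
  have : adaptInd k' J G * adaptInd k J' (Function.update G j h ∘ τ) = 0 := by
    by_contra hne
    have h1 := adaptInd_ne_zero (left_ne_zero_of_mul hne)
    have h2 := adapted_update (adaptInd_ne_zero (right_ne_zero_of_mul hne))
    obtain ⟨p, q, hpq, hp1, hp2⟩ : ∃ p q : Fin (n + 1), k p - k' p ≠ k q - k' q ∧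
        k p - k' p ≠ k (ends (G j)).1 - k' (ends (G j)).1 ∧
        k p - k' p ≠ k (ends (G j)).2 - k' (ends (G j)).2 := by
      by_contra! hc
      have c0 := hc p₀ p₁ h01
      have c1 := hc p₁ p₀ h01.symm
      have c2 := hc p₂ p₀ h02.symm
      by_cases e0 : k p₀ - k' p₀ = k (ends (G j)).1 - k' (ends (G j)).1
      · have c1' := c1 fun h => h01 (e0.trans h.symm)
        have c2' := c2 fun h => h02 (e0.trans h.symm)
        exact h12 (c1'.trans c2'.symm)
      · have c0' := c0 e0
        by_cases e1 : k p₁ - k' p₁ = k (ends (G j)).1 - k' (ends (G j)).1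
        · have c2' := c2 fun h => h12 (e1.trans h.symm)
          exact h02 (c0'.trans c2'.symm)
        · exact h01 (c0'.trans (c1 e1).symm)
    refine not_adapted_of_cut hJ hs' ho'
      (U := Finset.univ.filter fun x => k x - k' x = k p - k' p) (p := p) (q := q) (by simp)
      (by simpa using hpq.symm) (fun i => ?_) h1
    simp only [Finset.mem_filter, Finset.mem_univ, true_and]
    by_cases hi : i = j
    · subst hi
      exact ⟨fun h => absurd h.symm hp1, fun h => absurd h.symm hp2⟩
    · rw [(h2.2 i hi).sub_eq (h1 i).1]
  rw [this]; ring

/-- The sign that relates two flags whose last hyperplanes differ. -/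
theorem sign_mul_adaptInd_update {U : Finset (Fin (n + 1))} {u v : ZMod T} (huv : u ≠ v)
    (hU : ∀ p ∈ U, k p = k' p + u) (hU' : ∀ p ∉ U, k p = k' p + v) {p₀ p₁ : Fin (n + 1)}
    (hp₀ : p₀ ∈ U) (hp₁ : p₁ ∉ U) (τ : Equiv.Perm (Fin n)) (G : Fin n → Diag T (n + 1)) (j : Fin n)
    (h : Diag T (n + 1)) :
    (s : ℂ) * s' * (((Equiv.Perm.sign τ : ℤ) : ℂ) * (unbalInd k' h * unbalInd k (G j) *
      (adaptInd k' J G * adaptInd k J' (Function.update G j h ∘ τ)))) =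
      connect U Uᶜ (ends (G j)).1 (ends (G j)).2 * connect U Uᶜ (ends h).1 (ends h).2 *
        ((∏ i, adaptCoeff k' (J i) (G i)) *
          ∏ i, adaptCoeff k (J' i) (Function.update G j h (τ i))) := by
  have hside : ∀ h : Diag T (n + 1), (k (ends h).1 - k' (ends h).1 = k (ends h).2 - k' (ends h).2) ↔
      connect U Uᶜ (ends h).1 (ends h).2 = 0 := by
    intro h
    rw [← not_iff_not, ← ne_eq (connect _ _ _ _), connect_ne_zero_iff, not_iff_not]
    by_cases h1 : (ends h).1 ∈ U <;> by_cases h2 : (ends h).2 ∈ U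
    · simp [hU _ h1, hU _ h2, h1, h2]
    · simp [hU _ h1, hU' _ h2, h1, h2, huv]
    · simp [hU' _ h1, hU _ h2, h1, h2, huv.symm]
    · simp [hU' _ h1, hU' _ h2, h1, h2]
  by_cases h1 : ∀ i, Adapted k' (G i) (J i)
  · by_cases h2 : ∀ i, Adapted k ((Function.update G j h ∘ τ) i) (J' i)
    · obtain ⟨hbh, hbG⟩ := adapted_update h2
      have hG0 : ∀ i, i ≠ j → connect U Uᶜ (ends (G i)).1 (ends (G i)).2 = 0 := fun i hi =>
        (hside _).mp ((hbG i hi).sub_eq (h1 i).1)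
      have e1 := orient_of_adapted hJ ho' h1
      have e2 := orient_of_adapted hJ' ho h2
      have e3 : orient n (edgeVec ∘ ends ∘ Function.update G j h ∘ τ) =
          ((Equiv.Perm.sign τ : ℤ) : ℂ) * orient n (edgeVec ∘ ends ∘ Function.update G j h) := by
        have := AlternatingMap.map_perm (orient n) (edgeVec ∘ ends ∘ Function.update G j h) τ
        rw [Units.smul_def, zsmul_eq_mul] at this
        exact this
      have e4 := orient_edgeVec_update (e := ends ∘ G) hp₀ hp₁ j hG0 (ends h)
      rw [← Function.comp_update, Function.comp_apply, e1] at e4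
      -- If `G j` does not cross the cut, it is balanced for both potentials, and both sides vanish.
      by_cases hz : connect U Uᶜ (ends (G j)).1 (ends (G j)).2 = 0
      · have : unbalInd k (G j) = 0 := if_pos ((h1 j).1.of_sub_eq (by
          have := (hside (G j)).mpr hz
          linear_combination -this))
        rw [hz, this]; ring
      -- The updated tuple is a spanning tree as well, and its only edge that can cross the cut is
      -- `h`. So both exchanged edges cross it, and each is unbalanced for the potential for which
      -- it comes last.
      · have hzh : connect U Uᶜ (ends h).1 (ends h).2 ≠ 0 := by
          intro h0
          refine not_adapted_of_cut hJ' hs ho hp₀ hp₁ (G := Function.update G j h ∘ τ)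
            (fun i => ?_) h2
          by_contra hne
          refine connect_ne_zero_iff.mpr hne ?_
          rw [Function.comp_apply]
          by_cases hi : τ i = j
          · rw [hi, Function.update_self]; exact h0
          · rw [Function.update_of_ne hi]; exact hG0 _ hi
        have hu1 : unbalInd k' h = 1 := if_neg fun hb => hzh ((hside h).mp (hbh.sub_eq hb))
        have hu2 : unbalInd k (G j) = 1 := if_neg fun hb =>
          hz ((hside _).mp (hb.sub_eq (h1 j).1))
        have hn : ((n : ℂ) + 1) ≠ 0 := by exact_mod_cast n.succ_ne_zero
        have q1 := prod_adaptCoeff_mul_self hJ h1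
        have hsc : (s : ℂ) * s = 1 := by exact_mod_cast hs
        have hz2 := connect_mul_self hz
        rw [e2] at e3
        rw [adaptInd, adaptInd, if_pos h1, if_pos h2, hu1, hu2]
        change _ = _ * (_ * ∏ i, adaptCoeff k (J' i) ((Function.update G j h ∘ τ) i))
        set A := ∏ i, adaptCoeff k' (J i) (G i)
        set B := ∏ i, adaptCoeff k (J' i) ((Function.update G j h ∘ τ) i)
        set t := ((Equiv.Perm.sign τ : ℤ) : ℂ)
        set x := connect U Uᶜ (ends (G j)).1 (ends (G j)).2
        set y := connect U Uᶜ (ends h).1 (ends h).2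
        set D := orient n (edgeVec ∘ ends ∘ Function.update G j h)
        have hy2 : y * y = 1 := connect_mul_self hzh
        have e5 : x * (s * B) = t * (y * (s' * A)) := by
          apply mul_right_cancel₀ hn
          linear_combination x * e3 + t * e4
        linear_combination (-A * s * y) * e5 + (x * y * A * B) * hsc - (s * t * s') * q1 -
          (s * t * s' * A * A) * hy2
    · rw [adaptInd, adaptInd, if_neg h2]
      have := prod_adaptCoeff_eq_zero hJ' h2
      simp only [Function.comp_apply] at this
      rw [this]; ring
  · rw [adaptInd, if_neg h1, prod_adaptCoeff_eq_zero hJ h1]; ring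

/-- The geometric form of flags whose potentials differ by two values. -/
theorem otherLast_of_sides (hab : ∀ x y, a x y = a y x)
    (hτ : ∀ j x y, a (shiftPerm (n + 1) j x) (shiftPerm (n + 1) j y) = a x y)
    {U : Finset (Fin (n + 1))} {u v : ZMod T} (huv : u ≠ v)
    (hU : ∀ p ∈ U, k p = k' p + u) (hU' : ∀ p ∉ U, k p = k' p + v) {p₀ p₁ : Fin (n + 1)}
    (hp₀ : p₀ ∈ U) (hp₁ : p₁ ∉ U) :
    (s : ℂ) * s' * otherLast (diagWeight a) k k' J J' =
      ∑ j, nodeSum a k' (connect U Uᶜ) (J j) *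
        ∑ τ : Equiv.Perm (Fin n), ∏ i, nodeSum a k (mixedConnect U J j (τ i)) (J' i) := by
  have hsame : ∀ (h : Diag T (n + 1)) (J₁ J₂ : List (ZMod T × Fin (n + 1)) ×
      List (ZMod T × Fin (n + 1))), adaptCoeff k' J₁ h * adaptCoeff k J₂ h =
      (sameSide U (ends h).1 (ends h).2 * nodeConnect J₁ (ends h).1 (ends h).2) *
        adaptCoeff k J₂ h := by
    intro h J₁ J₂
    by_cases hb : Balanced k h
    · have : Balanced k' h ↔ ((ends h).1 ∈ U ↔ (ends h).2 ∈ U) := by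
        constructor
        · intro hb'
          have := hb.sub_eq hb'
          by_cases h1 : (ends h).1 ∈ U <;> by_cases h2 : (ends h).2 ∈ U
          · simp [h1, h2]
          · simp [hU _ h1, hU' _ h2, huv] at this
          · simp [hU' _ h1, hU _ h2, huv.symm] at this
          · simp [h1, h2]
        · intro hiff
          refine hb.of_sub_eq ?_
          by_cases h1 : (ends h).1 ∈ U
          · have h2 := hiff.mp h1
            rw [hU _ h1, hU _ h2]; ring
          · have h2 := fun h => h1 (hiff.mpr h)
            rw [hU' _ h1, hU' _ h2]; ring
      congr 1
      rw [adaptCoeff, sameSide, if_congr this rfl rfl]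
      split_ifs <;> simp
    · simp [adaptCoeff, hb]
  rw [otherLast, Finset.mul_sum]
  refine Finset.sum_congr rfl fun j _ => ?_
  rw [Finset.mul_sum, Finset.mul_sum]
  refine Finset.sum_congr rfl fun τ _ => ?_
  have hκ : ∀ i p q, mixedConnect U J j i p q = -mixedConnect U J j i q p := by
    intro i p q
    unfold mixedConnect
    split_ifs
    · exact connect_swap _ _ _ _
    · simp only [nodeConnect]
      rw [sameSide_swap, connect_swap, mul_neg]
  have e1 : ∏ i, nodeSum a k (mixedConnect U J j (τ i)) (J' i) =
      ∏ i, ∑ h : Diag T (n + 1), diagWeight a h *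
        (mixedConnect U J j i (ends h).1 (ends h).2 * adaptCoeff k (J' (τ.symm i)) h) := by
    rw [← Equiv.prod_comp τ fun i => ∑ h : Diag T (n + 1), diagWeight a h *
        (mixedConnect U J j i (ends h).1 (ends h).2 * adaptCoeff k (J' (τ.symm i)) h)]
    refine Finset.prod_congr rfl fun i _ => ?_
    rw [sum_adaptCoeff hab hτ k (hκ _), Equiv.symm_apply_apply]
  -- After the exchange of `h` with `G j`, the edge `g` belongs only to the bracket `J j` of the
  -- second flag, and the tuple `G` to the brackets of the first; so the sum over `g` splits off as
  -- one factor.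
  rw [e1, Finset.prod_univ_sum, Fintype.piFinset_univ,
    ← sum_adaptCoeff hab hτ k' (fun p q => connect_swap U Uᶜ p q) (J j), sum_update_swap j,
    Finset.sum_mul, Finset.mul_sum]
  refine Finset.sum_congr rfl fun g _ => ?_
  rw [Finset.mul_sum, Finset.mul_sum]
  refine Finset.sum_congr rfl fun G _ => ?_
  rw [mul_left_comm, sign_mul_adaptInd_update hJ hJ' hs hs' ho ho' huv hU hU' hp₀ hp₁,
    Function.update_self, Function.update_idem, Function.update_eq_self,
    ← Equiv.prod_comp τ.symm fun i => adaptCoeff k (J' i) (G (τ i))]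
  simp only [Equiv.apply_symm_apply]
  have p1 : ∏ i ∈ Finset.univ.erase j, diagWeight a (Function.update G j g i) =
      ∏ i ∈ Finset.univ.erase j, diagWeight a (G i) := Finset.prod_congr rfl fun i hi => by
    rw [Function.update_of_ne (Finset.ne_of_mem_erase hi)]
  have p2 : ∏ i ∈ Finset.univ.erase j, adaptCoeff k' (J i) (Function.update G j g i) =
      ∏ i ∈ Finset.univ.erase j, adaptCoeff k' (J i) (G i) := Finset.prod_congr rfl fun i hi => by
    rw [Function.update_of_ne (Finset.ne_of_mem_erase hi)]
  rw [← Finset.mul_prod_erase _ _ (Finset.mem_univ j),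
    ← Finset.mul_prod_erase _ (fun i => adaptCoeff k' (J i) _) (Finset.mem_univ j),
    Function.update_self, p1, p2, ← Finset.mul_prod_erase _ (fun i => adaptCoeff k (J' (τ.symm i)) (G i)) (Finset.mem_univ j)]
  conv_rhs => rw [← Finset.mul_prod_erase _ _ (Finset.mem_univ j)]
  have e2 : ∏ i ∈ Finset.univ.erase j, diagWeight a (G i) *
      (mixedConnect U J j i (ends (G i)).1 (ends (G i)).2 * adaptCoeff k (J' (τ.symm i)) (G i)) =
      (∏ i ∈ Finset.univ.erase j, diagWeight a (G i)) *
        ((∏ i ∈ Finset.univ.erase j, adaptCoeff k' (J i) (G i)) *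
          ∏ i ∈ Finset.univ.erase j, adaptCoeff k (J' (τ.symm i)) (G i)) := by
    rw [← Finset.prod_mul_distrib, ← Finset.prod_mul_distrib]
    refine Finset.prod_congr rfl fun i hi => ?_
    rw [hsame, mixedConnect, if_neg (Finset.ne_of_mem_erase hi)]
  have e3 : mixedConnect U J j j = connect U Uᶜ := if_pos rfl
  rw [e2, e3]
  ring

omit hJ hJ' hs hs' ho ho' in
theorem disjoint_of_mem_nodes {m : ℕ} {k : Fin m → ZMod T} {c : FreeMagma (ZMod T × Fin m)}
    (hc : HasPotential k (content c)) {J : List (ZMod T × Fin m) × List (ZMod T × Fin m)}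
    (hJ : J ∈ nodes c) : Disjoint (indices J.1) (indices J.2) := by
  have hsub := nodes_sublist hJ
  have hnd := hc.nodup.sublist hsub
  rw [Finset.disjoint_left]
  intro p hp hp'
  simp only [indices, List.mem_toFinset, List.mem_map] at hp hp'
  obtain ⟨x, hx, rfl⟩ := hp
  obtain ⟨y, hy, hxy⟩ := hp'
  have e1 := (hc.mem_iff x).mp (hsub.subset (List.mem_append_left _ hx))
  have e2 := (hc.mem_iff y).mp (hsub.subset (List.mem_append_right _ hy))
  have : x = y := Prod.ext (by rw [e1, e2, hxy]) hxy.symm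
  subst this
  exact List.disjoint_of_nodup_append hnd hx hy

omit hJ hJ' hs hs' ho ho' in
/-- The geometric form in terms of the derivations that are attached to the powers of `τ`. -/
theorem geomForm_eq_crossTotal {m : ℕ} {a : ZMod T × Fin m → ZMod T × Fin m → ℂ} {ω : ℂ}
    (hω : IsPrimitiveRoot ω T) (hab : ∀ x y, a x y = a y x)
    (hτ : ∀ j x y, a (shiftPerm m j x) (shiftPerm m j y) = a x y)
    {c d : FreeMagma (ZMod T × Fin m)} {s s' : ℤ} {Ls Ls' : List (Submodule ℂ (Fin m → ℂ))}
    (hf : FlagOf ω [c] s Ls) (hf' : FlagOf ω [d] s' Ls') :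
    (s : ℂ) * s' * geomForm (diagHyp ω) (diagWeight a) (completeFlag Ls) (completeFlag Ls') =
      -2⁻¹ * crossTotal a d c := by
  rcases m with _ | n
  · obtain ⟨x, _⟩ := List.exists_mem_of_ne_nil _ (content_ne_nil c)
    exact x.2.elim0
  obtain ⟨k, J', hc, hJ', hs, hL, ho⟩ := hf.exists_full_spec hω
  obtain ⟨k', J, hd, hJ, hs', hL', ho'⟩ := hf'.exists_full_spec hω
  have hJd : ∀ i, Disjoint (indices (J i).1) (indices (J i).2) := fun i =>
    disjoint_of_mem_nodes hd (hJ.mem_iff.mpr (by simp))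
  have hJd' : ∀ i, Disjoint (indices (J' i).1) (indices (J' i).2) := fun i =>
    disjoint_of_mem_nodes hc (hJ'.mem_iff.mpr (by simp))
  rw [geomForm_eq_sub (diagWeight a) hL hL', mul_sub]
  -- The cases are that `k - k'` is constant, takes exactly two values, or takes at least three.
  -- Only the first part of the geometric form survives in the first case, only the second part in
  -- the second, and nothing in the third.
  by_cases h0 : ∀ p, k p - k' p = k 0 - k' 0
  · have hu : ∀ p, k p = k' p + (k 0 - k' 0) := fun p => by rw [← h0 p]; ring
    rw [sameLast_of_const hJd hJd' hs hs' ho ho' hab hτ hu, otherLast_of_const _ hu,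
      crossTotal_of_const hab hc hd hJ hJ' 0 hu, sum_unbalanced hab hτ]
    ring
  push Not at h0
  obtain ⟨p₁, hp₁⟩ := h0
  rw [sameLast_eq_zero hJd hs' ho' _ hp₁, mul_zero, zero_sub]
  by_cases h2 : ∀ p, k p - k' p = k 0 - k' 0 ∨ k p - k' p = k p₁ - k' p₁
  · have hU : ∀ p ∈ Finset.univ.filter fun p => k p - k' p = k 0 - k' 0,
        k p = k' p + (k 0 - k' 0) := by
      intro p hp
      rw [← (Finset.mem_filter.mp hp).2]; ring
    have hU' : ∀ p ∉ Finset.univ.filter fun p => k p - k' p = k 0 - k' 0,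
        k p = k' p + (k p₁ - k' p₁) := by
      intro p hp
      have h := (h2 p).resolve_left (by simpa using hp)
      rw [← h]; ring
    have h0U : (0 : Fin (n + 1)) ∈ Finset.univ.filter fun p => k p - k' p = k 0 - k' 0 := by simp
    have h1U : p₁ ∉ Finset.univ.filter fun p => k p - k' p = k 0 - k' 0 := by simpa using hp₁
    rw [otherLast_of_sides hJd hJd' hs hs' ho ho' hab hτ hp₁.symm hU hU' h0U h1U,
      crossTotal_of_sides hab hτ hc hd hJ hJ' hp₁.symm hU hU' h0U h1U]
    ring
  · push Not at h2
    obtain ⟨p₂, hp₂, hp₂'⟩ := h2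
    rw [otherLast_of_three hJd hs' ho' _ hp₁ hp₂'.symm hp₂.symm,
      crossTotal_of_three hc hd hp₁ hp₂'.symm hp₂.symm]
    ring

end GeomCross

/-! ### Polarization -/

section Polarization

open LogPoisson Classical

variable {X Y : Type*} [Fintype Y] (χ : Y → X)

/-- The homomorphism that sends a letter to the sum of the letters above it. -/
def polar : FreeLieAlgebra ℂ X →ₗ⁅ℂ⁆ FreeLieAlgebra ℂ Y :=
  FreeLieAlgebra.lift ℂ fun x => ∑ y, if χ y = x then FreeLieAlgebra.of ℂ y else 0

theorem polar_of (x : X) : polar χ (FreeLieAlgebra.of ℂ x) =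
    ∑ y, if χ y = x then FreeLieAlgebra.of ℂ y else 0 := by simp [polar]

theorem lift_polar {L : Type*} [LieRing L] [LieAlgebra ℂ L] (g : Y → L)
    (x : FreeLieAlgebra ℂ X) : FreeLieAlgebra.lift ℂ g (polar χ x) =
      FreeLieAlgebra.lift ℂ (fun x => ∑ y, if χ y = x then g y else 0) x := by
  have : (FreeLieAlgebra.lift ℂ g).comp (polar χ) =
      FreeLieAlgebra.lift ℂ (fun x => ∑ y, if χ y = x then g y else 0) := by
    refine FreeLieAlgebra.hom_ext fun x => ?_
    rw [LieHom.comp_apply, polar_of, FreeLieAlgebra.lift_of_apply, map_sum]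
    refine Finset.sum_congr rfl fun y _ => ?_
    split_ifs <;> simp
  exact LieHom.congr_fun this x

theorem crossDer_polar {M : Type*} [AddCommMonoid M] (c A : M →+ M →+ ℂ) (q : M → ℂ)
    (g g' : Y → LogPoisson c) (x : FreeLieAlgebra ℂ X) :
    crossDer c A q g g' (polar χ x) = crossDer c A q (fun x => ∑ y, if χ y = x then g y else 0)
      (fun x => ∑ y, if χ y = x then g' y else 0) x := by
  have h : (fun x => ∑ y, if χ y = x then inclLeft c A (g y) + inclRight c A (g' y) else 0) =
      fun x => inclLeft c A (∑ y, if χ y = x then g y else 0) +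
        inclRight c A (∑ y, if χ y = x then g' y else 0) := by
    funext x
    rw [map_sum, map_sum, ← Finset.sum_add_distrib]
    refine Finset.sum_congr rfl fun y _ => ?_
    split_ifs <;> simp
  simp only [crossDer, LinearMap.add_apply, LinearMap.comp_apply, LieHom.coe_toLinearMap,
    doubledHom, lift_polar, h]

/-- The sum of the coordinates of the positions with a given property. -/
def posSum (κ : ℕ → ℕ → ℂ) (n : ℕ) (P : ℕ → Prop) : LogPoisson (pairForm κ) :=
  ∑ i ∈ Finset.range n, if P i then mono _ (Finsupp.single i 1) 1 else 0

/-- The derivation that is attached to two kernels on positions. -/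
def kernelDer {X : Type*} (κ κ' : ℕ → ℕ → ℂ) (g g' : X → LogPoisson (pairForm κ)) :
    FreeLieAlgebra ℂ X →ₗ[ℂ] LogPoisson (pairForm κ) :=
  crossDer (pairForm κ) (pairForm κ') (quadForm κ') g g'

/-- The value of the derivation that is attached to two kernels on positions. -/
def kernelValue {X : Type*} (κ κ' : ℕ → ℕ → ℂ) (n : ℕ) (g g' : X → LogPoisson (pairForm κ))
    (x : FreeLieAlgebra ℂ X) : ℂ :=
  coeff (fullExp n) (kernelDer κ κ' g g' x)

/-- The Poisson algebra is a type that depends on the word. In this form it depends on the word only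
through kernels and length, which can be rewritten for a lifted word. -/
theorem crossValue_eq_kernelValue (a : X → X → ℂ) (t : Equiv.Perm X) (x : FreeLieAlgebra ℂ X)
    (w : List X) : crossValue a t x w = kernelValue (orderKernel a w) (crossKernel a t w) w.length
      (fun x => posSum _ w.length fun i => w[i]? = some x)
      (fun x => posSum _ w.length fun i => w[i]? = some (t x)) x := by
  have h : letterSum a w = fun x => posSum _ w.length fun i => w[i]? = some x := by
    funext x
    unfold letterSum posSum
    refine Finset.sum_congr rfl fun i _ => ?_
    congr
  change coeff _ (kernelDer _ (crossKernel a t w) (letterSum a w) (fun x => letterSum a w (t x)) x)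
    = _
  rw [h]
  rfl

/-- The letter at a position of `w` equals `f y` for exactly one `y`, so each position is counted
once on the right. -/
theorem posSum_polar (κ : ℕ → ℕ → ℂ) (w : List Y) (f : Y → Y) (hf : Function.Bijective f)
    {t : X → X} (ht : Function.Injective t) (h : ∀ y, χ (f y) = t (χ y)) (x : X) :
    (posSum κ w.length fun i => (w.map χ)[i]? = some (t x)) =
      ∑ y, if χ y = x then posSum κ w.length (fun i => w[i]? = some (f y)) else 0 := by
  have h1 : ∀ y, (if χ y = x then posSum κ w.length (fun i => w[i]? = some (f y)) else 0) =
      ∑ i ∈ Finset.range w.length,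
        if χ y = x ∧ w[i]? = some (f y) then mono _ (Finsupp.single i 1) 1 else 0 := by
    intro y
    unfold posSum
    by_cases hy : χ y = x
    · simp only [hy, if_true, true_and]
      refine Finset.sum_congr rfl fun i _ => ?_
      congr
    · simp only [hy, if_false, false_and, Finset.sum_const_zero]
  rw [Finset.sum_congr rfl fun y _ => h1 y]
  unfold posSum
  rw [Finset.sum_comm]
  refine Finset.sum_congr rfl fun i hi => ?_
  obtain ⟨y, hy⟩ : ∃ y, w[i]? = some y := by
    rw [Finset.mem_range] at hi
    exact ⟨w[i], List.getElem?_eq_getElem hi⟩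
  obtain ⟨y', rfl⟩ := hf.2 y
  rw [Finset.sum_eq_single y']
  · simp only [List.getElem?_map, hy, Option.map_some, Option.some.injEq, h, ht.eq_iff, and_true]
  · intro z _ hz
    rw [if_neg]
    rintro ⟨_, hz'⟩
    rw [hy, Option.some.injEq] at hz'
    exact hz (hf.1 hz').symm
  · simp

/-- The values of the derivation on words that are lifted to another alphabet. -/
theorem crossValue_map (a : X → X → ℂ) {t : Equiv.Perm X} {t' : Equiv.Perm Y}
    (h : ∀ y, χ (t' y) = t (χ y)) (x : FreeLieAlgebra ℂ X) (w : List Y) :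
    crossValue a t x (w.map χ) =
      crossValue (fun y z => a (χ y) (χ z)) t' (polar χ x) w := by
  have hsymm : ∀ y, χ (t'.symm y) = t.symm (χ y) := fun y => by
    rw [Equiv.eq_symm_apply, ← h, Equiv.apply_symm_apply]
  have hopt : ∀ o o' : Option Y, optKernel a (o.map χ) (o'.map χ) =
      optKernel (fun y z => a (χ y) (χ z)) o o' := by
    rintro (_ | y) (_ | z) <;> rfl
  have h1 : orderKernel a (w.map χ) = orderKernel (fun y z => a (χ y) (χ z)) w := by
    funext i j
    simp only [orderKernel, List.getElem?_map, hopt]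
  have h2 : crossKernel a t (w.map χ) = crossKernel (fun y z => a (χ y) (χ z)) t' w := by
    funext i j
    simp only [crossKernel, List.getElem?_map]
    rw [← hopt, Option.map_map, Option.map_map]
    congr 2
    funext y
    exact (hsymm y).symm
  have h3 : ∀ κ, (fun x => posSum κ w.length fun i => (w.map χ)[i]? = some x) = fun x =>
      ∑ y, if χ y = x then posSum κ w.length (fun i => w[i]? = some y) else 0 := fun κ =>
    funext fun x => posSum_polar χ κ w id Function.bijective_id (t := id) Function.injective_id
      (fun _ => rfl) x
  have h4 : ∀ κ, (fun x => posSum κ w.length fun i => (w.map χ)[i]? = some (t x)) = fun x =>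
      ∑ y, if χ y = x then posSum κ w.length (fun i => w[i]? = some (t' y)) else 0 := fun κ =>
    funext fun x => posSum_polar χ κ w t' t'.bijective t.injective h x
  rw [crossValue_eq_kernelValue, crossValue_eq_kernelValue, h1, h2, List.length_map, h3, h4,
    kernelValue, kernelValue, kernelDer, kernelDer, crossDer_polar]

theorem consMap_apply_nil (x : X) (t : Words X) : consMap x t [] = 0 := by
  rw [consMap, Finsupp.lmapDomain_apply]
  exact Finsupp.mapDomain_of_notMem_range _ _ (by simp)

theorem consMap_apply_cons (x y : X) (t : Words X) (w : List X) :
    consMap x t (y :: w) = if y = x then t w else 0 := by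
  rw [consMap, Finsupp.lmapDomain_apply]
  split_ifs with h
  · subst h
    exact Finsupp.mapDomain_apply List.cons_injective _ _
  · refine Finsupp.mapDomain_of_notMem_range _ _ ?_
    rintro ⟨v, hv⟩
    exact h (List.cons.inj hv).1.symm

theorem leftMul_polar (x : FreeLieAlgebra ℂ X) {s : Words Y} {t : Words X}
    (h : ∀ w, s w = t (w.map χ)) (w : List Y) :
    leftMul Y (polar χ x) s w = leftMul X x t (w.map χ) := by
  induction x using freeLie_induction generalizing s t w with
  | zero => simp
  | of x =>
    rw [polar_of, leftMul_of, map_sum, LinearMap.sum_apply, Finsupp.finsetSum_apply]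
    rcases w with _ | ⟨y, w⟩
    · rw [List.map_nil, consMap_apply_nil]
      refine Finset.sum_eq_zero fun y _ => ?_
      split_ifs
      · rw [leftMul_of, consMap_apply_nil]
      · simp
    · rw [List.map_cons, consMap_apply_cons, Finset.sum_eq_single y]
      · split_ifs
        · rw [leftMul_of, consMap_apply_cons, if_pos rfl, h]
        · simp
      · intro z _ hz
        split_ifs
        · rw [leftMul_of, consMap_apply_cons, if_neg hz.symm]
        · simp
      · simp
  | add x y hx hy => simp only [map_add, LinearMap.add_apply, Finsupp.add_apply, hx h, hy h]
  | smul z x hx => simp only [map_smul, LinearMap.smul_apply, Finsupp.smul_apply, hx h]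
  | lie x y hx hy =>
    simp only [LieHom.map_lie, LieRing.of_associative_ring_bracket, LinearMap.sub_apply,
      Module.End.mul_apply, Finsupp.sub_apply, hx (hy h), hy (hx h)]

/-- Polarization replaces each letter of a word independently by all its lifts, so each lift of a
word occurs with the coefficient of that word. -/
theorem wordExp_polar (x : FreeLieAlgebra ℂ X) (w : List Y) :
    wordExp (polar χ x) w = wordExp x (w.map χ) := by
  refine leftMul_polar χ x (fun w => ?_) w
  rcases w with _ | ⟨y, w⟩
  · simp
  · rw [Finsupp.single_eq_of_ne (by simp), Finsupp.single_eq_of_ne (by simp)]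

theorem polar_relabel {t : Equiv.Perm X} {t' : Equiv.Perm Y} (h : ∀ y, χ (t' y) = t (χ y))
    (x : FreeLieAlgebra ℂ X) : polar χ (relabel t x) = relabel t' (polar χ x) := by
  have : (polar χ).comp (relabel t) = (relabel t').comp (polar χ) := by
    refine FreeLieAlgebra.hom_ext fun x => ?_
    rw [LieHom.comp_apply, LieHom.comp_apply, relabel_of, polar_of, polar_of, map_sum,
      ← Equiv.sum_comp t']
    refine Finset.sum_congr rfl fun y _ => ?_
    rw [h, if_congr t.injective.eq_iff rfl rfl]
    split_ifs <;> simp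
  exact LieHom.congr_fun this x

/-- Above each letter there is one letter, so polarization along a bijection is relabelling by its
inverse. -/
theorem polar_equiv (t : Equiv.Perm Y) (y : FreeLieAlgebra ℂ Y) : polar t (relabel t y) = y := by
  have : (polar t).comp (relabel t) = LieHom.id := by
    refine FreeLieAlgebra.hom_ext fun x => ?_
    rw [LieHom.comp_apply, relabel_of, polar_of]
    simp [t.injective.eq_iff]
  exact LieHom.congr_fun this y

theorem wordSum_map {X Y : Type*} (f : List Y → ℂ) (g : X → Y) (c : FreeMagma X) :
    wordSum f (FreeMagma.map g c) = wordSum (fun w => f (w.map g)) c := by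
  induction c generalizing f with
  | ih1 x => rfl
  | ih2 c d hc hd =>
    rw [map_mul, wordSum_mul, wordSum_mul, hc]
    refine wordSum_congr fun u _ => ?_
    rw [hd]
    simp only [List.map_append]

/-- The form that is attached to a permutation is invariant under the permutations that commute
with it. -/
theorem crossForm_relabel {a : Y → Y → ℂ} {t t' : Equiv.Perm Y}
    (ha : ∀ y z, a (t' y) (t' z) = a y z) (h : ∀ y, t' (t y) = t (t' y))
    (v u : FreeLieAlgebra ℂ Y) :
    crossForm a t (relabel t' v) (wordExp (relabel t' u)) = crossForm a t v (wordExp u) := by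
  have hlin : (crossForm a t (relabel t' v) ∘ₗ wordExp) ∘ₗ (relabel t').toLinearMap =
      crossForm a t v ∘ₗ wordExp := by
    refine freeLie_linear_ext fun c => ?_
    change evalWords _ (wordExp (relabel t' (commutator c))) = evalWords _ _
    rw [relabel_commutator, evalWords_wordExp, evalWords_wordExp, wordSum_map]
    refine wordSum_congr fun w _ => ?_
    have e := crossValue_map t' a h (relabel t' v) w
    rw [polar_equiv] at e
    rw [e]
    simp only [ha]
  exact LinearMap.congr_fun hlin u

end Polarization

/-! ### Multilinear components -/

section Multilinear

open scoped TensorProduct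

theorem weightProj_commutator {X κ : Type*} [DecidableEq κ] (deg : X → κ) (w : κ →₀ ℕ)
    (c : FreeMagma X) :
    weightProj deg w (commutator c) =
      if contentSum (fun x => Finsupp.single (deg x) 1) c = w then commutator c else 0 := by
  have h : (FreeLieAlgebra.lift ℂ
        (fun x => (MvPolynomial.X (deg x) : MvPolynomial κ ℂ) ⊗ₜ[ℂ] FreeLieAlgebra.of ℂ x) :
        FreeLieAlgebra ℂ X →ₗ⁅ℂ⁆ MvPolynomial κ ℂ ⊗[ℂ] FreeLieAlgebra ℂ X) (commutator c) =
      MvPolynomial.monomial (contentSum (fun x => Finsupp.single (deg x) 1) c) (1 : ℂ) ⊗ₜ[ℂ]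
        commutator c := by
    induction c with
    | ih1 x => rw [commutator, FreeLieAlgebra.lift_of_apply, contentSum_of]; rfl
    | ih2 c d hc hd =>
      rw [commutator_mul, LieHom.map_lie, hc, hd, contentSum_mul,
        LieAlgebra.ExtendScalars.bracket_tmul, MvPolynomial.monomial_mul, mul_one]
  simp only [weightProj, LinearMap.comp_apply, LieHom.coe_toLinearMap, h,
    LinearMap.rTensor_tmul, MvPolynomial.lcoeff_apply, MvPolynomial.coeff_monomial,
    LinearEquiv.coe_coe, TensorProduct.lid_tmul]
  classical
  split_ifs <;> simp

variable {T m : ℕ} [NeZero T]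

/-- The weight of a letter of `𝔞`. -/
def letterWeight (x : ZMod T × Fin m) : Fin m →₀ ℕ := Finsupp.single x.2 1

/-- The projection to the multilinear component of `𝔞`. -/
def multiProj (T m : ℕ) [NeZero T] : FreeA T m →ₗ[ℂ] FreeA T m :=
  weightProj Prod.snd (Finsupp.equivFunOnFinite.symm fun _ => 1)

theorem multiProj_commutator (c : FreeMagma (ZMod T × Fin m)) :
    multiProj T m (commutator c) =
      if contentSum letterWeight c = Finsupp.equivFunOnFinite.symm fun _ => 1
        then commutator c else 0 :=
  weightProj_commutator _ _ _

/-- The word with given letters and indices. -/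
def multiWord (π : Equiv.Perm (Fin m)) (k : Fin m → ZMod T) : List (ZMod T × Fin m) :=
  List.ofFn fun i => (k i, π i)

theorem hasPotential_multiWord (π : Equiv.Perm (Fin m)) (k : Fin m → ZMod T) :
    HasPotential (k ∘ π.symm) (multiWord π k) := by
  have h : (fun i => (k i, π i)) = (fun p => ((k ∘ π.symm) p, p)) ∘ π := by
    funext i; simp
  rw [HasPotential, multiWord, h]
  exact Equiv.Perm.ofFn_comp_perm π _

theorem sum_letterWeight_apply (w : List (ZMod T × Fin m)) (p : Fin m) :
    (w.map letterWeight).sum p = (w.map Prod.snd).count p := by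
  induction w with
  | nil => rfl
  | cons x w ih =>
    rw [List.map_cons, List.sum_cons, Finsupp.add_apply, ih, List.map_cons, List.count_cons,
      letterWeight, Finsupp.single_apply, add_comm]
    simp

theorem sum_letterWeight_multiWord (π : Equiv.Perm (Fin m)) (k : Fin m → ZMod T) :
    ((multiWord π k).map letterWeight).sum = Finsupp.equivFunOnFinite.symm fun _ => 1 := by
  rw [(hasPotential_multiWord π k).sum_map]
  ext p
  simp [letterWeight, Finsupp.single_apply]

theorem exists_multiWord {w : List (ZMod T × Fin m)}
    (h : (w.map letterWeight).sum = Finsupp.equivFunOnFinite.symm fun _ => 1) :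
    ∃ π k, w = multiWord π k := by
  have hc : ∀ p, (w.map Prod.snd).count p = 1 := fun p => by
    rw [← sum_letterWeight_apply, h]; rfl
  have hperm : (w.map Prod.snd).Perm (List.finRange m) := by
    rw [List.perm_iff_count]
    intro p
    rw [hc, List.count_eq_one_of_mem (List.nodup_finRange m) (List.mem_finRange p)]
  have hlen : w.length = m := by simpa using hperm.length_eq
  obtain ⟨f, rfl⟩ : ∃ f : Fin m → ZMod T × Fin m, w = List.ofFn f :=
    ⟨fun i => w.get (i.cast hlen.symm), List.ext_getElem (by simp [hlen]) (by simp)⟩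
  rw [List.map_ofFn] at hperm
  have hinj := List.nodup_ofFn.mp (hperm.nodup_iff.mpr (List.nodup_finRange _))
  exact ⟨Equiv.ofBijective _ (Finite.injective_iff_bijective.mp hinj), fun i => (f i).1, rfl⟩

theorem multiWord_injective :
    Function.Injective fun p : Equiv.Perm (Fin m) × (Fin m → ZMod T) => multiWord p.1 p.2 := by
  rintro ⟨π, k⟩ ⟨π', k'⟩ h
  have h1 := List.ofFn_injective h
  have h2 : ∀ i, k i = k' i ∧ π i = π' i := fun i => Prod.ext_iff.mp (congrFun h1 i)
  exact Prod.ext (Equiv.ext fun i => (h2 i).2) (funext fun i => (h2 i).1)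

theorem wordExp_multiProj (x : FreeA T m) (w : List (ZMod T × Fin m)) :
    wordExp (multiProj T m x) w =
      if (w.map letterWeight).sum = Finsupp.equivFunOnFinite.symm fun _ => 1
        then wordExp x w else 0 := by
  classical
  have h : (Finsupp.lapply w ∘ₗ wordExp) ∘ₗ multiProj T m =
      (if (w.map letterWeight).sum = Finsupp.equivFunOnFinite.symm fun _ => 1 then
        (Finsupp.lapply w ∘ₗ wordExp : FreeA T m →ₗ[ℂ] ℂ) else 0) := by
    refine freeLie_linear_ext fun c => ?_
    rw [LinearMap.comp_apply, multiProj_commutator]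
    by_cases hw : w.Perm (content c)
    · have : (w.map letterWeight).sum = contentSum letterWeight c := (hw.map _).sum_eq
      rw [this]
      split_ifs <;> simp
    · have h0 := wordExp_commutator_apply_eq_zero hw
      split_ifs <;> simp [h0]
  have h2 := LinearMap.congr_fun h x
  refine Eq.trans h2 ?_
  split_ifs <;> rfl

/-- Translations preserve the weight, so the form does as well, and components of other weights
vanish on multilinear words. -/
theorem crossValue_multiProj (a : ZMod T × Fin m → ZMod T × Fin m → ℂ) (l : ZMod T)
    (x : FreeA T m) {w : List (ZMod T × Fin m)}
    (hw : (w.map letterWeight).sum = Finsupp.equivFunOnFinite.symm fun _ => 1) :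
    crossValue a (shiftPerm m l) (multiProj T m x) w = crossValue a (shiftPerm m l) x w := by
  classical
  have h : (LinearMap.proj w ∘ₗ crossValue a (shiftPerm m l)) ∘ₗ multiProj T m =
      LinearMap.proj w ∘ₗ crossValue a (shiftPerm m l) := by
    refine freeLie_linear_ext fun c => ?_
    rw [LinearMap.comp_apply, multiProj_commutator]
    split_ifs with h
    · rfl
    · rw [map_zero]
      exact (crossValue_commutator_eq_zero (d := letterWeight) a (fun x => rfl)
        (fun h' => h (h'.symm.trans hw))).symm
  exact LinearMap.congr_fun h x

theorem multiProj_relabel (l : ZMod T) (x : FreeA T m) :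
    multiProj T m (relabel (shiftPerm m l) x) = relabel (shiftPerm m l) (multiProj T m x) := by
  classical
  have h : multiProj T m ∘ₗ (relabel (shiftPerm m l)).toLinearMap =
      (relabel (shiftPerm m l)).toLinearMap ∘ₗ multiProj T m := by
    refine freeLie_linear_ext fun c => ?_
    have hc : contentSum letterWeight (FreeMagma.map (shiftPerm m l) c) =
        contentSum letterWeight c := by
      rw [contentSum, content_map, List.map_map]; rfl
    simp only [LinearMap.comp_apply, LieHom.coe_toLinearMap, relabel_commutator,
      multiProj_commutator, hc]
    split_ifs
    · rw [relabel_commutator]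
    · simp
  exact LinearMap.congr_fun h x

/-- The span of the averages of the multilinear commutators. -/
def barSpan (T m : ℕ) [NeZero T] : Submodule ℂ (FreeA T m) :=
  Submodule.span ℂ {x | ∃ c k, HasPotential k (content c) ∧ x = bar (commutator c)}

theorem shift_eq_relabel (j : ZMod T) (x : FreeA T m) : shift j x = relabel (shiftPerm m j) x := rfl

theorem bar_add (x y : FreeA T m) : bar (x + y) = bar x + bar y := by
  simp [bar, Finset.sum_add_distrib]

theorem bar_smul (z : ℂ) (x : FreeA T m) : bar (z • x) = z • bar x := by
  simp [bar, Finset.smul_sum]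

theorem bar_multiProj_mem (x : FreeA T m) : bar (multiProj T m x) ∈ barSpan T m := by
  classical
  have hx : x ∈ Submodule.span ℂ (Set.range commutator) := by
    rw [span_range_commutator]; trivial
  induction hx using Submodule.span_induction with
  | mem x hx =>
    obtain ⟨c, rfl⟩ := hx
    rw [multiProj_commutator]
    split_ifs with h
    · obtain ⟨π, k, hw⟩ := exists_multiWord h
      exact Submodule.subset_span ⟨c, _, hw ▸ hasPotential_multiWord π k, rfl⟩
    · simp [bar]
  | zero => simp [bar]
  | add x y _ _ hx hy => rw [map_add, bar_add]; exact add_mem hx hy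
  | smul z x _ hx => rw [map_smul, bar_smul]; exact Submodule.smul_mem _ z hx

/-- The projection of an invariant element is invariant, so it is its own average up to the factor
`T`; averaging a spanning set of commutators suffices. -/
theorem multiProj_mem_barSpan {x : FreeA T m} (hx : ∀ j, relabel (shiftPerm m j) x = x) :
    multiProj T m x ∈ barSpan T m := by
  have h : bar (multiProj T m x) = (T : ℂ) • multiProj T m x := by
    have : ∀ j : ZMod T, shift j (multiProj T m x) = multiProj T m x := fun j => by
      rw [shift_eq_relabel, ← multiProj_relabel, hx]
    simp [bar, this, ZMod.card, Nat.cast_smul_eq_nsmul]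
  have hT : (T : ℂ) ≠ 0 := Nat.cast_ne_zero.mpr (NeZero.ne T)
  have h2 := Submodule.smul_mem _ (T : ℂ)⁻¹ (bar_multiProj_mem x)
  rwa [h, smul_smul, inv_mul_cancel₀ hT, one_smul] at h2

/-- The sum of the values on all multilinear words. -/
theorem evalWords_multiProj (f : List (ZMod T × Fin m) → ℂ) (x : FreeA T m) :
    evalWords f (wordExp (multiProj T m x)) =
      ∑ p : Equiv.Perm (Fin m) × (Fin m → ZMod T),
        wordExp x (multiWord p.1 p.2) * f (multiWord p.1 p.2) := by
  classical
  have h1 : evalWords f (wordExp (multiProj T m x)) =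
      ∑ w ∈ Finset.univ.image fun p : Equiv.Perm (Fin m) × (Fin m → ZMod T) =>
        multiWord p.1 p.2, wordExp (multiProj T m x) w * f w := by
    rw [evalWords, Finsupp.linearCombination_apply, Finsupp.sum]
    refine Finset.sum_subset (fun w hw => ?_) fun w _ hw => ?_
    · rw [Finsupp.mem_support_iff, wordExp_multiProj] at hw
      split_ifs at hw with h
      · obtain ⟨π, k, rfl⟩ := exists_multiWord h
        exact Finset.mem_image_of_mem _ (Finset.mem_univ (π, k))
      · exact absurd rfl hw
    · rw [Finsupp.notMem_support_iff.mp hw, zero_smul]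
  rw [h1, Finset.sum_image multiWord_injective.injOn]
  refine Finset.sum_congr rfl fun p _ => ?_
  rw [wordExp_multiProj, if_pos (sum_letterWeight_multiWord _ _)]

end Multilinear

/-! ### The symmetrization map -/

section Counting

/-- Fibres of equal size give one solution, and all solutions form a coset of the stabilizer of `f`,
a product of symmetric groups. -/
theorem card_perm_comp {m r : ℕ} (f γ : Fin m → Fin r)
    (h : ∀ c, Fintype.card {p // γ p = c} = Fintype.card {p // f p = c}) :
    Fintype.card {π : Equiv.Perm (Fin m) // f ∘ π = γ} =
      ∏ c, (Fintype.card {p // f p = c}).factorial := by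
  let e : Equiv.Perm (Fin m) := Equiv.ofFiberEquiv fun c => Fintype.equivOfCardEq (h c)
  have he : ∀ p, f (e p) = γ p := Equiv.ofFiberEquiv_map _
  rw [← DomMulAct.stabilizer_card f]
  refine Fintype.card_congr ((Equiv.mulRight e⁻¹).subtypeEquiv fun π => ?_)
  rw [Equiv.coe_mulRight]
  constructor
  · intro hπ
    funext p
    have := congrFun hπ (e⁻¹ p)
    rwa [← he, Equiv.Perm.inv_def, Equiv.apply_symm_apply] at this
  · intro hπ
    funext p
    have := congrFun hπ (e p)
    rwa [Function.comp_apply, Equiv.Perm.mul_apply, Equiv.Perm.inv_def, Equiv.symm_apply_apply,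
      he] at this

theorem card_colour {r : ℕ} (lam : Fin r → ℕ) (c : Fin r) :
    Fintype.card {p : Fin (∑ i, lam i) // colour p = c} = lam c := by
  rw [← Fintype.card_fin (lam c)]
  exact Fintype.card_congr ((finSigmaFinEquiv.symm.subtypeEquiv fun p => Iff.rfl).trans
    (Equiv.sigmaSubtype c))

variable {R r T : ℕ} [NeZero T] {perm : Equiv.Perm (Fin R)} {rep : Fin r → Fin R}

theorem pow_val_natCast (hT : orderOf perm = T) (n : ℕ) : perm ^ (n : ZMod T).val = perm ^ n := by
  rw [ZMod.val_natCast, ← hT, pow_mod_orderOf]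

theorem perm_pow_val_add (hT : orderOf perm = T) (k l : ZMod T) :
    perm ^ (k + l).val = perm ^ l.val * perm ^ k.val := by
  rw [← pow_add, ← pow_val_natCast hT (l.val + k.val), Nat.cast_add, ZMod.natCast_zmod_val, ZMod.natCast_zmod_val,
    add_comm]

theorem card_dvd_val {p : ℕ} (hp : p ∣ T) :
    (Finset.univ.filter fun k : ZMod T => p ∣ k.val).card = T / p := by
  have hT := Nat.pos_of_ne_zero (NeZero.ne T)
  have hp0 : 0 < p := Nat.pos_of_dvd_of_pos hp hT
  conv_rhs => rw [← Finset.card_range (T / p)]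
  have hlt : ∀ i ∈ Finset.range (T / p), i * p < T := fun i hi => by
    rw [Finset.mem_range] at hi
    calc i * p < T / p * p := Nat.mul_lt_mul_of_pos_right hi hp0
      _ ≤ T := Nat.div_mul_le_self T p
  refine Finset.card_bij' (fun k _ => k.val / p) (fun i _ => ((i * p : ℕ) : ZMod T)) ?_ ?_ ?_ ?_
  · intro k hk
    rw [Finset.mem_range]
    exact Nat.div_lt_div_of_lt_of_dvd hp (ZMod.val_lt k)
  · intro i hi
    rw [Finset.mem_filter, ZMod.val_cast_of_lt (hlt i hi)]
    exact ⟨Finset.mem_univ _, Dvd.intro_left i rfl⟩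
  · intro k hk
    rw [Finset.mem_filter] at hk
    rw [Nat.div_mul_cancel hk.2, ZMod.natCast_zmod_val]
  · intro i hi
    rw [ZMod.val_cast_of_lt (hlt i hi), Nat.mul_div_cancel _ hp0]

theorem pow_apply_eq_self_iff (i : Fin R) (n : ℕ) :
    (perm ^ n) i = i ↔ Function.minimalPeriod perm i ∣ n := by
  rw [← Function.isPeriodicPt_iff_minimalPeriod_dvd, Function.IsPeriodicPt, Function.IsFixedPt,
    Equiv.Perm.iterate_eq_pow]

/-- Translation in `ℤ/T` reduces to `i = j`, where the exponents are the multiples of the length of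
the cycle. -/
theorem card_pow_eq (hT : orderOf perm = T) {i j : Fin R} (h : perm.SameCycle i j) :
    (Finset.univ.filter fun k : ZMod T => (perm ^ k.val) i = j).card =
      T / Function.minimalPeriod perm i := by
  have hd : Function.minimalPeriod perm i ∣ T := by
    rw [← pow_apply_eq_self_iff, ← hT, pow_orderOf_eq_one]; rfl
  obtain ⟨n, rfl⟩ := h.exists_nat_pow_eq
  rw [← card_dvd_val hd]
  refine (Finset.card_equiv (Equiv.addRight (n : ZMod T)) fun k => ?_).symm
  simp only [Finset.mem_filter, Finset.mem_univ, true_and, Equiv.coe_addRight]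
  rw [perm_pow_val_add hT, pow_val_natCast hT, Equiv.Perm.mul_apply, (perm ^ n).injective.eq_iff,
    pow_apply_eq_self_iff]

/-- The index of the cycle of a letter. -/
def cycleIndex (hrep : ∀ j, ∃! i, perm.SameCycle (rep i) j) (j : Fin R) : Fin r :=
  (hrep j).choose

variable (hrep : ∀ j, ∃! i, perm.SameCycle (rep i) j)

theorem sameCycle_iff {i : Fin r} {j : Fin R} :
    perm.SameCycle (rep i) j ↔ cycleIndex hrep j = i := by
  have h := (hrep j).choose_spec
  refine ⟨fun hi => (h.2 i hi).symm, ?_⟩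
  rintro rfl
  exact h.1

/-- The weight of a letter. -/
def cycleWeight (j : Fin R) : Fin r → ℕ := Pi.single (cycleIndex hrep j) 1

theorem cycleIndex_perm (j : Fin R) : cycleIndex hrep (perm j) = cycleIndex hrep j := by
  rw [← sameCycle_iff, Equiv.Perm.sameCycle_apply_right, sameCycle_iff]

theorem cycleWeight_perm_pow (n : ℕ) (j : Fin R) :
    cycleWeight hrep ((perm ^ n) j) = cycleWeight hrep j := by
  induction n with
  | zero => rfl
  | succ n ih => rw [pow_succ', Equiv.Perm.mul_apply, cycleWeight, cycleIndex_perm]; exact ih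

theorem sum_cycleWeight_apply (w : List (Fin R)) (i : Fin r) :
    (w.map (cycleWeight hrep)).sum i = w.countP fun j => cycleIndex hrep j = i := by
  induction w with
  | nil => rfl
  | cons j w ih =>
    rw [List.map_cons, List.sum_cons, Pi.add_apply, ih, List.countP_cons, cycleWeight,
      Pi.single_apply, add_comm]
    congr 1
    simp [eq_comm]

theorem sum_sum_cycleWeight (w : List (Fin R)) :
    ∑ i, (w.map (cycleWeight hrep)).sum i = w.length := by
  induction w with
  | nil => simp
  | cons j w ih =>
    simp only [List.map_cons, List.sum_cons, Pi.add_apply, Finset.sum_add_distrib, ih,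
      List.length_cons, cycleWeight, Finset.sum_pi_single']
    simp [add_comm]

theorem weightSpace_eq_span (lam : Fin r → ℕ) : weightSpace perm rep lam =
    Submodule.span ℂ {x | ∃ c, x = commutator c ∧ contentSum (cycleWeight hrep) c = lam} := by
  classical
  unfold weightSpace
  congr 1
  ext x
  refine exists_congr fun c => and_congr_right fun _ => ?_
  rw [funext_iff]
  refine forall_congr' fun i => ?_
  rw [contentSum, sum_cycleWeight_apply]
  simp only [sameCycle_iff hrep]

/-- The letter below a letter of `𝔞`. -/
def orbitLetter (T : ℕ) (perm : Equiv.Perm (Fin R)) (rep : Fin r → Fin R) (lam : Fin r → ℕ)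
    (x : ZMod T × Fin (∑ i, lam i)) : Fin R :=
  (perm ^ x.1.val) (rep (colour x.2))

theorem sym_eq (lam : Fin r → ℕ) (x : FreeLieAlgebra ℂ (Fin R)) :
    sym T perm rep lam x = multiProj T _ (polar (orbitLetter T perm rep lam) x) := by
  have h : symHom T perm rep lam = polar (orbitLetter T perm rep lam) := by
    refine FreeLieAlgebra.hom_ext fun j => ?_
    rw [polar_of, Fintype.sum_prod_type, symHom, FreeLieAlgebra.lift_of_apply]
    refine Finset.sum_congr rfl fun k _ => Finset.sum_congr rfl fun p _ => ?_
    unfold orbitLetter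
    congr
  rw [← h]
  rfl

theorem orbitLetter_shiftPerm (hT : orderOf perm = T) (lam : Fin r → ℕ) (l : ZMod T)
    (x : ZMod T × Fin (∑ i, lam i)) :
    orbitLetter T perm rep lam (shiftPerm _ l x) =
      (perm ^ l.val) (orbitLetter T perm rep lam x) := by
  rw [orbitLetter, shiftPerm_apply, perm_pow_val_add hT]; rfl

/-- The number of lifts of a word of weight `lam`. -/
theorem card_lifts (hT : orderOf perm = T) (lam : Fin r → ℕ) {v : Fin (∑ i, lam i) → Fin R}
    (hv : ∀ c, Fintype.card {p // cycleIndex hrep (v p) = c} = lam c) :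
    (Finset.univ.filter fun p : Equiv.Perm (Fin (∑ i, lam i)) × (Fin (∑ i, lam i) → ZMod T) =>
      ∀ i, orbitLetter T perm rep lam (p.2 i, p.1 i) = v i).card = symOrder T perm rep lam := by
  have h1 : ∀ π : Equiv.Perm (Fin (∑ i, lam i)),
      (Finset.univ.filter fun k : Fin (∑ i, lam i) → ZMod T =>
        ∀ i, orbitLetter T perm rep lam (k i, π i) = v i).card =
      if colour ∘ π = cycleIndex hrep ∘ v then
        ∏ c, (T / Function.minimalPeriod perm (rep c)) ^ lam c else 0 := by
    intro π
    have e1 : (Finset.univ.filter fun k : Fin (∑ i, lam i) → ZMod T =>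
        ∀ i, orbitLetter T perm rep lam (k i, π i) = v i) = Fintype.piFinset fun i =>
          Finset.univ.filter fun κ : ZMod T => (perm ^ κ.val) (rep (colour (π i))) = v i := by
      ext k
      simp only [Finset.mem_filter, Finset.mem_univ, true_and, Fintype.mem_piFinset]
      rfl
    rw [e1, Fintype.card_piFinset]
    split_ifs with h
    · have e2 : ∀ i, colour (π i) = cycleIndex hrep (v i) := congrFun h
      have e3 : ∀ i, (Finset.univ.filter fun κ : ZMod T =>
          (perm ^ κ.val) (rep (colour (π i))) = v i).card =
            T / Function.minimalPeriod perm (rep (cycleIndex hrep (v i))) := fun i => by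
        rw [e2]; exact card_pow_eq hT ((sameCycle_iff hrep).mpr rfl)
      rw [Finset.prod_congr rfl fun i _ => e3 i,
        ← Finset.prod_fiberwise Finset.univ fun i => cycleIndex hrep (v i)]
      refine Finset.prod_congr rfl fun c _ => ?_
      rw [← hv c, Fintype.card_subtype]
      refine Finset.prod_eq_pow_card fun i hi => ?_
      rw [(Finset.mem_filter.mp hi).2]
    · obtain ⟨i, hi⟩ := Function.ne_iff.mp h
      refine Finset.prod_eq_zero (Finset.mem_univ i) ?_
      rw [Finset.card_eq_zero, Finset.filter_eq_empty_iff]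
      intro κ _ hκ
      refine hi ((sameCycle_iff hrep).mp ?_).symm
      exact ⟨κ.val, by rw [zpow_natCast]; exact hκ⟩
  have h2 : (Finset.univ.filter fun π : Equiv.Perm (Fin (∑ i, lam i)) =>
      colour ∘ π = cycleIndex hrep ∘ v).card = ∏ c, (lam c).factorial := by
    rw [← Fintype.card_subtype, card_perm_comp]
    · simp only [card_colour]
    · intro c; rw [card_colour, ← hv c]; rfl
  rw [Finset.card_filter, Fintype.sum_prod_type]
  simp only [← Finset.card_filter]
  rw [Finset.sum_congr rfl fun π _ => h1 π, Finset.sum_ite, Finset.sum_const_zero, add_zero,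
    Finset.sum_const, h2, smul_eq_mul, mul_comm, ← Finset.prod_mul_distrib]
  rfl

theorem map_multiWord {Y : Type*} {n : ℕ} (χ : ZMod T × Fin n → Y) (π : Equiv.Perm (Fin n))
    (k : Fin n → ZMod T) : (multiWord π k).map χ = List.ofFn fun i => χ (k i, π i) := by
  rw [multiWord, List.map_ofFn]; rfl

/-- Words that occur in an element of weight `lam` have that weight, and each of them has `symOrder`
multilinear lifts by `card_lifts`. -/
theorem sum_lifts (hrep : ∀ j, ∃! i, perm.SameCycle (rep i) j) (hT : orderOf perm = T) {lam : Fin r → ℕ} {y : FreeLieAlgebra ℂ (Fin R)}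
    (hy : y ∈ weightSpace perm rep lam) (f : List (Fin R) → ℂ) :
    ∑ p : Equiv.Perm (Fin (∑ i, lam i)) × (Fin (∑ i, lam i) → ZMod T),
      wordExp y ((multiWord p.1 p.2).map (orbitLetter T perm rep lam)) *
        f ((multiWord p.1 p.2).map (orbitLetter T perm rep lam)) =
      symOrder T perm rep lam * evalWords f (wordExp y) := by
  classical
  rw [weightSpace_eq_span hrep] at hy
  induction hy using Submodule.span_induction with
  | mem y hy =>
    obtain ⟨c, rfl, hc⟩ := hy
    set t := wordExp (commutator c)
    have h1 : ∀ w, t w * f w = ∑ u ∈ t.support, if w = u then t u * f u else 0 := fun w => by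
      rw [Finset.sum_ite_eq]
      split_ifs with h
      · rfl
      · rw [Finsupp.notMem_support_iff.mp h, zero_mul]
    rw [Finset.sum_congr rfl fun p _ => h1 _, Finset.sum_comm, evalWords, Finsupp.linearCombination_apply, Finsupp.sum, Finset.mul_sum]
    refine Finset.sum_congr rfl fun u hu => ?_
    rw [← Finset.sum_filter, Finset.sum_const, nsmul_eq_mul, smul_eq_mul]
    congr 2
    have hperm : u.Perm (content c) := by
      by_contra h
      exact Finsupp.mem_support_iff.mp hu (wordExp_commutator_apply_eq_zero h)
    have hsum : (u.map (cycleWeight hrep)).sum = lam := by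
      rw [← hc]; exact (hperm.map _).sum_eq
    have hlen : u.length = ∑ i, lam i := by rw [← sum_sum_cycleWeight hrep, hsum]
    obtain ⟨v, rfl⟩ : ∃ v : Fin (∑ i, lam i) → Fin R, u = List.ofFn v :=
      ⟨fun i => u.get (i.cast hlen.symm), List.ext_getElem (by simp [hlen]) (by simp)⟩
    rw [← card_lifts hrep hT lam (v := v)]
    · congr 1
      ext p
      rw [Finset.mem_filter, Finset.mem_filter, map_multiWord, List.ofFn_inj, funext_iff]
    · intro i
      refine Eq.trans ?_ (congrFun hsum i)
      rw [List.map_ofFn, List.sum_ofFn, Finset.sum_apply, Fintype.card_subtype,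
        Finset.card_filter]
      refine Finset.sum_congr rfl fun p _ => ?_
      rw [Function.comp_apply, cycleWeight, Pi.single_apply]
      simp only [eq_comm]
  | zero => simp
  | add y z _ _ hy hz =>
    simp only [map_add, Finsupp.add_apply, add_mul, Finset.sum_add_distrib, hy, hz, mul_add]
  | smul z y _ hy =>
    simp only [map_smul, Finsupp.smul_apply, smul_eq_mul, mul_assoc, ← Finset.mul_sum, hy]
    ring

end Counting

/-! ### The geometric form on the averages -/

section GeomZero

variable {T m : ℕ} [NeZero T]

/-- The bilinear form on `𝔞` that restricts to the geometric form of the weights of `a`. -/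
def shiftForm (a : ZMod T × Fin m → ZMod T × Fin m → ℂ) : FreeA T m →ₗ[ℂ] FreeA T m →ₗ[ℂ] ℂ :=
  (-(2 * T : ℂ)⁻¹) •
    ((∑ l ∈ Finset.univ.erase (0 : ZMod T), (crossForm a (shiftPerm m l)).flip) ∘ₗ wordExp)

theorem shiftForm_apply (a : ZMod T × Fin m → ZMod T × Fin m → ℂ) (u v : FreeA T m) :
    shiftForm a u v = -(2 * T : ℂ)⁻¹ *
      ∑ l ∈ Finset.univ.erase (0 : ZMod T), crossForm a (shiftPerm m l) v (wordExp u) := by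
  simp only [shiftForm, LinearMap.smul_apply, LinearMap.comp_apply, LinearMap.sum_apply,
    LinearMap.flip_apply, smul_eq_mul]

theorem relabel_shiftPerm_add (i j : ZMod T) (x : FreeA T m) :
    relabel (shiftPerm m (j + i)) x = relabel (shiftPerm m i) (relabel (shiftPerm m j) x) := by
  rw [relabel_relabel]
  congr 1
  congr 1
  funext x
  simp [add_assoc]

/-- The form is invariant under simultaneous translation, so the `T` translates of `c` contribute
equally. This cancels the `T` in the normalization of `shiftForm`; the remaining `-½` is that of
`geomForm_eq_crossTotal`. -/
theorem shiftForm_bar {a : ZMod T × Fin m → ZMod T × Fin m → ℂ}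
    (hτ : ∀ j x y, a (shiftPerm m j x) (shiftPerm m j y) = a x y)
    (c d : FreeMagma (ZMod T × Fin m)) :
    shiftForm a (bar (commutator c)) (bar (commutator d)) = -2⁻¹ * crossTotal a d c := by
  have h1 : ∀ l i : ZMod T, crossForm a (shiftPerm m l) (bar (commutator d))
      (wordExp (shift i (commutator c))) = ∑ j : ZMod T,
        crossForm a (shiftPerm m l) (shift j (commutator d)) (wordExp (commutator c)) := by
    intro l i
    rw [bar, map_sum, LinearMap.sum_apply, ← Equiv.sum_comp (Equiv.addRight i)]
    refine Finset.sum_congr rfl fun j _ => ?_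
    rw [Equiv.coe_addRight, shift_eq_relabel, shift_eq_relabel, relabel_shiftPerm_add,
      crossForm_relabel (hτ i) (fun y => by simp [add_right_comm])]
    rfl
  have h2 : ∀ l : ZMod T, crossForm a (shiftPerm m l) (bar (commutator d))
      (wordExp (bar (commutator c))) = T * ∑ j : ZMod T,
        wordSum (crossValue a (shiftPerm m l) (commutator (FreeMagma.map (shiftPerm m j) d))) c := by
    intro l
    conv_lhs => rw [bar.eq_1 (commutator c)]
    rw [map_sum, map_sum, Finset.sum_congr rfl fun i _ => h1 l i, Finset.sum_const,
      Finset.card_univ, ZMod.card, nsmul_eq_mul]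
    congr 1
    refine Finset.sum_congr rfl fun j _ => ?_
    rw [shift_eq_relabel, relabel_commutator]
    exact evalWords_wordExp _ _
  have hT : (T : ℂ) ≠ 0 := Nat.cast_ne_zero.mpr (NeZero.ne T)
  rw [shiftForm_apply, Finset.sum_congr rfl fun l _ => h2 l, ← Finset.mul_sum, Finset.sum_comm,
    crossTotal]
  field_simp

theorem isGeomZero_shiftForm {ω : ℂ} (hω : IsPrimitiveRoot ω T)
    {a : ZMod T × Fin m → ZMod T × Fin m → ℂ} (hab : ∀ x y, a x y = a y x)
    (hτ : ∀ j x y, a (shiftPerm m j x) (shiftPerm m j y) = a x y) :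
    IsGeomZero ω (diagWeight a) (shiftForm a) := fun c d s s' Ls Ls' hf hf' => by
  rw [geomForm_eq_crossTotal hω hab hτ hf hf', shiftForm_bar hτ]

theorem eq_on_barSpan {Γ Γ' : FreeA T m →ₗ[ℂ] FreeA T m →ₗ[ℂ] ℂ}
    (h : ∀ c d k k', HasPotential k (content c) → HasPotential k' (content d) →
      Γ (bar (commutator c)) (bar (commutator d)) = Γ' (bar (commutator c)) (bar (commutator d)))
    {u v : FreeA T m} (hu : u ∈ barSpan T m) (hv : v ∈ barSpan T m) : Γ u v = Γ' u v := by
  refine Submodule.span_induction₂ (p := fun u v _ _ => Γ u v = Γ' u v) ?_ ?_ ?_ ?_ ?_ ?_ ?_ hu hv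
  · rintro _ _ ⟨c, k, hc, rfl⟩ ⟨d, k', hd, rfl⟩
    exact h c d k k' hc hd
  · intro y _; simp
  · intro x _; simp
  · intro x y z _ _ _ h₁ h₂; simp only [map_add, LinearMap.add_apply, h₁, h₂]
  · intro x y z _ _ _ h₁ h₂; simp only [map_add, h₁, h₂]
  · intro r x y _ _ h; simp only [map_smul, LinearMap.smul_apply, h]
  · intro r x y _ _ h; simp only [map_smul, h]

/-- Flags are attached to all multilinear commutators, so the values on the spanning set are
prescribed. -/
theorem IsGeomZero.unique {ω : ℂ} {a : Diag T m → ℂ} {Γ Γ' : FreeA T m →ₗ[ℂ] FreeA T m →ₗ[ℂ] ℂ}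
    (h : IsGeomZero ω a Γ) (h' : IsGeomZero ω a Γ') {u v : FreeA T m} (hu : u ∈ barSpan T m)
    (hv : v ∈ barSpan T m) : Γ u v = Γ' u v := by
  refine eq_on_barSpan (fun c d k k' hc hd => ?_) hu hv
  obtain ⟨s, Ls, hf⟩ := FlagOf.exists_of_hasPotential (ω := ω) hc
  obtain ⟨s', Ls', hf'⟩ := FlagOf.exists_of_hasPotential (ω := ω) hd
  rw [h c d s s' Ls Ls' hf hf', h' c d s s' Ls Ls' hf hf']

/-- The geometric form is symmetric in its two flags, so the transposed form has the same prescribed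
values. -/
theorem IsGeomZero.symm {ω : ℂ} {a : Diag T m → ℂ} {Γ : FreeA T m →ₗ[ℂ] FreeA T m →ₗ[ℂ] ℂ}
    (h : IsGeomZero ω a Γ) {u v : FreeA T m} (hu : u ∈ barSpan T m) (hv : v ∈ barSpan T m) :
    Γ u v = Γ v u := by
  refine IsGeomZero.unique (Γ' := Γ.flip) h ?_ hu hv
  intro c d s s' Ls Ls' hf hf'
  rw [LinearMap.flip_apply, h d c s' s Ls' Ls hf' hf, mul_comm (s' : ℂ)]
  congr 1
  unfold geomForm
  congr 1
  refine Finset.sum_congr rfl fun H _ => ?_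
  ring

end GeomZero

/-! ### The sum over the nontrivial powers of the permutation -/

section TotalForm

variable {R r T : ℕ} [NeZero T] {perm : Equiv.Perm (Fin R)} {rep : Fin r → Fin R}
  {b : Fin R → Fin R → ℂ}

variable (T perm b) in
/-- The sum of the forms that are attached to the nontrivial powers of a permutation. -/
def totalForm : FreeLieAlgebra ℂ (Fin R) →ₗ[ℂ] Words (Fin R) →ₗ[ℂ] ℂ :=
  ∑ l ∈ Finset.univ.erase (0 : ZMod T), crossForm b (perm ^ l.val)

theorem totalForm_apply (x : FreeLieAlgebra ℂ (Fin R)) (t : Words (Fin R)) :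
    totalForm T perm b x t =
      ∑ l ∈ Finset.univ.erase (0 : ZMod T), crossForm b (perm ^ l.val) x t := by
  simp only [totalForm, LinearMap.sum_apply]

variable (T perm rep b) in
/-- The weights of the pairs of letters of `𝔞`. -/
def liftKernel (lam : Fin r → ℕ) (x y : ZMod T × Fin (∑ i, lam i)) : ℂ :=
  b (orbitLetter T perm rep lam x) (orbitLetter T perm rep lam y)

theorem pow_invariant (hperm : ∀ i j, b (perm i) (perm j) = b i j) (n : ℕ) (i j : Fin R) :
    b ((perm ^ n) i) ((perm ^ n) j) = b i j := by
  induction n with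
  | zero => rfl
  | succ n ih => rw [pow_succ', Equiv.Perm.mul_apply, Equiv.Perm.mul_apply, hperm, ih]

theorem liftKernel_shiftPerm (hT : orderOf perm = T)
    (hperm : ∀ i j, b (perm i) (perm j) = b i j) (lam : Fin r → ℕ) (j : ZMod T)
    (x y : ZMod T × Fin (∑ i, lam i)) :
    liftKernel T perm rep b lam (shiftPerm _ j x) (shiftPerm _ j y) =
      liftKernel T perm rep b lam x y := by
  rw [liftKernel, orbitLetter_shiftPerm hT, orbitLetter_shiftPerm hT, pow_invariant hperm]
  rfl

theorem isGeomZero_liftKernel {ω : ℂ} (hω : IsPrimitiveRoot ω T) (hT : orderOf perm = T)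
    (hb : ∀ i j, b i j = b j i) (hperm : ∀ i j, b (perm i) (perm j) = b i j) (lam : Fin r → ℕ) :
    IsGeomZero ω (diagWeight (liftKernel T perm rep b lam))
      (shiftForm (liftKernel T perm rep b lam)) :=
  isGeomZero_shiftForm hω (fun _ _ => hb _ _) (liftKernel_shiftPerm hT hperm lam)

theorem sym_mem_barSpan (hT : orderOf perm = T) (lam : Fin r → ℕ) {x : FreeLieAlgebra ℂ (Fin R)}
    (hx : relabel perm x = x) : sym T perm rep lam x ∈ barSpan T _ := by
  rw [sym_eq]
  refine multiProj_mem_barSpan fun j => ?_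
  rw [← polar_relabel _ (orbitLetter_shiftPerm hT lam j), relabel_pow_eq hx]

/-- Both the derivation and the expansion into words are compatible with polarization, so the sum
over multilinear words collects, for each original word, its `symOrder` lifts. -/
theorem shiftForm_sym (hrep : ∀ j, ∃! i, perm.SameCycle (rep i) j) (hT : orderOf perm = T)
    {lam : Fin r → ℕ} (x : FreeLieAlgebra ℂ (Fin R)) {y : FreeLieAlgebra ℂ (Fin R)}
    (hy : y ∈ weightSpace perm rep lam) :
    shiftForm (liftKernel T perm rep b lam) (sym T perm rep lam y) (sym T perm rep lam x) =
      -(2 * T : ℂ)⁻¹ * (symOrder T perm rep lam * totalForm T perm b x (wordExp y)) := by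
  rw [shiftForm_apply, totalForm_apply]
  congr 1
  rw [Finset.mul_sum]
  refine Finset.sum_congr rfl fun l _ => ?_
  refine Eq.trans ?_ (sum_lifts hrep hT hy (crossValue b (perm ^ l.val) x))
  rw [sym_eq, sym_eq]
  refine (evalWords_multiProj _ _).trans (Finset.sum_congr rfl fun p _ => ?_)
  rw [crossValue_multiProj _ _ _ (sum_letterWeight_multiWord _ _), wordExp_polar,
    crossValue_map _ b (orbitLetter_shiftPerm hT lam l)]
  rfl

theorem symOrder_ne_zero (hT : orderOf perm = T) (lam : Fin r → ℕ) :
    symOrder T perm rep lam ≠ 0 := by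
  refine Finset.prod_ne_zero_iff.mpr fun i _ =>
    mul_ne_zero (pow_ne_zero _ ?_) (Nat.factorial_ne_zero _)
  have hd : Function.minimalPeriod perm (rep i) ∣ T := by
    rw [← pow_apply_eq_self_iff, ← hT, pow_orderOf_eq_one]; rfl
  have h0 := Nat.pos_of_ne_zero (NeZero.ne T)
  exact (Nat.div_pos (Nat.le_of_dvd h0 hd) (Nat.pos_of_dvd_of_pos hd h0)).ne'

/-- The fixed points are spanned by fixed points that are homogeneous. -/
theorem mem_span_of_fixed (hrep : ∀ j, ∃! i, perm.SameCycle (rep i) j) (hT : orderOf perm = T)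
    {x : FreeLieAlgebra ℂ (Fin R)} (hx : relabel perm x = x) :
    x ∈ Submodule.span ℂ {x | ∃ lam, x ∈ weightSpace perm rep lam ∧ relabel perm x = x} := by
  let avg : FreeLieAlgebra ℂ (Fin R) →ₗ[ℂ] FreeLieAlgebra ℂ (Fin R) :=
    ∑ l : ZMod T, (relabel ⇑(perm ^ l.val)).toLinearMap
  have havg : ∀ z, avg z = ∑ l : ZMod T, relabel ⇑(perm ^ l.val) z := fun z => by
    simp only [avg, LinearMap.sum_apply]; rfl
  have h1 : ∀ z, avg z ∈ Submodule.span ℂ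
      {x | ∃ lam, x ∈ weightSpace perm rep lam ∧ relabel perm x = x} := by
    intro z
    have hz : z ∈ Submodule.span ℂ (Set.range commutator) := by
      rw [span_range_commutator]; trivial
    induction hz using Submodule.span_induction with
    | mem z hz =>
      obtain ⟨c, rfl⟩ := hz
      -- The weight counts letters by cycles, so the average of a commutator over the powers of the
      -- permutation stays homogeneous.
      refine Submodule.subset_span ⟨contentSum (cycleWeight hrep) c, ?_, ?_⟩
      · rw [havg, weightSpace_eq_span hrep]
        refine sum_mem fun l _ => Submodule.subset_span ⟨_, relabel_commutator _ _, ?_⟩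
        rw [contentSum, content_map, List.map_map]
        congr 1
        exact List.map_congr_left fun j _ => cycleWeight_perm_pow hrep _ j
      · rw [havg, map_sum]
        conv_rhs => rw [← Equiv.sum_comp (Equiv.addRight (1 : ZMod T))]
        refine Finset.sum_congr rfl fun l _ => ?_
        have h := pow_val_natCast hT 1
        rw [Nat.cast_one, pow_one] at h
        rw [relabel_relabel, Equiv.coe_addRight, perm_pow_val_add hT, h, Equiv.Perm.coe_mul]
    | zero => simp
    | add x y _ _ hx hy => rw [map_add]; exact add_mem hx hy
    | smul z x _ hx => rw [map_smul]; exact Submodule.smul_mem _ z hx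
  have h2 : avg x = (T : ℂ) • x := by
    rw [havg, Finset.sum_congr rfl fun l _ => relabel_pow_eq hx _]
    simp [ZMod.card, Nat.cast_smul_eq_nsmul]
  have hT0 : (T : ℂ) ≠ 0 := Nat.cast_ne_zero.mpr (NeZero.ne T)
  have h3 := Submodule.smul_mem _ (T : ℂ)⁻¹ (h1 x)
  rwa [h2, smul_smul, inv_mul_cancel₀ hT0, one_smul] at h3

/-- The total form vanishes on commutators whose degrees are different. -/
theorem totalForm_eq_zero {N : Type*} [AddCommMonoid N] {d : Fin R → N}
    (hd : ∀ (n : ℕ) j, d ((perm ^ n) j) = d j) {c c' : FreeMagma (Fin R)}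
    (h : contentSum d c' ≠ contentSum d c) :
    totalForm T perm b (commutator c) (wordExp (commutator c')) = 0 := by
  rw [totalForm_apply]
  exact Finset.sum_eq_zero fun l _ => crossForm_commutator_eq_zero b (hd _) h

theorem totalForm_weight_ne (hrep : ∀ j, ∃! i, perm.SameCycle (rep i) j) {lam mu : Fin r → ℕ}
    (hne : lam ≠ mu) {x y : FreeLieAlgebra ℂ (Fin R)} (hx : x ∈ weightSpace perm rep lam)
    (hy : y ∈ weightSpace perm rep mu) : totalForm T perm b x (wordExp y) = 0 := by
  rw [weightSpace_eq_span hrep] at hx hy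
  refine Submodule.span_induction₂ (p := fun x y _ _ => totalForm T perm b x (wordExp y) = 0)
    ?_ ?_ ?_ ?_ ?_ ?_ ?_ hx hy
  · rintro _ _ ⟨c, rfl, hc⟩ ⟨d, rfl, hd⟩
    exact totalForm_eq_zero (cycleWeight_perm_pow hrep) (by rw [hc, hd]; exact hne.symm)
  · intro y _; simp
  · intro x _; simp
  · intro x y z _ _ _ h₁ h₂; rw [map_add, LinearMap.add_apply, h₁, h₂, add_zero]
  · intro x y z _ _ _ h₁ h₂; rw [map_add, map_add, h₁, h₂, add_zero]
  · intro r x y _ _ h; rw [map_smul, LinearMap.smul_apply, h, smul_zero]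
  · intro r x y _ _ h; rw [map_smul, map_smul, h, smul_zero]

/-- On each weight the total form is a nonzero multiple of `G₀` on symmetrizations, and `G₀` is
symmetric; different weights are orthogonal. This is where the comparison with geometry enters the
cocycle identity. -/
theorem totalForm_symm (hrep : ∀ j, ∃! i, perm.SameCycle (rep i) j) {ω : ℂ}
    (hω : IsPrimitiveRoot ω T) (hT : orderOf perm = T) (hb : ∀ i j, b i j = b j i)
    (hperm : ∀ i j, b (perm i) (perm j) = b i j) {x y : FreeLieAlgebra ℂ (Fin R)}
    (hx : relabel perm x = x) (hy : relabel perm y = y) :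
    totalForm T perm b x (wordExp y) = totalForm T perm b y (wordExp x) := by
  refine Submodule.span_induction₂
    (p := fun x y _ _ => totalForm T perm b x (wordExp y) = totalForm T perm b y (wordExp x))
    ?_ ?_ ?_ ?_ ?_ ?_ ?_ (mem_span_of_fixed hrep hT hx) (mem_span_of_fixed hrep hT hy)
  · rintro x y ⟨lam, hx, hx'⟩ ⟨mu, hy, hy'⟩
    by_cases hne : lam = mu
    · subst hne
      have h := (isGeomZero_liftKernel (rep := rep) hω hT hb hperm lam).symm
        (sym_mem_barSpan (rep := rep) hT lam hy') (sym_mem_barSpan (rep := rep) hT lam hx')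
      rw [shiftForm_sym hrep hT x hy, shiftForm_sym hrep hT y hx] at h
      have hT0 : (T : ℂ) ≠ 0 := Nat.cast_ne_zero.mpr (NeZero.ne T)
      have h0 : (symOrder T perm rep lam : ℂ) ≠ 0 := Nat.cast_ne_zero.mpr (symOrder_ne_zero hT lam)
      exact mul_left_cancel₀ h0
        (mul_left_cancel₀ (neg_ne_zero.mpr (inv_ne_zero (mul_ne_zero two_ne_zero hT0))) h)
    · rw [totalForm_weight_ne hrep hne hx hy, totalForm_weight_ne hrep (Ne.symm hne) hy hx]
  · intro y _; simp
  · intro x _; simp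
  · intro x y z _ _ _ h₁ h₂; simp only [map_add, LinearMap.add_apply, h₁, h₂]
  · intro x y z _ _ _ h₁ h₂; simp only [map_add, LinearMap.add_apply, h₁, h₂]
  · intro r x y _ _ h; simp only [map_smul, LinearMap.smul_apply, h]
  · intro r x y _ _ h; simp only [map_smul, LinearMap.smul_apply, h]

end TotalForm

/-! ### Central extensions by a cocycle -/

section CentralExtension

variable {K : Type u} [LieRing K] [LieAlgebra ℂ K]

/-- The direct sum of a Lie algebra and a line, for the bracket that is twisted by a form. -/
def CentralExt (_ : K →ₗ[ℂ] K →ₗ[ℂ] ℂ) : Type u := K × ℂ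

variable (Ω : K →ₗ[ℂ] K →ₗ[ℂ] ℂ)

instance : AddCommGroup (CentralExt Ω) := inferInstanceAs (AddCommGroup (K × ℂ))

instance : Module ℂ (CentralExt Ω) := inferInstanceAs (Module ℂ (K × ℂ))

instance : Bracket (CentralExt Ω) (CentralExt Ω) where
  bracket x y := ((⁅x.1, y.1⁆, Ω x.1 y.1) : K × ℂ)

variable {Ω}

/-- The central component of the Jacobi identity is the cocycle identity, and that of `[x, x] = 0`
is skew-symmetry in characteristic zero. -/
theorem exists_centralExt (hskew : ∀ x y, Ω x y = -Ω y x)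
    (hΩ : ∀ x y z, Ω x ⁅y, z⁆ + Ω y ⁅z, x⁆ + Ω z ⁅x, y⁆ = 0) :
    ∃ (L : Type u) (_ : LieRing L) (_ : LieAlgebra ℂ L) (e : (K × ℂ) ≃ₗ[ℂ] L),
      (∀ (x y : K) (a b : ℂ), ⁅e (x, a), e (y, b)⁆ = e (⁅x, y⁆, Ω x y)) ∧
      ∀ v : L, ⁅e (0, 1), v⁆ = 0 := by
  let I : LieRing (CentralExt Ω) :=
    { add_lie := fun x y z => Prod.ext (add_lie x.1 y.1 z.1)
        (by change Ω (x.1 + y.1) z.1 = Ω x.1 z.1 + Ω y.1 z.1; rw [map_add, LinearMap.add_apply])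
      lie_add := fun x y z => Prod.ext (lie_add x.1 y.1 z.1) (map_add (Ω x.1) y.1 z.1)
      lie_self := fun x => Prod.ext (lie_self x.1) (self_eq_neg.mp (hskew x.1 x.1))
      leibniz_lie := fun x y z => Prod.ext (leibniz_lie x.1 y.1 z.1) (by
        change Ω x.1 ⁅y.1, z.1⁆ = Ω ⁅x.1, y.1⁆ z.1 + Ω y.1 ⁅x.1, z.1⁆
        rw [hskew ⁅x.1, y.1⁆, ← lie_skew x.1 z.1, map_neg]
        linear_combination hΩ x.1 y.1 z.1) }
  let A : LieAlgebra ℂ (CentralExt Ω) :=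
    { lie_smul := fun t x y => Prod.ext (lie_smul t x.1 y.1) (map_smul (Ω x.1) t y.1) }
  refine ⟨CentralExt Ω, I, A, LinearEquiv.refl ℂ (K × ℂ), fun x y a b => rfl, fun v => ?_⟩
  refine Prod.ext (zero_lie v.1) ?_
  change Ω 0 v.1 = 0
  rw [map_zero, LinearMap.zero_apply]

end CentralExtension

/-! ### The form on the fixed points -/

section Omega

variable {R r T : ℕ} [NeZero T] {𝔥 : Type u} [AddCommGroup 𝔥] [Module ℂ 𝔥]
  [FiniteDimensional ℂ 𝔥] {B : LinearMap.BilinForm ℂ 𝔥} {hB : B.Nondegenerate}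
  {α : Fin R → Module.Dual ℂ 𝔥} {perm : Equiv.Perm (Fin R)} {rep : Fin r → Fin R}
  {σ : LieG B hB α ≃ₗ⁅ℂ⁆ LieG B hB α}

variable (T hB α perm) in
/-- The skew-symmetric form on `𝔤` that restricts to the cocycle. -/
def ambientForm (hsymm : B.IsSymm) : LieG B hB α →ₗ[ℂ] LieG B hB α →ₗ[ℂ] ℂ :=
  (2 * T : ℂ)⁻¹ •
    ((totalForm T perm (rootForm B hB α)).compl₁₂ (compMinus hB α hsymm) (projPlus hB α hsymm) -
      ((totalForm T perm (rootForm B hB α)).compl₁₂ (compMinus hB α hsymm)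
        (projPlus hB α hsymm)).flip)

variable (hsymm : B.IsSymm)

theorem ambientForm_apply (u v : LieG B hB α) : ambientForm T hB α perm hsymm u v = (2 * T : ℂ)⁻¹ *
    (totalForm T perm (rootForm B hB α) (compMinus hB α hsymm u) (projPlus hB α hsymm v) -
      totalForm T perm (rootForm B hB α) (compMinus hB α hsymm v) (projPlus hB α hsymm u)) := by
  simp only [ambientForm, LinearMap.smul_apply, LinearMap.sub_apply, LinearMap.compl₁₂_apply,
    LinearMap.flip_apply, smul_eq_mul]

theorem ambientForm_skew (u v : LieG B hB α) :
    ambientForm T hB α perm hsymm u v = -ambientForm T hB α perm hsymm v u := by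
  rw [ambientForm_apply, ambientForm_apply]; ring

theorem ambientForm_toH (h : 𝔥) (v : LieG B hB α) :
    ambientForm T hB α perm hsymm (toH B hB α h) v = 0 := by
  simp [ambientForm_apply]

theorem ambientForm_toN (x : FreeLieAlgebra ℂ (Fin R)) (v : LieG B hB α) :
    ambientForm T hB α perm hsymm (toN B hB α x) v = (2 * T : ℂ)⁻¹ *
      totalForm T perm (rootForm B hB α) x (projPlus hB α hsymm v) := by
  simp [ambientForm_apply]

theorem ambientForm_toNPlus_toNPlus (x y : FreeLieAlgebra ℂ (Fin R)) :
    ambientForm T hB α perm hsymm (toNPlus B hB α x) (toNPlus B hB α y) = 0 := by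
  simp [ambientForm_apply]

variable (T hB α perm) in
/-- The cyclic sum that vanishes for a cocycle. -/
def cyclicSum (u v w : LieG B hB α) : ℂ :=
  ambientForm T hB α perm hsymm u ⁅v, w⁆ + ambientForm T hB α perm hsymm v ⁅w, u⁆ +
    ambientForm T hB α perm hsymm w ⁅u, v⁆

theorem cyclicSum_rotate (u v w : LieG B hB α) :
    cyclicSum T hB α perm hsymm u v w = cyclicSum T hB α perm hsymm v w u := by
  unfold cyclicSum; ring

theorem cyclicSum_swap (u v w : LieG B hB α) :
    cyclicSum T hB α perm hsymm u v w = -cyclicSum T hB α perm hsymm v u w := by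
  unfold cyclicSum
  rw [← lie_skew v w, ← lie_skew w u, ← lie_skew u v]
  simp only [map_neg]
  ring

theorem cyclicSum_add (u v w w' : LieG B hB α) : cyclicSum T hB α perm hsymm u v (w + w') =
    cyclicSum T hB α perm hsymm u v w + cyclicSum T hB α perm hsymm u v w' := by
  simp only [cyclicSum, lie_add, add_lie, map_add, LinearMap.add_apply]
  ring

/-- Brackets of 𝔫 with 𝔫 and 𝔥 stay in 𝔫, which pairs to zero with 𝔫. For the 𝔫₊-component of `w`
the sum over `l` of `crossForm_lie` applies. -/
theorem cyclicSum_toN_toN {x x' : FreeLieAlgebra ℂ (Fin R)} (hx : relabel perm x = x)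
    (hx' : relabel perm x' = x') (w : LieG B hB α) :
    cyclicSum T hB α perm hsymm (toN B hB α x) (toN B hB α x') w = 0 := by
  have h0 : ∀ w : LieG B hB α, cyclicSum T hB α perm hsymm (toN B hB α x) (toN B hB α x') w =
      (2 * T : ℂ)⁻¹ *
        (totalForm T perm (rootForm B hB α) x (projPlus hB α hsymm ⁅toN B hB α x', w⁆) -
          totalForm T perm (rootForm B hB α) x' (projPlus hB α hsymm ⁅toN B hB α x, w⁆) -
            totalForm T perm (rootForm B hB α) ⁅x, x'⁆ (projPlus hB α hsymm w)) := by
    intro w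
    rw [cyclicSum, ambientForm_skew hsymm w, ← LieHom.map_lie, ← lie_skew w, map_neg,
      ambientForm_toN, ambientForm_toN, ambientForm_toN]
    ring
  obtain ⟨z, h, y, rfl⟩ := exists_triangular w
  rw [cyclicSum_add, cyclicSum_add, h0, h0, h0]
  have h1 : ∀ v, projPlus hB α hsymm ⁅toN B hB α v, toN B hB α z⁆ = 0 := fun v => by
    rw [← LieHom.map_lie, projPlus_toN]
  have h2 : ∀ v, projPlus hB α hsymm ⁅toN B hB α v, toH B hB α h⁆ = 0 := fun v => by
    obtain ⟨v', hv'⟩ := exists_lie_toH_toN (B := B) (hB := hB) (α := α) h v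
    rw [← lie_skew, hv', map_neg, projPlus_toN, neg_zero]
  have h3 : totalForm T perm (rootForm B hB α) ⁅x, x'⁆ (wordExp y) =
      totalForm T perm (rootForm B hB α) x
        (projPlus hB α hsymm ⁅toN B hB α x', toNPlus B hB α y⁆) -
      totalForm T perm (rootForm B hB α) x'
        (projPlus hB α hsymm ⁅toN B hB α x, toNPlus B hB α y⁆) := by
    simp only [totalForm_apply]
    rw [← Finset.sum_sub_distrib]
    exact Finset.sum_congr rfl fun l _ =>
      crossForm_lie hsymm _ (relabel_pow_eq hx _) (relabel_pow_eq hx' _) y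
  simp only [h1, h2, projPlus_toN, projPlus_toH, projPlus_toNPlus, h3, map_zero]
  ring

theorem cyclicSum_toH_toH (h h' : 𝔥) (w : LieG B hB α) :
    cyclicSum T hB α perm hsymm (toH B hB α h) (toH B hB α h') w = 0 := by
  rw [cyclicSum, lie_toH_toH, ambientForm_toH, ambientForm_toH, map_zero]
  ring

/-- The eigenvalues of `h` on commutators of 𝔫 and of 𝔫₊ enter with opposite signs. They cancel for
equal degrees; since `α_i(h)` is constant on cycles, the form vanishes for different ones. -/
theorem cyclicSum_toH_toN_toNPlus {h : 𝔥} (hh : ∀ i, α (perm i) h = α i h)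
    (x y : FreeLieAlgebra ℂ (Fin R)) :
    cyclicSum T hB α perm hsymm (toH B hB α h) (toN B hB α x) (toNPlus B hB α y) = 0 := by
  have hd : ∀ (n : ℕ) j, α ((perm ^ n) j) h = α j h := by
    intro n j
    induction n with
    | zero => rfl
    | succ n ih => rw [pow_succ', Equiv.Perm.mul_apply, hh, ih]
  rw [cyclicSum, ambientForm_toH, zero_add, ← lie_skew, map_neg]
  have hx : x ∈ Submodule.span ℂ (Set.range commutator) := by
    rw [span_range_commutator]; trivial
  have hy : y ∈ Submodule.span ℂ (Set.range commutator) := by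
    rw [span_range_commutator]; trivial
  refine Submodule.span_induction₂ (p := fun x y _ _ =>
    -ambientForm T hB α perm hsymm (toN B hB α x) ⁅toH B hB α h, toNPlus B hB α y⁆ +
      ambientForm T hB α perm hsymm (toNPlus B hB α y) ⁅toH B hB α h, toN B hB α x⁆ = 0)
    ?_ ?_ ?_ ?_ ?_ ?_ ?_ hx hy
  · rintro _ _ ⟨c, rfl⟩ ⟨d, rfl⟩
    rw [lie_toH_toN, lie_toH_toNPlus, map_smul, map_smul, ambientForm_skew hsymm (toNPlus B hB α _),
      ambientForm_toN, projPlus_toNPlus, smul_eq_mul, smul_eq_mul]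
    by_cases hcd : contentSum (fun i => α i h) d = contentSum (fun i => α i h) c
    · rw [hcd]; ring
    · rw [totalForm_eq_zero (d := fun i => α i h) hd hcd]; ring
  · intro y _; simp
  · intro x _; simp
  · intro x y z _ _ _ h₁ h₂
    simp only [map_add, LinearMap.add_apply, lie_add]
    linear_combination h₁ + h₂
  · intro x y z _ _ _ h₁ h₂
    simp only [map_add, LinearMap.add_apply, lie_add]
    linear_combination h₁ + h₂
  · intro s x y _ _ h₁
    simp only [map_smul, LinearMap.smul_apply, lie_smul, smul_eq_mul]
    linear_combination s * h₁
  · intro s x y _ _ h₁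
    simp only [map_smul, LinearMap.smul_apply, lie_smul, smul_eq_mul]
    linear_combination s * h₁

end Omega

/-! ### The cocycle on the fixed points -/

section Cocycle

variable {R r T : ℕ} [NeZero T] {𝔥 : Type u} [AddCommGroup 𝔥] [Module ℂ 𝔥]
  [FiniteDimensional ℂ 𝔥] {B : LinearMap.BilinForm ℂ 𝔥} {hB : B.Nondegenerate}
  {α : Fin R → Module.Dual ℂ 𝔥} {perm : Equiv.Perm (Fin R)} {rep : Fin r → Fin R}
  {σ : LieG B hB α ≃ₗ⁅ℂ⁆ LieG B hB α} {ω : ℂ}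

theorem chevalley_mem (hsymm : B.IsSymm) (hα : LinearIndependent ℂ α)
    (hE : ∀ i, σ (gen B hB α (.E i)) = gen B hB α (.E (perm i)))
    (hF : ∀ i, σ (gen B hB α (.F i)) = gen B hB α (.F (perm i))) {u : LieG B hB α}
    (hu : u ∈ fixedPoints σ) : chevalley B hB α u ∈ fixedPoints σ := by
  obtain ⟨x, h, y, rfl, hx, hh, hy⟩ := exists_triangular_fixed hsymm hα hE hF hu
  rw [map_add, map_add, chevalley_toN, chevalley_toNPlus, chevalley_H]
  exact add_mem (add_mem (toNPlus_mem hE hx) (neg_mem hh)) (toN_mem hF hy)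

/-- The involution exchanges the two arguments of the total form, which is symmetric on fixed
points, whereas the ambient form is skew. -/
theorem ambientForm_chevalley (hsymm : B.IsSymm) (hα : LinearIndependent ℂ α)
    (hE : ∀ i, σ (gen B hB α (.E i)) = gen B hB α (.E (perm i)))
    (hF : ∀ i, σ (gen B hB α (.F i)) = gen B hB α (.F (perm i)))
    (hH : ∀ i, σ (gen B hB α (.H (coroot B hB α i))) = gen B hB α (.H (coroot B hB α (perm i))))
    (hT : orderOf perm = T) (hrep : ∀ j, ∃! i, perm.SameCycle (rep i) j)
    (hω : IsPrimitiveRoot ω T) {u v : LieG B hB α} (hu : u ∈ fixedPoints σ)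
    (hv : v ∈ fixedPoints σ) :
    ambientForm T hB α perm hsymm (chevalley B hB α u) (chevalley B hB α v) =
      -ambientForm T hB α perm hsymm u v := by
  obtain ⟨x, h, y, rfl, hx, -, hy⟩ := exists_triangular_fixed hsymm hα hE hF hu
  obtain ⟨x', h', y', rfl, hx', -, hy'⟩ := exists_triangular_fixed hsymm hα hE hF hv
  have hs : ∀ {x y : FreeLieAlgebra ℂ (Fin R)}, relabel perm x = x → relabel perm y = y →
      totalForm T perm (rootForm B hB α) x (wordExp y) =
        totalForm T perm (rootForm B hB α) y (wordExp x) := fun hx hy =>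
    totalForm_symm hrep hω hT (rootForm_symm hsymm) (rootForm_perm hsymm hE hH) hx hy
  rw [ambientForm_apply, ambientForm_apply]
  simp only [map_add, map_neg, chevalley_toN, chevalley_toNPlus, chevalley_H,
    compMinus_toN, compMinus_toNPlus, compMinus_toH, projPlus_toN, projPlus_toNPlus, projPlus_toH,
    add_zero, zero_add, neg_zero]
  rw [hs hy hx', hs hy' hx]
  ring

/-- By trilinearity each argument may be taken in 𝔫^σ, 𝔥^σ or 𝔫₊^σ. Either two arguments lie in the
same part, or all three parts occur once; the case of two arguments in 𝔫₊^σ is reduced to 𝔫^σ by the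
Chevalley involution. -/
theorem cyclicSum_eq_zero (hsymm : B.IsSymm) (hα : LinearIndependent ℂ α)
    (hE : ∀ i, σ (gen B hB α (.E i)) = gen B hB α (.E (perm i)))
    (hF : ∀ i, σ (gen B hB α (.F i)) = gen B hB α (.F (perm i)))
    (hH : ∀ i, σ (gen B hB α (.H (coroot B hB α i))) = gen B hB α (.H (coroot B hB α (perm i))))
    (hT : orderOf perm = T) (hrep : ∀ j, ∃! i, perm.SameCycle (rep i) j)
    (hω : IsPrimitiveRoot ω T) {u v w : LieG B hB α} (hu : u ∈ fixedPoints σ)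
    (hv : v ∈ fixedPoints σ) (hw : w ∈ fixedPoints σ) :
    cyclicSum T hB α perm hsymm u v w = 0 := by
  let N : LieG B hB α → Prop := fun u => ∃ x, relabel perm x = x ∧ u = toN B hB α x
  let H : LieG B hB α → Prop := fun u => ∃ h, σ (toH B hB α h) = toH B hB α h ∧ u = toH B hB α h
  let P : LieG B hB α → Prop := fun u => ∃ y, relabel perm y = y ∧ u = toNPlus B hB α y
  have hmem : ∀ {u}, N u ∨ H u ∨ P u → u ∈ fixedPoints σ := by
    rintro u (⟨x, hx, rfl⟩ | ⟨h, hh, rfl⟩ | ⟨y, hy, rfl⟩)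
    exacts [toN_mem hF hx, hh, toNPlus_mem hE hy]
  have hNN : ∀ {u v w}, N u → N v → cyclicSum T hB α perm hsymm u v w = 0 := by
    rintro _ _ w ⟨x, hx, rfl⟩ ⟨x', hx', rfl⟩
    exact cyclicSum_toN_toN hsymm hx hx' w
  have hHH : ∀ {u v w}, H u → H v → cyclicSum T hB α perm hsymm u v w = 0 := by
    rintro _ _ w ⟨h, _, rfl⟩ ⟨h', _, rfl⟩
    exact cyclicSum_toH_toH hsymm h h' w
  have hPP : ∀ {u v w}, P u → P v → w ∈ fixedPoints σ →
      cyclicSum T hB α perm hsymm u v w = 0 := by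
    rintro _ _ w ⟨x, hx, rfl⟩ ⟨x', hx', rfl⟩ hw
    have h1 := toN_mem (σ := σ) hF hx
    have h2 := toN_mem (σ := σ) hF hx'
    have h3 := chevalley_mem hsymm hα hE hF hw
    have h4 := cyclicSum_toN_toN (T := T) hsymm hx hx' (chevalley B hB α w)
    rw [← chevalley_toN, ← chevalley_toN, ← chevalley_chevalley w, cyclicSum, ← LieHom.map_lie,
      ← LieHom.map_lie, ← LieHom.map_lie,
      ambientForm_chevalley hsymm hα hE hF hH hT hrep hω h1 ((fixedPoints σ).lie_mem h2 h3),
      ambientForm_chevalley hsymm hα hE hF hH hT hrep hω h2 ((fixedPoints σ).lie_mem h3 h1),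
      ambientForm_chevalley hsymm hα hE hF hH hT hrep hω h3 ((fixedPoints σ).lie_mem h1 h2)]
    rw [cyclicSum] at h4
    linear_combination -h4
  have hHNP : ∀ {u v w}, H u → N v → P w → cyclicSum T hB α perm hsymm u v w = 0 := by
    rintro _ _ _ ⟨h, hh, rfl⟩ ⟨x, _, rfl⟩ ⟨y, _, rfl⟩
    exact cyclicSum_toH_toN_toNPlus hsymm (root_perm_of_fixed hsymm hE hh) x y
  have hHPN : ∀ {u v w}, H u → P v → N w → cyclicSum T hB α perm hsymm u v w = 0 := by
    intro u v w hu hv hw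
    rw [cyclicSum_rotate, cyclicSum_rotate, cyclicSum_swap, hHNP hu hw hv, neg_zero]
  have hpair : ∀ {u v w}, N u ∨ H u ∨ P u → N v ∨ H v ∨ P v → N w ∨ H w ∨ P w →
      cyclicSum T hB α perm hsymm u v w = 0 := by
    intro u v w hu hv hw
    have e1 := cyclicSum_rotate (T := T) (perm := perm) hsymm u v w
    have e2 := e1.trans (cyclicSum_rotate hsymm v w u)
    have hu' := hmem hu
    have hv' := hmem hv
    have hw' := hmem hw
    -- Cyclic rotations bring a pair of arguments from the same part to the front, or the three
    -- parts into one of two cyclic orders.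
    rcases hu with hu | hu | hu <;> rcases hv with hv | hv | hv <;> rcases hw with hw | hw | hw <;>
      first
      | exact hNN hu hv
      | exact e1.trans (hNN hv hw)
      | exact e2.trans (hNN hw hu)
      | exact hHH hu hv
      | exact e1.trans (hHH hv hw)
      | exact e2.trans (hHH hw hu)
      | exact hPP hu hv hw'
      | exact e1.trans (hPP hv hw hu')
      | exact e2.trans (hPP hw hu hv')
      | exact hHNP hu hv hw
      | exact e1.trans (hHNP hv hw hu)
      | exact e2.trans (hHNP hw hu hv)
      | exact hHPN hu hv hw
      | exact e1.trans (hHPN hv hw hu)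
      | exact e2.trans (hHPN hw hu hv)
  have hsplit : ∀ {u v}, (∀ w, N w ∨ H w ∨ P w → cyclicSum T hB α perm hsymm u v w = 0) →
      ∀ w ∈ fixedPoints σ, cyclicSum T hB α perm hsymm u v w = 0 := by
    intro u v h w hw
    obtain ⟨x, k, y, rfl, hx, hk, hy⟩ := exists_triangular_fixed hsymm hα hE hF hw
    rw [cyclicSum_add, cyclicSum_add, h _ (Or.inl ⟨x, hx, rfl⟩), h _ (Or.inr (Or.inl ⟨k, hk, rfl⟩)),
      h _ (Or.inr (Or.inr ⟨y, hy, rfl⟩)), add_zero, add_zero]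
  refine hsplit (fun w hw => ?_) w hw
  rw [← cyclicSum_rotate]
  refine hsplit (fun v hv => ?_) v hv
  rw [← cyclicSum_rotate]
  exact hsplit (fun u hu => hpair hv hw hu) u hu

variable (σ T perm) in
/-- The cocycle on the fixed points. -/
def omegaForm (hsymm : B.IsSymm) : fixedPoints σ →ₗ[ℂ] fixedPoints σ →ₗ[ℂ] ℂ :=
  (ambientForm T hB α perm hsymm).compl₁₂ ((fixedPoints σ).incl : fixedPoints σ →ₗ[ℂ] LieG B hB α)
    ((fixedPoints σ).incl : fixedPoints σ →ₗ[ℂ] LieG B hB α)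

theorem omegaForm_apply (hsymm : B.IsSymm) (u v : fixedPoints σ) :
    omegaForm T perm σ hsymm u v = ambientForm T hB α perm hsymm u v := rfl

theorem diagWeight_liftKernel (lam : Fin r → ℕ) :
    diagWeight (liftKernel T perm rep (rootForm B hB α) lam) =
      cartanWeight T perm rep B hB α lam := by
  funext p
  rw [diagWeight, liftKernel, orbitLetter, orbitLetter, ZMod.val_zero, pow_zero, cartanWeight]
  rfl

theorem omegaForm_toN_toNPlus (hsymm : B.IsSymm) {x y : FreeLieAlgebra ℂ (Fin R)}
    (hx : toN B hB α x ∈ fixedPoints σ) (hy : toNPlus B hB α y ∈ fixedPoints σ) :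
    omegaForm T perm σ hsymm ⟨toN B hB α x, hx⟩ ⟨toNPlus B hB α y, hy⟩ =
      (2 * T : ℂ)⁻¹ * totalForm T perm (rootForm B hB α) x (wordExp y) := by
  rw [omegaForm_apply, ambientForm_toN, projPlus_toNPlus]

theorem isOmega_omegaForm (hsymm : B.IsSymm)
    (hE : ∀ i, σ (gen B hB α (.E i)) = gen B hB α (.E (perm i)))
    (hH : ∀ i, σ (gen B hB α (.H (coroot B hB α i))) = gen B hB α (.H (coroot B hB α (perm i))))
    (hT : orderOf perm = T) (hrep : ∀ j, ∃! i, perm.SameCycle (rep i) j)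
    (hω : IsPrimitiveRoot ω T) : IsOmega T perm rep ω σ (omegaForm T perm σ hsymm) := by
  constructor
  · intro u v
    rw [omegaForm_apply, omegaForm_apply]
    exact ambientForm_skew hsymm _ _
  · intro lam _
    refine ⟨shiftForm (liftKernel T perm rep (rootForm B hB α) lam), ?_, ?_⟩
    · rw [← diagWeight_liftKernel]
      exact isGeomZero_liftKernel hω hT (rootForm_symm hsymm) (rootForm_perm hsymm hE hH) lam
    · intro x hx y hy hx' hy'
      rw [omegaForm_toN_toNPlus, shiftForm_sym hrep hT x hy]
      have h0 : (symOrder T perm rep lam : ℂ) ≠ 0 := Nat.cast_ne_zero.mpr (symOrder_ne_zero hT lam)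
      -- The factor `symOrder` from the count of lifts cancels, and the two minus signs leave `1 /
      -- (2T)`, the normalization of `ambientForm`.
      rw [neg_mul, mul_neg, neg_neg, mul_left_comm, inv_mul_cancel_left₀ h0]
  · intro lam mu hne x hx y hy hx' hy'
    rw [omegaForm_toN_toNPlus, totalForm_weight_ne hrep hne hx hy, mul_zero]
  · intro x y hx hy
    rw [omegaForm_apply, ambientForm_toN, projPlus_toN, map_zero, mul_zero]
  · intro x y hx hy
    rw [omegaForm_apply, ambientForm_toNPlus_toNPlus]
  · intro h hh v
    have e : ((⟨gen B hB α (.H h), hh⟩ : fixedPoints σ) : LieG B hB α) = toH B hB α h := rfl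
    rw [omegaForm_apply, e, ambientForm_toH]

theorem omegaForm_cocycle (hsymm : B.IsSymm) (hα : LinearIndependent ℂ α)
    (hE : ∀ i, σ (gen B hB α (.E i)) = gen B hB α (.E (perm i)))
    (hF : ∀ i, σ (gen B hB α (.F i)) = gen B hB α (.F (perm i)))
    (hH : ∀ i, σ (gen B hB α (.H (coroot B hB α i))) = gen B hB α (.H (coroot B hB α (perm i))))
    (hT : orderOf perm = T) (hrep : ∀ j, ∃! i, perm.SameCycle (rep i) j)
    (hω : IsPrimitiveRoot ω T) (x y z : fixedPoints σ) :
    omegaForm T perm σ hsymm x ⁅y, z⁆ + omegaForm T perm σ hsymm y ⁅z, x⁆ +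
      omegaForm T perm σ hsymm z ⁅x, y⁆ = 0 := by
  simp only [omegaForm_apply, LieSubalgebra.coe_bracket]
  exact cyclicSum_eq_zero hsymm hα hE hF hH hT hrep hω x.2 y.2 z.2

/-! ### Uniqueness -/

/-- There is no commutator without letters. The weight zero, which the geometric condition leaves
out, therefore causes no ambiguity. -/
theorem eq_zero_of_mem_weightSpace_zero (hrep : ∀ j, ∃! i, perm.SameCycle (rep i) j)
    {x : FreeLieAlgebra ℂ (Fin R)} (hx : x ∈ weightSpace perm rep 0) : x = 0 := by
  rw [weightSpace_eq_span hrep] at hx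
  induction hx using Submodule.span_induction with
  | mem x hx =>
    obtain ⟨c, -, hc⟩ := hx
    have h := sum_sum_cycleWeight hrep (content c)
    rw [show ((content c).map (cycleWeight hrep)).sum = 0 from hc] at h
    simp only [Pi.zero_apply, Finset.sum_const_zero] at h
    exact absurd (List.length_eq_zero_iff.mp h.symm) (content_ne_nil c)
  | zero => rfl
  | add x y _ _ hx hy => rw [hx, hy, add_zero]
  | smul z x _ hx => rw [hx, smul_zero]

theorem eq_of_homogeneous (hrep : ∀ j, ∃! i, perm.SameCycle (rep i) j) (hT : orderOf perm = T)
    {e : FreeLieAlgebra ℂ (Fin R) →ₗ[ℂ] LieG B hB α}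
    (he : ∀ x, relabel perm x = x → e x ∈ fixedPoints σ) {f g : fixedPoints σ →ₗ[ℂ] ℂ}
    (h : ∀ lam x, x ∈ weightSpace perm rep lam → ∀ hx : relabel perm x = x,
      f ⟨e x, he x hx⟩ = g ⟨e x, he x hx⟩) {x : FreeLieAlgebra ℂ (Fin R)}
    (hx : relabel perm x = x) : f ⟨e x, he x hx⟩ = g ⟨e x, he x hx⟩ := by
  -- Membership is part of the claim, because the induction over the span has to supply it for sums
  -- and multiples.
  have key : ∃ hx : e x ∈ fixedPoints σ, f ⟨e x, hx⟩ = g ⟨e x, hx⟩ := by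
    have hspan := mem_span_of_fixed hrep hT hx
    clear hx
    induction hspan using Submodule.span_induction with
    | mem x hx =>
      obtain ⟨lam, h1, h2⟩ := hx
      exact ⟨he x h2, h lam x h1 h2⟩
    | zero =>
      refine ⟨by rw [map_zero]; exact zero_mem _, ?_⟩
      have : ∀ h0, (⟨e 0, h0⟩ : fixedPoints σ) = 0 := fun h0 => Subtype.ext (map_zero e)
      rw [this, map_zero, map_zero]
    | add x y _ _ hx hy =>
      obtain ⟨hx, hx'⟩ := hx
      obtain ⟨hy, hy'⟩ := hy
      refine ⟨by rw [map_add]; exact add_mem hx hy, ?_⟩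
      have : ∀ h0, (⟨e (x + y), h0⟩ : fixedPoints σ) = ⟨e x, hx⟩ + ⟨e y, hy⟩ :=
        fun h0 => Subtype.ext (map_add e x y)
      rw [this, map_add, map_add, hx', hy']
    | smul z x _ hx =>
      obtain ⟨hx, hx'⟩ := hx
      refine ⟨by rw [map_smul]; exact (fixedPoints σ).smul_mem z hx, ?_⟩
      have : ∀ h0, (⟨e (z • x), h0⟩ : fixedPoints σ) = z • ⟨e x, hx⟩ :=
        fun h0 => Subtype.ext (map_smul e z x)
      rw [this, map_smul, map_smul, hx']
  exact key.2

/-- The triangular decomposition and skew-symmetry leave only the pairing of 𝔫^σ with 𝔫₊^σ, and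
homogeneous fixed points span each of these. On a common nonzero weight, symmetrizations of fixed
points lie in `barSpan`, where the two forms `Γ` agree. -/
theorem IsOmega.unique (hsymm : B.IsSymm) (hα : LinearIndependent ℂ α)
    (hE : ∀ i, σ (gen B hB α (.E i)) = gen B hB α (.E (perm i)))
    (hF : ∀ i, σ (gen B hB α (.F i)) = gen B hB α (.F (perm i)))
    (hT : orderOf perm = T) (hrep : ∀ j, ∃! i, perm.SameCycle (rep i) j)
    {Ω Ω' : fixedPoints σ →ₗ[ℂ] fixedPoints σ →ₗ[ℂ] ℂ} (h : IsOmega T perm rep ω σ Ω)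
    (h' : IsOmega T perm rep ω σ Ω') : Ω = Ω' := by
  have hhom : ∀ lam x, x ∈ weightSpace perm rep lam → ∀ mu y, y ∈ weightSpace perm rep mu →
      ∀ (hx : relabel perm x = x) (hy : relabel perm y = y),
        Ω ⟨toN B hB α x, toN_mem hF hx⟩ ⟨toNPlus B hB α y, toNPlus_mem hE hy⟩ =
          Ω' ⟨toN B hB α x, toN_mem hF hx⟩ ⟨toNPlus B hB α y, toNPlus_mem hE hy⟩ := by
    intro lam x hx mu y hy hx' hy'
    by_cases hne : lam = mu
    · subst hne
      by_cases h0 : lam = 0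
      · subst h0
        have hx0 : (⟨toN B hB α x, toN_mem hF hx'⟩ : fixedPoints σ) = 0 :=
          Subtype.ext ((congrArg (toN B hB α) (eq_zero_of_mem_weightSpace_zero hrep hx)).trans
            (map_zero _))
        rw [hx0, map_zero, map_zero]
      · obtain ⟨Γ, hΓ, e⟩ := h.geometric lam h0
        obtain ⟨Γ', hΓ', e'⟩ := h'.geometric lam h0
        rw [e x hx y hy, e' x hx y hy, hΓ.unique hΓ' (sym_mem_barSpan hT lam hy')
          (sym_mem_barSpan hT lam hx')]
    · rw [h.weight_ne lam mu hne x hx y hy, h'.weight_ne lam mu hne x hx y hy]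
  have hNP : ∀ x y (hx : relabel perm x = x) (hy : relabel perm y = y),
      Ω ⟨toN B hB α x, toN_mem hF hx⟩ ⟨toNPlus B hB α y, toNPlus_mem hE hy⟩ =
        Ω' ⟨toN B hB α x, toN_mem hF hx⟩ ⟨toNPlus B hB α y, toNPlus_mem hE hy⟩ := by
    intro x y hx hy
    refine eq_of_homogeneous hrep hT (e := (toN B hB α).toLinearMap) (fun x hx => toN_mem hF hx)
      (f := Ω.flip ⟨toNPlus B hB α y, toNPlus_mem hE hy⟩)
      (g := Ω'.flip ⟨toNPlus B hB α y, toNPlus_mem hE hy⟩) (fun lam x hxl hx => ?_) hx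
    exact eq_of_homogeneous hrep hT (e := (toNPlus B hB α).toLinearMap)
      (fun y hy => toNPlus_mem hE hy) (f := Ω ⟨toN B hB α x, toN_mem hF hx⟩)
      (g := Ω' ⟨toN B hB α x, toN_mem hF hx⟩) (fun mu y hyl hy => hhom lam x hxl mu y hyl hx hy) hy
  have hexp : ∀ {Ω : fixedPoints σ →ₗ[ℂ] fixedPoints σ →ₗ[ℂ] ℂ}, IsOmega T perm rep ω σ Ω →
      ∀ x h y x' h' y' (hx : toN B hB α x ∈ fixedPoints σ) (hh : toH B hB α h ∈ fixedPoints σ)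
        (hy : toNPlus B hB α y ∈ fixedPoints σ) (hx' : toN B hB α x' ∈ fixedPoints σ)
        (hh' : toH B hB α h' ∈ fixedPoints σ) (hy' : toNPlus B hB α y' ∈ fixedPoints σ),
        Ω (⟨_, hx⟩ + ⟨_, hh⟩ + ⟨_, hy⟩) (⟨_, hx'⟩ + ⟨_, hh'⟩ + ⟨_, hy'⟩) =
          Ω ⟨_, hx⟩ ⟨_, hy'⟩ - Ω ⟨_, hx'⟩ ⟨_, hy⟩ := by
    intro Ω hΩ x h y x' h' y' hx hh hy hx' hh' hy'
    have e1 : ∀ v, Ω ⟨toH B hB α h, hh⟩ v = 0 := hΩ.zero_H h hh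
    have e2 : ∀ v, Ω v ⟨toH B hB α h', hh'⟩ = 0 := fun v => by
      rw [hΩ.skew]; exact neg_eq_zero.mpr (hΩ.zero_H h' hh' v)
    simp only [map_add, LinearMap.add_apply, e1, e2, hΩ.zero_N, hΩ.zero_NPlus]
    rw [hΩ.skew ⟨toNPlus B hB α y, hy⟩]
    ring
  refine LinearMap.ext fun u => LinearMap.ext fun v => ?_
  obtain ⟨u, hu⟩ := u
  obtain ⟨v, hv⟩ := v
  obtain ⟨x, k, y, rfl, hx, hk, hy⟩ := exists_triangular_fixed hsymm hα hE hF hu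
  obtain ⟨x', k', y', rfl, hx', hk', hy'⟩ := exists_triangular_fixed hsymm hα hE hF hv
  have e := hexp h x k y x' k' y' (toN_mem hF hx) hk (toNPlus_mem hE hy) (toN_mem hF hx') hk'
    (toNPlus_mem hE hy')
  have e' := hexp h' x k y x' k' y' (toN_mem hF hx) hk (toNPlus_mem hE hy) (toN_mem hF hx') hk'
    (toNPlus_mem hE hy')
  rw [hNP x y' hx hy', hNP x' y hx' hy] at e
  exact e.trans e'.symm

end Cocycle

end CyclotomicCocycle

end

open CyclotomicCocycle in
/-- Cartan data `(𝔥, B, α)`, a diagram automorphism `σ` of `𝔤` with underlying permutation `perm`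
of order `T`, representatives `rep` of the cycles of `perm`, and a primitive `T`-th root of unity
`ω` determine a unique form `Ω` on `𝔤^σ`; it is a 2-cocycle, and the bracket
`[x, y]' = [x, y] + Ω(x, y) 𝗄` makes `𝔤^σ ⊕ ℂ 𝗄` a Lie algebra with `𝗄` central. -/
theorem mainTheorem4 {R r T : ℕ} [NeZero T] {𝔥 : Type u} [AddCommGroup 𝔥] [Module ℂ 𝔥]
    [FiniteDimensional ℂ 𝔥]
    (B : LinearMap.BilinForm ℂ 𝔥) (hB : B.Nondegenerate) (hsymm : B.IsSymm)
    (α : Fin R → Module.Dual ℂ 𝔥) (hα : LinearIndependent ℂ α)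
    (σ : LieG B hB α ≃ₗ⁅ℂ⁆ LieG B hB α) (perm : Equiv.Perm (Fin R))
    (hE : ∀ i, σ (gen B hB α (.E i)) = gen B hB α (.E (perm i)))
    (hF : ∀ i, σ (gen B hB α (.F i)) = gen B hB α (.F (perm i)))
    (hH : ∀ i, σ (gen B hB α (.H (coroot B hB α i))) = gen B hB α (.H (coroot B hB α (perm i))))
    (hT : orderOf perm = T)
    (rep : Fin r → Fin R) (hrep : ∀ j, ∃! i, perm.SameCycle (rep i) j)
    (ω : ℂ) (hω : IsPrimitiveRoot ω T) :
    ∃ Ω : fixedPoints σ →ₗ[ℂ] fixedPoints σ →ₗ[ℂ] ℂ,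
      IsOmega T perm rep ω σ Ω ∧
      (∀ Ω', IsOmega T perm rep ω σ Ω' → Ω' = Ω) ∧
      (∀ x y z : fixedPoints σ, Ω x ⁅y, z⁆ + Ω y ⁅z, x⁆ + Ω z ⁅x, y⁆ = 0) ∧
      ∃ (L : Type u) (_ : LieRing L) (_ : LieAlgebra ℂ L) (e : (fixedPoints σ × ℂ) ≃ₗ[ℂ] L),
        (∀ (x y : fixedPoints σ) (a b : ℂ), ⁅e (x, a), e (y, b)⁆ = e (⁅x, y⁆, Ω x y)) ∧
        ∀ v : L, ⁅e (0, 1), v⁆ = 0 := by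
  exact ⟨omegaForm T perm σ hsymm, isOmega_omegaForm hsymm hE hH hT hrep hω,
    fun Ω' h => h.unique hsymm hα hE hF hT hrep (isOmega_omegaForm hsymm hE hH hT hrep hω),
    omegaForm_cocycle hsymm hα hE hF hH hT hrep hω,
    exists_centralExt (isOmega_omegaForm hsymm hE hH hT hrep hω).skew
      (omegaForm_cocycle hsymm hα hE hF hH hT hrep hω)⟩
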